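/- **Setting.** Let $\mathbf v_1=(\frac{\sqrt3}{2},\frac12)$, $\mathbf v_2=(\frac{\sqrt3}{2},-\frac12)$, $\Lambda=\mathbb Z\mathbf v_1+\mathbb Z\mathbf v_2$, and let $\mathbf k_1,\mathbf k_2$ be the dual vectors, $\mathbf k_i\cdot\mathbf v_j=2\pi\delta_{ij}$. Put $A=\frac13(\mathbf v_1+\mathbf v_2)$, $B=\frac23(\mathbf v_1+\mathbf v_2)$, and let $0<r<\frac12|A-B|$. Let $\epsilon$ be equal to $\epsilon_A>0$ on the closed discs $B_r(A)+\Lambda$, $\epsilon_B>0$ on $B_r(B)+\Lambda$, and $\epsilon_0>0$ elsewhere. Let $\kappa:\mathbb R\to\mathbb R$ be bounded and measurable with $\kappa(\pm\infty)=\pm\kappa_\infty$, $\kappa_\infty>0$, and $\gamma(\mathbf x)=\kappa(\mathbf k_2\cdot\mathbf x)$; assume $\epsilon(\mathbf x)^2-\gamma(\mathbf x)^2>c_0>0$ for all $\mathbf x$. The material weight is either $$W=\begin{pmatrix}\epsilon & \mathrm i\gamma\\ -\mathrm i\gamma&\epsilon\end{pmatrix}^{-1}\quad\text{or}\quad W=\epsilon^{-1}I+\gamma\epsilon^{-2}\begin{pmatrix}0&-\mathrm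 i\\ \mathrm i&0\end{pmatrix}.$$ For an integer $L\ge1$ let $\Omega_{\Sigma,L}=\{\tau_1\mathbf v_1+\tau_2\mathbf v_2: 0\le\tau_1\le1,\ |\tau_2|\le L\}$; let $\Omega^1$ be the intersection of $\Omega_{\Sigma,L}$ with the closed discs $(B_r(A)\cup B_r(B))+\Lambda$, let $\Omega^2$ be $\Omega_{\Sigma,L}$ minus the corresponding open discs, and let $\Gamma=\Omega^1\cap\Omega^2$ with unit normal $n$ pointing out of $\Omega^1$. Write $W_i$ for the weight on the closed set $\Omega^i$ (on $\Gamma$ it is the trace from $\Omega^i$, i.e. formed with the value of $\epsilon$ on that side), and $\|W_i\|_\infty$ for the supremum over $\Omega^i$ of its spectral norm. Let $N\ge1$ and $h=\|\mathbf v_1\|/N$. The mesh $\hat{\mathcal T}_h$ divides $\Omega_{\Sigma,L}$ into $2LN^2$ congruent rhombuses, each split into two closed triangles along the short diagonal (in all rhombuses) or along the long diagonal (in all rhombuses). Let $\hat{\mathcal T}_{i,h}$ be the set of triangles meeting $\Omega^i$, $\Omega^i_h$ their union, and $\hat{\mathcal T}_{\Gamma,h}$ the set of triangles meeting $\Gamma$.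 The mesh is called admissible if $\Gamma$ meets the boundary of every $K\in\hat{\mathcal T}_{\Gamma,h}$ in exactly two points and every open edge of it in at most one. Let $\hat V_h=\hat V_{1,h}\oplus\hat V_{2,h}$, where $\hat V_{i,h}$ is the space of continuous complex functions on $\Omega^i_h$ that are polynomials of degree at most one on each $K\in\hat{\mathcal T}_{i,h}$. Let $\hat V_{h,0}\subset\hat V_h$ be the subspace of those $q=(q_1,q_2)$ both of whose components, where defined, are $\mathbf v_1$-periodic and vanish at $\tau_2=\pm L$. For $K\in\hat{\mathcal T}_{\Gamma,h}$ let $K_i=K\cap\Omega^i$, $\Gamma_K=K\cap\Gamma$, $D_K=\|W_2\|_\infty|K_1|+\|W_1\|_\infty|K_2|$, and $$\kappa_1|_K=\frac{\|W_2\|_\infty|K_1|}{D_K},\quad \kappa_2|_K=\frac{\|W_1\|_\infty|K_2|}{D_K},\quad \lambda_K=\frac{h\|W_1\|_\infty\|W_2\|_\infty|\Gamma_K|}{D_K}.$$ Put $\lambda|_K=\hat\lambda\lambda_K$, $\{\!\{q\}\!\}=\kappa_1q_1+\kappa_2q_2$, $[\![q]\!]=q_1-q_2$, and, for $k_\parallel\in[0,2\pi]$,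 $\nabla_{k_\parallel}=\nabla+\mathrm i\frac{k_\parallel}{2\pi}\mathbf k_1$. Define $$\hat a_h(u,v)=\sum_{i=1}^2\int_{\Omega^i}W_i\nabla_{k_\parallel}u_i\cdot\overline{\nabla_{k_\parallel}v_i}\,d\mathbf x-\int_\Gamma\{\!\{W\nabla_{k_\parallel}u\cdot n\}\!\}[\![\overline v]\!]\,ds-\int_\Gamma\{\!\{\overline{W\nabla_{k_\parallel}v\cdot n}\}\!\}[\![u]\!]\,ds+\frac1h\int_\Gamma\lambda[\![u]\!][\![\overline v]\!]\,ds,$$ $$|||u|||_h^2=\sum_{i=1}^2\|\nabla_{k_\parallel}u_i\|^2_{L^2(\Omega^i)}+\sum_{K\in\hat{\mathcal T}_{\Gamma,h}}h^{-1}\|[\![u]\!]\|^2_{L^2(\Gamma_K)}.$$ **Theorem.** Fix $\epsilon_A,\epsilon_B,\epsilon_0,\kappa$, the form of $W$, $c_0>0$, $L$, $k_\parallel$, the choice of the diagonal, and $r_0>0$. There is $\hat\lambda_0>0$ such that for every stability parameter $\hat\lambda\ge\hat\lambda_0$ there are constants $C_7,C_8>0$ such that, for every radius $r\in[r_0,\frac12|A-B|)$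 with $\epsilon^2-\gamma^2>c_0$ everywhere and every $N\ge1$ for which the mesh is admissible, $$\hat a_h(q_h,q_h)\in\mathbb R,\qquad C_7\,|||q_h|||_h^2\le\hat a_h(q_h,q_h)\qquad\forall q_h\in\hat V_h,$$ $$|\hat a_h(q_h,\chi_h)|\le C_8\,|||q_h|||_h\,|||\chi_h|||_h\qquad\forall q_h,\chi_h\in\hat V_{h,0}.$$ In particular $\hat\lambda_0,C_7,C_8$ depend neither on the mesh size nor on the location of the interface. -/

import Mathlib

open MeasureTheory Filter Topology

noncomputable section

namespace EdgeNitsche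

/-! ## Lattice and geometry -/

abbrev Plane := EuclideanSpace ℝ (Fin 2)

/-- Lattice vectors. -/
def v₁ : Plane := !₂[Real.sqrt 3 / 2, 1 / 2]

def v₂ : Plane := !₂[Real.sqrt 3 / 2, -(1 / 2)]

/-- Dual lattice vectors, normalised by `kᵢ ⬝ vⱼ = 2 π δᵢⱼ`. -/
def k₁ : Plane := (4 * Real.pi * Real.sqrt 3 / 3) • !₂[1 / 2, Real.sqrt 3 / 2]

def k₂ : Plane := (4 * Real.pi * Real.sqrt 3 / 3) • !₂[1 / 2, -(Real.sqrt 3 / 2)]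

/-- The two sites of the fundamental cell; `site 0` is the point `A` and `site 1` the point `B`. -/
def site (s : Fin 2) : Plane := (((s : ℕ) + 1 : ℝ) / 3) • (v₁ + v₂)

/-- `B_r(site s) + Λ`, with closed discs. -/
def discs (s : Fin 2) (r : ℝ) : Set Plane :=
  ⋃ (m : ℤ) (n : ℤ), Metric.closedBall (site s + (m : ℝ) • v₁ + (n : ℝ) • v₂) r

/-- The interior of `B_r(site s) + Λ`. -/
def openDiscs (s : Fin 2) (r : ℝ) : Set Plane :=
  ⋃ (m : ℤ) (n : ℤ), Metric.ball (site s + (m : ℝ) • v₁ + (n : ℝ) • v₂) r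

/-- The truncated cylinder cell `{τ₁ v₁ + τ₂ v₂ : 0 ≤ τ₁ ≤ 1, -L ≤ τ₂ ≤ L}`. -/
def cylinder (L : ℕ) : Set Plane :=
  {x | ∃ t₁ t₂ : ℝ, 0 ≤ t₁ ∧ t₁ ≤ 1 ∧ -(L : ℝ) ≤ t₂ ∧ t₂ ≤ L ∧ x = t₁ • v₁ + t₂ • v₂}

/-- The two closed subdomains of the truncated cylinder cell: index `0` is the union of the
inclusions, index `1` is the background. They overlap only along their common boundary. -/
def subdomain (L : ℕ) (r : ℝ) (i : Fin 2) : Set Plane :=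
  if i = 0 then cylinder L ∩ (discs 0 r ∪ discs 1 r)
  else cylinder L \ (openDiscs 0 r ∪ openDiscs 1 r)

/-- The interface `Γ`. -/
def interface (L : ℕ) (r : ℝ) : Set Plane := subdomain L r 0 ∩ subdomain L r 1

/-! ### Arc length on the interface

For `0 < r < |A - B| / 2` every disc lies strictly inside its own cell, so the interface is the
disjoint union of the circles of radius `r` about the sites `A + m v₂` and `B + m v₂`,
`-L ≤ m < L`; integrals over (parts of) it are taken with respect to arc length. -/

abbrev Circles (L : ℕ) := Fin 2 × Fin (2 * L)

def circleCenter {L : ℕ} (c : Circles L) : Plane :=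
  site c.1 + (((c.2 : ℕ) : ℝ) - (L : ℝ)) • v₂

/-- Unit normal on a circle pointing out of the inclusion. -/
def unitNormal (t : ℝ) : Plane := !₂[Real.cos t, Real.sin t]

def circlePoint {L : ℕ} (r : ℝ) (c : Circles L) (t : ℝ) : Plane :=
  circleCenter c + r • unitNormal t

/-- `∫_{Γ ∩ S} f(x, n(x)) ds`, where `n` is the unit normal out of the inclusions. -/
def lineIntegral {F : Type*} [NormedAddCommGroup F] [NormedSpace ℝ F] (L : ℕ) (r : ℝ)
    (S : Set Plane) (f : Plane → Plane → F) : F :=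
  ∑ c : Circles L,
    ∫ t in {t : ℝ | t ∈ Set.Ioc 0 (2 * Real.pi) ∧ circlePoint r c t ∈ S},
      r • f (circlePoint r c t) (unitNormal t)

/-! ## Material weight -/

/-- The two forms of the weight: the exact inverse matrix, and its first order approximation in
the Faraday rotation. -/
inductive WeightForm where
  | exact : WeightForm
  | firstOrder : WeightForm

/-- Permittivities and the domain wall function. -/
structure Medium where
  epsA : ℝ
  epsB : ℝ
  eps0 : ℝ
  kappa : ℝ → ℝ
  kappaInf : ℝ
  form : WeightForm
  epsA_pos : 0 < epsA
  epsB_pos : 0 < epsB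
  eps0_pos : 0 < eps0
  kappa_measurable : Measurable kappa
  kappa_bounded : ∃ b : ℝ, ∀ z, |kappa z| ≤ b
  kappaInf_pos : 0 < kappaInf
  kappa_top : Tendsto kappa atTop (𝓝 kappaInf)
  kappa_bot : Tendsto kappa atBot (𝓝 (-kappaInf))

namespace Medium

open Classical in
/-- The piecewise constant, lattice periodic permittivity. -/
def eps (M : Medium) (r : ℝ) (x : Plane) : ℝ :=
  if x ∈ discs 0 r then M.epsA else if x ∈ discs 1 r then M.epsB else M.eps0

/-- The Faraday rotation `γ(x) = κ(k₂ ⬝ x)`. -/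
def gamma (M : Medium) (x : Plane) : ℝ := M.kappa (inner ℝ k₂ x)

/-- `min (ε² - γ²) > c₀`. -/
def Elliptic (M : Medium) (r c₀ : ℝ) : Prop := ∀ x : Plane, c₀ < M.eps r x ^ 2 - M.gamma x ^ 2

open Classical in
/-- One-sided permittivity: `epsSide r 0` on the closed inclusions, `epsSide r 1` on the closed
background. On the interface these are the two one-sided traces of `eps`. -/
def epsSide (M : Medium) (r : ℝ) (i : Fin 2) (x : Plane) : ℝ :=
  if i = 0 then (if x ∈ discs 0 r then M.epsA else M.epsB) else M.eps0

/-- The weight matrix for permittivity `e` and Faraday rotation `g`. -/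
def weightMatrix : WeightForm → ℝ → ℝ → Matrix (Fin 2) (Fin 2) ℂ
  | .exact, e, g => (!![(e : ℂ), Complex.I * g; -(Complex.I * g), (e : ℂ)])⁻¹
  | .firstOrder, e, g =>
      ((e : ℂ)⁻¹) • (1 : Matrix (Fin 2) (Fin 2) ℂ) +
        ((g : ℂ) * ((e : ℂ) ^ 2)⁻¹) • !![0, -Complex.I; Complex.I, 0]

/-- `Wᵢ`, the material weight on the closed subdomain `i`. -/
def W (M : Medium) (r : ℝ) (i : Fin 2) (x : Plane) : Matrix (Fin 2) (Fin 2) ℂ :=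
  weightMatrix M.form (M.epsSide r i x) (M.gamma x)

/-- `‖Wᵢ‖_∞`: the supremum over subdomain `i` of the spectral norm of the weight. -/
def supW (M : Medium) (L : ℕ) (r : ℝ) (i : Fin 2) : ℝ :=
  sSup ((fun x => ‖Matrix.toEuclideanCLM (n := Fin 2) (𝕜 := ℂ) (M.W r i x)‖) '' subdomain L r i)

end Medium

/-! ## The uniform mesh -/

/-- The diagonal along which each small rhombus is split. -/
inductive Diagonal where
  | short : Diagonal
  | long : Diagonal

/-- `N * 2 L N` small rhombuses, each split into two triangles. -/
abbrev Elem (L N : ℕ) := Fin N × Fin (2 * L * N) × Bool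

/-- Vertices of the two triangles of the unit rhombus, in lattice coordinates. -/
def refVertex : Diagonal → Bool → Fin 3 → ℝ × ℝ
  | .short, false => ![(0, 0), (1, 0), (0, 1)]
  | .short, true => ![(1, 0), (0, 1), (1, 1)]
  | .long, false => ![(0, 0), (1, 0), (1, 1)]
  | .long, true => ![(0, 0), (0, 1), (1, 1)]

/-- Mesh size. -/
def meshSize (N : ℕ) : ℝ := ‖v₁‖ / N

variable {L N : ℕ}

def vertex (d : Diagonal) (K : Elem L N) (a : Fin 3) : Plane :=
  ((((K.1 : ℕ) : ℝ) + (refVertex d K.2.2 a).1) / N) • v₁ +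
    ((((K.2.1 : ℕ) : ℝ) + (refVertex d K.2.2 a).2) / N - L) • v₂

/-- The closed triangle. -/
def tri (d : Diagonal) (K : Elem L N) : Set Plane := convexHull ℝ (Set.range (vertex d K))

/-- The boundary of the triangle. -/
def triBoundary (d : Diagonal) (K : Elem L N) : Set Plane :=
  ⋃ (a : Fin 3) (b : Fin 3) (_ : a ≠ b), segment ℝ (vertex d K a) (vertex d K b)

/-- Elements meeting the (closed) subdomain `i`. -/
def coverElems (d : Diagonal) (r : ℝ) (i : Fin 2) : Set (Elem L N) :=
  {K | (subdomain L r i ∩ tri d K).Nonempty}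

open Classical in
/-- Interface elements. -/
def interfaceElems (L N : ℕ) (d : Diagonal) (r : ℝ) : Finset (Elem L N) :=
  Finset.univ.filter fun K => (interface L r ∩ tri d K).Nonempty

/-- Union of the elements covering subdomain `i`. -/
def coverDomain (L N : ℕ) (d : Diagonal) (r : ℝ) (i : Fin 2) : Set Plane :=
  ⋃ K ∈ coverElems (L := L) (N := N) d r i, tri d K

/-- The interface meets the boundary of each interface element exactly twice and each of its open
edges at most once. -/
def CutAssumption (L N : ℕ) (d : Diagonal) (r : ℝ) : Prop :=
  ∀ K ∈ interfaceElems L N d r,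
    (interface L r ∩ triBoundary d K).ncard = 2 ∧
      ∀ a b : Fin 3, a ≠ b →
        (interface L r ∩ openSegment ℝ (vertex d K a) (vertex d K b)).Subsingleton

/-! ## Finite element spaces -/

/-- A function restricting to a polynomial of degree at most one on `S`. -/
def IsAffineOn (v : Plane → ℂ) (S : Set Plane) : Prop :=
  ∃ (c : ℂ) (b : Fin 2 → ℂ), ∀ x ∈ S, v x = c + ∑ j, b j * (x j : ℂ)

/-- A pair `u = (u 0, u 1)`; only the values of `u i` on `coverDomain L N d r i` matter. -/
abbrev Pair := Fin 2 → Plane → ℂ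

/-- The unfitted finite element space `V̂_h = V̂_{1,h} ⊕ V̂_{2,h}`. -/
def Vh (L N : ℕ) (d : Diagonal) (r : ℝ) : Set Pair :=
  {u | ∀ i, ContinuousOn (u i) (coverDomain L N d r i) ∧
    ∀ K ∈ coverElems (L := L) (N := N) d r i, IsAffineOn (u i) (tri d K)}

/-- The subspace `V̂_{h,0}`: periodic in the direction `v₁`, zero at `τ₂ = ± L`. -/
def Vh0 (L N : ℕ) (d : Diagonal) (r : ℝ) : Set Pair :=
  {u | u ∈ Vh L N d r ∧
    (∀ i, ∀ x ∈ coverDomain L N d r i, x + v₁ ∈ coverDomain L N d r i → u i (x + v₁) = u i x) ∧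
    (∀ i, ∀ t ∈ Set.Icc (0 : ℝ) 1, ∀ s : ℝ, (s = L ∨ s = -L) →
      t • v₁ + s • v₂ ∈ coverDomain L N d r i → u i (t • v₁ + s • v₂) = 0)}

/-! ## Nitsche form and energy norm -/

/-- `(∇ + i (k_∥ / 2π) k₁) v`. For finite element functions the derivative exists at all interior
points of the elements, hence almost everywhere on the subdomains and on the interface. -/
def twistedGrad (kpar : ℝ) (v : Plane → ℂ) (x : Plane) : Fin 2 → ℂ := fun j =>
  fderiv ℝ v x (EuclideanSpace.single j 1) +
    Complex.I * ((kpar / (2 * Real.pi) * k₁ j : ℝ) : ℂ) * v x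

/-- `|K_i|`. -/
def cutArea (d : Diagonal) (r : ℝ) (K : Elem L N) (i : Fin 2) : ℝ :=
  (volume (tri d K ∩ subdomain L r i)).toReal

/-- `|Γ_K|`. -/
def cutLength (d : Diagonal) (r : ℝ) (K : Elem L N) : ℝ :=
  lineIntegral L r (tri d K) fun _ _ => (1 : ℝ)

/-- `‖W₂‖_∞ |K₁| + ‖W₁‖_∞ |K₂|`. -/
def weightDenom (M : Medium) (d : Diagonal) (r : ℝ) (K : Elem L N) : ℝ :=
  M.supW L r 1 * cutArea d r K 0 + M.supW L r 0 * cutArea d r K 1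

/-- The averaging weights `κ₁`, `κ₂` on `K`. -/
def avgWeight (M : Medium) (d : Diagonal) (r : ℝ) (K : Elem L N) (i : Fin 2) : ℝ :=
  M.supW L r (1 - i) * cutArea d r K i / weightDenom M d r K

/-- `λ_K`. -/
def lamK (M : Medium) (d : Diagonal) (r : ℝ) (K : Elem L N) : ℝ :=
  meshSize N * M.supW L r 0 * M.supW L r 1 * cutLength d r K / weightDenom M d r K

/-- The jump `u₁ - u₂`. -/
def jump (u : Pair) (x : Plane) : ℂ := u 0 x - u 1 x

/-- The flux `W_i (∇ + i (k_∥ / 2π) k₁) u_i ⬝ n`. -/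
def flux (M : Medium) (r kpar : ℝ) (i : Fin 2) (v : Plane → ℂ) (x n : Plane) : ℂ :=
  ∑ j, (M.W r i x).mulVec (twistedGrad kpar v x) j * (n j : ℂ)

/-- The weighted average of the flux on `Γ_K`. -/
def avgFlux (M : Medium) (r kpar : ℝ) (d : Diagonal) (K : Elem L N) (u : Pair)
    (x n : Plane) : ℂ :=
  ∑ i : Fin 2, (avgWeight M d r K i : ℂ) * flux M r kpar i (u i) x n

/-- The Nitsche form `â_h(u, v)` with stabilisation parameter `lam`; the integrals over the
interface are split over the interface elements. -/
def nitscheForm (M : Medium) (L N : ℕ) (d : Diagonal) (r kpar lam : ℝ) (u v : Pair) : ℂ :=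
  (∑ i : Fin 2, ∫ x in subdomain L r i,
      ∑ j, (M.W r i x).mulVec (twistedGrad kpar (u i) x) j * star (twistedGrad kpar (v i) x j))
  - (∑ K ∈ interfaceElems L N d r, lineIntegral L r (tri d K) fun x n =>
      avgFlux M r kpar d K u x n * star (jump v x))
  - (∑ K ∈ interfaceElems L N d r, lineIntegral L r (tri d K) fun x n =>
      star (avgFlux M r kpar d K v x n) * jump u x)
  + ((meshSize N : ℂ))⁻¹ * ∑ K ∈ interfaceElems L N d r, lineIntegral L r (tri d K) fun x _ =>
      ((lam * lamK M d r K : ℝ) : ℂ) * (jump u x * star (jump v x))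

/-- The square of the energy norm. -/
def energySq (L N : ℕ) (d : Diagonal) (r kpar : ℝ) (u : Pair) : ℝ :=
  (∑ i : Fin 2, ∫ x in subdomain L r i, ∑ j, ‖twistedGrad kpar (u i) x j‖ ^ 2)
  + ∑ K ∈ interfaceElems L N d r, (meshSize N)⁻¹ *
      lineIntegral L r (tri d K) fun x _ => ‖jump u x‖ ^ 2

/-- The energy norm. -/
def energyNorm (L N : ℕ) (d : Diagonal) (r kpar : ℝ) (u : Pair) : ℝ :=
  Real.sqrt (energySq L N d r kpar u)

end EdgeNitsche

end

/-! The averaging weights are proportional to the areas of the cut pieces: `κᵢ ‖Wᵢ‖ = ‖W₁‖ ‖W₂‖ |Kᵢ|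
/ D_K`. The factor `|Kᵢ|` is what an inverse estimate on a cut piece asks for, however thin the
piece is: `|Kᵢ| |p(x₀)|² ≤ C ∫_{Kᵢ} |p|²` for affine `p` and `x₀` on the interface
(`cut_affFn_sq_le`). Inside a disc the piece is convex, and a reflection argument suffices. Outside,
the piece is comparable to a convex core seen from the vertex of largest power with respect to the
circle. With Cauchy–Schwarz on `Γ_K` the flux terms are bounded by the root of the energy on `K`
times the root of the stabilisation (`norm_fluxTerm_le`). For large stability parameter, Young's
inequality leaves half of the bulk energy and one copy of the stabilisation (`nitscheForm_self`).
Boundedness uses the same estimates and the upper bound of `λ_K` (`norm_nitscheForm_le`,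
`le_sqrt_mul_sqrt`).

What remains is that `λ_K` is comparable to `|Γ_K| / h`, which degenerates on short cuts, while the
norm weights every jump with `h⁻¹`. The full jump is recovered from the stabilisation and the bulk
energy in `sum_jump_le`. A phase of modulus one turns the twisted gradient into a gradient, so along
a circle each component varies by an amount controlled by its energy in a collar of width comparable
to `h` (`collar_variation_le`). On every arc of that length some element has a long cut
(`exists_good_elem`), and the jump there controls the jump on the whole arc.

The collar in the background has to exist uniformly in the radius. At the limit `√3 / 6` the circles
touch the sides of the equilateral half-cells around the sites. With long diagonals admissibility
prevents this: an element straddling the common side of two half-cells is symmetric about it, so a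
disc entering it comes with its mirror image and produces too many intersections with the boundary
(`straddling_notMem`), which leaves a gap comparable to `h` (`gap_of_long`). With short diagonals
the sides are mesh lines, and close to a side the circle is almost parallel to it
(`jumpSq_le_of_near_side`). An element with an edge on the side then has a long cut. An element with
only its apex there is left after a step of length comparable to `e h` for a neighbour with a long
cut, and the change of the jump over this step is controlled by the inverse estimate, because both
pieces of the element have area at least a multiple of `(e h)²`. -/

noncomputable section

namespace EdgeNitsche

section

/-! ## Lattice coordinates -/

/-- First lattice coordinate. -/
def tau₁ (x : Plane) : ℝ := x 0 / Real.sqrt 3 + x 1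

/-- Second lattice coordinate. -/
def tau₂ (x : Plane) : ℝ := x 0 / Real.sqrt 3 - x 1

lemma sqrt_three_pos : 0 < Real.sqrt 3 := by positivity

lemma sqrt_three_sq : Real.sqrt 3 ^ 2 = 3 := Real.sq_sqrt (by norm_num)

lemma sqrt_three_gt : 1.73 < Real.sqrt 3 := Real.lt_sqrt_of_sq_lt (by norm_num)

lemma sqrt_three_lt : Real.sqrt 3 < 1.7321 := by
  rw [Real.sqrt_lt' (by norm_num)]; norm_num

@[simp] lemma tau₁_add (x y : Plane) : tau₁ (x + y) = tau₁ x + tau₁ y := by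
  simp [tau₁]; ring

@[simp] lemma tau₂_add (x y : Plane) : tau₂ (x + y) = tau₂ x + tau₂ y := by
  simp [tau₂]; ring

@[simp] lemma tau₁_sub (x y : Plane) : tau₁ (x - y) = tau₁ x - tau₁ y := by
  simp [tau₁]; ring

@[simp] lemma tau₂_sub (x y : Plane) : tau₂ (x - y) = tau₂ x - tau₂ y := by
  simp [tau₂]; ring

@[simp] lemma tau₁_smul (a : ℝ) (x : Plane) : tau₁ (a • x) = a * tau₁ x := by
  simp [tau₁]; ring

@[simp] lemma tau₂_smul (a : ℝ) (x : Plane) : tau₂ (a • x) = a * tau₂ x := by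
  simp [tau₂]; ring

@[simp] lemma tau₁_zero : tau₁ 0 = 0 := by simp [tau₁]

@[simp] lemma tau₂_zero : tau₂ 0 = 0 := by simp [tau₂]

@[simp] lemma tau₁_v₁ : tau₁ v₁ = 1 := by
  have := sqrt_three_pos; simp [tau₁, v₁]; field_simp; norm_num

@[simp] lemma tau₁_v₂ : tau₁ v₂ = 0 := by
  have := sqrt_three_pos; simp [tau₁, v₂]; field_simp; norm_num

@[simp] lemma tau₂_v₁ : tau₂ v₁ = 0 := by
  have := sqrt_three_pos; simp [tau₂, v₁]; field_simp; norm_num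

@[simp] lemma tau₂_v₂ : tau₂ v₂ = 1 := by
  have := sqrt_three_pos; simp [tau₂, v₂]; field_simp; norm_num

lemma eq_tau (x : Plane) : x = tau₁ x • v₁ + tau₂ x • v₂ := by
  have := sqrt_three_pos
  ext j
  fin_cases j <;> simp [tau₁, tau₂, v₁, v₂]
  · field_simp; ring
  · ring

lemma tau_ext {x y : Plane} (h₁ : tau₁ x = tau₁ y) (h₂ : tau₂ x = tau₂ y) : x = y := by
  rw [eq_tau x, eq_tau y, h₁, h₂]

lemma continuous_tau₁ : Continuous tau₁ := by unfold tau₁; fun_prop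

lemma continuous_tau₂ : Continuous tau₂ := by unfold tau₂; fun_prop

lemma norm_sq_plane (x : Plane) : ‖x‖ ^ 2 = x 0 ^ 2 + x 1 ^ 2 := by
  rw [EuclideanSpace.real_norm_sq_eq]; simp

/-- The lattice vectors have length one and enclose an angle of 60°, so `v₁ ⬝ v₂ = 1 / 2`. -/
lemma norm_sq_tau (x : Plane) : ‖x‖ ^ 2 = tau₁ x ^ 2 + tau₁ x * tau₂ x + tau₂ x ^ 2 := by
  have h3 := sqrt_three_sq
  have := sqrt_three_pos
  rw [norm_sq_plane, tau₁, tau₂]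
  field_simp
  linear_combination (x 0) ^ 2 * h3

lemma norm_v₁ : ‖v₁‖ = 1 := by
  rw [← sq_eq_sq₀ (norm_nonneg _) zero_le_one, norm_sq_tau]
  simp

lemma norm_v₂ : ‖v₂‖ = 1 := by
  rw [← sq_eq_sq₀ (norm_nonneg _) zero_le_one, norm_sq_tau]
  simp

lemma meshSize_eq (N : ℕ) : meshSize N = 1 / N := by rw [meshSize, norm_v₁]

lemma two_div_sqrt_three_sq : (2 / Real.sqrt 3) ^ 2 = 4 / 3 := by
  rw [div_pow, sqrt_three_sq]; norm_num

/-- Consecutive lines on which `τ₁`, `τ₂` or `τ₁ + τ₂` is an integer are `√3 / 2` apart, the height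
of a unit equilateral triangle. The function `τ₁ - τ₂`, constant along the long diagonals, is
steeper and has slope 2. -/
lemma abs_tau₁_le (x : Plane) : |tau₁ x| ≤ 2 / Real.sqrt 3 * ‖x‖ := by
  apply abs_le_of_sq_le_sq _ (by positivity)
  rw [mul_pow, two_div_sqrt_three_sq, norm_sq_tau]
  nlinarith [sq_nonneg (tau₁ x + 2 * tau₂ x)]

lemma abs_tau₂_le (x : Plane) : |tau₂ x| ≤ 2 / Real.sqrt 3 * ‖x‖ := by
  apply abs_le_of_sq_le_sq _ (by positivity)
  rw [mul_pow, two_div_sqrt_three_sq, norm_sq_tau]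
  nlinarith [sq_nonneg (tau₂ x + 2 * tau₁ x)]

lemma abs_tau_add_le (x : Plane) : |tau₁ x + tau₂ x| ≤ 2 / Real.sqrt 3 * ‖x‖ := by
  apply abs_le_of_sq_le_sq _ (by positivity)
  rw [mul_pow, two_div_sqrt_three_sq, norm_sq_tau]
  nlinarith [sq_nonneg (tau₁ x - tau₂ x)]

lemma abs_tau_sub_le (x : Plane) : |tau₁ x - tau₂ x| ≤ 2 * ‖x‖ := by
  apply abs_le_of_sq_le_sq _ (by positivity)
  rw [mul_pow, norm_sq_tau]
  nlinarith [sq_nonneg (tau₁ x + tau₂ x)]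

/-- This is the inradius of a unit equilateral triangle: the bound on the radius says that every
closed disc lies in the interior of the half-cell around its centre. -/
lemma half_dist_sites : dist (site 0) (site 1) / 2 = Real.sqrt 3 / 6 := by
  have h3 := sqrt_three_sq
  have h0 := sqrt_three_pos
  have h : ‖site 0 - site 1‖ ^ 2 = 1 / 3 := by
    rw [norm_sq_tau]; simp [site]; norm_num
  rw [dist_eq_norm]
  have : ‖site 0 - site 1‖ = Real.sqrt 3 / 3 := by
    rw [← sq_eq_sq₀ (norm_nonneg _) (by positivity), h, div_pow, h3]; norm_num
  rw [this]; ring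

lemma mem_cylinder {L : ℕ} {x : Plane} :
    x ∈ cylinder L ↔ 0 ≤ tau₁ x ∧ tau₁ x ≤ 1 ∧ -(L : ℝ) ≤ tau₂ x ∧ tau₂ x ≤ L := by
  constructor
  · rintro ⟨t₁, t₂, h₁, h₂, h₃, h₄, rfl⟩
    simpa using ⟨h₁, h₂, h₃, h₄⟩
  · rintro ⟨h₁, h₂, h₃, h₄⟩
    exact ⟨_, _, h₁, h₂, h₃, h₄, eq_tau x⟩

lemma isClosed_cylinder (L : ℕ) : IsClosed (cylinder L) := by
  have : cylinder L = {x | 0 ≤ tau₁ x} ∩ {x | tau₁ x ≤ 1} ∩ {x | -(L : ℝ) ≤ tau₂ x} ∩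
      {x | tau₂ x ≤ L} := by
    ext x; rw [mem_cylinder]; simp [and_assoc]
  rw [this]
  have h1 := continuous_tau₁
  have h2 := continuous_tau₂
  exact (((isClosed_le continuous_const h1).inter (isClosed_le h1 continuous_const)).inter
    (isClosed_le continuous_const h2)).inter (isClosed_le h2 continuous_const)

/-! ## The half-cells around the circles -/

/-- The sign distinguishing the two orientations of the half-cells. -/
def cellSign {L : ℕ} (c : Circles L) : ℝ := if c.1 = 0 then 1 else -1

/-- Barycentric coordinates in the equilateral half-cell around a circle. -/
def cellBary {L : ℕ} (c : Circles L) (a : Fin 3) (x : Plane) : ℝ :=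
  1 / 3 + cellSign c * (![-(tau₁ (x - circleCenter c) + tau₂ (x - circleCenter c)),
    tau₂ (x - circleCenter c), tau₁ (x - circleCenter c)] a)

/-- The closed half-cell around a circle. -/
def halfCell {L : ℕ} (c : Circles L) : Set Plane := {x | ∀ a, 0 ≤ cellBary c a x}

variable {L : ℕ}

lemma tau₁_center (c : Circles L) : tau₁ (circleCenter c) = ((c.1 : ℕ) + 1) / 3 := by
  simp [circleCenter, site]

lemma tau₂_center (c : Circles L) :
    tau₂ (circleCenter c) = ((c.1 : ℕ) + 1) / 3 + (((c.2 : ℕ) : ℝ) - L) := by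
  simp [circleCenter, site]

lemma cellSign_abs (c : Circles L) : |cellSign c| = 1 := by
  unfold cellSign; split_ifs <;> simp

lemma cellSign_sq (c : Circles L) : cellSign c * cellSign c = 1 := by
  unfold cellSign; split_ifs <;> simp

lemma cellBary_sum (c : Circles L) (x : Plane) :
    cellBary c 0 x + cellBary c 1 x + cellBary c 2 x = 1 := by
  simp [cellBary]; ring

lemma abs_cellBary_sub_le (c : Circles L) (a : Fin 3) (x : Plane) :
    |cellBary c a x - 1 / 3| ≤ 2 / Real.sqrt 3 * ‖x - circleCenter c‖ := by
  have h1 := abs_tau₁_le (x - circleCenter c)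
  have h2 := abs_tau₂_le (x - circleCenter c)
  have h3 := abs_tau_add_le (x - circleCenter c)
  simp only [cellBary, add_sub_cancel_left, abs_mul, cellSign_abs, one_mul]
  fin_cases a
  · rw [← abs_neg] at h3; simpa using h3
  · simpa using h2
  · simpa using h1

lemma cellBary_pos {c : Circles L} {r : ℝ} (hr : r < Real.sqrt 3 / 6) {x : Plane}
    (hx : x ∈ Metric.closedBall (circleCenter c) r) (a : Fin 3) : 0 < cellBary c a x := by
  have h := abs_cellBary_sub_le c a x
  rw [Metric.mem_closedBall, dist_eq_norm] at hx
  have h3 := sqrt_three_sq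
  have h0 := sqrt_three_pos
  have : 2 / Real.sqrt 3 * ‖x - circleCenter c‖ < 1 / 3 := by
    have : 2 / Real.sqrt 3 * ‖x - circleCenter c‖ < 2 / Real.sqrt 3 * (Real.sqrt 3 / 6) := by
      apply mul_lt_mul_of_pos_left _ (by positivity); linarith
    have h4 : 2 / Real.sqrt 3 * (Real.sqrt 3 / 6) = 1 / 3 := by field_simp; norm_num
    linarith
  linarith [(abs_le.mp h).1]

lemma closedBall_subset_halfCell {c : Circles L} {r : ℝ} (hr : r < Real.sqrt 3 / 6) :
    Metric.closedBall (circleCenter c) r ⊆ halfCell c :=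
  fun _ hx a => (cellBary_pos hr hx a).le

/-- The half-cells tile the cylinder with disjoint interiors. The inequalities first pin down the
integer index and then the orientation. -/
lemma eq_of_mem_halfCell {c c' : Circles L} {x : Plane} (hx : x ∈ halfCell c)
    (hx' : ∀ a, 0 < cellBary c' a x) : c = c' := by
  obtain ⟨s, m⟩ := c
  obtain ⟨s', m'⟩ := c'
  have h0 := hx 0
  have h1 := hx 1
  have h2 := hx 2
  have h0' := hx' 0
  have h1' := hx' 1
  have h2' := hx' 2
  have hm : ((m : ℕ) : ℝ) < m' + 1 ∧ ((m' : ℕ) : ℝ) < m + 1 := by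
    fin_cases s <;> fin_cases s' <;>
      simp [cellBary, cellSign, tau₁_center, tau₂_center] at h0 h1 h2 h0' h1' h2' <;>
      constructor <;> linarith
  have hm' : m = m' := by
    ext
    have h1 : (m : ℕ) < m' + 1 := by exact_mod_cast hm.1
    have h2 : (m' : ℕ) < m + 1 := by exact_mod_cast hm.2
    omega
  subst hm'
  fin_cases s <;> fin_cases s' <;> simp <;>
    simp [cellBary, cellSign, tau₁_center, tau₂_center] at h0 h1 h2 h0' h1' h2' <;> linarith

lemma halfCell_subset_cylinder (c : Circles L) : halfCell c ⊆ cylinder L := by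
  intro x hx
  obtain ⟨s, m⟩ := c
  have h0 := hx 0
  have h1 := hx 1
  have h2 := hx 2
  rw [mem_cylinder]
  have hm : ((m : ℕ) : ℝ) + 1 ≤ 2 * L := by exact_mod_cast m.2
  have hm0 : (0 : ℝ) ≤ ((m : ℕ) : ℝ) := Nat.cast_nonneg _
  fin_cases s <;>
    simp [cellBary, cellSign, tau₁_center, tau₂_center] at h0 h1 h2 <;>
    refine ⟨?_, ?_, ?_, ?_⟩ <;> linarith

lemma site_add_eq (s : Fin 2) (m : Fin (2 * L)) :
    site s + ((0 : ℤ) : ℝ) • v₁ + (((m : ℕ) - L : ℤ) : ℝ) • v₂ = circleCenter (s, m) := by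
  simp [circleCenter]

/-- Only the discs of the list `Circles L` reach the cylinder. -/
lemma exists_circle_of_mem {r : ℝ} (hr : r < Real.sqrt 3 / 6) {s : Fin 2} {m n : ℤ} {x : Plane}
    (hx : x ∈ cylinder L) (hxb : x ∈ Metric.closedBall (site s + (m : ℝ) • v₁ + (n : ℝ) • v₂) r) :
    ∃ c : Circles L, c.1 = s ∧ circleCenter c = site s + (m : ℝ) • v₁ + (n : ℝ) • v₂ := by
  set z := site s + (m : ℝ) • v₁ + (n : ℝ) • v₂ with hz
  rw [Metric.mem_closedBall, dist_eq_norm] at hxb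
  have h0 := sqrt_three_pos
  have hlt : 2 / Real.sqrt 3 * ‖x - z‖ < 1 / 3 := by
    have : 2 / Real.sqrt 3 * ‖x - z‖ < 2 / Real.sqrt 3 * (Real.sqrt 3 / 6) := by
      apply mul_lt_mul_of_pos_left _ (by positivity); linarith
    have h4 : 2 / Real.sqrt 3 * (Real.sqrt 3 / 6) = 1 / 3 := by field_simp; norm_num
    linarith
  have h1 := abs_le.mp ((abs_tau₁_le (x - z)).trans hlt.le)
  have h2 := abs_le.mp ((abs_tau₂_le (x - z)).trans hlt.le)
  have h1' := abs_lt.mp ((abs_tau₁_le (x - z)).trans_lt hlt)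
  have h2' := abs_lt.mp ((abs_tau₂_le (x - z)).trans_lt hlt)
  rw [mem_cylinder] at hx
  obtain ⟨hx1, hx2, hx3, hx4⟩ := hx
  have e1 : tau₁ (x - z) = tau₁ x - ((s : ℕ) + 1) / 3 - m := by simp [hz, site]; ring
  have e2 : tau₂ (x - z) = tau₂ x - ((s : ℕ) + 1) / 3 - n := by simp [hz, site]; ring
  rw [e1] at h1'
  rw [e2] at h2'
  -- On a disc both lattice coordinates differ from those of the centre by less than `1 / 3`, while
  -- the cylinder has width one in `τ₁`.
  have hm : m = 0 := by
    have a1 : (m : ℝ) < 1 := by fin_cases s <;> simp at h1' <;> linarith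
    have a2 : (-1 : ℝ) < m := by fin_cases s <;> simp at h1' <;> linarith
    have a1' : m < 1 := by exact_mod_cast a1
    have a2' : -1 < m := by exact_mod_cast a2
    omega
  have hn : -(L : ℤ) ≤ n ∧ n < L := by
    have a1 : (n : ℝ) < L := by fin_cases s <;> simp at h2' <;> linarith
    have a2 : (-(L : ℝ) - 1) < n := by fin_cases s <;> simp at h2' <;> linarith
    have a1' : n < L := by exact_mod_cast a1
    have a2' : -(L : ℤ) - 1 < n := by exact_mod_cast a2
    omega
  refine ⟨(s, ⟨(n + L).toNat, by omega⟩), rfl, ?_⟩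
  rw [hz, hm, ← site_add_eq]
  congr 3
  · push_cast
    have h : ((n + L).toNat : ℤ) = n + L := Int.toNat_of_nonneg (by omega)
    have h' : (((n + L).toNat : ℕ) : ℝ) = n + L := by exact_mod_cast congrArg (Int.cast (R := ℝ)) h
    linarith

lemma mem_discs_circle {r : ℝ} {c : Circles L} {x : Plane}
    (hx : x ∈ Metric.closedBall (circleCenter c) r) : x ∈ discs c.1 r := by
  simp only [discs, Set.mem_iUnion]
  exact ⟨0, (c.2 : ℕ) - L, by rw [site_add_eq]; exact hx⟩

lemma mem_openDiscs_circle {r : ℝ} {c : Circles L} {x : Plane}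
    (hx : x ∈ Metric.ball (circleCenter c) r) : x ∈ openDiscs c.1 r := by
  simp only [openDiscs, Set.mem_iUnion]
  exact ⟨0, (c.2 : ℕ) - L, by rw [site_add_eq]; exact hx⟩

lemma exists_circle_of_mem_discs {r : ℝ} (hr : r < Real.sqrt 3 / 6) {s : Fin 2} {x : Plane}
    (hx : x ∈ cylinder L) (hxd : x ∈ discs s r) :
    ∃ c : Circles L, c.1 = s ∧ x ∈ Metric.closedBall (circleCenter c) r := by
  simp only [discs, Set.mem_iUnion] at hxd
  obtain ⟨m, n, h⟩ := hxd
  obtain ⟨c, hc, hc'⟩ := exists_circle_of_mem hr hx h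
  exact ⟨c, hc, by rw [hc']; exact h⟩

lemma exists_circle_of_mem_openDiscs {r : ℝ} (hr : r < Real.sqrt 3 / 6) {s : Fin 2} {x : Plane}
    (hx : x ∈ cylinder L) (hxd : x ∈ openDiscs s r) :
    ∃ c : Circles L, c.1 = s ∧ x ∈ Metric.ball (circleCenter c) r := by
  simp only [openDiscs, Set.mem_iUnion] at hxd
  obtain ⟨m, n, h⟩ := hxd
  obtain ⟨c, hc, hc'⟩ := exists_circle_of_mem hr hx (Metric.ball_subset_closedBall h)
  exact ⟨c, hc, by rw [hc']; exact h⟩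

lemma fin_two_cases {P : Fin 2 → Prop} (s : Fin 2) (h : P s) : P 0 ∨ P 1 := by
  fin_cases s
  · exact Or.inl h
  · exact Or.inr h

lemma mem_subdomain_zero {r : ℝ} (hr : r < Real.sqrt 3 / 6) {x : Plane} :
    x ∈ subdomain L r 0 ↔ ∃ c : Circles L, x ∈ Metric.closedBall (circleCenter c) r := by
  simp only [subdomain, if_true]
  constructor
  · rintro ⟨hx, h | h⟩
    · obtain ⟨c, -, hc⟩ := exists_circle_of_mem_discs hr hx h; exact ⟨c, hc⟩
    · obtain ⟨c, -, hc⟩ := exists_circle_of_mem_discs hr hx h; exact ⟨c, hc⟩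
  · rintro ⟨c, hc⟩
    exact ⟨halfCell_subset_cylinder c (closedBall_subset_halfCell hr hc),
      fin_two_cases (P := fun s => x ∈ discs s r) c.1 (mem_discs_circle hc)⟩

lemma mem_subdomain_one {r : ℝ} (hr : r < Real.sqrt 3 / 6) {x : Plane} :
    x ∈ subdomain L r 1 ↔
      x ∈ cylinder L ∧ ∀ c : Circles L, x ∉ Metric.ball (circleCenter c) r := by
  simp only [subdomain, one_ne_zero, if_false, Set.mem_sdiff, Set.mem_union, not_or]
  refine and_congr_right fun hx => ⟨?_, ?_⟩
  · rintro ⟨h0, h1⟩ c hc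
    rcases fin_two_cases (P := fun s => x ∈ openDiscs s r) c.1 (mem_openDiscs_circle hc) with h | h
    · exact h0 h
    · exact h1 h
  · intro h
    constructor
    · intro h'
      obtain ⟨c, -, hc⟩ := exists_circle_of_mem_openDiscs hr hx h'; exact h c hc
    · intro h'
      obtain ⟨c, -, hc⟩ := exists_circle_of_mem_openDiscs hr hx h'; exact h c hc

lemma eq_of_mem_closedBalls {r : ℝ} (hr : r < Real.sqrt 3 / 6) {c c' : Circles L} {x : Plane}
    (h : x ∈ Metric.closedBall (circleCenter c) r)
    (h' : x ∈ Metric.closedBall (circleCenter c') r) : c = c' :=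
  eq_of_mem_halfCell (closedBall_subset_halfCell hr h) (cellBary_pos hr h')

/-- The discs are disjoint and stay inside half-cells of the cylinder, so every circle belongs to
the interface entirely, and the boundary of the cylinder contributes nothing. -/
lemma mem_interface {r : ℝ} (hr : r < Real.sqrt 3 / 6) {x : Plane} :
    x ∈ interface L r ↔ ∃ c : Circles L, x ∈ Metric.sphere (circleCenter c) r := by
  rw [interface, Set.mem_inter_iff, mem_subdomain_zero hr, mem_subdomain_one hr]
  constructor
  · rintro ⟨⟨c, hc⟩, -, h⟩
    refine ⟨c, ?_⟩
    have := h c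
    simp only [Metric.mem_ball, not_lt, Metric.mem_closedBall, Metric.mem_sphere] at *
    linarith
  · rintro ⟨c, hc⟩
    have hcb := Metric.sphere_subset_closedBall hc
    refine ⟨⟨c, hcb⟩, halfCell_subset_cylinder c (closedBall_subset_halfCell hr hcb), ?_⟩
    intro c' hc'
    have : c = c' := eq_of_mem_closedBalls hr hcb (Metric.ball_subset_closedBall hc')
    subst this
    simp only [Metric.mem_ball, Metric.mem_sphere] at *
    linarith

lemma subdomain_subset_cylinder (r : ℝ) (i : Fin 2) : subdomain L r i ⊆ cylinder L := by
  unfold subdomain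
  split_ifs
  · exact Set.inter_subset_left
  · exact Set.sdiff_subset

lemma cylinder_subset_union {r : ℝ} {x : Plane} (hx : x ∈ cylinder L) :
    x ∈ subdomain L r 0 ∨ x ∈ subdomain L r 1 := by
  simp only [subdomain, if_true, one_ne_zero, if_false]
  by_cases h : x ∈ discs 0 r ∪ discs 1 r
  · exact Or.inl ⟨hx, h⟩
  · refine Or.inr ⟨hx, fun h' => h ?_⟩
    have sub : ∀ s, openDiscs s r ⊆ discs s r := fun s => by
      unfold openDiscs discs
      exact Set.iUnion_mono fun m => Set.iUnion_mono fun n => Metric.ball_subset_closedBall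
    exact h'.imp (fun h => sub 0 h) (fun h => sub 1 h)

lemma isClosed_subdomain {r : ℝ} (hr : r < Real.sqrt 3 / 6) (i : Fin 2) :
    IsClosed (subdomain L r i) := by
  fin_cases i
  · have : subdomain L r 0 = ⋃ c : Circles L, Metric.closedBall (circleCenter c) r := by
      ext x; rw [mem_subdomain_zero hr]; simp
    simp only [Fin.zero_eta]
    rw [this]
    exact isClosed_iUnion_of_finite fun c => Metric.isClosed_closedBall
  · have : subdomain L r 1 = cylinder L ∩ ⋂ c : Circles L, (Metric.ball (circleCenter c) r)ᶜ := by
      ext x; rw [mem_subdomain_one hr]; simp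
    simp only [Fin.mk_one]
    rw [this]
    exact (isClosed_cylinder L).inter (isClosed_iInter fun c => Metric.isOpen_ball.isClosed_compl)

/-! ## Points on the circles -/

lemma norm_unitNormal (t : ℝ) : ‖unitNormal t‖ = 1 := by
  rw [← sq_eq_sq₀ (norm_nonneg _) zero_le_one, norm_sq_plane]
  simp [unitNormal]

lemma circlePoint_mem_sphere {r : ℝ} (hr : 0 ≤ r) (c : Circles L) (t : ℝ) :
    circlePoint r c t ∈ Metric.sphere (circleCenter c) r := by
  simp [circlePoint, norm_smul, norm_unitNormal, abs_of_nonneg hr]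

lemma circlePoint_mem_interface {r : ℝ} (hr0 : 0 ≤ r) (hr : r < Real.sqrt 3 / 6) (c : Circles L)
    (t : ℝ) : circlePoint r c t ∈ interface L r :=
  (mem_interface hr).2 ⟨c, circlePoint_mem_sphere hr0 c t⟩

lemma circlePoint_mem_subdomain {r : ℝ} (hr0 : 0 ≤ r) (hr : r < Real.sqrt 3 / 6) (c : Circles L)
    (t : ℝ) (i : Fin 2) : circlePoint r c t ∈ subdomain L r i := by
  have := circlePoint_mem_interface hr0 hr c t
  fin_cases i
  · exact this.1
  · exact this.2

lemma continuous_unitNormal : Continuous unitNormal := by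
  unfold unitNormal
  fun_prop

lemma continuous_circlePoint (r : ℝ) (c : Circles L) : Continuous (circlePoint r c) := by
  have := continuous_unitNormal
  unfold circlePoint
  fun_prop

end

section

/-! ## Mesh elements in barycentric coordinates -/

/-- Barycentric coordinates of the two triangles of the unit rhombus. -/
def refBary : Diagonal → Bool → Fin 3 → ℝ → ℝ → ℝ
  | .short, false, a, ξ, η => ![1 - ξ - η, ξ, η] a
  | .short, true, a, ξ, η => ![1 - η, 1 - ξ, ξ + η - 1] a
  | .long, false, a, ξ, η => ![1 - ξ, ξ - η, η] a
  | .long, true, a, ξ, η => ![1 - η, η - ξ, ξ] a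

variable {L N : ℕ}

/-- Barycentric coordinates of an element. -/
def bary (d : Diagonal) (K : Elem L N) (a : Fin 3) (x : Plane) : ℝ :=
  refBary d K.2.2 a (N * tau₁ x - (K.1 : ℕ)) (N * (tau₂ x + L) - (K.2.1 : ℕ))

lemma refBary_sum (d : Diagonal) (b : Bool) (ξ η : ℝ) : ∑ a, refBary d b a ξ η = 1 := by
  cases d <;> cases b <;> simp [Fin.sum_univ_three, refBary] <;> ring

lemma refBary_vertex (d : Diagonal) (b : Bool) (a a' : Fin 3) :
    refBary d b a (refVertex d b a').1 (refVertex d b a').2 = if a = a' then 1 else 0 := by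
  cases d <;> cases b <;> fin_cases a <;> fin_cases a' <;> simp [refBary, refVertex]

lemma refBary_convexComb (d : Diagonal) (b : Bool) (a : Fin 3) {s t : ℝ} (hst : s + t = 1)
    (ξ η ξ' η' : ℝ) : refBary d b a (s * ξ + t * ξ') (s * η + t * η') =
      s * refBary d b a ξ η + t * refBary d b a ξ' η' := by
  obtain rfl : s = 1 - t := by linarith
  cases d <;> cases b <;> fin_cases a <;> simp [refBary] <;> ring

lemma sum_refBary_vertex (d : Diagonal) (b : Bool) (ξ η : ℝ) :
    (∑ a, refBary d b a ξ η * (refVertex d b a).1 = ξ) ∧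
      ∑ a, refBary d b a ξ η * (refVertex d b a).2 = η := by
  cases d <;> cases b <;> simp [Fin.sum_univ_three, refBary, refVertex]

/-- The linear part of `refBary`. -/
lemma exists_refBary_coeff (d : Diagonal) (b : Bool) (a : Fin 3) :
    ∃ A B : ℝ, (A ≠ 0 ∨ B ≠ 0) ∧ (∀ u v : ℝ, |A * u + B * v| ≤ max (max |u| |v|)
      (max |u + v| |u - v|)) ∧
      ∀ ξ η, refBary d b a ξ η = refBary d b a 0 0 + (A * ξ + B * η) := by
  cases d <;> cases b <;> fin_cases a <;> simp only [refBary]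
  · exact ⟨-1, -1, by norm_num, fun u v => by
      rw [show -1 * u + -1 * v = -(u + v) by ring, abs_neg]; simp, fun ξ η => by simp; ring⟩
  · exact ⟨1, 0, by norm_num, fun u v => by simp, fun ξ η => by simp⟩
  · exact ⟨0, 1, by norm_num, fun u v => by simp, fun ξ η => by simp⟩
  · exact ⟨0, -1, by norm_num, fun u v => by simp, fun ξ η => by simp; ring⟩
  · exact ⟨-1, 0, by norm_num, fun u v => by simp, fun ξ η => by simp; ring⟩
  · exact ⟨1, 1, by norm_num, fun u v => by simp, fun ξ η => by simp; ring⟩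
  · exact ⟨-1, 0, by norm_num, fun u v => by simp, fun ξ η => by simp; ring⟩
  · exact ⟨1, -1, by norm_num, fun u v => by
      rw [show 1 * u + -1 * v = u - v by ring]; simp, fun ξ η => by simp; ring⟩
  · exact ⟨0, 1, by norm_num, fun u v => by simp, fun ξ η => by simp⟩
  · exact ⟨0, -1, by norm_num, fun u v => by simp, fun ξ η => by simp; ring⟩
  · exact ⟨-1, 1, by norm_num, fun u v => by
      rw [show -1 * u + 1 * v = -(u - v) by ring, abs_neg]; simp, fun ξ η => by simp; ring⟩
  · exact ⟨1, 0, by norm_num, fun u v => by simp, fun ξ η => by simp⟩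

lemma refBary_nonneg_bounds {d : Diagonal} {b : Bool} {ξ η : ℝ} (h : ∀ a, 0 ≤ refBary d b a ξ η) :
    0 ≤ ξ ∧ ξ ≤ 1 ∧ 0 ≤ η ∧ η ≤ 1 := by
  have h0 := h 0
  have h1 := h 1
  have h2 := h 2
  cases d <;> cases b <;> simp [refBary] at h0 h1 h2 <;> refine ⟨?_, ?_, ?_, ?_⟩ <;> linarith

lemma exists_refBary_nonneg (d : Diagonal) {ξ η : ℝ} (h1 : 0 ≤ ξ) (h2 : ξ ≤ 1) (h3 : 0 ≤ η)
    (h4 : η ≤ 1) : ∃ b, ∀ a, 0 ≤ refBary d b a ξ η := by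
  cases d
  · rcases le_total (ξ + η) 1 with h | h
    · exact ⟨false, fun a => by fin_cases a <;> simp [refBary] <;> linarith⟩
    · exact ⟨true, fun a => by fin_cases a <;> simp [refBary] <;> linarith⟩
  · rcases le_total η ξ with h | h
    · exact ⟨false, fun a => by fin_cases a <;> simp [refBary] <;> linarith⟩
    · exact ⟨true, fun a => by fin_cases a <;> simp [refBary] <;> linarith⟩

lemma bary_sum (d : Diagonal) (K : Elem L N) (x : Plane) : ∑ a, bary d K a x = 1 :=
  refBary_sum ..

lemma bary_convexComb (d : Diagonal) (K : Elem L N) (a : Fin 3) {s t : ℝ} (hst : s + t = 1)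
    (x y : Plane) : bary d K a (s • x + t • y) = s * bary d K a x + t * bary d K a y := by
  unfold bary
  rw [← refBary_convexComb _ _ _ hst]
  obtain rfl : s = 1 - t := by linarith
  simp only [tau₁_add, tau₁_smul, tau₂_add, tau₂_smul]
  congr 1 <;> ring

lemma tau₁_vertex (d : Diagonal) (K : Elem L N) (a : Fin 3) :
    tau₁ (vertex d K a) = ((K.1 : ℕ) + (refVertex d K.2.2 a).1) / N := by simp [vertex]

lemma tau₂_vertex (d : Diagonal) (K : Elem L N) (a : Fin 3) :
    tau₂ (vertex d K a) = ((K.2.1 : ℕ) + (refVertex d K.2.2 a).2) / N - L := by simp [vertex]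

lemma bary_vertex (hN : 0 < N) (d : Diagonal) (K : Elem L N) (a a' : Fin 3) :
    bary d K a (vertex d K a') = if a = a' then 1 else 0 := by
  have hN' : (N : ℝ) ≠ 0 := by positivity
  rw [← refBary_vertex d K.2.2 a a', bary, tau₁_vertex, tau₂_vertex]
  congr 1 <;> field_simp <;> ring

lemma sum_bary_vertex (hN : 0 < N) (d : Diagonal) (K : Elem L N) (x : Plane) :
    ∑ a, bary d K a x • vertex d K a = x := by
  have hN' : (N : ℝ) ≠ 0 := by positivity
  obtain ⟨e1, e2⟩ := sum_refBary_vertex d K.2.2 (N * tau₁ x - (K.1 : ℕ))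
    (N * (tau₂ x + L) - (K.2.1 : ℕ))
  have e0 := bary_sum d K x
  simp only [Fin.sum_univ_three, bary] at e0 e1 e2 ⊢
  apply tau_ext
  · simp only [tau₁_add, tau₁_smul, tau₁_vertex]
    field_simp
    linear_combination (K.1 : ℕ) * e0 + e1
  · simp only [tau₂_add, tau₂_smul, tau₂_vertex]
    field_simp
    linear_combination ((K.2.1 : ℕ) - (N : ℝ) * L) * e0 + e2

lemma tri_eq (hN : 0 < N) (d : Diagonal) (K : Elem L N) :
    tri d K = {x | ∀ a, 0 ≤ bary d K a x} := by
  apply Set.Subset.antisymm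
  · refine convexHull_min ?_ ?_
    · rintro _ ⟨a', rfl⟩ a
      rw [bary_vertex hN]
      split_ifs <;> norm_num
    · intro x hx y hy s t hs ht hst a
      rw [bary_convexComb d K a hst]
      have := hx a
      have := hy a
      positivity
  · intro x hx
    rw [← sum_bary_vertex hN d K x]
    exact (convex_convexHull ℝ _).sum_mem (fun a _ => hx a) (bary_sum d K x)
      (fun a _ => subset_convexHull ℝ _ ⟨a, rfl⟩)

lemma mem_tri (hN : 0 < N) {d : Diagonal} {K : Elem L N} {x : Plane} :
    x ∈ tri d K ↔ ∀ a, 0 ≤ bary d K a x := by rw [tri_eq hN]; rfl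

lemma convex_tri (d : Diagonal) (K : Elem L N) : Convex ℝ (tri d K) := convex_convexHull ℝ _

lemma isCompact_tri (d : Diagonal) (K : Elem L N) : IsCompact (tri d K) :=
  Set.Finite.isCompact_convexHull ℝ (Set.finite_range _)

lemma isClosed_tri (d : Diagonal) (K : Elem L N) : IsClosed (tri d K) := (isCompact_tri d K).isClosed

lemma measurableSet_tri (d : Diagonal) (K : Elem L N) : MeasurableSet (tri d K) :=
  (isClosed_tri d K).measurableSet

lemma vertex_mem_tri (d : Diagonal) (K : Elem L N) (a : Fin 3) : vertex d K a ∈ tri d K :=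
  subset_convexHull ℝ _ ⟨a, rfl⟩

lemma exists_bary_coeff (d : Diagonal) (K : Elem L N) (a : Fin 3) :
    ∃ A B : ℝ, (A ≠ 0 ∨ B ≠ 0) ∧ (∀ u v : ℝ, |A * u + B * v| ≤ max (max |u| |v|)
      (max |u + v| |u - v|)) ∧
      ∀ x, bary d K a x = bary d K a 0 + N * (A * tau₁ x + B * tau₂ x) := by
  obtain ⟨A, B, h1, h2, h3⟩ := exists_refBary_coeff d K.2.2 a
  refine ⟨A, B, h1, h2, fun x => ?_⟩
  unfold bary
  rw [h3, h3 (N * tau₁ 0 - _)]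
  simp
  ring

lemma continuous_bary (d : Diagonal) (K : Elem L N) (a : Fin 3) : Continuous (bary d K a) := by
  obtain ⟨A, B, -, -, h⟩ := exists_bary_coeff d K a
  have : bary d K a = fun x => bary d K a 0 + N * (A * tau₁ x + B * tau₂ x) := funext h
  rw [this]
  have := continuous_tau₁
  have := continuous_tau₂
  fun_prop

lemma two_div_sqrt_three_le : 2 / Real.sqrt 3 ≤ 2 := by
  rw [div_le_iff₀ sqrt_three_pos]; linarith [sqrt_three_gt]

/-- The smallest height of an element is `h / 2`, which occurs for the long diagonal (angles 30°,
30°, 120°). Hence the slope `2 N`. -/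
lemma abs_bary_sub_le (d : Diagonal) (K : Elem L N) (a : Fin 3) (x y : Plane) :
    |bary d K a x - bary d K a y| ≤ 2 * N * ‖x - y‖ := by
  obtain ⟨A, B, -, h2, h⟩ := exists_bary_coeff d K a
  have e : bary d K a x - bary d K a y = N * (A * tau₁ (x - y) + B * tau₂ (x - y)) := by
    rw [h x, h y]; simp; ring
  rw [e, abs_mul, Nat.abs_cast]
  have hle : |A * tau₁ (x - y) + B * tau₂ (x - y)| ≤ 2 * ‖x - y‖ := by
    refine (h2 _ _).trans ?_
    have h0 : 2 / Real.sqrt 3 * ‖x - y‖ ≤ 2 * ‖x - y‖ :=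
      mul_le_mul_of_nonneg_right two_div_sqrt_three_le (norm_nonneg _)
    exact max_le (max_le ((abs_tau₁_le _).trans h0) ((abs_tau₂_le _).trans h0))
      (max_le ((abs_tau_add_le _).trans h0) (abs_tau_sub_le _))
  nlinarith [Nat.cast_nonneg (α := ℝ) N]

lemma mem_interior_tri (hN : 0 < N) {d : Diagonal} {K : Elem L N} {x : Plane}
    (hx : ∀ a, 0 < bary d K a x) : x ∈ interior (tri d K) := by
  have ho : IsOpen {x | ∀ a, 0 < bary d K a x} := by
    simp only [Set.ofPred_forall]
    exact isOpen_iInter_of_finite fun a => isOpen_lt continuous_const (continuous_bary d K a)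
  refine interior_maximal ?_ ho hx
  intro y hy
  exact (mem_tri hN).2 fun a => (hy a).le

lemma bary_eq_zero_of_notMem_interior (hN : 0 < N) {d : Diagonal} {K : Elem L N} {x : Plane}
    (hx : x ∈ tri d K) (hx' : x ∉ interior (tri d K)) : ∃ a, bary d K a x = 0 := by
  by_contra! h
  exact hx' (mem_interior_tri hN fun a => lt_of_le_of_ne ((mem_tri hN).1 hx a) (h a).symm)

/-- The frontier of a convex set is a null set. -/
lemma ae_interior_tri (d : Diagonal) (K : Elem L N) :
    ∀ᵐ x : Plane, x ∈ tri d K → x ∈ interior (tri d K) := by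
  have h := (convex_tri d K).addHaar_frontier (volume : Measure Plane)
  rw [← compl_mem_ae_iff] at h
  filter_upwards [h] with x hx hxK
  by_contra h'
  exact hx ⟨subset_closure hxK, h'⟩

lemma tau_bounds_of_mem_tri (hN : 0 < N) {d : Diagonal} {K : Elem L N} {x : Plane}
    (hx : x ∈ tri d K) :
    ((K.1 : ℕ) : ℝ) ≤ N * tau₁ x ∧ N * tau₁ x ≤ (K.1 : ℕ) + 1 ∧
      ((K.2.1 : ℕ) : ℝ) ≤ N * (tau₂ x + L) ∧ N * (tau₂ x + L) ≤ (K.2.1 : ℕ) + 1 := by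
  have h := refBary_nonneg_bounds ((mem_tri hN).1 hx)
  obtain ⟨h1, h2, h3, h4⟩ := h
  refine ⟨?_, ?_, ?_, ?_⟩ <;> linarith

lemma tri_subset_cylinder (hN : 0 < N) (d : Diagonal) (K : Elem L N) : tri d K ⊆ cylinder L := by
  intro x hx
  obtain ⟨h1, h2, h3, h4⟩ := tau_bounds_of_mem_tri hN hx
  have hN' : (0 : ℝ) < N := by positivity
  have hi : ((K.1 : ℕ) : ℝ) + 1 ≤ N := by exact_mod_cast K.1.2
  have hj : ((K.2.1 : ℕ) : ℝ) + 1 ≤ 2 * L * N := by exact_mod_cast K.2.1.2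
  have hi0 : (0 : ℝ) ≤ ((K.1 : ℕ) : ℝ) := Nat.cast_nonneg _
  have hj0 : (0 : ℝ) ≤ ((K.2.1 : ℕ) : ℝ) := Nat.cast_nonneg _
  rw [mem_cylinder]
  refine ⟨?_, ?_, ?_, ?_⟩
  · by_contra h; push Not at h; nlinarith
  · by_contra h; push Not at h; nlinarith
  · by_contra h; push Not at h; nlinarith
  · by_contra h; push Not at h; nlinarith

/-- A point of `[0, n]` lies in one of the unit intervals. -/
lemma exists_unit_interval {n : ℕ} (hn : 0 < n) {y : ℝ} (h0 : 0 ≤ y) (h1 : y ≤ n) :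
    ∃ i : Fin n, ((i : ℕ) : ℝ) ≤ y ∧ y ≤ (i : ℕ) + 1 := by
  rcases h1.lt_or_eq with h | h
  · exact ⟨⟨⌊y⌋₊, (Nat.floor_lt h0).2 h⟩, Nat.floor_le h0, (Nat.lt_floor_add_one y).le⟩
  · refine ⟨⟨n - 1, by omega⟩, ?_, ?_⟩ <;> simp only [Nat.cast_sub hn] <;> rw [h] <;> simp

lemma exists_mem_tri (hL : 0 < L) (hN : 0 < N) (d : Diagonal) {x : Plane} (hx : x ∈ cylinder L) :
    ∃ K : Elem L N, x ∈ tri d K := by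
  rw [mem_cylinder] at hx
  obtain ⟨h1, h2, h3, h4⟩ := hx
  have hN' : (0 : ℝ) < N := by positivity
  obtain ⟨i, hi0, hi1⟩ := exists_unit_interval hN (y := N * tau₁ x) (by positivity) (by nlinarith)
  obtain ⟨j, hj0, hj1⟩ := exists_unit_interval (n := 2 * L * N) (by positivity)
    (y := N * (tau₂ x + L)) (by apply mul_nonneg hN'.le; linarith) (by push_cast; nlinarith)
  obtain ⟨b, hb⟩ := exists_refBary_nonneg d (ξ := N * tau₁ x - (i : ℕ))
    (η := N * (tau₂ x + L) - (j : ℕ)) (by linarith) (by linarith) (by linarith) (by linarith)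
  exact ⟨(i, j, b), (mem_tri hN).2 hb⟩

lemma norm_sub_le_of_mem_tri (hN : 0 < N) {d : Diagonal} {K : Elem L N} {x y : Plane}
    (hx : x ∈ tri d K) (hy : y ∈ tri d K) : ‖x - y‖ ≤ 2 * meshSize N := by
  obtain ⟨h1, h2, h3, h4⟩ := tau_bounds_of_mem_tri hN hx
  obtain ⟨h1', h2', h3', h4'⟩ := tau_bounds_of_mem_tri hN hy
  have hN' : (0 : ℝ) < N := by positivity
  rw [meshSize_eq]
  apply le_of_sq_le_sq _ (by positivity)
  rw [norm_sq_tau]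
  have e : (2 * (1 / (N : ℝ))) ^ 2 = 4 / N ^ 2 := by field_simp; norm_num
  rw [e, le_div_iff₀ (by positivity)]
  have a1 : |N * tau₁ (x - y)| ≤ 1 := by rw [tau₁_sub, abs_le]; constructor <;> linarith
  have a2 : |N * tau₂ (x - y)| ≤ 1 := by rw [tau₂_sub, abs_le]; constructor <;> linarith
  have b1 := (sq_le_one_iff_abs_le_one _).2 a1
  have b2 := (sq_le_one_iff_abs_le_one _).2 a2
  nlinarith [sq_nonneg (N * tau₁ (x - y) - N * tau₂ (x - y))]

lemma meshSize_pos (hN : 0 < N) : 0 < meshSize N := by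
  rw [meshSize_eq]; positivity

lemma meshSize_le_one (hN : 0 < N) : meshSize N ≤ 1 := by
  rw [meshSize_eq, div_le_one (by positivity)]; exact_mod_cast hN

/-- The barycentre of an element. -/
def centroid (d : Diagonal) (K : Elem L N) : Plane := ∑ a, (1 / 3 : ℝ) • vertex d K a

lemma bary_centroid (hN : 0 < N) (d : Diagonal) (K : Elem L N) (a : Fin 3) :
    bary d K a (centroid d K) = 1 / 3 := by
  have h : centroid d K = (1 / 3 : ℝ) • vertex d K 0 + (2 / 3 : ℝ) •
      ((1 / 2 : ℝ) • vertex d K 1 + (1 / 2 : ℝ) • vertex d K 2) := by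
    simp only [centroid, Fin.sum_univ_three, smul_add, smul_smul, add_assoc]
    norm_num
  rw [h, bary_convexComb _ _ _ (by norm_num), bary_convexComb _ _ _ (by norm_num)]
  simp only [bary_vertex hN]
  fin_cases a <;> simp <;> norm_num

/-- The coordinates equal `1 / 3` at the barycentre and have slope at most `2 N`, so they stay
nonnegative up to distance `h / 6`. -/
lemma ball_subset_tri (hN : 0 < N) (d : Diagonal) (K : Elem L N) :
    Metric.closedBall (centroid d K) (meshSize N / 6) ⊆ tri d K := by
  intro x hx
  rw [mem_tri hN]
  intro a
  rw [Metric.mem_closedBall, dist_eq_norm, meshSize_eq] at hx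
  have h := abs_bary_sub_le d K a x (centroid d K)
  rw [bary_centroid hN] at h
  have hN' : (0 : ℝ) < N := by positivity
  have : 2 * N * ‖x - centroid d K‖ ≤ 1 / 3 := by
    calc 2 * N * ‖x - centroid d K‖ ≤ 2 * N * (1 / N / 6) := by gcongr
      _ = 1 / 3 := by field_simp; norm_num
  linarith [(abs_le.mp h).1]

lemma volume_closedBall_toReal (x : Plane) {ρ : ℝ} (hρ : 0 ≤ ρ) :
    (volume (Metric.closedBall x ρ)).toReal = Real.pi * ρ ^ 2 := by
  rw [EuclideanSpace.volume_closedBall_fin_two]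
  simp [ENNReal.toReal_mul, hρ, mul_comm, Real.pi_pos.le]

lemma volume_tri_ge (hN : 0 < N) (d : Diagonal) (K : Elem L N) :
    meshSize N ^ 2 / 36 ≤ (volume (tri d K)).toReal := by
  have h1 : (volume (Metric.closedBall (centroid d K) (meshSize N / 6))).toReal ≤
      (volume (tri d K)).toReal :=
    ENNReal.toReal_mono (isCompact_tri d K).measure_lt_top.ne (measure_mono (ball_subset_tri hN d K))
  rw [volume_closedBall_toReal _ (by linarith [meshSize_pos hN])] at h1
  nlinarith [Real.pi_gt_three, sq_nonneg (meshSize N)]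

lemma volume_tri_le (hN : 0 < N) (d : Diagonal) (K : Elem L N) :
    (volume (tri d K)).toReal ≤ 16 * meshSize N ^ 2 := by
  have hh := meshSize_pos hN
  have h1 : (volume (tri d K)).toReal ≤
      (volume (Metric.closedBall (centroid d K) (2 * meshSize N))).toReal := by
    refine ENNReal.toReal_mono measure_closedBall_lt_top.ne (measure_mono fun x hx => ?_)
    rw [Metric.mem_closedBall, dist_eq_norm]
    exact norm_sub_le_of_mem_tri hN hx (ball_subset_tri hN d K (by simp; positivity))
  rw [volume_closedBall_toReal _ (by positivity)] at h1
  nlinarith [Real.pi_lt_d2, sq_nonneg (meshSize N), sq_pos_of_pos hh]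

/-- Boundedly many elements come close to a given point. -/
lemma card_elems_near_le (hN : 0 < N) (d : Diagonal) (x₀ : Plane) (s : Finset (Elem L N))
    (hs : ∀ K ∈ s, ∃ y ∈ tri d K, ‖y - x₀‖ ≤ meshSize N) : s.card ≤ 72 := by
  classical
  have hN' : (0 : ℝ) < N := by positivity
  set p : ℤ := ⌊N * tau₁ x₀⌋
  set q : ℤ := ⌊N * (tau₂ x₀ + L)⌋
  have key : ∀ K ∈ s, ((K.1 : ℕ) : ℤ) ∈ Finset.Icc (p - 3) (p + 2) ∧
      ((K.2.1 : ℕ) : ℤ) ∈ Finset.Icc (q - 3) (q + 2) := by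
    intro K hK
    obtain ⟨y, hy, hyx⟩ := hs K hK
    obtain ⟨h1, h2, h3, h4⟩ := tau_bounds_of_mem_tri hN hy
    have hb : N * (2 / Real.sqrt 3 * ‖y - x₀‖) < 2 := by
      rw [meshSize_eq] at hyx
      have h3 : 2 / Real.sqrt 3 < 2 := by
        rw [div_lt_iff₀ sqrt_three_pos]; linarith [sqrt_three_gt]
      calc N * (2 / Real.sqrt 3 * ‖y - x₀‖) ≤ N * (2 / Real.sqrt 3 * (1 / N)) := by gcongr
        _ = 2 / Real.sqrt 3 := by field_simp
        _ < 2 := h3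
    have t1 : |N * tau₁ (y - x₀)| < 2 := by
      rw [abs_mul, Nat.abs_cast]
      exact (mul_le_mul_of_nonneg_left (abs_tau₁_le _) hN'.le).trans_lt hb
    have t2 : |N * tau₂ (y - x₀)| < 2 := by
      rw [abs_mul, Nat.abs_cast]
      exact (mul_le_mul_of_nonneg_left (abs_tau₂_le _) hN'.le).trans_lt hb
    rw [tau₁_sub, mul_sub, abs_lt] at t1
    rw [tau₂_sub, mul_sub, abs_lt] at t2
    have p1 := Int.floor_le (N * tau₁ x₀)
    have p2 := Int.lt_floor_add_one (N * tau₁ x₀)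
    have q1 := Int.floor_le (N * (tau₂ x₀ + L))
    have q2 := Int.lt_floor_add_one (N * (tau₂ x₀ + L))
    have a1 : (((K.1 : ℕ) : ℤ) : ℝ) < (p + 3 : ℤ) := by push_cast; linarith
    have a2 : ((p - 4 : ℤ) : ℝ) < ((K.1 : ℕ) : ℤ) := by push_cast; linarith
    have b1 : (((K.2.1 : ℕ) : ℤ) : ℝ) < (q + 3 : ℤ) := by push_cast; linarith
    have b2 : ((q - 4 : ℤ) : ℝ) < ((K.2.1 : ℕ) : ℤ) := by push_cast; linarith
    have a1' := Int.cast_lt.1 a1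
    have a2' := Int.cast_lt.1 a2
    have b1' := Int.cast_lt.1 b1
    have b2' := Int.cast_lt.1 b2
    simp only [Finset.mem_Icc]
    omega
  -- Six values for each of the two indices and two triangles: `6 * 6 * 2 = 72`.
  let T : Finset (ℤ × ℤ × Bool) :=
    Finset.Icc (p - 3) (p + 2) ×ˢ Finset.Icc (q - 3) (q + 2) ×ˢ Finset.univ
  have hT : T.card = 72 := by
    simp only [T, Finset.card_product, Int.card_Icc, Finset.card_univ, Fintype.card_bool]
    rw [show p + 2 + 1 - (p - 3) = 6 by ring, show q + 2 + 1 - (q - 3) = 6 by ring]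
    rfl
  rw [← hT]
  refine Finset.card_le_card_of_injOn
    (fun K => (((K.1 : ℕ) : ℤ), ((K.2.1 : ℕ) : ℤ), K.2.2)) ?_ ?_
  · intro K hK
    have := key K hK
    simp only [T, Finset.coe_product, Set.mem_prod, Finset.mem_coe, Finset.mem_univ, and_true]
    exact this
  · rintro ⟨i, j, b⟩ - ⟨i', j', b'⟩ - h
    simp only [Prod.mk.injEq, Nat.cast_inj] at h
    obtain ⟨h1, h2, h3⟩ := h
    simp only [Prod.mk.injEq]
    exact ⟨Fin.ext h1, Fin.ext h2, h3⟩

/-! ## Mesh elements and half-cells -/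

/-- An element of the mesh cut along the long diagonals which is symmetric about the common side
of two half-cells. -/
def IsStraddling (d : Diagonal) (K : Elem L N) : Prop :=
  d = .long ∧ ((K.1 : ℕ) + (K.2.1 : ℕ) % N + 1 = N)

/-- The sides of the half-cells lie on the lines `τ₁ ∈ ℤ`, `τ₂ ∈ ℤ` and `τ₁ + τ₂ ∈ ℤ`. All of them
are mesh lines for the short diagonal. For the long diagonal the lines of the third kind bisect
exactly the rhombuses that satisfy the index condition of `IsStraddling`. -/
lemma subset_halfCell_or_straddling (hN : 0 < N) (d : Diagonal) (K : Elem L N) :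
    (∃ c : Circles L, tri d K ⊆ halfCell c) ∨ IsStraddling d K := by
  obtain ⟨i, j, b⟩ := K
  have hN' : (0 : ℝ) < N := by positivity
  have hdiv : (j : ℕ) / N < 2 * L := by
    rw [Nat.div_lt_iff_lt_mul hN]; exact j.2
  -- `m` is the unit cell of the element in the direction `v₂`, and `j'` is its row within that
  -- cell.
  set m : Fin (2 * L) := ⟨(j : ℕ) / N, hdiv⟩ with hm
  set j' := (j : ℕ) % N with hj'
  have hj : (j : ℕ) = N * ((j : ℕ) / N) + j' := (Nat.div_add_mod _ _).symm
  have hjr : ((j : ℕ) : ℝ) = N * ((m : ℕ) : ℝ) + j' := by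
    rw [hm]; exact_mod_cast hj
  have hi : ((i : ℕ) : ℝ) + 1 ≤ N := by exact_mod_cast i.2
  have hj2 : (j' : ℝ) + 1 ≤ N := by exact_mod_cast Nat.mod_lt (j : ℕ) hN
  have hi0 : (0 : ℝ) ≤ ((i : ℕ) : ℝ) := Nat.cast_nonneg _
  have hj0 : (0 : ℝ) ≤ (j' : ℝ) := Nat.cast_nonneg _
  have scale : ∀ (c : Circles L) (x : Plane),
      (∀ a, 0 ≤ N * cellBary c a x) → x ∈ halfCell c := fun c x h a =>
    (mul_nonneg_iff_of_pos_left hN').1 (h a)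
  -- In the cell `m`, the short diagonal `τ₁ + τ₂ = 1 + (m - L)` separates the half-cell of `A` from
  -- that of `B`, which is the subject of `hB`.
  have hA : ∀ x : Plane, 0 ≤ N * tau₁ x - (i : ℕ) → 0 ≤ N * (tau₂ x + L) - (j : ℕ) →
      (N * tau₁ x - (i : ℕ)) + (N * (tau₂ x + L) - (j : ℕ)) + i + j' ≤ N →
      x ∈ halfCell ((0, m) : Circles L) := by
    intro x h1 h2 h3
    apply scale
    intro a
    fin_cases a <;> simp [cellBary, cellSign, tau₁_center, tau₂_center] <;> nlinarith
  have hB : ∀ x : Plane, N * tau₁ x - (i : ℕ) ≤ 1 → N * (tau₂ x + L) - (j : ℕ) ≤ 1 →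
      N ≤ (N * tau₁ x - (i : ℕ)) + (N * (tau₂ x + L) - (j : ℕ)) + i + j' →
      x ∈ halfCell ((1, m) : Circles L) := by
    intro x h1 h2 h3
    apply scale
    intro a
    fin_cases a <;> simp [cellBary, cellSign, tau₁_center, tau₂_center] <;> nlinarith
  have cut : ∀ (n n' : ℕ), n ≤ n' → (n : ℝ) ≤ n' := fun n n' h => by exact_mod_cast h
  cases d
  · left
    cases b
    · rcases le_or_gt ((i : ℕ) + j' + 1) N with h | h
      · refine ⟨(0, m), fun x hx => ?_⟩
        have hb := (mem_tri hN).1 hx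
        have h0 := hb 0
        have h1 := hb 1
        have h2 := hb 2
        simp [bary, refBary] at h0 h1 h2
        have := cut _ _ h
        push_cast at this
        exact hA x (by linarith) (by linarith) (by linarith)
      · refine ⟨(1, m), fun x hx => ?_⟩
        have hb := (mem_tri hN).1 hx
        have h0 := hb 0
        have h1 := hb 1
        have h2 := hb 2
        simp [bary, refBary] at h0 h1 h2
        have := cut _ _ (Nat.le_of_lt_succ h)
        push_cast at this
        exact hB x (by linarith) (by linarith) (by linarith)
    · rcases le_or_gt N ((i : ℕ) + j' + 1) with h | h
      · refine ⟨(1, m), fun x hx => ?_⟩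
        have hb := (mem_tri hN).1 hx
        have h0 := hb 0
        have h1 := hb 1
        have h2 := hb 2
        simp [bary, refBary] at h0 h1 h2
        have := cut _ _ h
        push_cast at this
        exact hB x (by linarith) (by linarith) (by linarith)
      · refine ⟨(0, m), fun x hx => ?_⟩
        have hb := (mem_tri hN).1 hx
        have h0 := hb 0
        have h1 := hb 1
        have h2 := hb 2
        simp [bary, refBary] at h0 h1 h2
        have := cut _ _ (Nat.succ_le_of_lt h)
        push_cast at this
        exact hA x (by linarith) (by linarith) (by linarith)
  · by_cases hs : (i : ℕ) + j' + 1 = N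
    · exact Or.inr ⟨rfl, hs⟩
    left
    rcases lt_or_gt_of_ne hs with h | h
    · refine ⟨(0, m), fun x hx => ?_⟩
      have hbd := refBary_nonneg_bounds ((mem_tri hN).1 hx)
      have := cut _ _ (Nat.succ_le_of_lt h)
      push_cast at this
      exact hA x hbd.1 hbd.2.2.1 (by have := hbd.2.1; have := hbd.2.2.2; linarith)
    · refine ⟨(1, m), fun x hx => ?_⟩
      have hbd := refBary_nonneg_bounds ((mem_tri hN).1 hx)
      have := cut _ _ (Nat.le_of_lt_succ h)
      push_cast at this
      exact hB x hbd.2.1 hbd.2.2.2 (by have := hbd.1; have := hbd.2.2.1; linarith)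

end

section

/-! ## Consequences of the admissibility of the mesh -/

lemma exists_sphere_crossing {x y c : Plane} {r : ℝ} (hx : dist x c < r) (hy : r ≤ dist y c) :
    ∃ s : ℝ, 0 < s ∧ s ≤ 1 ∧ dist ((1 - s) • x + s • y) c = r := by
  have hcont : ContinuousOn (fun s : ℝ => dist ((1 - s) • x + s • y) c) (Set.Icc 0 1) := by
    fun_prop
  have h := intermediate_value_Icc (zero_le_one (α := ℝ)) hcont
  have hr : r ∈ Set.Icc (dist ((1 - (0 : ℝ)) • x + (0 : ℝ) • y) c)
      (dist ((1 - (1 : ℝ)) • x + (1 : ℝ) • y) c) := by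
    simp only [sub_zero, one_smul, zero_smul, add_zero, sub_self, zero_add]
    exact ⟨hx.le, hy⟩
  obtain ⟨s, ⟨hs0, hs1⟩, hs⟩ := h hr
  refine ⟨s, lt_of_le_of_ne hs0 ?_, hs1, hs⟩
  rintro rfl
  simp at hs
  linarith

lemma exists_sphere_crossing_open {x y c : Plane} {r : ℝ} (hx : dist x c < r)
    (hy : r < dist y c) : ∃ s : ℝ, 0 < s ∧ s < 1 ∧ dist ((1 - s) • x + s • y) c = r := by
  obtain ⟨s, h0, h1, h⟩ := exists_sphere_crossing hx hy.le
  refine ⟨s, h0, lt_of_le_of_ne h1 ?_, h⟩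
  rintro rfl
  simp at h
  linarith

variable {L N : ℕ}

/-- An edge with end points outside a disc does not enter the disc. -/
lemma dist_midpoint_ge {r : ℝ} (hr : r < Real.sqrt 3 / 6) {d : Diagonal}
    (hcut : CutAssumption L N d r) {K : Elem L N} (hK : K ∈ interfaceElems L N d r)
    (c : Circles L) {a b : Fin 3} (ha : r < dist (vertex d K a) (circleCenter c))
    (hb : r < dist (vertex d K b) (circleCenter c)) :
    r ≤ dist ((1 / 2 : ℝ) • vertex d K a + (1 / 2 : ℝ) • vertex d K b) (circleCenter c) := by
  by_contra! h
  set m := (1 / 2 : ℝ) • vertex d K a + (1 / 2 : ℝ) • vertex d K b with hm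
  have hab : a ≠ b := by
    rintro rfl
    have : m = vertex d K a := by rw [hm, ← add_smul]; norm_num
    rw [this] at h
    linarith
  -- With the midpoint inside the disc and both ends outside, each half of the edge carries a
  -- crossing. The open edge has at most one, so the two coincide, which is only possible if the end
  -- points coincide.
  obtain ⟨s, hs0, hs1, hs⟩ := exists_sphere_crossing_open h ha
  obtain ⟨t, ht0, ht1, ht⟩ := exists_sphere_crossing_open h hb
  have hsub := (hcut K hK).2 a b hab
  have e1 : (1 - s) • m + s • vertex d K a ∈
      interface L r ∩ openSegment ℝ (vertex d K a) (vertex d K b) := by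
    refine ⟨(mem_interface hr).2 ⟨c, hs⟩, (1 + s) / 2, (1 - s) / 2, by linarith, by linarith,
      by ring, ?_⟩
    rw [hm]; module
  have e2 : (1 - t) • m + t • vertex d K b ∈
      interface L r ∩ openSegment ℝ (vertex d K a) (vertex d K b) := by
    refine ⟨(mem_interface hr).2 ⟨c, ht⟩, (1 - t) / 2, (1 + t) / 2, by linarith, by linarith,
      by ring, ?_⟩
    rw [hm]; module
  have e := hsub e1 e2
  have e' : ((s + t) / 2) • (vertex d K a - vertex d K b) = 0 := by
    have : ((s + t) / 2) • (vertex d K a - vertex d K b) =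
      ((1 - s) • m + s • vertex d K a) - ((1 - t) • m + t • vertex d K b) := by rw [hm]; module
    rw [this, e, sub_self]
  rcases smul_eq_zero.1 e' with h0 | h0
  · linarith
  · have hab' := sub_eq_zero.1 h0
    have : m = vertex d K a := by rw [hm, ← hab', ← add_smul]; norm_num
    rw [this] at h
    linarith

/-- Reflection about the common side of the two half-cells with index `m`. -/
def reflect (m : Fin (2 * L)) (x : Plane) : Plane :=
  (1 + ((m : ℕ) - (L : ℝ)) - tau₂ x) • v₁ + (1 + ((m : ℕ) - (L : ℝ)) - tau₁ x) • v₂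

lemma reflect_comb (m : Fin (2 * L)) (x y : Plane) (s : ℝ) :
    reflect m ((1 - s) • x + s • y) = (1 - s) • reflect m x + s • reflect m y :=
  tau_ext (by simp [reflect]; ring) (by simp [reflect]; ring)

/-- The reflection is an isometry that exchanges the two centres of the cell `m`. -/
lemma dist_reflect (m : Fin (2 * L)) (x : Plane) (s : Fin 2) :
    dist (reflect m x) (circleCenter (1 - s, m)) = dist x (circleCenter (s, m)) := by
  rw [dist_eq_norm, dist_eq_norm, ← sq_eq_sq₀ (norm_nonneg _) (norm_nonneg _), norm_sq_tau,
    norm_sq_tau]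
  simp only [tau₁_sub, tau₂_sub, tau₁_center, tau₂_center, reflect, tau₁_add, tau₂_add, tau₁_smul,
    tau₂_smul, tau₁_v₁, tau₁_v₂, tau₂_v₁, tau₂_v₂]
  fin_cases s <;> simp <;> ring

/-! ### Elements symmetric about the common side of two half-cells -/

section Straddling

variable {i : Fin N} {j : Fin (2 * L * N)} {b : Bool}

/-- The index of the cell of an element. -/
def cellIndex (hN : 0 < N) (j : Fin (2 * L * N)) : Fin (2 * L) :=
  ⟨(j : ℕ) / N, by rw [Nat.div_lt_iff_lt_mul hN]; exact j.2⟩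

lemma cast_eq_cellIndex (hN : 0 < N) (j : Fin (2 * L * N)) :
    ((j : ℕ) : ℝ) = N * ((cellIndex hN j : ℕ) : ℝ) + ((j : ℕ) % N : ℕ) := by
  exact_mod_cast (Nat.div_add_mod (j : ℕ) N).symm

lemma straddling_cast (hs : IsStraddling .long (i, j, b)) :
    ((i : ℕ) : ℝ) + (((j : ℕ) % N : ℕ) : ℝ) + 1 = N := by
  exact_mod_cast hs.2

/-- The axis passes through the vertex 1, at the obtuse angle, and through the midpoint of the edge
along the long diagonal. So the vertex 1 is fixed and the vertices 0 and 2 are exchanged. -/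
lemma reflect_vertex (hN : 0 < N) (hs : IsStraddling .long (i, j, b)) (a : Fin 3) :
    reflect (cellIndex hN j) (vertex .long (i, j, b) a) = vertex .long (i, j, b) (2 - a) := by
  have h1 := cast_eq_cellIndex hN j
  have h2 := straddling_cast hs
  have hN' : (N : ℝ) ≠ 0 := by positivity
  apply tau_ext <;>
    simp only [reflect, tau₁_add, tau₂_add, tau₁_smul,
      tau₂_smul, tau₁_v₁, tau₁_v₂, tau₂_v₁, tau₂_v₂, tau₁_vertex, tau₂_vertex] <;>
    cases b <;> fin_cases a <;> simp [refVertex] <;> field_simp <;> linarith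

lemma reflect_tri (hN : 0 < N) (hs : IsStraddling .long (i, j, b)) {x : Plane}
    (hx : x ∈ tri .long (i, j, b)) : reflect (cellIndex hN j) x ∈ tri .long (i, j, b) := by
  have hsub : tri .long (i, j, b) ⊆
      reflect (cellIndex hN j) ⁻¹' (tri .long (i, j, b)) := by
    refine convexHull_min ?_ ?_
    · rintro _ ⟨a, rfl⟩
      rw [Set.mem_preimage, reflect_vertex hN hs]
      exact vertex_mem_tri _ _ _
    · intro x hx y hy s t hs ht hst
      obtain rfl : s = 1 - t := by linarith
      rw [Set.mem_preimage, reflect_comb]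
      exact convex_tri _ _ hx hy hs ht (by ring)
  exact hsub hx

lemma half_comb {x y : Plane} {s : ℝ} :
    (1 - s) • x + s • ((1 / 2 : ℝ) • x + (1 / 2 : ℝ) • y) = (1 - s / 2) • x + (s / 2) • y := by
  module

/-- A disc that enters a straddling element crosses one of two half edges. -/
lemma exists_edge_point (hN : 0 < N) (hs : IsStraddling .long (i, j, b)) {r : ℝ}
    (hr : r < Real.sqrt 3 / 6) {y : Plane} (hy : y ∈ tri .long (i, j, b))
    (hyb : dist y (circleCenter (0, cellIndex hN j)) < r) :
    ∃ s : ℝ, 0 ≤ s ∧ s ≤ 1 ∧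
      (dist ((1 - s) • vertex .long (i, j, b) 0 + s • vertex .long (i, j, b) 1)
          (circleCenter (0, cellIndex hN j)) < r ∨
        dist ((1 - s / 2) • vertex .long (i, j, b) 0 + (s / 2) • vertex .long (i, j, b) 2)
          (circleCenter (0, cellIndex hN j)) < r) := by
  have h1 := cast_eq_cellIndex hN j
  have h2 := straddling_cast hs
  have hN' : (0 : ℝ) < N := by positivity
  have hb := (mem_tri hN).1 hy
  have hpos := cellBary_pos (c := ((0, cellIndex hN j) : Circles L)) hr
    (Metric.mem_closedBall.2 hyb.le) 0
  set m := cellIndex hN j with hm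
  set A := circleCenter ((0, m) : Circles L) with hA
  set ξ := N * tau₁ y - (i : ℕ) with hξ
  set η := N * (tau₂ y + L) - (j : ℕ) with hη
  have hs1 : ξ + η < 1 := by
    have : 0 < N * cellBary ((0, m) : Circles L) 0 y := mul_pos hN' hpos
    simp [cellBary, cellSign, tau₁_center, tau₂_center] at this
    nlinarith
  have hbd := refBary_nonneg_bounds hb
  -- The squared norm splits into a part in `τ₁ + τ₂` and a part in `τ₁ - τ₂`. On a line parallel to
  -- the axis the first is constant, and the distance to `A` grows with the absolute value of the
  -- second.
  have hdist : ∀ z : Plane, tau₁ z + tau₂ z = tau₁ y + tau₂ y →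
      |N * (tau₁ (z - A) - tau₂ (z - A))| ≤ |N * (tau₁ (y - A) - tau₂ (y - A))| →
      dist z A < r := by
    intro z hz hz'
    refine lt_of_le_of_lt ?_ hyb
    rw [dist_eq_norm, dist_eq_norm]
    apply le_of_sq_le_sq _ (norm_nonneg _)
    have e : ∀ w : Plane, ‖w‖ ^ 2 = (3 * (tau₁ w + tau₂ w) ^ 2 + (tau₁ w - tau₂ w) ^ 2) / 4 := by
      intro w; rw [norm_sq_tau]; ring
    rw [e, e]
    rw [abs_mul, abs_mul] at hz'
    have h3 := le_of_mul_le_mul_left hz' (by positivity)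
    have h4 := sq_le_sq.2 h3
    have h5 : tau₁ (z - A) + tau₂ (z - A) = tau₁ (y - A) + tau₂ (y - A) := by
      simp only [tau₁_sub, tau₂_sub]; linarith
    rw [h5]
    linarith
  have ey : N * (tau₁ (y - A) - tau₂ (y - A)) = (ξ - η) + ((i : ℕ) - (((j : ℕ) % N : ℕ) : ℝ)) := by
    rw [hξ, hη, hA]; simp [tau₁_center, tau₂_center]; linarith
  -- The parallel to the axis through `y` meets the element in a chord from the long edge to the
  -- edge 01, on which `ξ - η` runs between 0 and `±(ξ + η)`, an interval shorter than one. The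
  -- offset `i - j'` is an integer, so the foot of `A` is not strictly inside the chord, and one of
  -- its two ends is the point closest to `A`.
  have hij : (((j : ℕ) % N : ℕ) : ℝ) ≤ (i : ℕ) ∨ ((i : ℕ) : ℝ) + 1 ≤ (((j : ℕ) % N : ℕ) : ℝ) := by
    rcases le_or_gt ((j : ℕ) % N) (i : ℕ) with h | h
    · exact Or.inl (by exact_mod_cast h)
    · exact Or.inr (by exact_mod_cast h)
  have hij' : ((i : ℕ) : ℝ) ≤ (((j : ℕ) % N : ℕ) : ℝ) ∨ (((j : ℕ) % N : ℕ) : ℝ) + 1 ≤ (i : ℕ) := by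
    rcases le_or_gt (i : ℕ) ((j : ℕ) % N) with h | h
    · exact Or.inl (by exact_mod_cast h)
    · exact Or.inr (by exact_mod_cast h)
  refine ⟨ξ + η, by linarith [hbd.1, hbd.2.2.1], hs1.le, ?_⟩
  have esum : ξ + η = N * (tau₁ y + tau₂ y) + N * L - (i : ℕ) - (j : ℕ) := by rw [hξ, hη]; ring
  have ediag : ∀ z : Plane, z = (1 - (ξ + η) / 2) • vertex .long (i, j, b) 0 +
      ((ξ + η) / 2) • vertex .long (i, j, b) 2 →
      tau₁ z + tau₂ z = tau₁ y + tau₂ y ∧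
        N * (tau₁ (z - A) - tau₂ (z - A)) = (i : ℕ) - (((j : ℕ) % N : ℕ) : ℝ) := by
    rintro z rfl
    constructor
    · simp only [tau₁_add, tau₂_add, tau₁_smul, tau₂_smul, tau₁_vertex, tau₂_vertex]
      cases b <;> simp [refVertex] <;> field_simp <;> rw [esum] <;> ring
    · rw [hA]
      simp only [tau₁_sub, tau₂_sub, tau₁_add, tau₂_add, tau₁_smul, tau₂_smul, tau₁_vertex,
        tau₂_vertex, tau₁_center, tau₂_center]
      cases b <;> simp [refVertex] <;> field_simp <;> rw [h1] <;> ring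
  have eside : ∀ z : Plane, z = (1 - (ξ + η)) • vertex .long (i, j, b) 0 +
      (ξ + η) • vertex .long (i, j, b) 1 →
      tau₁ z + tau₂ z = tau₁ y + tau₂ y ∧
        N * (tau₁ (z - A) - tau₂ (z - A)) =
          (if b then -(ξ + η) else ξ + η) + ((i : ℕ) - (((j : ℕ) % N : ℕ) : ℝ)) := by
    rintro z rfl
    constructor
    · simp only [tau₁_add, tau₂_add, tau₁_smul, tau₂_smul, tau₁_vertex, tau₂_vertex]
      cases b <;> simp [refVertex] <;> field_simp <;> rw [esum] <;> ring
    · rw [hA]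
      simp only [tau₁_sub, tau₂_sub, tau₁_add, tau₂_add, tau₁_smul, tau₂_smul, tau₁_vertex,
        tau₂_vertex, tau₁_center, tau₂_center]
      cases b <;> simp [refVertex] <;> field_simp <;> rw [h1] <;> ring
  cases b
  · have hb1 := hb 1
    simp [bary, refBary] at hb1
    have hle : η ≤ ξ := by rw [hξ, hη]; linarith
    rcases hij with h | h
    · right
      obtain ⟨z1, z2⟩ := ediag _ rfl
      refine hdist _ z1 ?_
      rw [z2, ey, abs_of_nonneg (by linarith), abs_of_nonneg (by linarith)]
      linarith
    · left
      obtain ⟨z1, z2⟩ := eside _ rfl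
      refine hdist _ z1 ?_
      rw [z2, ey, abs_of_nonpos (by simp; linarith), abs_of_nonpos (by linarith [hbd.2.1, hbd.2.2.1])]
      simp
      linarith [hbd.2.2.1]
  · have hb1 := hb 1
    simp [bary, refBary] at hb1
    have hle : ξ ≤ η := by rw [hξ, hη]; linarith
    rcases hij' with h | h
    · right
      obtain ⟨z1, z2⟩ := ediag _ rfl
      refine hdist _ z1 ?_
      rw [z2, ey, abs_of_nonpos (by linarith), abs_of_nonpos (by linarith)]
      linarith
    · left
      obtain ⟨z1, z2⟩ := eside _ rfl
      refine hdist _ z1 ?_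
      rw [z2, ey, abs_of_nonneg (by simp; linarith), abs_of_nonneg (by linarith [hbd.1, hbd.2.2.2])]
      simp
      linarith [hbd.1]

lemma segment_subset_triBoundary (d : Diagonal) (K : Elem L N) {a b : Fin 3} (hab : a ≠ b) :
    segment ℝ (vertex d K a) (vertex d K b) ⊆ triBoundary d K := by
  intro x hx
  simp only [triBoundary, Set.mem_iUnion]
  exact ⟨a, b, hab, hx⟩

lemma segment_comb {x y : Plane} {s : ℝ} (h0 : 0 ≤ s) (h1 : s ≤ 1) :
    (1 - s) • x + s • y ∈ segment ℝ x y := ⟨1 - s, s, by linarith, h0, by ring, rfl⟩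

/-- The crossings towards `U` and towards `V` differ because `w` lies between them: if they
coincided, `w` would itself be on the circle. -/
lemma exists_two_crossings {U V w A : Plane} {r s : ℝ} (hs0 : 0 ≤ s) (hs1 : s ≤ 1)
    (hw : w = (1 - s) • U + s • V) (hwr : dist w A < r) (hUr : r ≤ dist U A) (hV : r ≤ dist V A) :
    ∃ z ∈ segment ℝ U V, ∃ z' ∈ segment ℝ U V, z ≠ z' ∧ dist z A = r ∧ dist z' A = r := by
  obtain ⟨t, ht0, ht1, ht⟩ := exists_sphere_crossing hwr hUr
  obtain ⟨t', ht0', ht1', ht'⟩ := exists_sphere_crossing hwr hV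
  set z := (1 - t) • w + t • U with hz
  set z' := (1 - t') • w + t' • V with hz'
  have hwseg : w ∈ segment ℝ U V := by rw [hw]; exact segment_comb hs0 hs1
  have hzs : z ∈ segment ℝ U V := (convex_segment U V) hwseg (left_mem_segment ℝ U V)
    (by linarith) ht0.le (by ring)
  have hzs' : z' ∈ segment ℝ U V := (convex_segment U V) hwseg (right_mem_segment ℝ U V)
    (by linarith) ht0'.le (by ring)
  have hzz : z ≠ z' := by
    intro h
    have e : dist w A < r := hwr
    have : w ∈ segment ℝ z z' := by
      -- The distances of `z` and `z'` from `w` are in the ratio `t s : t' (1 - s)`, which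
      -- determines these weights.
      refine ⟨t' * (1 - s) / (t' * (1 - s) + t * s), t * s / (t' * (1 - s) + t * s), ?_, ?_, ?_, ?_⟩
      · apply div_nonneg <;> nlinarith [mul_nonneg ht0.le hs0, mul_nonneg ht0'.le (sub_nonneg.2 hs1)]
      · apply div_nonneg <;> nlinarith [mul_nonneg ht0.le hs0, mul_nonneg ht0'.le (sub_nonneg.2 hs1)]
      all_goals
        have hD : 0 < t' * (1 - s) + t * s := by
          rcases hs0.eq_or_lt with h | h
          · rw [← h]; simpa using ht0'
          · have : 0 < t * s := mul_pos ht0 h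
            have : 0 ≤ t' * (1 - s) := mul_nonneg ht0'.le (by linarith)
            linarith
      · rw [← add_div, div_self hD.ne']
      · rw [hz, hz', hw]
        generalize hDe : t' * (1 - s) + t * s = D at hD
        apply tau_ext <;> simp only [tau₁_add, tau₂_add, tau₁_smul, tau₂_smul] <;>
          field_simp <;> rw [← hDe] <;> ring
    rw [← h, segment_same, Set.mem_singleton_iff] at this
    rw [this, ht] at e
    exact lt_irrefl _ e
  exact ⟨z, hzs, z', hzs', hzz, ht, ht'⟩

set_option maxHeartbeats 1000000 in
/-- A disc does not enter a straddling element. -/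
lemma straddling_notMem_left {r : ℝ} (hr : r < Real.sqrt 3 / 6) (hN : 0 < N)
    (hcut : CutAssumption L N .long r) (hs : IsStraddling .long (i, j, b))
    (hK : ((i, j, b) : Elem L N) ∈ interfaceElems L N .long r) {y : Plane}
    (hy : y ∈ tri .long (i, j, b)) : r ≤ dist y (circleCenter (0, cellIndex hN j)) := by
  by_contra! hyb
  have hN' : (0 : ℝ) < N := by positivity
  have h1 := cast_eq_cellIndex hN j
  have h2 := straddling_cast hs
  set m := cellIndex hN j with hm
  set A := circleCenter ((0, m) : Circles L) with hA
  -- On the axis and beyond it one has left the interior of the half-cell of `A`, so the disc about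
  -- `A` is not met.
  have hfar : ∀ z : Plane, N ≤ N * (tau₁ z + tau₂ z - ((m : ℕ) - (L : ℝ))) → r < dist z A := by
    intro z hz
    by_contra! h
    have hpos := cellBary_pos (c := ((0, m) : Circles L)) hr (Metric.mem_closedBall.2 h) 0
    have := mul_pos hN' hpos
    simp [cellBary, cellSign, tau₁_center, tau₂_center] at this
    nlinarith
  have hnear : ∀ z : Plane, dist z A = r → tau₁ z + tau₂ z - ((m : ℕ) - (L : ℝ)) < 1 := by
    intro z hz
    by_contra! h
    have := hfar z (by nlinarith)
    linarith
  set U := vertex .long (i, j, b) 0 with hU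
  set O := vertex .long (i, j, b) 1 with hO
  set U' := vertex .long (i, j, b) 2 with hU'
  have hσ0 : reflect m U = U' := reflect_vertex hN hs 0
  have hσ1 : reflect m O = O := reflect_vertex hN hs 1
  have hσ2 : reflect m U' = U := reflect_vertex hN hs 2
  have hOfar : r < dist O A := by
    apply hfar
    rw [hO, tau₁_vertex, tau₂_vertex]
    apply le_of_eq
    cases b <;> simp [refVertex] <;> field_simp <;> linarith
  set M := (1 / 2 : ℝ) • U + (1 / 2 : ℝ) • U' with hM
  have hMfar : r < dist M A := by
    apply hfar
    rw [hM, hU, hU']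
    simp only [tau₁_add, tau₂_add, tau₁_smul, tau₂_smul, tau₁_vertex, tau₂_vertex]
    apply le_of_eq
    cases b <;> simp [refVertex] <;> field_simp <;> linarith
  have hint : ∀ z, dist z A = r → z ∈ interface L r := fun z hz => (mem_interface hr).2 ⟨(0, m), hz⟩
  have hint' : ∀ z, dist z A = r → reflect m z ∈ interface L r := fun z hz =>
    (mem_interface hr).2 ⟨(1, m), by
      have := dist_reflect m z 0
      rw [sub_zero] at this
      rw [Metric.mem_sphere, this, ← hA, hz]⟩
  -- Points of the circle about `A` and reflected points of that circle lie strictly on opposite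
  -- sides of the axis.
  have hne : ∀ z z', dist z A = r → dist z' A = r → z ≠ reflect m z' := by
    intro z z' hz hz' h
    have e1 := hnear z hz
    have e2 := hnear z' hz'
    rw [h] at e1
    simp [reflect] at e1
    linarith
  -- If the vertex 0 is inside the disc, the circle about `A` crosses the long edge before its
  -- midpoint, and the circle about `B` has the mirror crossing on the same open edge, which admits
  -- only one.
  by_cases hUr : dist U A < r
  · obtain ⟨s, hs0, hs1, hsr⟩ := exists_sphere_crossing_open hUr hMfar
    have hz := (hcut _ hK).2 0 2 (by decide)
    rw [half_comb] at hsr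
    set z := (1 - s / 2) • U + (s / 2) • U' with hzdef
    have hz1 : z ∈ openSegment ℝ U U' := ⟨1 - s / 2, s / 2, by linarith, by linarith, by ring, rfl⟩
    have hz2 : reflect m z ∈ openSegment ℝ U U' := by
      rw [hzdef, reflect_comb, hσ0, hσ2]
      exact ⟨s / 2, 1 - s / 2, by linarith, by linarith, by ring, by rw [add_comm]⟩
    exact hne z z hsr hsr (hz ⟨hint z hsr, hz1⟩ ⟨hint' z hsr, hz2⟩)
  · push Not at hUr
    -- If the vertex 0 is not inside the disc, the circle about `A` crosses an edge, or half an
    -- edge, twice. With one mirror image this makes three interface points on the boundary of the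
    -- element instead of two.
    have main : ∀ (V : Plane) (w : Plane) (s : ℝ), 0 ≤ s → s ≤ 1 → w = (1 - s) • U + s • V →
        dist w A < r → r < dist V A → segment ℝ U V ⊆ triBoundary .long (i, j, b) →
        (∀ z ∈ segment ℝ U V, reflect m z ∈ triBoundary .long (i, j, b)) → False := by
      intro V w s hs0 hs1 hw hwr hV hseg hseg'
      obtain ⟨z, hzs, z', hzs', hzz, ht, ht'⟩ := exists_two_crossings hs0 hs1 hw hwr hUr hV.le
      have hcard := (hcut _ hK).1
      have hfin : (interface L r ∩ triBoundary .long (i, j, b)).Finite :=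
        Set.finite_of_ncard_ne_zero (by rw [hcard]; norm_num)
      have hsub : ({z, z', reflect m z} : Set Plane) ⊆
          interface L r ∩ triBoundary .long (i, j, b) := by
        rintro p (rfl | rfl | rfl)
        · exact ⟨hint _ ht, hseg hzs⟩
        · exact ⟨hint _ ht', hseg hzs'⟩
        · exact ⟨hint' _ ht, hseg' _ hzs⟩
      have hle := Set.ncard_le_ncard hsub hfin
      rw [hcard, Set.ncard_eq_three.2 ⟨z, z', reflect m z, hzz, hne _ _ ht ht, hne _ _ ht' ht, rfl⟩]
        at hle
      omega
    obtain ⟨s, hs0, hs1, h | h⟩ := exists_edge_point hN hs hr hy hyb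
    · refine main O _ s hs0 hs1 rfl h hOfar (segment_subset_triBoundary _ _ (by decide)) ?_
      rintro z ⟨p, q, hp, hq, hpq, rfl⟩
      obtain rfl : p = 1 - q := by linarith
      rw [reflect_comb, hσ0, hσ1]
      exact segment_subset_triBoundary _ _ (show (2 : Fin 3) ≠ 1 by decide)
        (segment_comb hq (by linarith))
    · have hsegM : segment ℝ U M ⊆ segment ℝ U U' := by
        refine (convex_segment U U').segment_subset (left_mem_segment ℝ U U') ?_
        exact ⟨1 / 2, 1 / 2, by norm_num, by norm_num, by norm_num, rfl⟩
      refine main M _ s hs0 hs1 half_comb.symm h hMfar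
        (hsegM.trans (segment_subset_triBoundary _ _ (by decide))) ?_
      intro z hz
      obtain ⟨p, q, hp, hq, hpq, rfl⟩ := hsegM hz
      obtain rfl : p = 1 - q := by linarith
      rw [reflect_comb, hσ0, hσ2]
      exact segment_subset_triBoundary _ _ (show (2 : Fin 3) ≠ 0 by decide)
        (segment_comb hq (by linarith))

end Straddling

/-- No disc enters a straddling element. -/
lemma straddling_notMem {r : ℝ} (hr : r < Real.sqrt 3 / 6) (hN : 0 < N) {d : Diagonal}
    (hcut : CutAssumption L N d r) {K : Elem L N} (hs : IsStraddling d K)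
    (hK : K ∈ interfaceElems L N d r) {y : Plane} (hy : y ∈ tri d K) (c : Circles L) :
    r ≤ dist y (circleCenter c) := by
  obtain rfl := hs.1
  obtain ⟨i, j, b⟩ := K
  by_contra! hyb
  have h1 := cast_eq_cellIndex hN j
  have h2 := straddling_cast hs
  have hN' : (0 : ℝ) < N := by positivity
  have hbd := refBary_nonneg_bounds ((mem_tri hN).1 hy)
  set m := cellIndex hN j with hm
  have hj0 : (0 : ℝ) ≤ (((j : ℕ) % N : ℕ) : ℝ) := Nat.cast_nonneg _
  have hi0 : (0 : ℝ) ≤ ((i : ℕ) : ℝ) := Nat.cast_nonneg _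
  -- The point lies in one of the two half-cells of its cell, so only the discs about these two
  -- centres can contain it. The disc about `B` is reduced to the one about `A` by reflection.
  have hhalf : ∃ s : Fin 2, y ∈ halfCell ((s, m) : Circles L) := by
    rcases le_total (N * (tau₁ y + tau₂ y - ((m : ℕ) - (L : ℝ)))) N with h | h
    · refine ⟨0, fun a => (mul_nonneg_iff_of_pos_left hN').1 ?_⟩
      fin_cases a <;> simp [cellBary, cellSign, tau₁_center, tau₂_center] <;> simp at hbd <;> nlinarith
    · refine ⟨1, fun a => (mul_nonneg_iff_of_pos_left hN').1 ?_⟩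
      fin_cases a <;> simp [cellBary, cellSign, tau₁_center, tau₂_center] <;> simp at hbd <;> nlinarith
  obtain ⟨s, hsy⟩ := hhalf
  have hc := eq_of_mem_halfCell hsy (cellBary_pos hr (Metric.mem_closedBall.2 hyb.le))
  rw [← hc] at hyb
  have hs01 : s = 0 ∨ s = 1 := by fin_cases s <;> simp
  rcases hs01 with rfl | rfl
  · exact absurd (straddling_notMem_left hr hN hcut hs hK hy) (not_le.2 hyb)
  · have := straddling_notMem_left hr hN hcut hs hK (reflect_tri hN hs hy)
    have e := dist_reflect m y 1
    rw [sub_self] at e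
    rw [e] at this
    exact absurd this (not_le.2 hyb)

end

/-! ### The gap between the circles and the sides of the half-cells for long diagonals -/

section

variable {L N : ℕ}

set_option maxHeartbeats 1000000 in
/-- If the mesh is cut along the long diagonals, admissibility keeps the circles away from the
boundaries of the half-cells. -/
lemma gap_of_long {r : ℝ} (hr : r < Real.sqrt 3 / 6) (hL : 0 < L) (hN : 0 < N)
    (hcut : CutAssumption L N .long r) : r ≤ Real.sqrt 3 / 6 - meshSize N / 20 := by
  by_contra! hgap
  have hN' : (0 : ℝ) < N := by positivity
  have h3 := sqrt_three_sq
  have h30 := sqrt_three_pos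
  have h3a := sqrt_three_gt
  have h3b := sqrt_three_lt
  have hh0 := meshSize_pos hN
  have hh1 := meshSize_le_one hN
  set h := meshSize N with hh
  have hNh : (N : ℝ) * h = 1 := by rw [hh, meshSize_eq]; field_simp
  -- This is the square of the negated claim, with the term `(h / 20)²` dropped.
  have hr2 : (Real.sqrt 3 / 6) ^ 2 - Real.sqrt 3 / 60 * h < r ^ 2 := by
    have : (Real.sqrt 3 / 6 - h / 20) ^ 2 < r ^ 2 := by
      apply sq_lt_sq' <;> nlinarith
    nlinarith [sq_nonneg h]
  -- Here `y` is the offset of the centre of the rhombus from the midpoint of the common side of two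
  -- half-cells, measured along that side. If the gap fails, an element this close to the midpoint
  -- is entered by the disc about `A`, contrary to `straddling_notMem`.
  have key : ∀ (K : Elem L N) (y : ℝ), IsStraddling .long K → K.2.2 = false →
      N * (2 * y) = (K.1 : ℕ) - ((K.2.1 : ℕ) : ℝ) → ((K.2.1 : ℕ) < N) → y ^ 2 ≤ h / 8 → 
      (y = 0 ∨ h ≤ 1 / 2 ∧ y ^ 2 = h ^ 2 / 4) → False := by
    rintro ⟨i, j, b⟩ y hs hb hy hj hy2 hcase
    simp only at hb hy hj
    subst hb
    have hmod : (j : ℕ) % N = j := Nat.mod_eq_of_lt hj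
    have hsum : ((i : ℕ) : ℝ) + ((j : ℕ) : ℝ) + 1 = N := by
      have := straddling_cast hs
      rwa [hmod] at this
    set c : Circles L := (0, ⟨0, by omega⟩) with hc
    set δ := h / (2 * Real.sqrt 3) with hδ
    have hδ0 : 0 < δ := by positivity
    have hδs : δ * Real.sqrt 3 = h / 2 := by rw [hδ]; field_simp
    have hδ1 : N * δ ≤ 1 / 2 := by
      have : N * δ * Real.sqrt 3 = 1 / 2 := by rw [mul_assoc, hδs]; linarith
      nlinarith
    -- The vector `δ (v₁ + v₂)` has length `δ √3 = h / 2`. So `z` is the centre of the rhombus moved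
    -- by `h / 2` perpendicularly to the common side, and its squared distance to `A` is `(√3 / 6 -
    -- h / 2)² + y²`.
    set z : Plane := (1 / 2 + y - δ) • v₁ + (1 / 2 - y - δ - L) • v₂ with hz
    have hzt : z ∈ tri .long (i, j, false) := by
      rw [mem_tri hN]
      have e1 : N * tau₁ z - (i : ℕ) = 1 / 2 - N * δ := by
        rw [hz]; simp; linarith
      have e2 : N * (tau₂ z + L) - (j : ℕ) = 1 / 2 - N * δ := by
        rw [hz]; simp; linarith
      have hNδ : 0 < N * δ := by positivity
      intro a
      rw [bary, e1, e2]
      fin_cases a <;> simp [refBary] <;> linarith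
    have hzd : dist z (circleCenter c) < r := by
      have hr0 : 0 ≤ r := by nlinarith
      rw [dist_eq_norm, ← sq_lt_sq₀ (norm_nonneg _) hr0, norm_sq_tau]
      refine lt_of_le_of_lt (b := (Real.sqrt 3 / 6 - h / 2) ^ 2 + y ^ 2) (le_of_eq ?_)
        (lt_of_le_of_lt ?_ hr2)
      · simp only [tau₁_sub, tau₂_sub, tau₁_center, tau₂_center, hc, hz, tau₁_add, tau₂_add,
          tau₁_smul, tau₂_smul, tau₁_v₁, tau₁_v₂, tau₂_v₁, tau₂_v₂]
        simp
        have hδh : h = 2 * (δ * Real.sqrt 3) := by rw [hδs]; ring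
        rw [hδh]
        linear_combination (-(1 / 36) + δ / 3 - δ ^ 2) * h3
      · rcases hcase with rfl | ⟨hle, hy'⟩ <;> nlinarith
    have hv : r ≤ dist (vertex .long (i, j, false) 2) (circleCenter c) := by
      by_contra! hlt
      have hpos := cellBary_pos hr (Metric.mem_closedBall.2 hlt.le) 0
      have := mul_pos hN' hpos
      simp only [cellBary, cellSign, tau₁_sub, tau₂_sub, tau₁_center, tau₂_center, hc, tau₁_vertex,
        tau₂_vertex, refVertex] at this
      simp at this
      have e : (N : ℝ) * (3⁻¹ + (3⁻¹ - (((j : ℕ) : ℝ) + 1) / N + (3⁻¹ - (((i : ℕ) : ℝ) + 1) / N))) =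
        N - (((j : ℕ) : ℝ) + 1) - (((i : ℕ) : ℝ) + 1) := by field_simp; ring
      nlinarith
    obtain ⟨s, hs0, hs1, hsd⟩ := exists_sphere_crossing hzd hv
    have hK : ((i, j, false) : Elem L N) ∈ interfaceElems L N .long r := by
      classical
      simp only [interfaceElems, Finset.mem_filter, Finset.mem_univ, true_and]
      exact ⟨_, (mem_interface hr).2 ⟨c, hsd⟩,
        convex_tri _ _ hzt (vertex_mem_tri _ _ 2) (by linarith) hs0.le (by ring)⟩
    exact absurd (straddling_notMem hr hN hcut hs hK hzt c) (not_le.2 hzd)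
  -- For odd `N` a straddling rhombus is centred at the midpoint of the side. For even `N` the
  -- nearest ones are shifted by `h / 2` along the side.
  rcases Nat.even_or_odd N with ⟨n, hn⟩ | ⟨n, hn⟩
  · have hn1 : 1 ≤ n := by omega
    have hLN : N ≤ 2 * L * N := by nlinarith
    have hhalf : h ≤ 1 / 2 := by
      have : (2 : ℝ) ≤ N := by exact_mod_cast (by omega : 2 ≤ N)
      nlinarith
    refine key (⟨n, by omega⟩, ⟨n - 1, by omega⟩, false) (h / 2) ⟨rfl, ?_⟩ rfl ?_ ?_ ?_ ?_
    · simp only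
      rw [Nat.mod_eq_of_lt (by omega)]
      omega
    · simp only [Nat.cast_sub hn1]
      push_cast
      linarith
    · simp only; omega
    · nlinarith
    · exact Or.inr ⟨hhalf, by ring⟩
  · have hLN : N ≤ 2 * L * N := by nlinarith
    refine key (⟨n, by omega⟩, ⟨n, by omega⟩, false) 0 ⟨rfl, ?_⟩ rfl ?_ ?_ ?_ (Or.inl rfl)
    · simp only
      rw [Nat.mod_eq_of_lt (by omega)]
      omega
    · simp
    · simp only; omega
    · nlinarith

/-! ## Affine functions on cut elements -/

/-- A complex polynomial of degree at most one. -/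
def affFn (c : ℂ) (b : Fin 2 → ℂ) (x : Plane) : ℂ := c + ∑ j, b j * (x j : ℂ)

lemma continuous_affFn (c : ℂ) (b : Fin 2 → ℂ) : Continuous (affFn c b) := by
  unfold affFn
  fun_prop

lemma affFn_comb (c : ℂ) (b : Fin 2 → ℂ) {s t : ℝ} (hst : s + t = 1) (x y : Plane) :
    affFn c b (s • x + t • y) = s * affFn c b x + t * affFn c b y := by
  obtain rfl : s = 1 - t := by linarith
  simp [affFn, Fin.sum_univ_two]
  ring

/-- The homothety of ratio `1 / 2` about `x₀` maps the convex set into itself and scales areas by `1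
/ 4`. -/
lemma integral_half_homothety_le {T : Set Plane} (hT : Convex ℝ T) (hTm : MeasurableSet T)
    {x₀ : Plane} (hx₀ : x₀ ∈ T) {g : Plane → ℝ} (hg : IntegrableOn g T) (hg0 : ∀ x, 0 ≤ g x) :
    ∫ x in T, g ((1 / 2 : ℝ) • x₀ + (1 / 2 : ℝ) • x) ≤ 4 * ∫ x in T, g x := by
  set f : Plane → Plane := fun x => (1 / 2 : ℝ) • x₀ + (1 / 2 : ℝ) • x with hf
  have hd : ∀ x ∈ T, HasFDerivWithinAt f ((1 / 2 : ℝ) • ContinuousLinearMap.id ℝ Plane) T x := by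
    intro x _
    exact (((hasFDerivAt_id x).const_smul (1 / 2 : ℝ)).const_add _).hasFDerivWithinAt
  have hinj : Set.InjOn f T := by
    intro x _ y _ h
    simpa [hf] using h
  have h := integral_image_eq_integral_abs_det_fderiv_smul volume hTm hd hinj g
  have hdet : |((1 / 2 : ℝ) • ContinuousLinearMap.id ℝ Plane).det| = 1 / 4 := by
    rw [ContinuousLinearMap.det]
    simp [LinearMap.det_smul]
    norm_num
  simp only [hdet, smul_eq_mul] at h
  rw [integral_const_mul] at h
  have hsub : f '' T ⊆ T := by
    rintro _ ⟨x, hx, rfl⟩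
    exact hT hx₀ hx (by norm_num) (by norm_num) (by norm_num)
  have hle := setIntegral_mono_set hg (Eventually.of_forall hg0) hsub.eventuallyLE
  linarith

/-- An affine function satisfies `p(x₀) = 2 p(m) - p(x)`, where `m` is the midpoint of `x₀` and `x`.
Squaring and integrating over `x`, with `integral_half_homothety_le` for the values at `m`, gives
`34 = 8 * 4 + 2`. The shape of the set does not enter, which is why thin pieces are harmless. -/
lemma convex_affFn_sq_le {T : Set Plane} (hT : Convex ℝ T) (hTc : IsCompact T) {x₀ : Plane}
    (hx₀ : x₀ ∈ T) (c : ℂ) (b : Fin 2 → ℂ) :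
    (volume T).toReal * ‖affFn c b x₀‖ ^ 2 ≤ 34 * ∫ x in T, ‖affFn c b x‖ ^ 2 := by
  have hcont := continuous_affFn c b
  have hi1 : IntegrableOn (fun x => ‖affFn c b x‖ ^ 2) T :=
    (Continuous.continuousOn (by fun_prop)).integrableOn_compact hTc
  have hi2 : IntegrableOn (fun x => ‖affFn c b ((1 / 2 : ℝ) • x₀ + (1 / 2 : ℝ) • x)‖ ^ 2) T :=
    (Continuous.continuousOn (by fun_prop)).integrableOn_compact hTc
  have h1 := integral_half_homothety_le hT hTc.measurableSet hx₀ hi1 (fun x => by positivity)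
  have hpt : ∀ x, ‖affFn c b x₀‖ ^ 2 ≤
      8 * ‖affFn c b ((1 / 2 : ℝ) • x₀ + (1 / 2 : ℝ) • x)‖ ^ 2 + 2 * ‖affFn c b x‖ ^ 2 := by
    intro x
    have e : affFn c b x₀ = 2 * affFn c b ((1 / 2 : ℝ) • x₀ + (1 / 2 : ℝ) • x) - affFn c b x := by
      rw [affFn_comb _ _ (by norm_num)]; push_cast; ring
    have hn : ‖affFn c b x₀‖ ≤
        2 * ‖affFn c b ((1 / 2 : ℝ) • x₀ + (1 / 2 : ℝ) • x)‖ + ‖affFn c b x‖ := by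
      rw [e]; refine (norm_sub_le _ _).trans ?_
      rw [norm_mul]; simp
    nlinarith [norm_nonneg (affFn c b x₀), norm_nonneg (affFn c b x),
      sq_nonneg (2 * ‖affFn c b ((1 / 2 : ℝ) • x₀ + (1 / 2 : ℝ) • x)‖ - ‖affFn c b x‖)]
  have hm := setIntegral_mono_on (μ := volume) (s := T) (f := fun _ => ‖affFn c b x₀‖ ^ 2)
    (integrableOn_const hTc.measure_lt_top.ne) ((hi2.const_mul 8).add (hi1.const_mul 2))
    hTc.measurableSet (fun x _ => hpt x)
  simp only [Pi.add_apply] at hm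
  rw [integral_add (hi2.const_mul 8) (hi1.const_mul 2), integral_const_mul, integral_const_mul,
    setIntegral_const, smul_eq_mul, Measure.real] at hm
  linarith

/-- The constant in the local estimate for affine functions. -/
def affConst : ℝ := 10710340

/-- A set that is comparable to a convex subset. -/
lemma affFn_sq_le_of_convex_core {S T : Set Plane} (hT : Convex ℝ T) (hTc : IsCompact T)
    (hTS : T ⊆ S) (hSc : IsCompact S) {P : Plane} (hP : P ∈ T)
    (hcore : ∀ x ∈ S, (16 / 17 : ℝ) • P + (1 / 17 : ℝ) • x ∈ T) {x₀ : Plane} (hx₀ : x₀ ∈ S)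
    (c : ℂ) (b : Fin 2 → ℂ) :
    (volume S).toReal * ‖affFn c b x₀‖ ^ 2 ≤ affConst * ∫ x in S, ‖affFn c b x‖ ^ 2 := by
  have hcont := continuous_affFn c b
  have hi1 : IntegrableOn (fun x => ‖affFn c b x‖ ^ 2) S :=
    (Continuous.continuousOn (by fun_prop)).integrableOn_compact hSc
  set y := (16 / 17 : ℝ) • P + (1 / 17 : ℝ) • x₀ with hy
  have hyT : y ∈ T := hcore _ hx₀
  have hp := convex_affFn_sq_le hT hTc hP c b
  have hq := convex_affFn_sq_le hT hTc hyT c b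
  have hTI : ∫ x in T, ‖affFn c b x‖ ^ 2 ≤ ∫ x in S, ‖affFn c b x‖ ^ 2 :=
    setIntegral_mono_set hi1 (Eventually.of_forall fun x => by positivity) hTS.eventuallyLE
  -- The set `S` lies in the image of `T` under the homothety of ratio 17 about `P`, and `289 =
  -- 17²`.
  have hvol : (volume S).toReal ≤ 289 * (volume T).toReal := by
    have hsub : S ⊆ AffineMap.homothety P (17 : ℝ) '' T := by
      intro x hx
      refine ⟨_, hcore x hx, ?_⟩
      simp only [AffineMap.homothety_apply, vsub_eq_sub, vadd_eq_add]
      module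
    have h1 := measure_mono (μ := volume) hsub
    rw [Measure.addHaar_image_homothety] at h1
    have h2 := ENNReal.toReal_mono (ENNReal.mul_ne_top ENNReal.ofReal_ne_top
      hTc.measure_lt_top.ne) h1
    rw [ENNReal.toReal_mul, ENNReal.toReal_ofReal (abs_nonneg _)] at h2
    simp at h2
    norm_num at h2
    exact h2
  have hpt : ‖affFn c b x₀‖ ^ 2 ≤ 2 * (289 * ‖affFn c b y‖ ^ 2 + 256 * ‖affFn c b P‖ ^ 2) := by
    have e : affFn c b x₀ = 17 * affFn c b y - 16 * affFn c b P := by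
      rw [hy, affFn_comb _ _ (by norm_num)]; push_cast; ring
    have hn : ‖affFn c b x₀‖ ≤ 17 * ‖affFn c b y‖ + 16 * ‖affFn c b P‖ := by
      rw [e]; refine (norm_sub_le _ _).trans ?_
      rw [norm_mul, norm_mul]; simp
    nlinarith [norm_nonneg (affFn c b x₀), norm_nonneg (affFn c b y), norm_nonneg (affFn c b P),
      sq_nonneg (17 * ‖affFn c b y‖ - 16 * ‖affFn c b P‖)]
  have hTnn : 0 ≤ (volume T).toReal := ENNReal.toReal_nonneg
  calc (volume S).toReal * ‖affFn c b x₀‖ ^ 2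
      ≤ (289 * (volume T).toReal) *
        (2 * (289 * ‖affFn c b y‖ ^ 2 + 256 * ‖affFn c b P‖ ^ 2)) := by gcongr
    _ = 578 * (289 * ((volume T).toReal * ‖affFn c b y‖ ^ 2) +
          256 * ((volume T).toReal * ‖affFn c b P‖ ^ 2)) := by ring
    _ ≤ 578 * (289 * (34 * ∫ x in T, ‖affFn c b x‖ ^ 2) +
          256 * (34 * ∫ x in T, ‖affFn c b x‖ ^ 2)) := by gcongr
    -- The value of `affConst` is `578 * (289 + 256) * 34`.
    _ = affConst * ∫ x in T, ‖affFn c b x‖ ^ 2 := by rw [affConst]; ring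
    _ ≤ affConst * ∫ x in S, ‖affFn c b x‖ ^ 2 := by
        apply mul_le_mul_of_nonneg_left hTI; norm_num [affConst]

lemma convex_affFn_sq_le' {T : Set Plane} (hT : Convex ℝ T) (hTc : IsCompact T) {x₀ : Plane}
    (hx₀ : x₀ ∈ T) (c : ℂ) (b : Fin 2 → ℂ) :
    (volume T).toReal * ‖affFn c b x₀‖ ^ 2 ≤ affConst * ∫ x in T, ‖affFn c b x‖ ^ 2 := by
  refine (convex_affFn_sq_le hT hTc hx₀ c b).trans ?_
  apply mul_le_mul_of_nonneg_right _ (integral_nonneg fun x => by positivity)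
  norm_num [affConst]

/-! ### The power of a point with respect to a circle -/

/-- The power of the point `x` with respect to the circle about `c` of radius `r`. -/
def power (c : Plane) (r : ℝ) (x : Plane) : ℝ := ‖x - c‖ ^ 2 - r ^ 2

lemma power_nonneg_iff {c : Plane} {r : ℝ} (hr : 0 ≤ r) {x : Plane} :
    0 ≤ power c r x ↔ r ≤ dist x c := by
  rw [power, sub_nonneg, sq_le_sq₀ hr (norm_nonneg _), dist_eq_norm]

lemma power_pos_iff {c : Plane} {r : ℝ} (hr : 0 ≤ r) {x : Plane} :
    0 < power c r x ↔ r < dist x c := by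
  rw [power, sub_pos, sq_lt_sq₀ hr (norm_nonneg _), dist_eq_norm]

/-- The power is `‖x‖²` plus an affine function, so only the quadratic part deviates from
interpolation. In particular the power is convex, and its defect measures lengths of chords. -/
lemma power_comb (c : Plane) (r : ℝ) {s t : ℝ} (hst : s + t = 1) (x y : Plane) :
    power c r (s • x + t • y) = s * power c r x + t * power c r y - s * t * ‖x - y‖ ^ 2 := by
  obtain rfl : s = 1 - t := by linarith
  simp only [power, norm_sq_plane, PiLp.sub_apply, PiLp.add_apply, PiLp.smul_apply, smul_eq_mul]
  ring

/-- If `x` and `z` lie outside the disc and on the same side of it, their distance is controlled. -/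
lemma norm_sub_sq_le_of_midpoint {c : Plane} {r : ℝ} {x z : Plane}
    (h : 0 ≤ power c r ((1 / 2 : ℝ) • x + (1 / 2 : ℝ) • z)) :
    ‖x - z‖ ^ 2 ≤ 2 * (power c r x + power c r z) := by
  rw [power_comb c r (by norm_num)] at h
  linarith

/-- On the segment from `z` outside to `w` inside the disc, points outside are close to `z`. -/
lemma norm_sub_sq_le_of_ray {c : Plane} {r : ℝ} {z w x : Plane} (hw : power c r w ≤ 0)
    {s : ℝ} (hs0 : 0 ≤ s) (hs1 : s < 1) (hx : x = (1 - s) • z + s • w) (hpx : 0 ≤ power c r x) :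
    ‖x - z‖ ^ 2 ≤ 4 * power c r z := by
  have hxz : x - z = s • (w - z) := by rw [hx]; module
  have hn : ‖x - z‖ ^ 2 = s ^ 2 * ‖z - w‖ ^ 2 := by
    rw [hxz, norm_smul, mul_pow, Real.norm_eq_abs, sq_abs, norm_sub_rev]
  rw [hx, power_comb c r (by ring)] at hpx
  set D := ‖z - w‖ ^ 2 with hD
  have hD0 : 0 ≤ D := by positivity
  rw [hn]
  have h2 : s * D ≤ power c r z := by
    by_contra! hlt
    nlinarith
  have : 0 ≤ s * D := by positivity
  nlinarith

/-- If the coordinate vanished, a small move away from the vertex `a` would make it negative without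
leaving the element. -/
lemma bary_pos_of_mem_interior (hN : 0 < N) {d : Diagonal} {K : Elem L N} {x : Plane}
    (hx : x ∈ interior (tri d K)) (a : Fin 3) : 0 < bary d K a x := by
  have h0 := (mem_tri hN).1 (interior_subset hx) a
  refine lt_of_le_of_ne h0 fun h => ?_
  have hc : Continuous fun ε : ℝ => (1 + ε) • x + (-ε) • vertex d K a := by fun_prop
  have hmem : ∀ᶠ ε : ℝ in 𝓝 0, (1 + ε) • x + (-ε) • vertex d K a ∈ interior (tri d K) := by
    apply hc.continuousAt.eventually_mem
    simpa using isOpen_interior.mem_nhds hx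
  have hmem' : ∀ᶠ ε : ℝ in 𝓝[>] 0, (1 + ε) • x + (-ε) • vertex d K a ∈ interior (tri d K) :=
    nhdsWithin_le_nhds hmem
  obtain ⟨ε, hε, hε0⟩ := (hmem'.and self_mem_nhdsWithin).exists
  have h1 := (mem_tri hN).1 (interior_subset hε) a
  rw [bary_convexComb _ _ _ (by ring), bary_vertex hN, ← h] at h1
  simp at h1
  exact absurd h1 (not_le.2 hε0)

/-- The part of an element outside a disc is seen from one of its vertices at a distance that is
controlled by the power of that vertex. -/
lemma exists_core_vertex (hN : 0 < N) (d : Diagonal) (K : Elem L N) (c : Plane) (r : ℝ)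
    (hedge : ∀ a b : Fin 3, 0 < power c r (vertex d K a) → 0 < power c r (vertex d K b) →
      0 ≤ power c r ((1 / 2 : ℝ) • vertex d K a + (1 / 2 : ℝ) • vertex d K b)) :
    (∀ x ∈ tri d K, power c r x ≤ 0) ∨ ∃ P ∈ tri d K, 0 < power c r P ∧
      ∀ x, (∀ a, 0 < bary d K a x) → 0 ≤ power c r x → ‖x - P‖ ^ 2 ≤ 16 * power c r P := by
  -- `P` is the vertex of largest power. If its power is not positive, the whole element lies in the
  -- closed disc by convexity of the power.
  obtain ⟨a₀, ha₀⟩ := Finite.exists_max fun a => power c r (vertex d K a)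
  set P := vertex d K a₀ with hP
  have hconv : ∀ y z : Plane, ∀ M : ℝ, power c r y ≤ M → power c r z ≤ M → ∀ s t : ℝ, 0 ≤ s →
      0 ≤ t → s + t = 1 → power c r (s • y + t • z) ≤ M := by
    intro y z M hy hz s t hs ht hst
    rw [power_comb c r hst]
    have h1 : 0 ≤ s * t * ‖y - z‖ ^ 2 := by positivity
    have h2 := mul_le_mul_of_nonneg_left hy hs
    have h3 := mul_le_mul_of_nonneg_left hz ht
    have h4 : s * M + t * M = M := by rw [← add_mul, hst, one_mul]
    linarith
  rcases le_or_gt (power c r P) 0 with hP0 | hP0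
  · left
    intro x hx
    have hsub : tri d K ⊆ {x | power c r x ≤ 0} := by
      refine convexHull_min ?_ ?_
      · rintro _ ⟨a, rfl⟩
        exact (ha₀ a).trans hP0
      · intro y hy z hz s t hs ht hst
        exact hconv y z 0 hy hz s t hs ht hst
    exact hsub hx
  refine Or.inr ⟨P, vertex_mem_tri d K a₀, hP0, ?_⟩
  intro x hx hpx
  have hsum : ∀ (f : Fin 3 → Plane), ∑ a, f a = f a₀ + f (a₀ + 1) + f (a₀ + 2) := by
    intro f
    rw [Fin.sum_univ_three]
    fin_cases a₀ <;> simp <;> abel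
  have hsum' : ∀ (f : Fin 3 → ℝ), ∑ a, f a = f a₀ + f (a₀ + 1) + f (a₀ + 2) := by
    intro f
    rw [Fin.sum_univ_three]
    fin_cases a₀ <;> simp <;> ring
  have e := sum_bary_vertex hN d K x
  have e1 := bary_sum d K x
  rw [hsum] at e
  rw [hsum'] at e1
  have hb0 := hx a₀
  have hb1 := hx (a₀ + 1)
  have hb2 := hx (a₀ + 2)
  have hE1 := hedge a₀ (a₀ + 1) hP0
  have hE2 := hedge a₀ (a₀ + 2) hP0
  have hm1 := ha₀ (a₀ + 1)
  have hm2 := ha₀ (a₀ + 2)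
  rw [← hP] at e hE1 hE2
  set Q := vertex d K (a₀ + 1)
  set R := vertex d K (a₀ + 2)
  generalize bary d K a₀ x = β₀ at *
  generalize bary d K (a₀ + 1) x = β₁ at *
  generalize bary d K (a₀ + 2) x = β₂ at *
  have hdist : 0 < power c r Q → ‖Q - P‖ ^ 2 ≤ 4 * power c r P := by
    intro h
    rw [norm_sub_rev]
    linarith [norm_sub_sq_le_of_midpoint (hE1 h)]
  have hdist' : 0 < power c r R → ‖R - P‖ ^ 2 ≤ 4 * power c r P := by
    intro h
    rw [norm_sub_rev]
    linarith [norm_sub_sq_le_of_midpoint (hE2 h)]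
  -- Here `R` is not outside the disc and `Q` is close to `P`. With `z` on `PQ` and `x` on `zR`, the
  -- ray estimate gives `‖x - z‖² ≤ 4 power z ≤ 4 power P`. Together with `‖z - P‖² ≤ 4 power P`
  -- this gives the constant `16 = (2 + 2)²`.
  have mixed : ∀ (Q R : Plane) (β₁ β₂ : ℝ), 0 < β₁ → 0 < β₂ → β₀ + β₁ + β₂ = 1 →
      β₀ • P + β₁ • Q + β₂ • R = x → power c r Q ≤ power c r P → power c r R ≤ 0 →
      ‖Q - P‖ ^ 2 ≤ 4 * power c r P → ‖x - P‖ ^ 2 ≤ 16 * power c r P := by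
    intro Q R β₁ β₂ hb1 hb2 e1 e hQ hR hQP
    set z := (β₀ / (β₀ + β₁)) • P + (β₁ / (β₀ + β₁)) • Q with hz
    have hD : 0 < β₀ + β₁ := by linarith
    have hpz : power c r z ≤ power c r P := hconv P Q _ le_rfl hQ _ _ (by positivity)
      (by positivity) (by field_simp)
    have hxz : x = (1 - β₂) • z + β₂ • R := by
      rw [← e, hz, smul_add, smul_smul, smul_smul, show 1 - β₂ = β₀ + β₁ by linarith,
        mul_div_cancel₀ _ hD.ne', mul_div_cancel₀ _ hD.ne']
    have h1 := norm_sub_sq_le_of_ray hR hb2.le (by linarith) hxz hpx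
    have h2 : ‖z - P‖ ≤ ‖Q - P‖ := by
      have : z - P = (β₁ / (β₀ + β₁)) • (Q - P) := by
        have : β₀ / (β₀ + β₁) = 1 - β₁ / (β₀ + β₁) := by field_simp; ring
        rw [hz, this]; module
      rw [this, norm_smul, Real.norm_of_nonneg (by positivity)]
      apply mul_le_of_le_one_left (norm_nonneg _)
      rw [div_le_one hD]; linarith
    have h3 : ‖x - P‖ ≤ ‖x - z‖ + ‖z - P‖ := norm_sub_le_norm_sub_add_norm_sub x z P
    have h4 : ‖z - P‖ ^ 2 ≤ 4 * power c r P := by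
      refine le_trans ?_ hQP
      gcongr
    nlinarith [norm_nonneg (x - P), norm_nonneg (x - z), norm_nonneg (z - P),
      sq_nonneg (‖x - z‖ - ‖z - P‖)]
  -- The cases are: no other vertex outside the disc, exactly one, or both.
  rcases le_or_gt (power c r Q) 0 with hQ | hQ <;> rcases le_or_gt (power c r R) 0 with hR | hR
  · set w := (β₁ / (β₁ + β₂)) • Q + (β₂ / (β₁ + β₂)) • R with hw
    have hD : 0 < β₁ + β₂ := by linarith
    have hpw : power c r w ≤ 0 := hconv Q R _ hQ hR _ _ (by positivity)
      (by positivity) (by field_simp)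
    have hxw : x = (1 - (β₁ + β₂)) • P + (β₁ + β₂) • w := by
      rw [← e, hw, smul_add, smul_smul, smul_smul, show 1 - (β₁ + β₂) = β₀ by linarith,
        mul_div_cancel₀ _ hD.ne', mul_div_cancel₀ _ hD.ne', add_assoc]
    have := norm_sub_sq_le_of_ray hpw hD.le (by linarith) hxw hpx
    linarith
  · refine mixed R Q β₂ β₁ hb2 hb1 (by linarith) ?_ hm2 hQ (hdist' hR)
    rw [← e]; abel
  · exact mixed Q R β₁ β₂ hb1 hb2 e1 e hm1 hR (hdist hQ)
  · have hxP : x - P = β₁ • (Q - P) + β₂ • (R - P) := by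
      rw [← e, show β₀ = 1 - β₁ - β₂ by linarith]; module
    have h1 : ‖x - P‖ ≤ β₁ * ‖Q - P‖ + β₂ * ‖R - P‖ := by
      rw [hxP]
      refine (norm_add_le _ _).trans ?_
      rw [norm_smul, norm_smul, Real.norm_of_nonneg hb1.le, Real.norm_of_nonneg hb2.le]
    have h2 := hdist hQ
    have h3 := hdist' hR
    have h4 : β₁ * ‖Q - P‖ + β₂ * ‖R - P‖ ≤ ‖Q - P‖ + ‖R - P‖ := by
      nlinarith [norm_nonneg (Q - P), norm_nonneg (R - P)]
    nlinarith [norm_nonneg (x - P), norm_nonneg (Q - P), norm_nonneg (R - P),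
      sq_nonneg (‖Q - P‖ - ‖R - P‖)]

/-- On the half-plane `2 ⟪y - P, c - P⟫ ≤ power P` this identity yields `power y ≥ ‖y - P‖² ≥ 0`.
The half-plane therefore avoids the open disc, and it cuts a convex core containing `P` out of the
exterior. -/
lemma power_eq_inner (c : Plane) (r : ℝ) (P y : Plane) :
    power c r y = ‖y - P‖ ^ 2 - 2 * inner ℝ (y - P) (c - P) + power c r P := by
  have h : y - c = (y - P) - (c - P) := by abel
  rw [power, power, h, norm_sub_sq_real, norm_sub_rev P c]
  ring

/-! ### The inverse estimate on the two pieces of an interface element -/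

lemma affConst_pos : 0 < affConst := by norm_num [affConst]

/-- The local estimate on the part of an element outside a disc. -/
lemma affFn_sq_le_outside (hN : 0 < N) (d : Diagonal) (K : Elem L N) (c : Plane) {r : ℝ}
    (hr : 0 ≤ r)
    (hedge : ∀ a b : Fin 3, 0 < power c r (vertex d K a) → 0 < power c r (vertex d K b) →
      0 ≤ power c r ((1 / 2 : ℝ) • vertex d K a + (1 / 2 : ℝ) • vertex d K b))
    {x₀ : Plane} (hx₀ : x₀ ∈ interior (tri d K)) (hx₀' : r ≤ dist x₀ c) (k : ℂ) (b : Fin 2 → ℂ) :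
    (volume (tri d K \ Metric.ball c r)).toReal * ‖affFn k b x₀‖ ^ 2 ≤
      affConst * ∫ x in tri d K \ Metric.ball c r, ‖affFn k b x‖ ^ 2 := by
  have hcont := continuous_affFn k b
  have hSc : IsCompact (tri d K \ Metric.ball c r) := (isCompact_tri d K).diff Metric.isOpen_ball
  set S := tri d K \ Metric.ball c r with hS
  have hmemS : ∀ x, x ∈ S ↔ x ∈ tri d K ∧ 0 ≤ power c r x := by
    intro x
    rw [hS, Set.mem_sdiff, Metric.mem_ball, not_lt, power_nonneg_iff hr]
  rcases exists_core_vertex hN d K c r hedge with h | ⟨P, hPK, hP0, hP⟩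
  · have hsub : S ⊆ Metric.sphere c r := by
      intro x hx
      have h1 := h x ((hmemS x).1 hx).1
      have h2 := ((hmemS x).1 hx).2
      have h3 : ‖x - c‖ ^ 2 = r ^ 2 := by rw [power] at h1 h2; linarith
      rw [Metric.mem_sphere, dist_eq_norm]
      exact (sq_eq_sq₀ (norm_nonneg _) hr).1 h3
    have h0 : volume S = 0 := measure_mono_null hsub (Measure.addHaar_sphere _ c r)
    rw [h0, ENNReal.toReal_zero, zero_mul]
    exact mul_nonneg affConst_pos.le (integral_nonneg fun x => by positivity)
  -- The distance bound is only known at interior points of the element, so it is built into the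
  -- set. This changes `S` by a null set.
  · set S' := S ∩ {x | ‖x - P‖ ^ 2 ≤ 16 * power c r P} with hS'
    have hS'c : IsCompact S' := hSc.inter_right (isClosed_le (by fun_prop) continuous_const)
    have hS'S : S' ⊆ S := Set.inter_subset_left
    have hae : S' =ᵐ[volume] S := by
      filter_upwards [ae_interior_tri d K] with x hx
      apply propext
      refine ⟨fun h => hS'S h, fun h => ⟨h, ?_⟩⟩
      have hxS := (hmemS x).1 h
      exact hP x (bary_pos_of_mem_interior hN (hx hxS.1)) hxS.2
    -- The convex core: the part of the element in the half-plane of `power_eq_inner`.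
    set T := tri d K ∩ {y | 2 * inner ℝ (y - P) (c - P) ≤ power c r P} with hT
    have hTconv : Convex ℝ T := by
      refine (convex_tri d K).inter ?_
      intro y hy z hz s t hs ht hst
      simp only [Set.mem_ofPred_eq] at hy hz ⊢
      have e : s • y + t • z - P = s • (y - P) + t • (z - P) := by
        have : P = s • P + t • P := by rw [← add_smul, hst, one_smul]
        nth_rewrite 1 [this]; module
      rw [e, inner_add_left, real_inner_smul_left, real_inner_smul_left]
      have h1 := mul_le_mul_of_nonneg_left hy hs
      have h2 := mul_le_mul_of_nonneg_left hz ht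
      have h3 : s * power c r P + t * power c r P = power c r P := by rw [← add_mul, hst, one_mul]
      linarith
    have hTc : IsCompact T :=
      (isCompact_tri d K).inter_right (isClosed_le (by fun_prop) continuous_const)
    have hPT : P ∈ T := ⟨hPK, by simp [hP0.le]⟩
    -- For `x` outside the disc with `‖x - P‖² ≤ 16 power P` one has `2 ⟪x - P, c - P⟫ ≤ 17 power
    -- P`, so contraction to `P` by the factor `1 / 17` leads into the half-plane.
    have hcore : ∀ x ∈ S', (16 / 17 : ℝ) • P + (1 / 17 : ℝ) • x ∈ T := by
      rintro x ⟨hxS, hx⟩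
      have hxS' := (hmemS x).1 hxS
      refine ⟨convex_tri d K hPK hxS'.1 (by norm_num) (by norm_num) (by norm_num), ?_⟩
      simp only [Set.mem_ofPred_eq] at hx ⊢
      have e : (16 / 17 : ℝ) • P + (1 / 17 : ℝ) • x - P = (1 / 17 : ℝ) • (x - P) := by module
      rw [e, real_inner_smul_left]
      have := power_eq_inner c r P x
      linarith [hxS'.2]
    have hTS : T ∩ Metric.closedBall P (Real.sqrt (16 * power c r P)) ⊆ S' := by
      rintro y ⟨⟨hyK, hy⟩, hyb⟩
      simp only [Set.mem_ofPred_eq] at hy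
      refine ⟨(hmemS y).2 ⟨hyK, ?_⟩, ?_⟩
      · have := power_eq_inner c r P y
        linarith [sq_nonneg ‖y - P‖]
      · rw [Metric.mem_closedBall, dist_eq_norm] at hyb
        simp only [Set.mem_ofPred_eq]
        rw [← Real.sq_sqrt (show 0 ≤ 16 * power c r P by positivity)]
        gcongr
    have hx₀S : x₀ ∈ S' := by
      refine ⟨(hmemS x₀).2 ⟨interior_subset hx₀, (power_nonneg_iff hr).2 hx₀'⟩, ?_⟩
      exact hP x₀ (bary_pos_of_mem_interior hN hx₀) ((power_nonneg_iff hr).2 hx₀')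
    have main := affFn_sq_le_of_convex_core (S := S')
      (hTconv.inter (convex_closedBall P (Real.sqrt (16 * power c r P))))
      (hTc.inter_right Metric.isClosed_closedBall) hTS hS'c
      (P := P) ⟨hPT, Metric.mem_closedBall_self (Real.sqrt_nonneg _)⟩ ?_ hx₀S k b
    · rw [measure_congr hae, setIntegral_congr_set hae] at main
      exact main
    · intro x hx
      refine ⟨hcore x hx, ?_⟩
      have hx2 : ‖x - P‖ ^ 2 ≤ 16 * power c r P := hx.2
      rw [Metric.mem_closedBall, dist_eq_norm]
      apply Real.le_sqrt_of_sq_le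
      have e : (16 / 17 : ℝ) • P + (1 / 17 : ℝ) • x - P = (1 / 17 : ℝ) • (x - P) := by module
      rw [e, norm_smul, mul_pow, Real.norm_of_nonneg (by norm_num)]
      nlinarith [sq_nonneg ‖x - P‖]

/-- The parts of an element on the two sides of the interface. -/
def cutPart (d : Diagonal) (r : ℝ) (K : Elem L N) (i : Fin 2) : Set Plane :=
  tri d K ∩ subdomain L r i

/-- The other discs lie in the interiors of other half-cells and do not reach the element, so the
pieces are described by a single disc. -/
lemma cutPart_eq_of_subset {r : ℝ} (hr : r < Real.sqrt 3 / 6) {d : Diagonal} {K : Elem L N}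
    (hN : 0 < N) {c : Circles L} (hc : tri d K ⊆ halfCell c) :
    cutPart d r K 0 = tri d K ∩ Metric.closedBall (circleCenter c) r ∧
      cutPart d r K 1 = tri d K \ Metric.ball (circleCenter c) r := by
  have huniq : ∀ x ∈ tri d K, ∀ c' : Circles L, x ∈ Metric.closedBall (circleCenter c') r →
      c' = c := fun x hx c' h => (eq_of_mem_halfCell (hc hx) (cellBary_pos hr h)).symm
  constructor
  · ext x
    simp only [cutPart, Set.mem_inter_iff, mem_subdomain_zero hr]
    refine and_congr_right fun hx => ⟨?_, fun h => ⟨c, h⟩⟩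
    rintro ⟨c', h⟩
    rwa [huniq x hx c' h] at h
  · ext x
    simp only [cutPart, Set.mem_inter_iff, mem_subdomain_one hr, Set.mem_sdiff]
    refine and_congr_right fun hx => ⟨fun h => h.2 c, fun h => ⟨tri_subset_cylinder hN d K hx, ?_⟩⟩
    intro c' h'
    rw [huniq x hx c' (Metric.ball_subset_closedBall h')] at h'
    exact h h'

/-- The local inverse estimate: on both sides of the interface the values of an affine function are
bounded by its mean. -/
theorem cut_affFn_sq_le {r : ℝ} (hr0 : 0 ≤ r) (hr : r < Real.sqrt 3 / 6) (hN : 0 < N)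
    {d : Diagonal} (hcut : CutAssumption L N d r) {K : Elem L N} (hK : K ∈ interfaceElems L N d r)
    {x₀ : Plane} (hx₀ : x₀ ∈ interior (tri d K)) (hx₀' : x₀ ∈ interface L r) (i : Fin 2)
    (k : ℂ) (b : Fin 2 → ℂ) :
    cutArea d r K i * ‖affFn k b x₀‖ ^ 2 ≤
      affConst * ∫ x in cutPart d r K i, ‖affFn k b x‖ ^ 2 := by
  change (volume (cutPart d r K i)).toReal * _ ≤ _
  have hnn : 0 ≤ affConst * ∫ x in cutPart d r K i, ‖affFn k b x‖ ^ 2 :=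
    mul_nonneg affConst_pos.le (integral_nonneg fun x => by positivity)
  have hxK := interior_subset hx₀
  rcases subset_halfCell_or_straddling hN d K with ⟨c, hc⟩ | hs
  · obtain ⟨e0, e1⟩ := cutPart_eq_of_subset hr hN hc
    obtain ⟨c', hc'⟩ := (mem_interface hr).1 hx₀'
    have hcc : c = c' := eq_of_mem_halfCell (hc hxK)
      (cellBary_pos hr (Metric.sphere_subset_closedBall hc'))
    subst hcc
    fin_cases i
    · simp only [Fin.zero_eta]
      rw [e0]
      exact convex_affFn_sq_le' ((convex_tri d K).inter (convex_closedBall _ _))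
        ((isCompact_tri d K).inter_right Metric.isClosed_closedBall)
        ⟨hxK, Metric.sphere_subset_closedBall hc'⟩ k b
    · simp only [Fin.mk_one]
      rw [e1]
      refine affFn_sq_le_outside hN d K _ hr0 ?_ hx₀ (le_of_eq (Metric.mem_sphere.1 hc').symm) k b
      intro a a' ha ha'
      rw [power_nonneg_iff hr0]
      exact dist_midpoint_ge hr hcut hK c ((power_pos_iff hr0).1 ha) ((power_pos_iff hr0).1 ha')
  -- Discs can only touch a straddling interface element. Its part in the inclusions is contained in
  -- circles, hence null, and its part in the background is the whole element.
  · have hout := fun y hy c => straddling_notMem hr hN hcut hs hK (y := y) hy c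
    fin_cases i
    · simp only [Fin.zero_eta] at hnn ⊢
      have h0 : volume (cutPart d r K 0) = 0 := by
        refine measure_mono_null (t := ⋃ c : Circles L, Metric.sphere (circleCenter c) r) ?_ ?_
        · rintro x ⟨hxK, hx⟩
          obtain ⟨c, hc⟩ := (mem_subdomain_zero hr).1 hx
          exact Set.mem_iUnion.2 ⟨c, le_antisymm hc (hout x hxK c)⟩
        · exact measure_iUnion_null fun c => Measure.addHaar_sphere _ _ _
      rw [h0, ENNReal.toReal_zero, zero_mul]
      exact hnn
    · simp only [Fin.mk_one]
      have h1 : cutPart d r K 1 = tri d K := by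
        refine Set.inter_eq_left.2 fun x hx => (mem_subdomain_one hr).2
          ⟨tri_subset_cylinder hN d K hx, fun c h => ?_⟩
        exact absurd (hout x hx c) (not_le.2 h)
      rw [h1]
      exact convex_affFn_sq_le' (convex_tri d K) (isCompact_tri d K) hxK k b

end

section

variable {L N : ℕ}

/-! ## The material weight -/

lemma inner_k₂_v₁ : inner ℝ k₂ v₁ = 0 := by
  simp [k₂, v₁, PiLp.inner_apply, Fin.sum_univ_two, inner_smul_left]
  ring

/-- The vector `k₂` is orthogonal to `v₁`, so the Faraday rotation is constant along `v₁`. This is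
what transfers ellipticity to the one-sided trace of the permittivity on the circles. -/
lemma gamma_add_smul (M : Medium) (x : Plane) (t : ℝ) : M.gamma (x + t • v₁) = M.gamma x := by
  rw [Medium.gamma, Medium.gamma, inner_add_right, inner_smul_right, inner_k₂_v₁, mul_zero,
    add_zero]

/-- From a point of a circle one reaches the background along the first lattice direction. -/
lemma exists_background_point {r : ℝ} (hr0 : 0 ≤ r) (hr : r < Real.sqrt 3 / 6) {c : Circles L}
    {x : Plane} (hx : dist x (circleCenter c) = r) :
    ∃ t : ℝ, x + t • v₁ ∉ discs 0 r ∧ x + t • v₁ ∉ discs 1 r := by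
  obtain ⟨σ, hσ, hin⟩ : ∃ σ : ℝ, σ ^ 2 = 1 ∧ 0 ≤ σ * inner ℝ (x - circleCenter c) v₁ := by
    rcases le_total 0 (inner ℝ (x - circleCenter c) v₁) with h | h
    · exact ⟨1, by norm_num, by linarith⟩
    · exact ⟨-1, by norm_num, by linarith⟩
  have hcell : ∀ᶠ t : ℝ in 𝓝[>] 0, ∀ a, 0 < cellBary c a (x + (σ * t) • v₁) := by
    rw [eventually_all]
    intro a
    have hcont : Continuous fun t : ℝ => cellBary c a (x + (σ * t) • v₁) := by
      have h1 := continuous_tau₁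
      have h2 := continuous_tau₂
      unfold cellBary
      fin_cases a <;> simp <;> fun_prop
    have h0 : 0 < cellBary c a (x + (σ * 0) • v₁) := by
      simpa using cellBary_pos hr (Metric.mem_closedBall.2 hx.le) a
    exact nhdsWithin_le_nhds (hcont.continuousAt.eventually (lt_mem_nhds h0))
  obtain ⟨t, hcell, ht⟩ := (hcell.and self_mem_nhdsWithin).exists
  have ht0 : (0 : ℝ) < t := ht
  set y := x + (σ * t) • v₁ with hy
  have hyc : y ∈ halfCell c := fun a => (hcell a).le
  have hyd : r < dist y (circleCenter c) := by
    rw [dist_eq_norm, ← sq_lt_sq₀ hr0 (norm_nonneg _), ← hx, dist_eq_norm]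
    have e : y - circleCenter c = (x - circleCenter c) + (σ * t) • v₁ := by rw [hy]; abel
    rw [e, norm_add_sq_real, inner_smul_right, norm_smul, norm_v₁, mul_one, Real.norm_eq_abs, sq_abs]
    have : 0 ≤ t * (σ * inner ℝ (x - circleCenter c) v₁) := mul_nonneg ht0.le hin
    have : (σ * t) ^ 2 = t ^ 2 := by rw [mul_pow, hσ, one_mul]
    nlinarith [sq_pos_of_pos ht0]
  have hno : ∀ s, y ∉ discs s r := by
    intro s hs
    obtain ⟨c', -, hc'⟩ := exists_circle_of_mem_discs hr (halfCell_subset_cylinder c hyc) hs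
    have := eq_of_mem_halfCell hyc (cellBary_pos hr hc')
    subst this
    exact absurd hc' (by simpa using hyd)
  exact ⟨σ * t, hno 0, hno 1⟩

/-- On a circle `eps` has the value of the inclusion, so the condition for the background trace
cannot be read off at the point itself. It is taken from a background point reached along `v₁`,
where the Faraday rotation is the same. -/
lemma epsSide_elliptic {M : Medium} {r c₀ : ℝ} (hr0 : 0 ≤ r) (hr : r < Real.sqrt 3 / 6)
    (hM : M.Elliptic r c₀) {i : Fin 2} {x : Plane} (hx : x ∈ subdomain L r i) :
    c₀ < M.epsSide r i x ^ 2 - M.gamma x ^ 2 := by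
  classical
  fin_cases i
  · simp only [subdomain, Fin.zero_eta, if_true] at hx
    have h := hM x
    simp only [Medium.eps] at h
    simp only [Medium.epsSide, Fin.zero_eta, if_true]
    by_cases h0 : x ∈ discs 0 r
    · simpa [h0] using h
    · have h1 : x ∈ discs 1 r := hx.2.resolve_left h0
      simpa [h0, h1] using h
  · simp only [Medium.epsSide, Fin.mk_one, one_ne_zero, if_false]
    have hx1 := (mem_subdomain_one hr).1 hx
    by_cases hc : ∃ c : Circles L, dist x (circleCenter c) = r
    · obtain ⟨c, hc⟩ := hc
      obtain ⟨t, h0, h1⟩ := exists_background_point hr0 hr hc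
      have h := hM (x + t • v₁)
      rw [gamma_add_smul] at h
      simpa [Medium.eps, h0, h1] using h
    · have hno : ∀ s, x ∉ discs s r := by
        intro s hs
        obtain ⟨c, -, hc'⟩ := exists_circle_of_mem_discs hr hx1.1 hs
        have h2 := hx1.2 c
        rw [Metric.mem_ball, not_lt] at h2
        exact hc ⟨c, le_antisymm hc' h2⟩
      have h := hM x
      simpa [Medium.eps, hno 0, hno 1] using h

/-- The common shape of the weights. -/
def hermWeight (p q : ℝ) : Matrix (Fin 2) (Fin 2) ℂ :=
  !![(p : ℂ), -(Complex.I * q); Complex.I * q, (p : ℂ)]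

/-- The eigenvalues are `p ± q`. For the exact inverse they are `1 / (ε ∓ γ)`. For the first order
form they are `(ε ± γ) / ε²`, and `ε - |γ| = (ε² - γ²) / (ε + |γ|)` turns ellipticity into the lower
bound. -/
lemma weightMatrix_eq (form : WeightForm) {e g c₀ e₀ e₁ : ℝ} (hc₀ : 0 < c₀) (he₀ : 0 < e₀)
    (h0 : e₀ ≤ e) (h1 : e ≤ e₁) (hell : c₀ < e ^ 2 - g ^ 2) :
    ∃ p q : ℝ, Medium.weightMatrix form e g = hermWeight p q ∧
      min (1 / (2 * e₁)) (c₀ / (2 * e₁ ^ 3)) ≤ p - |q| ∧ p + |q| ≤ max (2 * e₁ / c₀) (2 / e₀) := by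
  have he : 0 < e := by linarith
  have he₁ : 0 < e₁ := by linarith
  have hD : 0 < e ^ 2 - g ^ 2 := by linarith
  have hg : |g| < e := abs_lt_of_sq_lt_sq (by linarith) he.le
  have hgs : e ^ 2 - g ^ 2 = (e - |g|) * (e + |g|) := by
    rw [← sq_abs g]; ring
  have hg0 := abs_nonneg g
  have hDC : ((e : ℂ) ^ 2 - (g : ℂ) ^ 2) ≠ 0 := by exact_mod_cast hD.ne'
  have heC : (e : ℂ) ≠ 0 := by exact_mod_cast he.ne'
  have hI := Complex.I_sq
  cases form
  · refine ⟨e / (e ^ 2 - g ^ 2), g / (e ^ 2 - g ^ 2), ?_, ?_, ?_⟩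
    · refine Matrix.inv_eq_left_inv ?_
      ext a b
      fin_cases a <;> fin_cases b <;>
        simp [hermWeight, Matrix.mul_apply, Fin.sum_univ_two] <;> field_simp <;>
        first
          | ring1
          | (rw [hI]; ring1)
    · refine (min_le_left _ _).trans ?_
      rw [abs_div, abs_of_pos hD, ← sub_div, hgs, div_mul_cancel_left₀ (by linarith), ← one_div]
      apply one_div_le_one_div_of_le <;> linarith
    · refine le_trans ?_ (le_max_left _ _)
      rw [abs_div, abs_of_pos hD, ← add_div]
      gcongr <;> linarith
  · refine ⟨1 / e, g / e ^ 2, ?_, ?_, ?_⟩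
    · ext a b
      fin_cases a <;> fin_cases b <;>
        simp [hermWeight, Medium.weightMatrix] <;> field_simp
    · refine (min_le_right _ _).trans ?_
      rw [abs_div, abs_of_pos (by positivity : 0 < e ^ 2)]
      have e1 : 1 / e - |g| / e ^ 2 = (e ^ 2 - g ^ 2) / (e ^ 2 * (e + |g|)) := by
        rw [hgs]; field_simp
      have hden : e ^ 2 * (e + |g|) ≤ 2 * e₁ ^ 3 :=
        calc e ^ 2 * (e + |g|) ≤ e₁ ^ 2 * (e₁ + e₁) := by gcongr; linarith
          _ = 2 * e₁ ^ 3 := by ring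
      rw [e1]
      exact div_le_div₀ hD.le hell.le (by positivity) hden
    · refine le_trans ?_ (le_max_right _ _)
      rw [abs_div, abs_of_pos (by positivity : 0 < e ^ 2)]
      have e1 : 1 / e + |g| / e ^ 2 = (e + |g|) / e ^ 2 := by field_simp
      rw [e1, div_le_div_iff₀ (by positivity) he₀]
      nlinarith

/-- The off-diagonal entries contribute `-2 q Im (z₀ z̄₁)`, which is real and bounded by `|q| ‖z‖²`.
-/
lemma hermWeight_form (p q : ℝ) (z : Fin 2 → ℂ) :
    (∑ j, (hermWeight p q).mulVec z j * star (z j)).im = 0 ∧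
      (p - |q|) * ∑ j, ‖z j‖ ^ 2 ≤ (∑ j, (hermWeight p q).mulVec z j * star (z j)).re := by
  have e : ∑ j, (hermWeight p q).mulVec z j * star (z j) =
      ((p * (‖z 0‖ ^ 2 + ‖z 1‖ ^ 2) - 2 * q * (z 0 * star (z 1)).im : ℝ) : ℂ) := by
    simp only [Complex.sq_norm, Complex.normSq_apply]
    apply Complex.ext <;>
      simp [hermWeight, Matrix.mulVec, dotProduct, Fin.sum_univ_two] <;> ring
  rw [e]
  refine ⟨Complex.ofReal_im _, ?_⟩
  rw [Complex.ofReal_re, Fin.sum_univ_two]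
  have h1 : |(z 0 * star (z 1)).im| ≤ ‖z 0‖ * ‖z 1‖ := by
    refine (Complex.abs_im_le_norm _).trans ?_
    rw [norm_mul, norm_star]
  have h2 : q * (z 0 * star (z 1)).im ≤ |q| * (‖z 0‖ * ‖z 1‖) := by
    refine (le_abs_self _).trans ?_
    rw [abs_mul]
    gcongr
  nlinarith [abs_nonneg q, sq_nonneg (‖z 0‖ - ‖z 1‖)]

lemma hermWeight_norm_le (p q : ℝ) (hp : 0 ≤ p) (z : Fin 2 → ℂ) :
    ∑ j, ‖(hermWeight p q).mulVec z j‖ ^ 2 ≤ (p + |q|) ^ 2 * ∑ j, ‖z j‖ ^ 2 := by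
  have h0 : ‖(hermWeight p q).mulVec z 0‖ ≤ p * ‖z 0‖ + |q| * ‖z 1‖ := by
    simp only [hermWeight, Matrix.mulVec, dotProduct, Fin.sum_univ_two]
    refine (norm_add_le _ _).trans ?_
    simp [abs_of_nonneg hp]
  have h1 : ‖(hermWeight p q).mulVec z 1‖ ≤ |q| * ‖z 0‖ + p * ‖z 1‖ := by
    simp only [hermWeight, Matrix.mulVec, dotProduct, Fin.sum_univ_two]
    refine (norm_add_le _ _).trans ?_
    simp [abs_of_nonneg hp]
  rw [Fin.sum_univ_two, Fin.sum_univ_two]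
  have h0' := pow_le_pow_left₀ (norm_nonneg _) h0 2
  have h1' := pow_le_pow_left₀ (norm_nonneg _) h1 2
  have hpq : 0 ≤ p * |q| := mul_nonneg hp (abs_nonneg q)
  nlinarith [mul_nonneg hpq (sq_nonneg (‖z 0‖ - ‖z 1‖))]

lemma norm_mulVec_le (A : Matrix (Fin 2) (Fin 2) ℂ) (z : Fin 2 → ℂ) :
    ∑ j, ‖A.mulVec z j‖ ^ 2 ≤
      ‖Matrix.toEuclideanCLM (n := Fin 2) (𝕜 := ℂ) A‖ ^ 2 * ∑ j, ‖z j‖ ^ 2 := by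
  have h := (Matrix.toEuclideanCLM (n := Fin 2) (𝕜 := ℂ) A).le_opNorm (WithLp.toLp 2 z)
  rw [Matrix.toEuclideanCLM_toLp] at h
  have h2 := pow_le_pow_left₀ (norm_nonneg _) h 2
  rwa [mul_pow, EuclideanSpace.norm_sq_eq, EuclideanSpace.norm_sq_eq] at h2

lemma opNorm_le_of_mulVec (A : Matrix (Fin 2) (Fin 2) ℂ) {w : ℝ} (hw : 0 ≤ w)
    (h : ∀ z : Fin 2 → ℂ, ∑ j, ‖A.mulVec z j‖ ^ 2 ≤ w ^ 2 * ∑ j, ‖z j‖ ^ 2) :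
    ‖Matrix.toEuclideanCLM (n := Fin 2) (𝕜 := ℂ) A‖ ≤ w := by
  refine ContinuousLinearMap.opNorm_le_bound _ hw fun x => ?_
  rw [← sq_le_sq₀ (norm_nonneg _) (by positivity), mul_pow, EuclideanSpace.norm_sq_eq,
    EuclideanSpace.norm_sq_eq]
  exact h (WithLp.ofLp x)

/-- Uniform bounds for the weights. -/
structure WeightBounds (M : Medium) (L : ℕ) (r wmin wmax : ℝ) : Prop where
  form_im : ∀ i, ∀ x ∈ subdomain L r i, ∀ z : Fin 2 → ℂ,
    (∑ j, (M.W r i x).mulVec z j * star (z j)).im = 0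
  form_re : ∀ i, ∀ x ∈ subdomain L r i, ∀ z : Fin 2 → ℂ,
    wmin * ∑ j, ‖z j‖ ^ 2 ≤ (∑ j, (M.W r i x).mulVec z j * star (z j)).re
  mulVec_le : ∀ i, ∀ x ∈ subdomain L r i, ∀ z : Fin 2 → ℂ,
    ∑ j, ‖(M.W r i x).mulVec z j‖ ^ 2 ≤ M.supW L r i ^ 2 * ∑ j, ‖z j‖ ^ 2
  le_supW : ∀ i, wmin ≤ M.supW L r i
  supW_le : ∀ i, M.supW L r i ≤ wmax

lemma subdomain_nonempty {r : ℝ} (hL : 0 < L) (hr0 : 0 ≤ r) (hr : r < Real.sqrt 3 / 6)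
    (i : Fin 2) : (subdomain L r i).Nonempty :=
  ⟨circlePoint r ((0, ⟨0, by omega⟩) : Circles L) 0, circlePoint_mem_subdomain hr0 hr _ _ i⟩

/-- The bounds depend only on the extreme permittivities and on `c₀`. This is where uniformity in
the radius enters for the coefficients. -/
theorem exists_weightBounds (M : Medium) {c₀ : ℝ} (hc₀ : 0 < c₀) (hL : 0 < L) :
    ∃ wmin wmax : ℝ, 0 < wmin ∧ 0 < wmax ∧ ∀ r : ℝ, 0 ≤ r → r < Real.sqrt 3 / 6 →
      M.Elliptic r c₀ → WeightBounds M L r wmin wmax := by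
  classical
  set e₀ := min M.epsA (min M.epsB M.eps0) with he₀
  set e₁ := max M.epsA (max M.epsB M.eps0) with he₁
  have h0 : 0 < e₀ := lt_min M.epsA_pos (lt_min M.epsB_pos M.eps0_pos)
  have h1 : 0 < e₁ := lt_max_of_lt_left M.epsA_pos
  set wmin := min (1 / (2 * e₁)) (c₀ / (2 * e₁ ^ 3))
  set wmax := max (2 * e₁ / c₀) (2 / e₀)
  have hmin : 0 < wmin := lt_min (by positivity) (by positivity)
  have hmax : 0 < wmax := lt_max_of_lt_left (by positivity)
  refine ⟨wmin, wmax, hmin, hmax, fun r hr0 hr hM => ?_⟩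
  have hW : ∀ i, ∀ x ∈ subdomain L r i, ∃ p q : ℝ, M.W r i x = hermWeight p q ∧
      wmin ≤ p - |q| ∧ p + |q| ≤ wmax := by
    intro i x hx
    have hel := epsSide_elliptic hr0 hr hM hx
    refine weightMatrix_eq M.form hc₀ h0 ?_ ?_ hel
    · unfold Medium.epsSide
      split_ifs <;> simp [he₀]
    · unfold Medium.epsSide
      split_ifs <;> simp [he₁]
  have hle : ∀ i, ∀ x ∈ subdomain L r i,
      ‖Matrix.toEuclideanCLM (n := Fin 2) (𝕜 := ℂ) (M.W r i x)‖ ≤ wmax := by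
    intro i x hx
    obtain ⟨p, q, e, hp, hq⟩ := hW i x hx
    have hp0 : 0 ≤ p := by linarith [abs_nonneg q]
    rw [e]
    refine (opNorm_le_of_mulVec _ (by positivity) (hermWeight_norm_le p q hp0)).trans hq
  have hge : ∀ i, ∀ x ∈ subdomain L r i,
      wmin ≤ ‖Matrix.toEuclideanCLM (n := Fin 2) (𝕜 := ℂ) (M.W r i x)‖ := by
    intro i x hx
    obtain ⟨p, q, e, hp, hq⟩ := hW i x hx
    -- Testing with the first unit vector shows that `p` is at most the norm, and `p ≥ wmin + |q|`.
    have hn := norm_mulVec_le (M.W r i x) ![1, 0]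
    rw [e] at hn ⊢
    simp [hermWeight, Matrix.mulVec, dotProduct, Fin.sum_univ_two] at hn
    have hpp : p ^ 2 ≤ ‖Matrix.toEuclideanCLM (n := Fin 2) (𝕜 := ℂ) (hermWeight p q)‖ ^ 2 := by
      refine le_trans ?_ hn
      nlinarith [sq_nonneg q]
    have := abs_le_of_sq_le_sq hpp (norm_nonneg _)
    linarith [le_abs_self p, abs_nonneg q]
  have hbdd : ∀ i, BddAbove ((fun x => ‖Matrix.toEuclideanCLM (n := Fin 2) (𝕜 := ℂ)
      (M.W r i x)‖) '' subdomain L r i) := by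
    intro i
    refine ⟨wmax, ?_⟩
    rintro _ ⟨x, hx, rfl⟩
    exact hle i x hx
  have hsup : ∀ i, ∀ x ∈ subdomain L r i,
      ‖Matrix.toEuclideanCLM (n := Fin 2) (𝕜 := ℂ) (M.W r i x)‖ ≤ M.supW L r i :=
    fun i x hx => le_csSup (hbdd i) ⟨x, hx, rfl⟩
  constructor
  · intro i x hx z
    obtain ⟨p, q, e, hp, hq⟩ := hW i x hx
    rw [e]
    exact (hermWeight_form p q z).1
  · intro i x hx z
    obtain ⟨p, q, e, hp, hq⟩ := hW i x hx
    rw [e]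
    refine le_trans ?_ (hermWeight_form p q z).2
    exact mul_le_mul_of_nonneg_right hp (Finset.sum_nonneg fun j _ => by positivity)
  · intro i x hx z
    refine (norm_mulVec_le _ _).trans ?_
    have := hsup i x hx
    gcongr
  · intro i
    obtain ⟨x, hx⟩ := subdomain_nonempty hL hr0 hr i
    exact (hge i x hx).trans (hsup i x hx)
  · intro i
    refine csSup_le ((subdomain_nonempty hL hr0 hr i).image _) ?_
    rintro _ ⟨x, hx, rfl⟩
    exact hle i x hx

lemma measurableSet_discs (s : Fin 2) (r : ℝ) : MeasurableSet (discs s r) :=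
  MeasurableSet.iUnion fun _ => MeasurableSet.iUnion fun _ => Metric.isClosed_closedBall.measurableSet

lemma measurable_W (M : Medium) (r : ℝ) (i a b : Fin 2) :
    Measurable fun x => M.W r i x a b := by
  classical
  have hg : Measurable M.gamma := M.kappa_measurable.comp (by fun_prop)
  have he : Measurable (M.epsSide r i) := by
    unfold Medium.epsSide
    split_ifs
    · exact Measurable.ite (measurableSet_discs 0 r) measurable_const measurable_const
    · exact measurable_const
  have hgC : Measurable fun x => (M.gamma x : ℂ) := Complex.measurable_ofReal.comp hg
  have heC : Measurable fun x => (M.epsSide r i x : ℂ) := Complex.measurable_ofReal.comp he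
  unfold Medium.W
  cases M.form
  · simp only [Medium.weightMatrix, Matrix.inv_def, Matrix.adjugate_fin_two, Matrix.det_fin_two,
      Ring.inverse_eq_inv']
    fin_cases a <;> fin_cases b <;> simp <;> fun_prop
  · simp only [Medium.weightMatrix]
    fin_cases a <;> fin_cases b <;> simp <;> fun_prop

end

section

variable {L N : ℕ}

/-! ## Finite element functions -/

/-- The shift of the twisted gradient. -/
def waveVec (kpar : ℝ) (j : Fin 2) : ℝ := kpar / (2 * Real.pi) * k₁ j

/-- The square of the length of the twisted gradient. -/
def gradSq (kpar : ℝ) (v : Plane → ℂ) (x : Plane) : ℝ := ∑ j, ‖twistedGrad kpar v x j‖ ^ 2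

lemma gradSq_nonneg (kpar : ℝ) (v : Plane → ℂ) (x : Plane) : 0 ≤ gradSq kpar v x :=
  Finset.sum_nonneg fun _ _ => by positivity

/-- The interiors of the elements covering a subdomain. -/
def liveSet (L N : ℕ) (d : Diagonal) (r : ℝ) (i : Fin 2) : Set Plane :=
  ⋃ K ∈ coverElems (L := L) (N := N) d r i, interior (tri d K)

lemma isOpen_liveSet (d : Diagonal) (r : ℝ) (i : Fin 2) : IsOpen (liveSet L N d r i) :=
  isOpen_biUnion fun _ _ => isOpen_interior

lemma mem_coverElems_of_mem {d : Diagonal} {r : ℝ} {i : Fin 2} {x : Plane} {K : Elem L N}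
    (hx : x ∈ subdomain L r i) (hK : x ∈ tri d K) : K ∈ coverElems d r i := ⟨x, hx, hK⟩

lemma mem_coverElems_of_interface {d : Diagonal} {r : ℝ} {K : Elem L N}
    (hK : K ∈ interfaceElems L N d r) (i : Fin 2) : K ∈ coverElems d r i := by
  classical
  simp only [interfaceElems, Finset.mem_filter] at hK
  obtain ⟨x, hx, hxK⟩ := hK.2
  fin_cases i
  · exact ⟨x, hx.1, hxK⟩
  · exact ⟨x, hx.2, hxK⟩

lemma mem_interfaceElems {d : Diagonal} {r : ℝ} {K : Elem L N} {x : Plane}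
    (hx : x ∈ interface L r) (hxK : x ∈ tri d K) : K ∈ interfaceElems L N d r := by
  classical
  simp only [interfaceElems, Finset.mem_filter]
  exact ⟨Finset.mem_univ _, x, hx, hxK⟩

lemma subdomain_subset_coverDomain (hL : 0 < L) (hN : 0 < N) (d : Diagonal) (r : ℝ) (i : Fin 2) :
    subdomain L r i ⊆ coverDomain L N d r i := by
  intro x hx
  obtain ⟨K, hK⟩ := exists_mem_tri hL hN d (subdomain_subset_cylinder r i hx)
  exact Set.mem_biUnion (mem_coverElems_of_mem hx hK) hK

lemma ae_mem_liveSet (hL : 0 < L) (hN : 0 < N) (d : Diagonal) (r : ℝ) (i : Fin 2) :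
    ∀ᵐ x : Plane, x ∈ subdomain L r i → x ∈ liveSet L N d r i := by
  have h : ∀ᵐ x : Plane, ∀ K : Elem L N, x ∈ tri d K → x ∈ interior (tri d K) :=
    ae_all_iff.2 fun K => ae_interior_tri d K
  filter_upwards [h] with x hx hxi
  obtain ⟨K, hK⟩ := exists_mem_tri hL hN d (subdomain_subset_cylinder r i hxi)
  exact Set.mem_biUnion (mem_coverElems_of_mem hxi hK) (hx K hK)

/-- The derivative of an affine function. -/
def affDeriv (b : Fin 2 → ℂ) : Plane →L[ℝ] ℂ :=
  ∑ j, b j • (Complex.ofRealCLM.comp (EuclideanSpace.proj j : Plane →L[ℝ] ℝ))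

lemma affDeriv_apply (b : Fin 2 → ℂ) (z : Plane) : affDeriv b z = ∑ j, b j * (z j : ℂ) := by
  simp [affDeriv]

lemma hasFDerivAt_affFn (c : ℂ) (b : Fin 2 → ℂ) (x : Plane) :
    HasFDerivAt (affFn c b) (affDeriv b) x := by
  have h : ∀ j : Fin 2, HasFDerivAt (fun y : Plane => b j * ((y j : ℝ) : ℂ))
      (b j • (Complex.ofRealCLM.comp (EuclideanSpace.proj j : Plane →L[ℝ] ℝ))) x := by
    intro j
    have h1 : HasFDerivAt (fun y : Plane => ((y j : ℝ) : ℂ)) (Complex.ofRealCLM.comp (EuclideanSpace.proj j : Plane →L[ℝ] ℝ)) x :=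
      (Complex.ofRealCLM.comp (EuclideanSpace.proj j : Plane →L[ℝ] ℝ)).hasFDerivAt
    exact h1.const_mul (b j)
  have := (HasFDerivAt.fun_sum (u := Finset.univ) fun j _ => h j).const_add c
  exact this

lemma hasFDerivAt_of_affine {v : Plane → ℂ} {S : Set Plane} {c : ℂ} {b : Fin 2 → ℂ}
    (h : ∀ x ∈ S, v x = affFn c b x) {x : Plane} (hx : x ∈ interior S) :
    HasFDerivAt v (affDeriv b) x := by
  refine (hasFDerivAt_affFn c b x).congr_of_eventuallyEq ?_
  filter_upwards [isOpen_interior.mem_nhds hx] with y hy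
  exact h y (interior_subset hy)

/-- Because of the term of order zero, the twisted gradient of an affine function is affine and not
constant on an element. Hence the inverse estimate is needed for affine functions. -/
lemma twistedGrad_eq_affFn (kpar : ℝ) {v : Plane → ℂ} {S : Set Plane} {c : ℂ} {b : Fin 2 → ℂ}
    (h : ∀ x ∈ S, v x = affFn c b x) {x : Plane} (hx : x ∈ interior S) (j : Fin 2) :
    twistedGrad kpar v x j = affFn (b j + Complex.I * (waveVec kpar j : ℂ) * c)
      (fun l => Complex.I * (waveVec kpar j : ℂ) * b l) x := by
  rw [twistedGrad, (hasFDerivAt_of_affine h hx).fderiv, h x (interior_subset hx)]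
  fin_cases j <;> simp [affFn, affDeriv_apply, Fin.sum_univ_two, waveVec] <;> ring

section

variable {d : Diagonal} {r : ℝ} {u : Pair}

lemma exists_affFn (hu : u ∈ Vh L N d r) {i : Fin 2} {K : Elem L N} (hK : K ∈ coverElems d r i) :
    ∃ (c : ℂ) (b : Fin 2 → ℂ), ∀ x ∈ tri d K, u i x = affFn c b x :=
  (hu i).2 K hK

lemma exists_twistedGrad_affFn (kpar : ℝ) (hu : u ∈ Vh L N d r) {i : Fin 2} {K : Elem L N}
    (hK : K ∈ coverElems d r i) :
    ∃ (c : Fin 2 → ℂ) (b : Fin 2 → Fin 2 → ℂ), ∀ x ∈ interior (tri d K), ∀ j,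
      twistedGrad kpar (u i) x j = affFn (c j) (b j) x := by
  obtain ⟨c, b, h⟩ := exists_affFn hu hK
  exact ⟨_, _, fun x hx j => twistedGrad_eq_affFn kpar h hx j⟩

lemma continuousOn_twistedGrad (kpar : ℝ) (hu : u ∈ Vh L N d r) (i j : Fin 2) :
    ContinuousOn (fun x => twistedGrad kpar (u i) x j) (liveSet L N d r i) := by
  intro x hx
  simp only [liveSet, Set.mem_iUnion] at hx
  obtain ⟨K, hK, hx⟩ := hx
  obtain ⟨c, b, h⟩ := exists_twistedGrad_affFn kpar hu hK
  refine ContinuousAt.continuousWithinAt ?_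
  refine (continuous_affFn (c j) (b j)).continuousAt.congr ?_
  filter_upwards [isOpen_interior.mem_nhds hx] with y hy
  exact (h y hy j).symm

/-- This bound depends on the function and on the mesh. It only serves integrability and enters no
final constant. -/
lemma exists_twistedGrad_bound (kpar : ℝ) (hu : u ∈ Vh L N d r) (i : Fin 2) :
    ∃ B : ℝ, 0 ≤ B ∧ ∀ x ∈ liveSet L N d r i, ∀ j, ‖twistedGrad kpar (u i) x j‖ ≤ B := by
  classical
  have h : ∀ K : Elem L N, ∃ B : ℝ, K ∈ coverElems d r i → ∀ x ∈ interior (tri d K), ∀ j,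
      ‖twistedGrad kpar (u i) x j‖ ≤ B := by
    intro K
    by_cases hK : K ∈ coverElems d r i
    · obtain ⟨c, b, h⟩ := exists_twistedGrad_affFn kpar hu hK
      have hb : ∀ j, ∃ B, ∀ x ∈ tri d K, ‖affFn (c j) (b j) x‖ ≤ B := fun j =>
        (isCompact_tri d K).exists_bound_of_continuousOn (continuous_affFn (c j) (b j)).continuousOn
      choose B hB using hb
      refine ⟨max (B 0) (B 1), fun _ x hx j => ?_⟩
      rw [h x hx j]
      refine (hB j x (interior_subset hx)).trans ?_
      fin_cases j <;> simp
    · exact ⟨0, fun h => absurd h hK⟩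
  choose B hB using h
  refine ⟨∑ K, |B K|, Finset.sum_nonneg fun _ _ => abs_nonneg _, fun x hx j => ?_⟩
  simp only [liveSet, Set.mem_iUnion] at hx
  obtain ⟨K, hK, hx⟩ := hx
  refine (hB K hK x hx j).trans ((le_abs_self _).trans ?_)
  exact Finset.single_le_sum (f := fun K => |B K|) (fun _ _ => abs_nonneg _) (Finset.mem_univ K)

/-- The part of a subdomain interior to the elements. -/
def coreSet (L N : ℕ) (d : Diagonal) (r : ℝ) (i : Fin 2) : Set Plane :=
  subdomain L r i ∩ liveSet L N d r i

/-- The squared twisted gradient, extended by zero. -/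
def density (L N : ℕ) (d : Diagonal) (r kpar : ℝ) (u : Pair) (i : Fin 2) : Plane → ℝ :=
  (coreSet L N d r i).indicator (gradSq kpar (u i))

lemma measurableSet_coreSet (hr : r < Real.sqrt 3 / 6) (i : Fin 2) :
    MeasurableSet (coreSet L N d r i) :=
  (isClosed_subdomain hr i).measurableSet.inter (isOpen_liveSet d r i).measurableSet

lemma density_nonneg (kpar : ℝ) (i : Fin 2) (x : Plane) : 0 ≤ density L N d r kpar u i x :=
  Set.indicator_nonneg (fun _ _ => gradSq_nonneg _ _ _) x

lemma continuousOn_gradSq (kpar : ℝ) (hu : u ∈ Vh L N d r) (i : Fin 2) :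
    ContinuousOn (gradSq kpar (u i)) (liveSet L N d r i) := by
  have h := continuousOn_twistedGrad kpar hu i
  exact continuousOn_finsetSum _ fun j _ => ((h j).norm.pow 2)

lemma measurable_density (hr : r < Real.sqrt 3 / 6) (kpar : ℝ) (hu : u ∈ Vh L N d r) (i : Fin 2) :
    Measurable (density L N d r kpar u i) := by
  classical
  have h := (continuousOn_gradSq kpar hu i).mono
    (Set.inter_subset_right (s := subdomain L r i))
  change ContinuousOn _ (coreSet L N d r i) at h
  have := h.measurable_piecewise (g := fun _ => (0 : ℝ)) continuousOn_const
    (measurableSet_coreSet hr i)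
  rw [density, ← Set.piecewise_eq_indicator]
  convert this using 2; rfl

lemma exists_density_bound (kpar : ℝ) (hu : u ∈ Vh L N d r) (i : Fin 2) :
    ∃ B : ℝ, 0 ≤ B ∧ ∀ x, density L N d r kpar u i x ≤ B := by
  obtain ⟨B, hB0, hB⟩ := exists_twistedGrad_bound kpar hu i
  refine ⟨B ^ 2 + B ^ 2, by positivity, fun x => ?_⟩
  by_cases hx : x ∈ coreSet L N d r i
  swap
  · rw [density, Set.indicator_of_notMem hx]
    positivity
  rw [density, Set.indicator_of_mem hx, gradSq, Fin.sum_univ_two]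
  have h0 := hB x hx.2 0
  have h1 := hB x hx.2 1
  gcongr

lemma volume_cylinder_lt_top : volume (cylinder L) < ⊤ := by
  refine (measure_mono (t := Metric.closedBall 0 (1 + L)) ?_).trans_lt measure_closedBall_lt_top
  rintro _ ⟨t, s, h0, h1, h2, h3, rfl⟩
  rw [mem_closedBall_zero_iff]
  refine (norm_add_le _ _).trans ?_
  rw [norm_smul, norm_smul, norm_v₁, norm_v₂, mul_one, mul_one, Real.norm_eq_abs, Real.norm_eq_abs]
  exact add_le_add (abs_le.2 ⟨by linarith, h1⟩) (abs_le.2 ⟨h2, h3⟩)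

lemma integrable_density (hr : r < Real.sqrt 3 / 6) (kpar : ℝ) (hu : u ∈ Vh L N d r) (i : Fin 2) :
    Integrable (density L N d r kpar u i) := by
  obtain ⟨B, hB0, hB⟩ := exists_density_bound kpar hu i
  have h1 : IntegrableOn (density L N d r kpar u i) (cylinder L) := by
    refine Measure.integrableOn_of_bounded (M := B) volume_cylinder_lt_top.ne
      (measurable_density hr kpar hu i).aestronglyMeasurable ?_
    filter_upwards with x
    rw [Real.norm_of_nonneg (density_nonneg _ _ _)]
    exact hB x
  refine (integrableOn_iff_integrable_of_support_subset ?_).1 h1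
  refine Set.support_indicator_subset.trans ?_
  exact Set.inter_subset_left.trans (subdomain_subset_cylinder r i)

lemma gradSq_ae_eq_density (hL : 0 < L) (hN : 0 < N) (kpar : ℝ) (i : Fin 2) :
    ∀ᵐ x : Plane, x ∈ subdomain L r i → gradSq kpar (u i) x = density L N d r kpar u i x := by
  filter_upwards [ae_mem_liveSet hL hN d r i] with x hx hxi
  rw [density, Set.indicator_of_mem]
  exact ⟨hxi, hx hxi⟩

lemma setIntegral_gradSq (hL : 0 < L) (hN : 0 < N) (kpar : ℝ) (i : Fin 2)
    {S : Set Plane} (hS : MeasurableSet S) (hSi : S ⊆ subdomain L r i) :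
    ∫ x in S, gradSq kpar (u i) x = ∫ x in S, density L N d r kpar u i x := by
  refine setIntegral_congr_ae hS ?_
  filter_upwards [gradSq_ae_eq_density (d := d) (r := r) (u := u) hL hN kpar i] with x hx hxS
  exact hx (hSi hxS)

lemma integral_density (hL : 0 < L) (hN : 0 < N) (hr : r < Real.sqrt 3 / 6) (kpar : ℝ) (i : Fin 2) :
    ∫ x, density L N d r kpar u i x = ∫ x in subdomain L r i, gradSq kpar (u i) x := by
  rw [setIntegral_gradSq (d := d) (N := N) (r := r) hL hN kpar i (isClosed_subdomain hr i).measurableSet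
    subset_rfl, setIntegral_eq_integral_of_forall_compl_eq_zero]
  intro x hx
  rw [density, Set.indicator_of_notMem]
  exact fun h => hx h.1

lemma measurableSet_cutPart (hr : r < Real.sqrt 3 / 6) (K : Elem L N) (i : Fin 2) :
    MeasurableSet (cutPart d r K i) :=
  (measurableSet_tri d K).inter (isClosed_subdomain hr i).measurableSet

/-- The energy of one component on one side of an element. -/
def cutEnergy (d : Diagonal) (r kpar : ℝ) (u : Pair) (K : Elem L N) (i : Fin 2) : ℝ :=
  ∫ x in cutPart d r K i, gradSq kpar (u i) x

lemma cutEnergy_nonneg (kpar : ℝ) (K : Elem L N) (i : Fin 2) : 0 ≤ cutEnergy d r kpar u K i :=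
  integral_nonneg fun _ => gradSq_nonneg _ _ _

lemma sum_indicator_tri_le (hN : 0 < N) (s : Finset (Elem L N)) (x : Plane) :
    ∑ K ∈ s, (tri d K).indicator (fun _ => (1 : ℝ)) x ≤ 72 := by
  classical
  have e : ∑ K ∈ s, (tri d K).indicator (fun _ => (1 : ℝ)) x =
      ((s.filter fun K => x ∈ tri d K).card : ℝ) := by
    rw [Finset.card_filter]
    push_cast
    exact Finset.sum_congr rfl fun K _ => by simp [Set.indicator_apply]
  rw [e]
  have := card_elems_near_le hN d x (s.filter fun K => x ∈ tri d K) fun K hK =>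
    ⟨x, (Finset.mem_filter.1 hK).2, by simpa using (meshSize_pos hN).le⟩
  exact_mod_cast this

/-- The elements overlap at most 72-fold, so local energies add up to a multiple of the global one
that is independent of the mesh. -/
lemma sum_cutEnergy_le (hL : 0 < L) (hN : 0 < N) (hr : r < Real.sqrt 3 / 6) (kpar : ℝ)
    (hu : u ∈ Vh L N d r) (s : Finset (Elem L N)) (i : Fin 2) :
    ∑ K ∈ s, cutEnergy d r kpar u K i ≤ 72 * ∫ x in subdomain L r i, gradSq kpar (u i) x := by
  classical
  have hi := integrable_density hr kpar hu i
  have e : ∀ K : Elem L N, cutEnergy d r kpar u K i =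
      ∫ x, (tri d K).indicator (density L N d r kpar u i) x := by
    intro K
    rw [cutEnergy, setIntegral_gradSq (d := d) (N := N) (r := r) hL hN kpar i (measurableSet_cutPart hr K i)
      Set.inter_subset_right, ← integral_indicator (measurableSet_cutPart hr K i)]
    congr 1
    ext x
    by_cases h : x ∈ tri d K <;> by_cases h' : x ∈ subdomain L r i <;>
      simp [Set.indicator_apply, cutPart, h, h', density, coreSet]
  simp only [e]
  rw [← integral_finsetSum _ fun K _ => hi.indicator (measurableSet_tri d K),
    ← integral_density (d := d) (N := N) hL hN hr, ← integral_const_mul]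
  refine integral_mono (integrable_finsetSum _ fun K _ => hi.indicator (measurableSet_tri d K))
    (hi.const_mul _) fun x => ?_
  have h1 := sum_indicator_tri_le (d := d) hN s x
  have h2 : ∑ K ∈ s, (tri d K).indicator (density L N d r kpar u i) x =
      (∑ K ∈ s, (tri d K).indicator (fun _ => (1 : ℝ)) x) * density L N d r kpar u i x := by
    rw [Finset.sum_mul]
    exact Finset.sum_congr rfl fun K _ => by simp [Set.indicator_apply]
  simp only [h2]
  exact mul_le_mul_of_nonneg_right h1 (density_nonneg _ _ _)

/-- The local inverse estimate for the twisted gradient. -/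
lemma cutArea_mul_gradSq_le (hr0 : 0 ≤ r) (hr : r < Real.sqrt 3 / 6) (hN : 0 < N)
    (hcut : CutAssumption L N d r) (kpar : ℝ) (hu : u ∈ Vh L N d r) {K : Elem L N}
    {x₀ : Plane} (hx₀ : x₀ ∈ interior (tri d K)) (hx₀' : x₀ ∈ interface L r) (i : Fin 2) :
    cutArea d r K i * gradSq kpar (u i) x₀ ≤ affConst * cutEnergy d r kpar u K i := by
  have hK := mem_interfaceElems hx₀' (interior_subset hx₀)
  obtain ⟨c, b, h⟩ := exists_twistedGrad_affFn kpar hu (mem_coverElems_of_interface hK i)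
  have e : cutEnergy d r kpar u K i = ∑ j, ∫ x in cutPart d r K i, ‖affFn (c j) (b j) x‖ ^ 2 := by
    rw [← integral_finsetSum]
    · refine setIntegral_congr_ae (measurableSet_cutPart hr K i) ?_
      filter_upwards [ae_interior_tri d K] with x hx hxc
      exact Finset.sum_congr rfl fun j _ => by rw [h x (hx hxc.1) j]
    · intro j _
      refine IntegrableOn.mono_set ?_ (Set.inter_subset_left : cutPart d r K i ⊆ tri d K)
      exact ((continuous_affFn (c j) (b j)).norm.pow 2).continuousOn.integrableOn_compact
        (isCompact_tri d K)
  rw [e, gradSq, Finset.mul_sum, Finset.mul_sum]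
  refine Finset.sum_le_sum fun j _ => ?_
  rw [h x₀ hx₀ j]
  exact cut_affFn_sq_le hr0 hr hN hcut hK hx₀ hx₀' i (c j) (b j)

end

end

section

variable {L N : ℕ}

/-! ## Exceptional parameters -/

/-- The left side is `‖z‖ cos (t - arg z)` for `z = A + i B`, so `t` is determined up to a sign and
multiples of `2π`. -/
lemma countable_trig_eq {A B : ℝ} (C : ℝ) (h : A ≠ 0 ∨ B ≠ 0) :
    {t : ℝ | A * Real.cos t + B * Real.sin t = C}.Countable := by
  set z : ℂ := ⟨A, B⟩ with hz
  have hz0 : ‖z‖ ≠ 0 := by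
    rw [norm_ne_zero_iff]
    intro h0
    rcases h with h | h
    · exact h (by simpa [hz] using congrArg Complex.re h0)
    · exact h (by simpa [hz] using congrArg Complex.im h0)
  have hA : ‖z‖ * Real.cos z.arg = A := Complex.norm_mul_cos_arg z
  have hB : ‖z‖ * Real.sin z.arg = B := Complex.norm_mul_sin_arg z
  rcases Set.eq_empty_or_nonempty {t : ℝ | A * Real.cos t + B * Real.sin t = C} with he | ⟨s, hs⟩
  · rw [he]; exact Set.countable_empty
  have hs' : ∀ t ∈ {t : ℝ | A * Real.cos t + B * Real.sin t = C},
      Real.cos (s - z.arg) = Real.cos (t - z.arg) := by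
    intro t ht
    have h1 : ‖z‖ * Real.cos (s - z.arg) = C := by
      rw [← (hs : A * Real.cos s + B * Real.sin s = C), Real.cos_sub, ← hA, ← hB]; ring
    have h2 : ‖z‖ * Real.cos (t - z.arg) = C := by
      rw [← (ht : A * Real.cos t + B * Real.sin t = C), Real.cos_sub, ← hA, ← hB]; ring
    exact mul_left_cancel₀ hz0 (h1.trans h2.symm)
  refine ((Set.countable_range fun k : ℤ => 2 * k * Real.pi + (s - z.arg) + z.arg).union
    (Set.countable_range fun k : ℤ => 2 * k * Real.pi - (s - z.arg) + z.arg)).mono ?_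
  intro t ht
  obtain ⟨k, hk | hk⟩ := Real.cos_eq_cos_iff.1 (hs' t ht)
  · exact Or.inl ⟨k, by simp only; linarith⟩
  · exact Or.inr ⟨k, by simp only; linarith⟩

lemma tau_unitNormal (A B t : ℝ) : A * tau₁ (unitNormal t) + B * tau₂ (unitNormal t) =
    (A + B) / Real.sqrt 3 * Real.cos t + (A - B) * Real.sin t := by
  simp [tau₁, tau₂, unitNormal]; ring

lemma tau_coeff_ne {A B : ℝ} (h : A ≠ 0 ∨ B ≠ 0) : (A + B) / Real.sqrt 3 ≠ 0 ∨ A - B ≠ 0 := by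
  by_contra! h'
  have h1 := (div_eq_zero_iff.1 h'.1).resolve_right sqrt_three_pos.ne'
  rcases h with h | h <;> apply h <;> linarith [h'.2]

/-- The points of an element that are not interior. -/
def skeleton (L N : ℕ) (d : Diagonal) : Set Plane :=
  {x | ∃ K : Elem L N, x ∈ tri d K ∧ x ∉ interior (tri d K)}

/-- The circle meets each of the finitely many edge lines at countably many parameters. Points where
a finite element function may fail to be differentiable are therefore negligible on the interface.
-/
lemma countable_circle_skeleton (hN : 0 < N) (d : Diagonal) (x₀ : Plane) {ρ : ℝ} (hρ : ρ ≠ 0) :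
    {t : ℝ | x₀ + ρ • unitNormal t ∈ skeleton L N d}.Countable := by
  have hN' : (N : ℝ) ≠ 0 := by positivity
  have hsub : {t : ℝ | x₀ + ρ • unitNormal t ∈ skeleton L N d} ⊆
      ⋃ (K : Elem L N) (a : Fin 3), {t | bary d K a (x₀ + ρ • unitNormal t) = 0} := by
    rintro t ⟨K, h1, h2⟩
    obtain ⟨a, ha⟩ := bary_eq_zero_of_notMem_interior hN h1 h2
    simp only [Set.mem_iUnion]
    exact ⟨K, a, ha⟩
  refine Set.Countable.mono hsub (Set.countable_iUnion fun K => Set.countable_iUnion fun a => ?_)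
  obtain ⟨A, B, hAB, -, h⟩ := exists_bary_coeff d K a
  refine (countable_trig_eq (-(bary d K a 0 + N * (A * tau₁ x₀ + B * tau₂ x₀)) / (N * ρ))
    (tau_coeff_ne hAB)).mono ?_
  intro t ht
  have ht' : bary d K a (x₀ + ρ • unitNormal t) = 0 := ht
  rw [h] at ht'
  rw [Set.mem_ofPred_eq, ← tau_unitNormal, eq_div_iff (by positivity)]
  simp only [tau₁_add, tau₂_add, tau₁_smul, tau₂_smul] at ht'
  linear_combination ht'

/-- Directions parallel to an edge of the mesh. -/
def edgeDirections (L N : ℕ) (d : Diagonal) : Set ℝ :=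
  {t | ∃ (K : Elem L N) (a : Fin 3), bary d K a (unitNormal t) = bary d K a 0}

lemma countable_edgeDirections (hN : 0 < N) (d : Diagonal) : (edgeDirections L N d).Countable := by
  have hN' : (N : ℝ) ≠ 0 := by positivity
  have hsub : edgeDirections L N d ⊆
      ⋃ (K : Elem L N) (a : Fin 3), {t | bary d K a (unitNormal t) = bary d K a 0} := by
    rintro t ⟨K, a, h⟩
    simp only [Set.mem_iUnion]
    exact ⟨K, a, h⟩
  refine Set.Countable.mono hsub (Set.countable_iUnion fun K => Set.countable_iUnion fun a => ?_)
  obtain ⟨A, B, hAB, -, h⟩ := exists_bary_coeff d K a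
  refine (countable_trig_eq 0 (tau_coeff_ne hAB)).mono ?_
  intro t ht
  have ht' : bary d K a (unitNormal t) = bary d K a 0 := ht
  rw [h, add_eq_left] at ht'
  rw [Set.mem_ofPred_eq, ← tau_unitNormal]
  exact (mul_eq_zero.1 ht').resolve_left hN'

/-- A line that is not parallel to an edge meets the line through that edge at most once. -/
lemma countable_ray_skeleton (hN : 0 < N) {d : Diagonal} (x₀ : Plane) {t : ℝ}
    (ht : t ∉ edgeDirections L N d) : {s : ℝ | x₀ + s • unitNormal t ∈ skeleton L N d}.Countable := by
  have hsub : {s : ℝ | x₀ + s • unitNormal t ∈ skeleton L N d} ⊆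
      ⋃ (K : Elem L N) (a : Fin 3), {s | bary d K a (x₀ + s • unitNormal t) = 0} := by
    rintro s ⟨K, h1, h2⟩
    obtain ⟨a, ha⟩ := bary_eq_zero_of_notMem_interior hN h1 h2
    simp only [Set.mem_iUnion]
    exact ⟨K, a, ha⟩
  refine Set.Countable.mono hsub (Set.countable_iUnion fun K => Set.countable_iUnion fun a => ?_)
  obtain ⟨A, B, hAB, -, h⟩ := exists_bary_coeff d K a
  have hne : (N : ℝ) * (A * tau₁ (unitNormal t) + B * tau₂ (unitNormal t)) ≠ 0 := by
    intro h0
    exact ht ⟨K, a, by rw [h, h0, add_zero]⟩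
  refine Set.Subsingleton.countable ?_
  intro s hs s' hs'
  have e : bary d K a (x₀ + s • unitNormal t) = bary d K a (x₀ + s' • unitNormal t) :=
    Eq.trans hs (Eq.symm hs')
  rw [h, h (x₀ + s' • unitNormal t)] at e
  simp only [tau₁_add, tau₂_add, tau₁_smul, tau₂_smul] at e
  have : (s - s') * (N * (A * tau₁ (unitNormal t) + B * tau₂ (unitNormal t))) = 0 := by
    linear_combination e
  linarith [(mul_eq_zero.1 this).resolve_right hne]

lemma ae_circlePoint_interior (hN : 0 < N) (d : Diagonal) {r : ℝ} (hr : r ≠ 0) (c : Circles L) :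
    ∀ᵐ t : ℝ, ∀ K : Elem L N, circlePoint r c t ∈ tri d K →
      circlePoint r c t ∈ interior (tri d K) := by
  have h := (countable_circle_skeleton (L := L) hN d (circleCenter c) hr).ae_notMem volume
  filter_upwards [h] with t ht K hK
  by_contra h'
  exact ht ⟨K, hK, h'⟩

/-! ## Integrals over parts of the interface -/

/-- The parameters of the part of a circle in a set. -/
def arcSet (r : ℝ) (c : Circles L) (S : Set Plane) : Set ℝ :=
  {t : ℝ | t ∈ Set.Ioc 0 (2 * Real.pi) ∧ circlePoint r c t ∈ S}

lemma lineIntegral_eq (r : ℝ) (S : Set Plane) {F : Type*} [NormedAddCommGroup F] [NormedSpace ℝ F]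
    (f : Plane → Plane → F) : lineIntegral L r S f =
      ∑ c : Circles L, ∫ t in arcSet r c S, r • f (circlePoint r c t) (unitNormal t) := rfl

lemma measurableSet_arcSet (r : ℝ) (c : Circles L) {S : Set Plane} (hS : MeasurableSet S) :
    MeasurableSet (arcSet r c S) :=
  measurableSet_Ioc.inter ((continuous_circlePoint r c).measurable hS)

lemma integrableOn_arcSet {F : Type*} [NormedAddCommGroup F] {f : ℝ → F} (hf : Continuous f)
    (r : ℝ) (c : Circles L) (S : Set Plane) : IntegrableOn f (arcSet r c S) :=
  (hf.integrableOn_Ioc (a := 0) (b := 2 * Real.pi)).mono_set fun _ h => h.1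

lemma lineIntegral_nonneg {r : ℝ} (hr : 0 ≤ r) (S : Set Plane) {f : Plane → Plane → ℝ}
    (hf : ∀ x n, 0 ≤ f x n) : 0 ≤ lineIntegral L r S f :=
  Finset.sum_nonneg fun _ _ => integral_nonneg fun _ => mul_nonneg hr (hf _ _)

lemma cutLength_eq (d : Diagonal) (r : ℝ) (K : Elem L N) :
    cutLength d r K = ∑ c : Circles L, r * (volume (arcSet r c (tri d K))).toReal := by
  rw [cutLength, lineIntegral_eq]
  refine Finset.sum_congr rfl fun c _ => ?_
  rw [setIntegral_const]
  simp [Measure.real, mul_comm]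

lemma cutLength_nonneg {r : ℝ} (hr : 0 ≤ r) (d : Diagonal) (K : Elem L N) : 0 ≤ cutLength d r K :=
  lineIntegral_nonneg hr _ fun _ _ => zero_le_one

/-- Cauchy–Schwarz on a part of the interface. -/
lemma sq_lineIntegral_le {r : ℝ} (hr : 0 ≤ r) (d : Diagonal) (K : Elem L N) {f : Plane → ℝ}
    (hf : ∀ c : Circles L, Continuous fun t => f (circlePoint r c t)) :
    lineIntegral L r (tri d K) (fun x _ => f x) ^ 2 ≤
      cutLength d r K * lineIntegral L r (tri d K) fun x _ => f x ^ 2 := by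
  -- The quadratic polynomial in `m` is the integral of `(f - m)²`. Its discriminant is not
  -- positive.
  have h : ∀ m : ℝ, 0 ≤ cutLength d r K * (m * m) +
      (-2 * lineIntegral L r (tri d K) fun x _ => f x) * m +
      lineIntegral L r (tri d K) fun x _ => f x ^ 2 := by
    intro m
    have h1 : 0 ≤ lineIntegral L r (tri d K) fun x _ => (f x - m) ^ 2 :=
      lineIntegral_nonneg hr _ fun _ _ => sq_nonneg _
    refine h1.trans_eq ?_
    simp only [cutLength, lineIntegral_eq, Finset.sum_mul, Finset.mul_sum, ← Finset.sum_add_distrib]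
    refine Finset.sum_congr rfl fun c _ => ?_
    have e : ∀ t, r • (f (circlePoint r c t) - m) ^ 2 = (m * m) * (r • (1 : ℝ)) +
        (-2 * m) * (r • f (circlePoint r c t)) + r • f (circlePoint r c t) ^ 2 := by
      intro t; simp only [smul_eq_mul]; ring
    simp only [e]
    have i1 : IntegrableOn (fun _ : ℝ => (m * m) * (r • (1 : ℝ))) (arcSet r c (tri d K)) :=
      integrableOn_arcSet continuous_const r c _
    have hc := hf c
    have i2 : IntegrableOn (fun t : ℝ => (-2 * m) * (r • f (circlePoint r c t)))
        (arcSet r c (tri d K)) := integrableOn_arcSet ((hc.const_smul r).const_mul _) r c _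
    have i3 : IntegrableOn (fun t : ℝ => r • f (circlePoint r c t) ^ 2) (arcSet r c (tri d K)) :=
      integrableOn_arcSet ((hc.pow 2).const_smul r) r c _
    have j1 := integral_add (i1.add i2) i3
    have j2 := integral_add i1 i2
    simp only [Pi.add_apply] at j1
    rw [j1, j2, integral_const_mul, integral_const_mul]
    ring
  have := discrim_le_zero h
  rw [discrim] at this
  nlinarith

/-- Only the majorant has to be integrable. Nothing is required of the regularity of `f`, which
involves the gradient on the interface. -/
lemma norm_lineIntegral_le {r : ℝ} (hr : 0 ≤ r) (d : Diagonal) (K : Elem L N)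
    {F : Type*} [NormedAddCommGroup F] [NormedSpace ℝ F] {f : Plane → Plane → F} {g : Plane → ℝ}
    (hg : ∀ c : Circles L, Continuous fun t => g (circlePoint r c t))
    (h : ∀ c : Circles L, ∀ᵐ t : ℝ, circlePoint r c t ∈ tri d K →
      ‖f (circlePoint r c t) (unitNormal t)‖ ≤ g (circlePoint r c t)) :
    ‖lineIntegral L r (tri d K) f‖ ≤ lineIntegral L r (tri d K) fun x _ => g x := by
  rw [lineIntegral_eq, lineIntegral_eq]
  refine (norm_sum_le _ _).trans (Finset.sum_le_sum fun c _ => ?_)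
  have hc := hg c
  refine norm_integral_le_of_norm_le (integrableOn_arcSet (hc.const_smul r) r c _) ?_
  rw [ae_restrict_iff' (measurableSet_arcSet r c (measurableSet_tri d K))]
  filter_upwards [h c] with t ht hta
  rw [norm_smul, Real.norm_of_nonneg hr, smul_eq_mul]
  exact mul_le_mul_of_nonneg_left (ht hta.2) hr

lemma norm_unitNormal_sub_sq (t s : ℝ) :
    ‖unitNormal t - unitNormal s‖ ^ 2 = (2 * Real.sin ((t - s) / 2)) ^ 2 := by
  rw [norm_sq_plane, mul_pow, Real.sin_sq_eq_half_sub, mul_div_cancel₀ _ two_ne_zero, Real.cos_sub]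
  simp only [unitNormal, PiLp.sub_apply, Matrix.cons_val_zero, Matrix.cons_val_one,
    Matrix.cons_val_fin_one]
  nlinarith [Real.sin_sq_add_cos_sq t, Real.sin_sq_add_cos_sq s]

lemma norm_unitNormal_sub (t s : ℝ) :
    ‖unitNormal t - unitNormal s‖ = 2 * |Real.sin ((t - s) / 2)| := by
  rw [← sq_eq_sq₀ (norm_nonneg _) (by positivity), norm_unitNormal_sub_sq, mul_pow, mul_pow, sq_abs]

lemma norm_circlePoint_sub {r : ℝ} (hr : 0 ≤ r) (c : Circles L) (t s : ℝ) :
    ‖circlePoint r c t - circlePoint r c s‖ = r * ‖unitNormal t - unitNormal s‖ := by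
  rw [circlePoint, circlePoint, add_sub_add_left_eq_sub, ← smul_sub, norm_smul,
    Real.norm_of_nonneg hr]

/-- The part of a circle in an element has length comparable to the mesh size at most. -/
lemma volume_arcSet_tri_le {r : ℝ} (hr : 0 < r) (hN : 0 < N) (d : Diagonal) (K : Elem L N)
    (c : Circles L) :
    r * (volume (arcSet r c (tri d K))).toReal ≤ 24 * meshSize N := by
  have hh := meshSize_pos hN
  rcases Set.eq_empty_or_nonempty (arcSet r c (tri d K)) with he | ⟨s, hs⟩
  · rw [he]; simp; positivity
  -- Points of an element are at most `2 h` apart, so `|sin ((t - s) / 2)| ≤ h / r`, and `|sin y| ≥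
  -- (2 / π) |y|` for `|y| ≤ π / 2`. The three intervals account for arcs that wrap around the ends
  -- of `(0, 2π]`.
  set ρ := Real.pi * meshSize N / r with hρ
  have hρ0 : 0 < ρ := by positivity
  have hsub : arcSet r c (tri d K) ⊆ Metric.closedBall s ρ ∪
      (Metric.closedBall (s + 2 * Real.pi) ρ ∪ Metric.closedBall (s - 2 * Real.pi) ρ) := by
    intro t ht
    have h1 := norm_sub_le_of_mem_tri hN ht.2 hs.2
    rw [norm_circlePoint_sub hr.le, norm_unitNormal_sub] at h1
    have h2 : |Real.sin ((t - s) / 2)| ≤ meshSize N / r := by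
      rw [le_div_iff₀ hr]; linarith
    have hpi := Real.pi_pos
    have key : ∀ y : ℝ, |y| ≤ Real.pi / 2 → |Real.sin y| ≤ meshSize N / r → |2 * y| ≤ ρ := by
      intro y hy hy'
      have h3 := (Real.mul_abs_le_abs_sin hy).trans hy'
      rw [abs_mul, abs_two, hρ]
      have h4 : Real.pi * (2 / Real.pi * |y|) ≤ Real.pi * (meshSize N / r) := by gcongr
      have e : Real.pi * (2 / Real.pi * |y|) = 2 * |y| := by field_simp
      rw [e] at h4
      rwa [mul_div_assoc]
    have a1 := ht.1.1
    have a2 := ht.1.2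
    have b1 := hs.1.1
    have b2 := hs.1.2
    by_cases c1 : |(t - s) / 2| ≤ Real.pi / 2
    · left
      rw [Metric.mem_closedBall, Real.dist_eq]
      have := key _ c1 h2
      rwa [mul_div_cancel₀ _ two_ne_zero] at this
    · right
      rcases le_or_gt 0 ((t - s) / 2) with c2 | c2
      · left
        rw [abs_of_nonneg c2, not_le] at c1
        rw [Metric.mem_closedBall, Real.dist_eq]
        have := key ((t - s) / 2 - Real.pi) (abs_le.2 ⟨by linarith, by linarith⟩)
          (by rwa [Real.sin_sub_pi, abs_neg])
        rw [show 2 * ((t - s) / 2 - Real.pi) = t - (s + 2 * Real.pi) by ring] at this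
        exact this
      · right
        rw [abs_of_neg c2, not_le] at c1
        rw [Metric.mem_closedBall, Real.dist_eq]
        have := key ((t - s) / 2 + Real.pi) (abs_le.2 ⟨by linarith, by linarith⟩)
          (by rwa [Real.sin_add_pi, abs_neg])
        rw [show 2 * ((t - s) / 2 + Real.pi) = t - (s - 2 * Real.pi) by ring] at this
        exact this
  have hv : volume (arcSet r c (tri d K)) ≤ ENNReal.ofReal (6 * ρ) := by
    refine (measure_mono hsub).trans ((measure_union_le _ _).trans
      ((add_le_add_right (measure_union_le _ _) _).trans ?_))
    rw [Real.volume_closedBall, Real.volume_closedBall, Real.volume_closedBall,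
      ← ENNReal.ofReal_add (by positivity) (by positivity),
      ← ENNReal.ofReal_add (by positivity) (by positivity)]
    apply ENNReal.ofReal_le_ofReal
    linarith
  have := ENNReal.toReal_le_of_le_ofReal (by positivity) hv
  calc r * (volume (arcSet r c (tri d K))).toReal ≤ r * (6 * ρ) := by gcongr
    _ = 6 * Real.pi * meshSize N := by rw [hρ]; field_simp
    _ ≤ 24 * meshSize N := by nlinarith [Real.pi_lt_d2]

/-- At most `24 h` from each of the `4 L` circles. -/
lemma cutLength_le {r : ℝ} (hr : 0 < r) (hN : 0 < N) (d : Diagonal) (K : Elem L N) :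
    cutLength d r K ≤ 96 * L * meshSize N := by
  rw [cutLength_eq]
  refine (Finset.sum_le_sum fun c _ => volume_arcSet_tri_le hr hN d K c).trans_eq ?_
  simp
  ring

/-! ## Bounds for the stabilisation and for the flux -/

section

variable {d : Diagonal} {r kpar : ℝ} {u v : Pair} {M : Medium} {wmin wmax : ℝ}

lemma cutArea_nonneg (K : Elem L N) (i : Fin 2) : 0 ≤ cutArea d r K i := ENNReal.toReal_nonneg

lemma cutArea_le (hN : 0 < N) (K : Elem L N) (i : Fin 2) :
    cutArea d r K i ≤ 16 * meshSize N ^ 2 :=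
  (ENNReal.toReal_mono (isCompact_tri d K).measure_lt_top.ne
    (measure_mono Set.inter_subset_left)).trans (volume_tri_le hN d K)

lemma le_cutArea_add (hN : 0 < N) (K : Elem L N) :
    meshSize N ^ 2 / 36 ≤ cutArea d r K 0 + cutArea d r K 1 := by
  refine (volume_tri_ge hN d K).trans ?_
  have hfin : ∀ i, volume (tri d K ∩ subdomain L r i) ≠ ⊤ := fun i =>
    ((measure_mono Set.inter_subset_left).trans_lt (isCompact_tri d K).measure_lt_top).ne
  rw [cutArea, cutArea, ← ENNReal.toReal_add (hfin 0) (hfin 1)]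
  refine ENNReal.toReal_mono (ENNReal.add_ne_top.2 ⟨hfin 0, hfin 1⟩) ?_
  refine le_trans (measure_mono fun x hx => ?_) (measure_union_le _ _)
  rcases cylinder_subset_union (r := r) (tri_subset_cylinder hN d K hx) with h | h
  · exact Or.inl ⟨hx, h⟩
  · exact Or.inr ⟨hx, h⟩

lemma le_weightDenom (hw : WeightBounds M L r wmin wmax) (hmin : 0 < wmin) (hN : 0 < N)
    (K : Elem L N) : wmin * (meshSize N ^ 2 / 36) ≤ weightDenom M d r K := by
  have h0 := hw.le_supW 0
  have h1 := hw.le_supW 1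
  have a0 := cutArea_nonneg (d := d) (r := r) K 0
  have a1 := cutArea_nonneg (d := d) (r := r) K 1
  calc wmin * (meshSize N ^ 2 / 36) ≤ wmin * (cutArea d r K 0 + cutArea d r K 1) :=
        mul_le_mul_of_nonneg_left (le_cutArea_add hN K) hmin.le
    _ ≤ weightDenom M d r K := by
        rw [weightDenom, mul_add]; gcongr

lemma weightDenom_pos (hw : WeightBounds M L r wmin wmax) (hmin : 0 < wmin) (hN : 0 < N)
    (K : Elem L N) : 0 < weightDenom M d r K :=
  lt_of_lt_of_le (by have := meshSize_pos hN; positivity) (le_weightDenom hw hmin hN K)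

lemma weightDenom_le (hw : WeightBounds M L r wmin wmax) (hmax : 0 < wmax) (hN : 0 < N)
    (K : Elem L N) : weightDenom M d r K ≤ 32 * wmax * meshSize N ^ 2 := by
  have h0 := hw.supW_le 0
  have h1 := hw.supW_le 1
  have a0 := cutArea_le (d := d) (r := r) hN K 0
  have a1 := cutArea_le (d := d) (r := r) hN K 1
  have b0 := cutArea_nonneg (d := d) (r := r) K 0
  have b1 := cutArea_nonneg (d := d) (r := r) K 1
  have : weightDenom M d r K ≤ wmax * (16 * meshSize N ^ 2) + wmax * (16 * meshSize N ^ 2) := by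
    rw [weightDenom]; gcongr
  linarith

lemma supW_pos (hw : WeightBounds M L r wmin wmax) (hmin : 0 < wmin) (i : Fin 2) :
    0 < M.supW L r i := hmin.trans_le (hw.le_supW i)

lemma lamK_nonneg (hr : 0 ≤ r) (hw : WeightBounds M L r wmin wmax) (hmin : 0 < wmin) (hN : 0 < N)
    (K : Elem L N) : 0 ≤ lamK M d r K := by
  have := meshSize_pos hN
  have := supW_pos hw hmin 0
  have := supW_pos hw hmin 1
  have := weightDenom_pos (d := d) hw hmin hN K
  have := cutLength_nonneg hr d K
  unfold lamK
  positivity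

lemma lamK_le (hr : 0 < r) (hw : WeightBounds M L r wmin wmax) (hmin : 0 < wmin) (hmax : 0 < wmax)
    (hN : 0 < N) (K : Elem L N) : lamK M d r K ≤ 3456 * L * wmax ^ 2 / wmin := by
  have hh := meshSize_pos hN
  have h0 := supW_pos hw hmin 0
  have h1 := supW_pos hw hmin 1
  have hg0 := cutLength_nonneg hr.le d K
  have hg := cutLength_le hr hN d K
  have hD := le_weightDenom (d := d) hw hmin hN K
  have a0 := hw.supW_le 0
  have a1 := hw.supW_le 1
  calc lamK M d r K ≤ meshSize N * wmax * wmax * (96 * L * meshSize N) /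
        (wmin * (meshSize N ^ 2 / 36)) := by
        unfold lamK; gcongr
    _ = 3456 * L * wmax ^ 2 / wmin := by field_simp; ring

/-- Since `D_K` is at most a multiple of `h²`, `λ_K` dominates the relative length `|Γ_K| / h` of
the cut. This degenerates for short cuts, so the stabilisation alone does not control the jump part
of the norm. -/
lemma le_lamK (hr : 0 < r) (hw : WeightBounds M L r wmin wmax) (hmin : 0 < wmin) (hmax : 0 < wmax)
    (hN : 0 < N) (K : Elem L N) :
    wmin ^ 2 / (32 * wmax) * (cutLength d r K / meshSize N) ≤ lamK M d r K := by
  have hh := meshSize_pos hN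
  have h0 := supW_pos hw hmin 0
  have h1 := supW_pos hw hmin 1
  have hg0 := cutLength_nonneg hr.le d K
  have hD := weightDenom_le (d := d) hw hmax hN K
  have hD0 := weightDenom_pos (d := d) hw hmin hN K
  have a0 := hw.le_supW 0
  have a1 := hw.le_supW 1
  calc wmin ^ 2 / (32 * wmax) * (cutLength d r K / meshSize N) =
      meshSize N * wmin * wmin * cutLength d r K / (32 * wmax * meshSize N ^ 2) := by
        field_simp
    _ ≤ lamK M d r K := by
        unfold lamK; gcongr

lemma norm_flux_le (hw : WeightBounds M L r wmin wmax) (hmin : 0 < wmin) (i : Fin 2) {w : Plane → ℂ}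
    {x : Plane} (hx : x ∈ subdomain L r i) (t : ℝ) :
    ‖flux M r kpar i w x (unitNormal t)‖ ≤ M.supW L r i * Real.sqrt (gradSq kpar w x) := by
  have h0 := supW_pos hw hmin i
  have h := hw.mulVec_le i x hx (twistedGrad kpar w x)
  set z := (M.W r i x).mulVec (twistedGrad kpar w x) with hz
  have h1 : ‖flux M r kpar i w x (unitNormal t)‖ ≤ ∑ j, ‖z j‖ * |unitNormal t j| := by
    refine (norm_sum_le _ _).trans (Finset.sum_le_sum fun j _ => ?_)
    rw [norm_mul, Complex.norm_real, Real.norm_eq_abs]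
  have h2 := Finset.sum_mul_sq_le_sq_mul_sq Finset.univ (fun j => ‖z j‖) fun j => |unitNormal t j|
  have h3 : ∑ j, |unitNormal t j| ^ 2 = 1 := by
    simp [Fin.sum_univ_two, unitNormal, sq_abs]
  rw [h3, mul_one] at h2
  rw [← Real.sqrt_sq h0.le, ← Real.sqrt_mul (by positivity)]
  refine h1.trans (Real.le_sqrt_of_sq_le (h2.trans h))

/-- The energy on both sides of an element. -/
def elemEnergy (d : Diagonal) (r kpar : ℝ) (u : Pair) (K : Elem L N) : ℝ :=
  ∑ i, cutEnergy d r kpar u K i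

lemma elemEnergy_nonneg (K : Elem L N) : 0 ≤ elemEnergy d r kpar u K :=
  Finset.sum_nonneg fun i _ => cutEnergy_nonneg kpar K i

/-- This identity is the reason for the choice of the weights: the factor `|Kᵢ|` compensates the
loss in the inverse estimate on a small piece. -/
lemma avgWeight_mul_supW (K : Elem L N) (i : Fin 2) : avgWeight M d r K i * M.supW L r i =
    M.supW L r 0 * M.supW L r 1 / weightDenom M d r K * cutArea d r K i := by
  have h : M.supW L r (1 - i) * M.supW L r i = M.supW L r 0 * M.supW L r 1 := by
    fin_cases i
    · exact mul_comm _ _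
    · rfl
  rw [avgWeight, ← h]
  ring

/-- The product `|Kᵢ| |∇u|` is split as `√|Kᵢ| ≤ 4 h` times `√(|Kᵢ| |∇u|²)`, and the second factor
is bounded by the inverse estimate. -/
lemma norm_avgWeight_mul_flux_le (hr0 : 0 < r) (hr : r < Real.sqrt 3 / 6) (hN : 0 < N)
    (hw : WeightBounds M L r wmin wmax) (hmin : 0 < wmin)
    (hcut : CutAssumption L N d r) (hu : u ∈ Vh L N d r) {K : Elem L N} {c : Circles L} {t : ℝ}
    (ht : circlePoint r c t ∈ interior (tri d K)) (i : Fin 2) :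
    ‖(avgWeight M d r K i : ℂ) * flux M r kpar i (u i) (circlePoint r c t) (unitNormal t)‖ ≤
      M.supW L r 0 * M.supW L r 1 / weightDenom M d r K * meshSize N *
        (4 * Real.sqrt affConst * Real.sqrt (elemEnergy d r kpar u K)) := by
  have hh := meshSize_pos hN
  have hD := weightDenom_pos (d := d) hw hmin hN K
  have w0 := supW_pos hw hmin 0
  have w1 := supW_pos hw hmin 1
  have hA0 : 0 < M.supW L r 0 * M.supW L r 1 / weightDenom M d r K := by positivity
  have hwt := avgWeight_mul_supW (d := d) (r := r) (M := M) K i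
  generalize M.supW L r 0 * M.supW L r 1 / weightDenom M d r K = A at hA0 hwt ⊢
  set x := circlePoint r c t with hx
  have hxi : x ∈ subdomain L r i := circlePoint_mem_subdomain hr0.le hr c t i
  have h1 := norm_flux_le (kpar := kpar) (w := u i) hw hmin i hxi t
  have ha := cutArea_nonneg (d := d) (r := r) K i
  have hw0 : 0 ≤ avgWeight M d r K i := by
    exact div_nonneg (mul_nonneg (supW_pos hw hmin (1 - i)).le ha) hD.le
  have h2 : cutArea d r K i * Real.sqrt (gradSq kpar (u i) x) ≤
      4 * meshSize N * (Real.sqrt affConst * Real.sqrt (elemEnergy d r kpar u K)) := by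
    have e : cutArea d r K i * Real.sqrt (gradSq kpar (u i) x) =
        Real.sqrt (cutArea d r K i) * Real.sqrt (cutArea d r K i * gradSq kpar (u i) x) := by
      rw [Real.sqrt_mul ha, ← mul_assoc, Real.mul_self_sqrt ha]
    rw [e, ← Real.sqrt_mul affConst_pos.le (elemEnergy d r kpar u K)]
    have s1 : Real.sqrt (cutArea d r K i) ≤ 4 * meshSize N := by
      rw [Real.sqrt_le_left (by positivity)]
      linarith [cutArea_le (d := d) (r := r) hN K i]
    have s2 : cutArea d r K i * gradSq kpar (u i) x ≤ affConst * elemEnergy d r kpar u K := by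
      refine (cutArea_mul_gradSq_le hr0.le hr hN hcut kpar hu ht
        (circlePoint_mem_interface hr0.le hr c t) i).trans ?_
      refine mul_le_mul_of_nonneg_left ?_ affConst_pos.le
      exact Finset.single_le_sum (f := fun i => cutEnergy d r kpar u K i)
        (fun i _ => cutEnergy_nonneg kpar K i) (Finset.mem_univ i)
    have s3 := Real.sqrt_le_sqrt s2
    gcongr
  rw [norm_mul, Complex.norm_real, Real.norm_of_nonneg hw0]
  calc avgWeight M d r K i * ‖flux M r kpar i (u i) x (unitNormal t)‖
      ≤ avgWeight M d r K i * (M.supW L r i * Real.sqrt (gradSq kpar (u i) x)) := by gcongr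
    _ = A * (cutArea d r K i * Real.sqrt (gradSq kpar (u i) x)) := by
        rw [← mul_assoc, hwt]; ring
    _ ≤ A * (4 * meshSize N * (Real.sqrt affConst * Real.sqrt (elemEnergy d r kpar u K))) := by
        gcongr
    _ = _ := by ring

lemma norm_avgFlux_le (hr0 : 0 < r) (hr : r < Real.sqrt 3 / 6) (hN : 0 < N)
    (hw : WeightBounds M L r wmin wmax) (hmin : 0 < wmin)
    (hcut : CutAssumption L N d r) (hu : u ∈ Vh L N d r) {K : Elem L N} {c : Circles L} {t : ℝ}
    (ht : circlePoint r c t ∈ interior (tri d K)) :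
    ‖avgFlux M r kpar d K u (circlePoint r c t) (unitNormal t)‖ ≤
      M.supW L r 0 * M.supW L r 1 * meshSize N / weightDenom M d r K *
        (8 * Real.sqrt affConst * Real.sqrt (elemEnergy d r kpar u K)) := by
  have hh := meshSize_pos hN
  have hD := weightDenom_pos (d := d) hw hmin hN K
  rw [avgFlux, Fin.sum_univ_two]
  refine (norm_add_le _ _).trans ((add_le_add
    (norm_avgWeight_mul_flux_le hr0 hr hN hw hmin hcut hu ht 0)
    (norm_avgWeight_mul_flux_le hr0 hr hN hw hmin hcut hu ht 1)).trans_eq ?_)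
  ring

/-- The jump is continuous along the interface. -/
lemma continuous_jump (hL : 0 < L) (hN : 0 < N) (hr0 : 0 < r) (hr : r < Real.sqrt 3 / 6)
    (hu : u ∈ Vh L N d r) (c : Circles L) : Continuous fun t => jump u (circlePoint r c t) := by
  have h : ∀ i, Continuous fun t => u i (circlePoint r c t) := fun i =>
    (hu i).1.comp_continuous (continuous_circlePoint r c) fun t =>
      subdomain_subset_coverDomain hL hN d r i (circlePoint_mem_subdomain hr0.le hr c t i)
  exact (h 0).sub (h 1)

/-- The stabilisation on one element. -/
def elemJump (M : Medium) (d : Diagonal) (r : ℝ) (u : Pair) (K : Elem L N) : ℝ :=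
  (meshSize N)⁻¹ * lamK M d r K * lineIntegral L r (tri d K) fun x _ => ‖jump u x‖ ^ 2

/-- With `B = ‖W₁‖ ‖W₂‖ h / D_K` one has `λ_K = B |Γ_K|`. Cauchy–Schwarz yields `∫ |[v]| ≤ √(|Γ_K| ∫
|[v]|²)`, and `B √|Γ_K| = √(B h) √(h⁻¹ λ_K)` with `B h` bounded. So the stabilisation suffices for
the flux terms even on short cuts. -/
lemma norm_fluxTerm_le (hL : 0 < L) (hr0 : 0 < r) (hr : r < Real.sqrt 3 / 6) (hN : 0 < N)
    (hw : WeightBounds M L r wmin wmax) (hmin : 0 < wmin) (hmax : 0 < wmax)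
    (hcut : CutAssumption L N d r) (hu : u ∈ Vh L N d r) (hv : v ∈ Vh L N d r) (K : Elem L N) :
    ‖lineIntegral L r (tri d K) fun x n => avgFlux M r kpar d K u x n * star (jump v x)‖ ≤
      48 * wmax * Real.sqrt (affConst / wmin) *
        (Real.sqrt (elemEnergy d r kpar u K) * Real.sqrt (elemJump M d r v K)) := by
  have hh := meshSize_pos hN
  have hD := weightDenom_pos (d := d) hw hmin hN K
  have w0 := supW_pos hw hmin 0
  have w1 := supW_pos hw hmin 1
  set B := M.supW L r 0 * M.supW L r 1 * meshSize N / weightDenom M d r K with hB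
  have hB0 : 0 < B := by positivity
  set m := B * (8 * Real.sqrt affConst * Real.sqrt (elemEnergy d r kpar u K)) with hm
  have hm0 : 0 ≤ m := by positivity
  set Y := lineIntegral L r (tri d K) fun x _ => ‖jump v x‖ ^ 2 with hY
  set I := lineIntegral L r (tri d K) fun x _ => ‖jump v x‖ with hI
  have hY0 : 0 ≤ Y := lineIntegral_nonneg hr0.le _ fun _ _ => by positivity
  have hg0 := cutLength_nonneg hr0.le d K
  have hcont : ∀ c : Circles L, Continuous fun t => ‖jump v (circlePoint r c t)‖ := fun c =>
    (continuous_jump hL hN hr0 hr hv c).norm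
  have h1 : ‖lineIntegral L r (tri d K) fun x n => avgFlux M r kpar d K u x n * star (jump v x)‖ ≤
      lineIntegral L r (tri d K) fun x _ => m * ‖jump v x‖ := by
    refine norm_lineIntegral_le hr0.le d K (fun c => (hcont c).const_mul m) fun c => ?_
    filter_upwards [ae_circlePoint_interior hN d hr0.ne' c] with t ht hK
    rw [norm_mul, norm_star]
    exact mul_le_mul_of_nonneg_right (norm_avgFlux_le hr0 hr hN hw hmin hcut hu (ht K hK))
      (norm_nonneg _)
  have h2 : (lineIntegral L r (tri d K) fun x _ => m * ‖jump v x‖) = m * I := by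
    rw [hI, lineIntegral_eq, lineIntegral_eq, Finset.mul_sum]
    refine Finset.sum_congr rfl fun c _ => ?_
    rw [← integral_const_mul]
    congr 1
    ext t
    simp only [smul_eq_mul]; ring
  have h3 : I ≤ Real.sqrt (cutLength d r K * Y) :=
    Real.le_sqrt_of_sq_le (sq_lineIntegral_le hr0.le d K hcont)
  have h4 : B * Real.sqrt (cutLength d r K * Y) ≤
      6 * wmax / Real.sqrt wmin * Real.sqrt (elemJump M d r v K) := by
    have hlam : lamK M d r K = B * cutLength d r K := by rw [lamK, hB]; ring
    have hBle : B * meshSize N ≤ 36 * wmax ^ 2 / wmin := by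
      have a0 := hw.supW_le 0
      have a1 := hw.supW_le 1
      have hDl := le_weightDenom (d := d) hw hmin hN K
      calc B * meshSize N ≤ wmax * wmax * meshSize N / (wmin * (meshSize N ^ 2 / 36)) * meshSize N := by
            rw [hB]; gcongr
        _ = 36 * wmax ^ 2 / wmin := by field_simp
    have e1 : 6 * wmax / Real.sqrt wmin = Real.sqrt (36 * wmax ^ 2 / wmin) := by
      rw [Real.sqrt_div (by positivity), show 36 * wmax ^ 2 = (6 * wmax) ^ 2 by ring,
        Real.sqrt_sq (by positivity)]
    rw [e1, ← Real.sqrt_mul (by positivity)]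
    refine Real.le_sqrt_of_sq_le ?_
    rw [mul_pow, Real.sq_sqrt (by positivity), elemJump, hlam, ← hY]
    calc B ^ 2 * (cutLength d r K * Y) =
        (B * meshSize N) * ((meshSize N)⁻¹ * (B * cutLength d r K) * Y) := by field_simp
      _ ≤ _ := by gcongr
  rw [h2] at h1
  refine h1.trans ?_
  calc m * I ≤ m * Real.sqrt (cutLength d r K * Y) := by gcongr
    _ = (8 * Real.sqrt affConst * Real.sqrt (elemEnergy d r kpar u K)) *
        (B * Real.sqrt (cutLength d r K * Y)) := by rw [hm]; ring
    _ ≤ (8 * Real.sqrt affConst * Real.sqrt (elemEnergy d r kpar u K)) *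
        (6 * wmax / Real.sqrt wmin * Real.sqrt (elemJump M d r v K)) := by gcongr
    _ = _ := by rw [Real.sqrt_div affConst_pos.le]; ring

end

end

section

variable {L N : ℕ}

/-! ## Bounded measurable functions of a real variable -/

/-- A bounded measurable function. -/
def IsTame (f : ℝ → ℝ) : Prop := Measurable f ∧ ∃ B : ℝ, ∀ t, |f t| ≤ B

namespace IsTame

variable {f g : ℝ → ℝ}

lemma integrableOn (hf : IsTame f) {S : Set ℝ} (hS : volume S ≠ ⊤) : IntegrableOn f S := by
  obtain ⟨hm, B, hB⟩ := hf
  exact Measure.integrableOn_of_bounded (M := B) hS hm.aestronglyMeasurable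
    (Eventually.of_forall hB)

lemma intervalIntegrable (hf : IsTame f) (a b : ℝ) : IntervalIntegrable f volume a b :=
  ⟨hf.integrableOn (by simp), hf.integrableOn (by simp)⟩

lemma add (hf : IsTame f) (hg : IsTame g) : IsTame fun t => f t + g t := by
  obtain ⟨hm, B, hB⟩ := hf
  obtain ⟨hm', B', hB'⟩ := hg
  exact ⟨hm.add hm', B + B', fun t => (abs_add_le _ _).trans (add_le_add (hB t) (hB' t))⟩

lemma const (c : ℝ) : IsTame fun _ => c := ⟨measurable_const, |c|, fun _ => le_rfl⟩

lemma const_mul (c : ℝ) (hf : IsTame f) : IsTame fun t => c * f t := by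
  obtain ⟨hm, B, hB⟩ := hf
  exact ⟨hm.const_mul c, |c| * B, fun t => by
    rw [abs_mul]; exact mul_le_mul_of_nonneg_left (hB t) (abs_nonneg _)⟩

lemma sq (hf : IsTame f) : IsTame fun t => f t ^ 2 := by
  obtain ⟨hm, B, hB⟩ := hf
  exact ⟨hm.pow_const 2, B ^ 2, fun t => by
    rw [abs_pow]; exact pow_le_pow_left₀ (abs_nonneg _) (hB t) 2⟩

lemma sqrt (hf : IsTame f) : IsTame fun t => Real.sqrt (f t) := by
  obtain ⟨hm, B, hB⟩ := hf
  exact ⟨hm.sqrt, Real.sqrt B, fun t => by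
    rw [abs_of_nonneg (Real.sqrt_nonneg _)]
    exact Real.sqrt_le_sqrt ((le_abs_self _).trans (hB t))⟩

lemma sum {ι : Type*} (s : Finset ι) {F : ι → ℝ → ℝ} (h : ∀ k ∈ s, IsTame (F k)) :
    IsTame fun t => ∑ k ∈ s, F k t := by
  classical
  induction s using Finset.induction_on with
  | empty => simpa using const 0
  | insert a s ha ih =>
    simp only [Finset.sum_insert ha]
    exact (h a (Finset.mem_insert_self _ _)).add
      (ih fun k hk => h k (Finset.mem_insert_of_mem hk))

lemma indicator (hf : IsTame f) {S : Set ℝ} (hS : MeasurableSet S) : IsTame (S.indicator f) := by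
  obtain ⟨hm, B, hB⟩ := hf
  refine ⟨hm.indicator hS, B, fun t => ?_⟩
  by_cases h : t ∈ S
  · rw [Set.indicator_of_mem h]; exact hB t
  · rw [Set.indicator_of_notMem h, abs_zero]; exact (abs_nonneg _).trans (hB t)

end IsTame

/-- Cauchy–Schwarz against the constant one, through the discriminant of `m ↦ ∫ (f - m)²`. -/
lemma sq_intervalIntegral_le {f : ℝ → ℝ} (hf : IsTame f) {a b : ℝ} (hab : a ≤ b) :
    (∫ t in a..b, f t) ^ 2 ≤ (b - a) * ∫ t in a..b, f t ^ 2 := by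
  have h : ∀ m : ℝ, 0 ≤ (b - a) * (m * m) + (-2 * ∫ t in a..b, f t) * m +
      ∫ t in a..b, f t ^ 2 := by
    intro m
    have h1 : 0 ≤ ∫ t in a..b, (f t - m) ^ 2 :=
      intervalIntegral.integral_nonneg hab fun _ _ => sq_nonneg _
    refine h1.trans_eq ?_
    have e : ∀ t, (f t - m) ^ 2 = m * m + (-2 * m) * f t + f t ^ 2 := fun t => by ring
    simp only [e]
    rw [intervalIntegral.integral_add
        (((IsTame.const (m * m)).add (hf.const_mul (-2 * m))).intervalIntegrable a b)
        (hf.sq.intervalIntegrable a b),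
      intervalIntegral.integral_add ((IsTame.const (m * m)).intervalIntegrable a b)
        ((hf.const_mul (-2 * m)).intervalIntegrable a b),
      intervalIntegral.integral_const, intervalIntegral.integral_const_mul, smul_eq_mul]
    ring
  have := discrim_le_zero h
  rw [discrim] at this
  nlinarith

/-! ## Variation of a finite element function along a curve -/

/-- The phase that turns the twisted gradient into a gradient. -/
def phase (kpar : ℝ) (x : Plane) : ℂ :=
  Complex.exp (Complex.I * affFn 0 (fun j => (waveVec kpar j : ℂ)) x)

lemma continuous_phase (kpar : ℝ) : Continuous (phase kpar) :=
  Complex.continuous_exp.comp (continuous_const.mul (continuous_affFn _ _))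

lemma norm_phase (kpar : ℝ) (x : Plane) : ‖phase kpar x‖ = 1 := by
  have e : affFn 0 (fun j => (waveVec kpar j : ℂ)) x =
      ((∑ j, waveVec kpar j * x j : ℝ) : ℂ) := by
    simp [affFn]
  rw [phase, e, mul_comm, Complex.norm_exp_ofReal_mul_I]

section

variable {d : Diagonal} {r kpar : ℝ} {u : Pair}

/-- The gradient of `phase * v` is `phase` times the twisted gradient of `v`. As the phase has
modulus one, the variation along a curve is bounded by the twisted gradient alone. -/
lemma exists_hasDerivAt_phase_mul (kpar : ℝ) {v : Plane → ℂ} {S : Set Plane} {c : ℂ} {b : Fin 2 → ℂ}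
    (h : ∀ x ∈ S, v x = affFn c b x) {γ : ℝ → Plane} {γ' : Plane} {s : ℝ} (hγ : HasDerivAt γ γ' s)
    (hs : γ s ∈ interior S) :
    ∃ D : ℂ, HasDerivAt (fun s => phase kpar (γ s) * v (γ s)) D s ∧
      ‖D‖ ≤ ‖γ'‖ * Real.sqrt (gradSq kpar v (γ s)) := by
  have h1 : HasDerivAt (fun s => v (γ s)) (affDeriv b γ') s :=
    (hasFDerivAt_of_affine h hs).comp_hasDerivAt s hγ
  have h2 : HasDerivAt (fun s => affFn 0 (fun j => (waveVec kpar j : ℂ)) (γ s))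
      (affDeriv (fun j => (waveVec kpar j : ℂ)) γ') s :=
    (hasFDerivAt_affFn 0 (fun j => (waveVec kpar j : ℂ)) (γ s)).comp_hasDerivAt s hγ
  have h3 := ((h2.const_mul Complex.I).cexp).mul h1
  refine ⟨_, h3, ?_⟩
  have e : Complex.exp (Complex.I * affFn 0 (fun j => (waveVec kpar j : ℂ)) (γ s)) *
        (Complex.I * affDeriv (fun j => (waveVec kpar j : ℂ)) γ') * v (γ s) +
      Complex.exp (Complex.I * affFn 0 (fun j => (waveVec kpar j : ℂ)) (γ s)) * affDeriv b γ' =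
      phase kpar (γ s) * ∑ j, twistedGrad kpar v (γ s) j * (γ' j : ℂ) := by
    have e1 : ∀ j, twistedGrad kpar v (γ s) j =
        b j + Complex.I * (waveVec kpar j : ℂ) * v (γ s) := by
      intro j
      rw [twistedGrad, (hasFDerivAt_of_affine h hs).fderiv]
      fin_cases j <;> simp [affDeriv_apply, Fin.sum_univ_two, waveVec]
    simp only [e1, affDeriv_apply, Fin.sum_univ_two, phase]
    ring
  rw [e, norm_mul, norm_phase, one_mul]
  have e2 : ‖∑ j, twistedGrad kpar v (γ s) j * (γ' j : ℂ)‖ ≤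
      ∑ j, ‖twistedGrad kpar v (γ s) j‖ * |γ' j| := by
    refine (norm_sum_le _ _).trans (Finset.sum_le_sum fun j _ => ?_)
    rw [norm_mul, Complex.norm_real, Real.norm_eq_abs]
  have e3 := Finset.sum_mul_sq_le_sq_mul_sq Finset.univ
    (fun j => ‖twistedGrad kpar v (γ s) j‖) fun j => |γ' j|
  have e4 : ∑ j, |γ' j| ^ 2 = ‖γ'‖ ^ 2 := by
    simp [norm_sq_plane, sq_abs]
  rw [e4] at e3
  refine e2.trans ?_
  rw [mul_comm, ← Real.sqrt_sq (norm_nonneg γ'), ← Real.sqrt_mul (gradSq_nonneg _ _ _)]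
  exact Real.le_sqrt_of_sq_le e3

lemma isTame_density_comp (hr : r < Real.sqrt 3 / 6) (kpar : ℝ) (hu : u ∈ Vh L N d r) (i : Fin 2)
    {γ : ℝ → Plane} (hγ : Continuous γ) : IsTame fun s => density L N d r kpar u i (γ s) := by
  obtain ⟨B, -, hB⟩ := exists_density_bound kpar hu i
  refine ⟨(measurable_density hr kpar hu i).comp hγ.measurable, B, fun t => ?_⟩
  rw [abs_of_nonneg (density_nonneg _ _ _)]
  exact hB _

/-- Variation along a curve within a subdomain. -/
lemma norm_phase_mul_sub_sq_le (hL : 0 < L) (hN : 0 < N) (hr : r < Real.sqrt 3 / 6)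
    (hu : u ∈ Vh L N d r) (i : Fin 2) {γ γ' : ℝ → Plane} {a b m : ℝ} (hab : a ≤ b)
    (hγ : ∀ s, HasDerivAt γ (γ' s) s) (hγ' : ∀ s, ‖γ' s‖ ≤ m)
    (hmem : ∀ s ∈ Set.Icc a b, γ s ∈ subdomain L r i)
    (hS : {s | γ s ∈ skeleton L N d}.Countable) :
    ‖phase kpar (γ b) * u i (γ b) - phase kpar (γ a) * u i (γ a)‖ ^ 2 ≤
      (b - a) * m ^ 2 * ∫ s in a..b, density L N d r kpar u i (γ s) := by
  set f : ℝ → ℂ := fun s => phase kpar (γ s) * u i (γ s) with hf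
  have hγc : Continuous γ := continuous_iff_continuousAt.2 fun s => (hγ s).continuousAt
  have htame := isTame_density_comp hr kpar hu i hγc
  have hcont : ContinuousOn f (Set.Icc a b) :=
    ((continuous_phase kpar).comp hγc).continuousOn.mul ((hu i).1.comp hγc.continuousOn
      fun s hs => subdomain_subset_coverDomain hL hN d r i (hmem s hs))
  have hder : ∀ s ∈ Set.Icc a b \ {s | γ s ∈ skeleton L N d}, ∃ D : ℂ, HasDerivAt f D s ∧
      ‖D‖ ≤ m * Real.sqrt (density L N d r kpar u i (γ s)) := by
    rintro s ⟨hs, hsS⟩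
    have hsi := hmem s hs
    obtain ⟨K, hK⟩ := exists_mem_tri hL hN d (subdomain_subset_cylinder r i hsi)
    have hKint : γ s ∈ interior (tri d K) := by
      by_contra h
      exact hsS ⟨K, hK, h⟩
    have hcov := mem_coverElems_of_mem hsi hK
    obtain ⟨c, β, hcβ⟩ := exists_affFn hu hcov
    obtain ⟨D, hD, hDn⟩ := exists_hasDerivAt_phase_mul kpar hcβ (hγ s) hKint
    refine ⟨D, hD, hDn.trans ?_⟩
    have e : density L N d r kpar u i (γ s) = gradSq kpar (u i) (γ s) :=
      Set.indicator_of_mem (show γ s ∈ coreSet L N d r i from ⟨hsi, Set.mem_biUnion hcov hKint⟩) _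
    rw [e]
    exact mul_le_mul_of_nonneg_right (hγ' s) (Real.sqrt_nonneg _)
  have hae : ∀ᵐ s : ℝ, s ∈ Set.Ioc a b → ‖deriv f s‖ ≤
      m * Real.sqrt (density L N d r kpar u i (γ s)) := by
    filter_upwards [hS.ae_notMem volume] with s hs hsab
    obtain ⟨D, hD, hDn⟩ := hder s ⟨Set.Ioc_subset_Icc_self hsab, hs⟩
    rwa [hD.deriv]
  have hg := (htame.sqrt.const_mul m)
  have hint : IntervalIntegrable (deriv f) volume a b := by
    refine (hg.intervalIntegrable a b).mono_fun (aestronglyMeasurable_deriv _ _) ?_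
    rw [Set.uIoc_of_le hab, EventuallyLE, ae_restrict_iff' measurableSet_Ioc]
    filter_upwards [hae] with s hs hsab
    exact (hs hsab).trans (le_abs_self _)
  -- Differentiability off the countably many parameters where the curve meets the skeleton is
  -- enough, since the function is continuous.
  have hftc : ∫ s in a..b, deriv f s = f b - f a :=
    integral_eq_of_hasDerivAt_off_countable_of_le f (deriv f) hab hS hcont
      (fun s hs => by
        obtain ⟨D, hD, -⟩ := hder s ⟨Set.Ioo_subset_Icc_self hs.1, hs.2⟩
        rwa [hD.deriv]) hint
  have h1 : ‖f b - f a‖ ≤ ∫ s in a..b, m * Real.sqrt (density L N d r kpar u i (γ s)) := by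
    rw [← hftc]
    exact intervalIntegral.norm_integral_le_of_norm_le hab hae (hg.intervalIntegrable a b)
  have h2 := sq_intervalIntegral_le hg hab
  have e : ∀ s, (m * Real.sqrt (density L N d r kpar u i (γ s))) ^ 2 =
      m ^ 2 * density L N d r kpar u i (γ s) := fun s => by
    rw [mul_pow, Real.sq_sqrt (density_nonneg _ _ _)]
  simp only [e] at h2
  rw [intervalIntegral.integral_const_mul (m ^ 2)] at h2
  calc ‖f b - f a‖ ^ 2 ≤ (∫ s in a..b, m * Real.sqrt (density L N d r kpar u i (γ s))) ^ 2 := by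
        gcongr
    _ ≤ _ := h2
    _ = _ := by ring

/-! ## Collars of the circles -/

/-- The energy on a part of a ray. -/
def rayEnergy (L N : ℕ) (d : Diagonal) (r kpar : ℝ) (u : Pair) (i : Fin 2) (x₀ : Plane) (α β t : ℝ) :
    ℝ := ∫ ρ in α..β, density L N d r kpar u i (x₀ + ρ • unitNormal t)

lemma continuous_polar (x₀ : Plane) : Continuous fun p : ℝ × ℝ => x₀ + p.1 • unitNormal p.2 := by
  have := continuous_unitNormal
  fun_prop

lemma isTame_ray (hr : r < Real.sqrt 3 / 6) (kpar : ℝ) (hu : u ∈ Vh L N d r) (i : Fin 2)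
    (x₀ : Plane) (t : ℝ) : IsTame fun ρ => density L N d r kpar u i (x₀ + ρ • unitNormal t) :=
  isTame_density_comp hr kpar hu i (by fun_prop)

lemma rayEnergy_nonneg (i : Fin 2) (x₀ : Plane) {α β : ℝ} (h : α ≤ β) (t : ℝ) :
    0 ≤ rayEnergy L N d r kpar u i x₀ α β t :=
  intervalIntegral.integral_nonneg h fun _ _ => density_nonneg _ _ _

lemma measurable_density_polar (hr : r < Real.sqrt 3 / 6) (kpar : ℝ) (hu : u ∈ Vh L N d r) (i : Fin 2)
    (x₀ : Plane) : Measurable fun p : ℝ × ℝ =>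
      density L N d r kpar u i (x₀ + p.1 • unitNormal p.2) :=
  (measurable_density hr kpar hu i).comp (continuous_polar x₀).measurable

lemma isTame_rayEnergy (hr : r < Real.sqrt 3 / 6) (kpar : ℝ) (hu : u ∈ Vh L N d r) (i : Fin 2)
    (x₀ : Plane) {α β : ℝ} (h : α ≤ β) : IsTame (rayEnergy L N d r kpar u i x₀ α β) := by
  obtain ⟨B, hB0, hB⟩ := exists_density_bound kpar hu i
  constructor
  · have hm : StronglyMeasurable (Function.uncurry fun t ρ : ℝ =>
        density L N d r kpar u i (x₀ + ρ • unitNormal t)) :=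
      ((measurable_density_polar hr kpar hu i x₀).comp measurable_swap).stronglyMeasurable
    have := (StronglyMeasurable.integral_prod_right (ν := volume.restrict (Set.Ioc α β)) hm).measurable
    convert this using 1
    ext t
    simp [rayEnergy, intervalIntegral.integral_of_le h]
  · refine ⟨B * |β - α|, fun t => ?_⟩
    have := intervalIntegral.norm_integral_le_of_norm_le_const (a := α) (b := β) (C := B)
      (f := fun ρ => density L N d r kpar u i (x₀ + ρ • unitNormal t)) fun ρ _ => by
        rw [Real.norm_of_nonneg (density_nonneg _ _ _)]; exact hB _
    exact this

lemma hasDerivAt_unitNormal (t : ℝ) :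
    HasDerivAt unitNormal (!₂[-Real.sin t, Real.cos t] : Plane) t := by
  have h : HasDerivAt (fun t : ℝ => ![Real.cos t, Real.sin t]) ![-Real.sin t, Real.cos t] t := by
    rw [hasDerivAt_pi]
    intro j
    fin_cases j
    · simpa using Real.hasDerivAt_cos t
    · simpa using Real.hasDerivAt_sin t
  exact (PiLp.hasFDerivAt_toLp 2 _).comp_hasDerivAt t h

lemma rayEnergy_mono (hr : r < Real.sqrt 3 / 6) (hu : u ∈ Vh L N d r) (i : Fin 2) (x₀ : Plane)
    {α β α' β' t : ℝ} (h1 : α ≤ α') (h2 : α' ≤ β') (h3 : β' ≤ β) :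
    rayEnergy L N d r kpar u i x₀ α' β' t ≤ rayEnergy L N d r kpar u i x₀ α β t :=
  intervalIntegral.integral_mono_interval h1 h2 h3
    (Eventually.of_forall fun _ => density_nonneg _ _ _)
    ((isTame_ray hr kpar hu i x₀ t).intervalIntegrable α β)

lemma ray_variation_le (hL : 0 < L) (hN : 0 < N) (hr : r < Real.sqrt 3 / 6)
    (hu : u ∈ Vh L N d r) (i : Fin 2) (x₀ : Plane) {α β t : ℝ} (ht : t ∉ edgeDirections L N d)
    (hmem : ∀ ρ ∈ Set.Icc α β, x₀ + ρ • unitNormal t ∈ subdomain L r i)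
    {ρ ρ' : ℝ} (hρ : ρ ∈ Set.Icc α β) (hρ' : ρ' ∈ Set.Icc α β) :
    ‖phase kpar (x₀ + ρ • unitNormal t) * u i (x₀ + ρ • unitNormal t) -
      phase kpar (x₀ + ρ' • unitNormal t) * u i (x₀ + ρ' • unitNormal t)‖ ^ 2 ≤
      (β - α) * rayEnergy L N d r kpar u i x₀ α β t := by
  wlog hle : ρ' ≤ ρ generalizing ρ ρ'
  · rw [norm_sub_rev]
    exact this hρ' hρ (le_of_not_ge hle)
  have hd : ∀ s, HasDerivAt (fun ρ : ℝ => x₀ + ρ • unitNormal t) (unitNormal t) s := by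
    intro s
    simpa using ((hasDerivAt_id s).smul_const (unitNormal t)).const_add x₀
  have h := norm_phase_mul_sub_sq_le (kpar := kpar) (m := 1) hL hN hr hu i hle hd
    (fun _ => (norm_unitNormal t).le)
    (fun s hs => hmem s ⟨hρ'.1.trans hs.1, hs.2.trans hρ.2⟩) (countable_ray_skeleton hN x₀ ht)
  refine h.trans ?_
  rw [one_pow, mul_one]
  have h1 := rayEnergy_mono (kpar := kpar) hr hu i x₀ (t := t) hρ'.1 hle hρ.2
  have h2 := rayEnergy_nonneg (d := d) (N := N) (L := L) (r := r) (kpar := kpar) (u := u) i x₀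
    (hρ'.1.trans (hle.trans hρ.2)) t
  have h3 := rayEnergy_nonneg (d := d) (N := N) (L := L) (r := r) (kpar := kpar) (u := u) i x₀
    hle t
  exact mul_le_mul (by linarith [hρ.2, hρ'.1]) h1 h3 (by linarith [hρ.2, hρ'.1])

lemma arc_variation_le (hL : 0 < L) (hN : 0 < N) (hr : r < Real.sqrt 3 / 6)
    (hu : u ∈ Vh L N d r) (i : Fin 2) (x₀ : Plane) {ρ a b : ℝ} (hρ : 0 < ρ) (hρ1 : ρ ≤ 1)
    (hab : a ≤ b) (hmem : ∀ t ∈ Set.Icc a b, x₀ + ρ • unitNormal t ∈ subdomain L r i) :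
    ‖phase kpar (x₀ + ρ • unitNormal b) * u i (x₀ + ρ • unitNormal b) -
      phase kpar (x₀ + ρ • unitNormal a) * u i (x₀ + ρ • unitNormal a)‖ ^ 2 ≤
      (b - a) * ∫ t in a..b, density L N d r kpar u i (x₀ + ρ • unitNormal t) := by
  have hd : ∀ s, HasDerivAt (fun t : ℝ => x₀ + ρ • unitNormal t)
      (ρ • (!₂[-Real.sin s, Real.cos s] : Plane)) s := fun s =>
    ((hasDerivAt_unitNormal s).const_smul ρ).const_add x₀
  have hn : ∀ s, ‖ρ • (!₂[-Real.sin s, Real.cos s] : Plane)‖ ≤ 1 := by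
    intro s
    have : ‖(!₂[-Real.sin s, Real.cos s] : Plane)‖ = 1 := by
      rw [← sq_eq_sq₀ (norm_nonneg _) zero_le_one, norm_sq_plane]
      simp
    rw [norm_smul, this, mul_one, Real.norm_of_nonneg hρ.le]
    exact hρ1
  have h := norm_phase_mul_sub_sq_le (kpar := kpar) hL hN hr hu i hab hd hn hmem
    (countable_circle_skeleton hN d x₀ hρ.ne')
  simpa using h

lemma add_three_sq_le (a b c : ℝ) : (a + b + c) ^ 2 ≤ 3 * (a ^ 2 + b ^ 2 + c ^ 2) := by
  nlinarith [sq_nonneg (a - b), sq_nonneg (b - c), sq_nonneg (a - c)]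

/-- Variation along a circle, measured through a collar. -/
lemma collar_variation_le (hL : 0 < L) (hN : 0 < N) (hr : r < Real.sqrt 3 / 6)
    (hu : u ∈ Vh L N d r) (i : Fin 2) (x₀ : Plane) {α β a b : ℝ} (hα : 0 < α) (hαβ : α < β)
    (hβ : β ≤ 1) (hab : a ≤ b) (ha : a ∉ edgeDirections L N d) (hb : b ∉ edgeDirections L N d)
    (hmem : ∀ ρ ∈ Set.Icc α β, ∀ t ∈ Set.Icc a b, x₀ + ρ • unitNormal t ∈ subdomain L r i)
    {ρ₀ : ℝ} (hρ₀ : ρ₀ ∈ Set.Icc α β) :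
    ‖phase kpar (x₀ + ρ₀ • unitNormal b) * u i (x₀ + ρ₀ • unitNormal b) -
      phase kpar (x₀ + ρ₀ • unitNormal a) * u i (x₀ + ρ₀ • unitNormal a)‖ ^ 2 ≤
      3 * (β - α) * (rayEnergy L N d r kpar u i x₀ α β a + rayEnergy L N d r kpar u i x₀ α β b) +
        3 * ((b - a) / (β - α)) * ∫ t in a..b, rayEnergy L N d r kpar u i x₀ α β t := by
  set V : ℝ → ℝ → ℂ := fun ρ t => phase kpar (x₀ + ρ • unitNormal t) * u i (x₀ + ρ • unitNormal t)
    with hV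
  set Q := rayEnergy L N d r kpar u i x₀ α β with hQ
  set A : ℝ → ℝ := fun ρ => ∫ t in a..b, density L N d r kpar u i (x₀ + ρ • unitNormal t) with hA
  obtain ⟨B, hB0, hB⟩ := exists_density_bound kpar hu i
  have hswap : ∫ ρ in α..β, A ρ = ∫ t in a..b, Q t := by
    have hi : Integrable (Function.uncurry fun (ρ t : ℝ) =>
        density L N d r kpar u i (x₀ + ρ • unitNormal t))
        ((volume.restrict (Set.uIoc α β)).prod (volume.restrict (Set.Ioc a b))) := by
      rw [Set.uIoc_of_le hαβ.le]
      refine Integrable.of_bound (C := B)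
        (measurable_density_polar hr kpar hu i x₀).aestronglyMeasurable ?_
      filter_upwards with p
      rw [Function.uncurry, Real.norm_of_nonneg (density_nonneg _ _ _)]
      exact hB _
    have := intervalIntegral_integral_swap hi
    simp only [hA, hQ, rayEnergy, intervalIntegral.integral_of_le hab]
    exact this
  -- For any radius `ρ` in the collar the path goes along the ray at `a` to radius `ρ`, along the
  -- arc of radius `ρ`, and back along the ray at `b`. Averaging over `ρ` turns the arc term into an
  -- integral over an area, which the bulk energy controls.
  have hpt : ∀ ρ ∈ Set.Icc α β, ‖V ρ₀ b - V ρ₀ a‖ ^ 2 ≤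
      3 * (β - α) * (Q a + Q b) + 3 * (b - a) * A ρ := by
    intro ρ hρ
    have h1 := ray_variation_le (kpar := kpar) hL hN hr hu i x₀ hb
      (fun ρ hρ => hmem ρ hρ b (Set.right_mem_Icc.2 hab)) hρ₀ hρ
    have h2 := arc_variation_le (kpar := kpar) hL hN hr hu i x₀ (hα.trans_le hρ.1)
      (hρ.2.trans hβ) hab (hmem ρ hρ)
    have h3 := ray_variation_le (kpar := kpar) hL hN hr hu i x₀ ha
      (fun ρ hρ => hmem ρ hρ a (Set.left_mem_Icc.2 hab)) hρ hρ₀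
    have htri : ‖V ρ₀ b - V ρ₀ a‖ ≤ ‖V ρ₀ b - V ρ b‖ + ‖V ρ b - V ρ a‖ + ‖V ρ a - V ρ₀ a‖ := by
      have e : V ρ₀ b - V ρ₀ a = (V ρ₀ b - V ρ b) + (V ρ b - V ρ a) + (V ρ a - V ρ₀ a) := by ring
      rw [e]
      exact norm_add₃_le
    calc ‖V ρ₀ b - V ρ₀ a‖ ^ 2 ≤
        (‖V ρ₀ b - V ρ b‖ + ‖V ρ b - V ρ a‖ + ‖V ρ a - V ρ₀ a‖) ^ 2 := by gcongr
      _ ≤ 3 * (‖V ρ₀ b - V ρ b‖ ^ 2 + ‖V ρ b - V ρ a‖ ^ 2 + ‖V ρ a - V ρ₀ a‖ ^ 2) :=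
          add_three_sq_le _ _ _
      _ ≤ 3 * ((β - α) * Q b + (b - a) * A ρ + (β - α) * Q a) := by gcongr
      _ = _ := by ring
  have hAi : IntervalIntegrable A volume α β := by
    have hm : StronglyMeasurable (Function.uncurry fun ρ t : ℝ =>
        density L N d r kpar u i (x₀ + ρ • unitNormal t)) :=
      (measurable_density_polar hr kpar hu i x₀).stronglyMeasurable
    have hm' := (StronglyMeasurable.integral_prod_right (ν := volume.restrict (Set.Ioc a b)) hm)
    have hA' : IsTame A := by
      refine ⟨?_, B * |b - a|, fun ρ => ?_⟩
      · convert hm'.measurable using 1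
        ext ρ
        simp [hA, intervalIntegral.integral_of_le hab]
      · exact intervalIntegral.norm_integral_le_of_norm_le_const (a := a) (b := b) (C := B)
          (f := fun t => density L N d r kpar u i (x₀ + ρ • unitNormal t)) fun t _ => by
            rw [Real.norm_of_nonneg (density_nonneg _ _ _)]; exact hB _
    exact hA'.intervalIntegrable α β
  have hint := intervalIntegral.integral_mono_on hαβ.le
    (intervalIntegrable_const (c := ‖V ρ₀ b - V ρ₀ a‖ ^ 2))
    (intervalIntegrable_const.add (hAi.const_mul (3 * (b - a)))) hpt
  rw [intervalIntegral.integral_const, intervalIntegral.integral_add intervalIntegrable_const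
    (hAi.const_mul (3 * (b - a))), intervalIntegral.integral_const,
    intervalIntegral.integral_const_mul, hswap, smul_eq_mul, smul_eq_mul] at hint
  have hs : 0 < β - α := sub_pos.2 hαβ
  refine le_of_mul_le_mul_left (hint.trans_eq ?_) hs
  field_simp

end

end

section

variable {L N : ℕ}

/-! ## Polar coordinates -/

lemma lintegral_plane (f : Plane → ENNReal) :
    ∫⁻ x, f x = ∫⁻ p : ℝ × ℝ, f (!₂[p.1, p.2]) := by
  have h1 := (PiLp.volume_preserving_toLp (Fin 2)).lintegral_comp_emb
    (MeasurableEquiv.toLp 2 (Fin 2 → ℝ)).measurableEmbedding f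
  have h2 := (volume_preserving_finTwoArrow ℝ).symm.lintegral_comp_emb
    (MeasurableEquiv.finTwoArrow (α := ℝ)).symm.measurableEmbedding
    (fun y : Fin 2 → ℝ => f (WithLp.toLp 2 y))
  rw [← h1, ← h2]
  rfl

/-- The Jacobian of polar coordinates is at least `α` for radii above `α`. -/
lemma lintegral_polar_le {f : Plane → ENNReal} (x₀ : Plane) {α β : ℝ} (hα : 0 < α) :
    ENNReal.ofReal α * ∫⁻ p in Set.Ioo α β ×ˢ Set.Ioo (-Real.pi) Real.pi,
      f (x₀ + p.1 • unitNormal p.2) ≤ ∫⁻ x, f x := by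
  have hshift : ∫⁻ x, f x = ∫⁻ x, f (x₀ + x) := (lintegral_add_left_eq_self f x₀).symm
  rw [hshift, lintegral_plane, ← lintegral_comp_polarCoord_symm,
    ← lintegral_const_mul' _ _ ENNReal.ofReal_ne_top]
  have hsub : Set.Ioo α β ×ˢ Set.Ioo (-Real.pi) Real.pi ⊆ polarCoord.target := by
    intro p hp
    exact ⟨hα.trans hp.1.1, hp.2⟩
  refine le_trans ?_ (lintegral_mono_set hsub)
  refine setLIntegral_mono' (measurableSet_Ioo.prod measurableSet_Ioo) fun p hp => ?_
  have e : x₀ + p.1 • unitNormal p.2 =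
      x₀ + !₂[(polarCoord.symm p).1, (polarCoord.symm p).2] := by
    congr 1
    ext j
    fin_cases j <;> simp [unitNormal, polarCoord]
  rw [smul_eq_mul, e]
  gcongr
  exact hp.1.1.le

lemma unitNormal_periodic : Function.Periodic unitNormal (2 * Real.pi) := by
  intro t
  simp [unitNormal]

lemma circlePoint_periodic (r : ℝ) (c : Circles L) :
    Function.Periodic (circlePoint r c) (2 * Real.pi) := by
  intro t
  rw [circlePoint, circlePoint, unitNormal_periodic t]

section

variable {d : Diagonal} {r kpar : ℝ} {u : Pair}

lemma rayEnergy_periodic (i : Fin 2) (x₀ : Plane) (α β : ℝ) :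
    Function.Periodic (rayEnergy L N d r kpar u i x₀ α β) (2 * Real.pi) := by
  intro t
  simp only [rayEnergy, unitNormal_periodic t]

/-- Polar coordinates about `x₀`. In the application the radii are at least `r₀ / 2`, which keeps
the factor `α⁻¹` uniform. -/
lemma integral_rayEnergy_le (hL : 0 < L) (hN : 0 < N) (hr : r < Real.sqrt 3 / 6)
    (hu : u ∈ Vh L N d r) (i : Fin 2) (x₀ : Plane) {α β : ℝ} (hα : 0 < α) (hαβ : α ≤ β) :
    ∫ t in (0)..(2 * Real.pi), rayEnergy L N d r kpar u i x₀ α β t ≤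
      α⁻¹ * ∫ x in subdomain L r i, gradSq kpar (u i) x := by
  have hpi := Real.pi_pos
  obtain ⟨B, hB0, hB⟩ := exists_density_bound kpar hu i
  have hm := measurable_density_polar hr kpar hu i x₀
  have hper := (rayEnergy_periodic (L := L) (N := N) (d := d) (r := r) (kpar := kpar) (u := u) i x₀
    α β).intervalIntegral_add_eq 0 (-Real.pi)
  rw [zero_add, show -Real.pi + 2 * Real.pi = Real.pi by ring] at hper
  rw [hper, ← integral_density (d := d) (N := N) hL hN hr, inv_mul_eq_div, le_div_iff₀ hα]
  have hIoo : volume (Set.Ioo α β ×ˢ Set.Ioo (-Real.pi) Real.pi) < ⊤ := by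
    rw [Measure.volume_eq_prod, Measure.prod_prod, Real.volume_Ioo, Real.volume_Ioo]
    exact ENNReal.mul_lt_top ENNReal.ofReal_lt_top ENNReal.ofReal_lt_top
  have hi : IntegrableOn (fun p : ℝ × ℝ => density L N d r kpar u i (x₀ + p.1 • unitNormal p.2))
      (Set.Ioo α β ×ˢ Set.Ioo (-Real.pi) Real.pi) := by
    refine Measure.integrableOn_of_bounded (M := B) hIoo.ne hm.aestronglyMeasurable ?_
    filter_upwards with p
    rw [Real.norm_of_nonneg (density_nonneg _ _ _)]
    exact hB _
  have e1 : ∫ t in (-Real.pi)..Real.pi, rayEnergy L N d r kpar u i x₀ α β t =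
      ∫ p in Set.Ioo α β ×ˢ Set.Ioo (-Real.pi) Real.pi,
        density L N d r kpar u i (x₀ + p.1 • unitNormal p.2) := by
    rw [Measure.volume_eq_prod] at hi ⊢
    have e2 := setIntegral_prod _ hi.swap
    rw [← setIntegral_prod_swap]
    refine Eq.trans ?_ e2.symm
    rw [intervalIntegral.integral_of_le (by linarith), integral_Ioc_eq_integral_Ioo]
    simp only [rayEnergy, intervalIntegral.integral_of_le hαβ, integral_Ioc_eq_integral_Ioo]
    rfl
  rw [e1]
  have h1 := integral_eq_lintegral_of_nonneg_ae
    (Eventually.of_forall fun p : ℝ × ℝ => density_nonneg (L := L) (N := N) (d := d) (r := r)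
      (u := u) kpar i (x₀ + p.1 • unitNormal p.2)) hm.aestronglyMeasurable
      (μ := volume.restrict (Set.Ioo α β ×ˢ Set.Ioo (-Real.pi) Real.pi))
  have h2 := integral_eq_lintegral_of_nonneg_ae
    (Eventually.of_forall fun x : Plane => density_nonneg (L := L) (N := N) (d := d) (r := r)
      (u := u) kpar i x) (measurable_density hr kpar hu i).aestronglyMeasurable (μ := volume)
  have hmul : ∀ X : ENNReal, X.toReal * α = (ENNReal.ofReal α * X).toReal := fun X => by
    rw [ENNReal.toReal_mul, ENNReal.toReal_ofReal hα.le, mul_comm]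
  rw [h1, h2, hmul]
  have hfin := (integrable_density hr kpar hu i).lintegral_lt_top
  exact ENNReal.toReal_mono hfin.ne (lintegral_polar_le
    (f := fun x => ENNReal.ofReal (density L N d r kpar u i x)) x₀ hα)

/-- The window may run past the end of `(0, 2π]`. By periodicity any full period carries the same
measure. -/
lemma volume_window_le (c : Circles L) {S : Set Plane} (hS : MeasurableSet S) (t : ℝ) {τ : ℝ}
    (hτ0 : 0 ≤ τ) (hτ : τ ≤ 2 * Real.pi) :
    (volume {s | s ∈ Set.Ioc t (t + τ) ∧ circlePoint r c s ∈ S}).toReal ≤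
      (volume (arcSet r c S)).toReal := by
  have hm : MeasurableSet {s | circlePoint r c s ∈ S} := (continuous_circlePoint r c).measurable hS
  set f : ℝ → ℝ := {s | circlePoint r c s ∈ S}.indicator fun _ => 1 with hf
  have hper : Function.Periodic f (2 * Real.pi) := by
    classical
    intro s
    simp only [hf, Set.indicator_apply, Set.mem_ofPred_eq, circlePoint_periodic r c s]
  have hvol : ∀ a b : ℝ, a ≤ b →
      (volume {s | s ∈ Set.Ioc a b ∧ circlePoint r c s ∈ S}).toReal = ∫ s in a..b, f s := by
    intro a b hab
    rw [intervalIntegral.integral_of_le hab, hf, setIntegral_indicator hm, setIntegral_const]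
    simp only [Measure.real, smul_eq_mul, mul_one]
    rfl
  have h2pi : (0 : ℝ) ≤ 2 * Real.pi := by positivity
  rw [hvol _ _ (by linarith)]
  have h1 : (volume (arcSet r c S)).toReal = ∫ s in (0)..(2 * Real.pi), f s := hvol _ _ h2pi
  have h2 := hper.intervalIntegral_add_eq 0 t
  rw [zero_add] at h2
  rw [h1, h2]
  have htame : IsTame f := (IsTame.const 1).indicator hm
  refine intervalIntegral.integral_mono_interval le_rfl (by linarith) (by linarith)
    (Eventually.of_forall fun s => ?_) (htame.intervalIntegrable _ _)
  exact Set.indicator_nonneg (fun _ _ => zero_le_one) s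

/-! ## The jump along a circle -/

/-- The squared jump along a circle. -/
def jumpSq (r : ℝ) (u : Pair) (c : Circles L) (t : ℝ) : ℝ := ‖jump u (circlePoint r c t)‖ ^ 2

/-- The squared jump along a circle, weighted with the relative length of the cut. -/
def weightedJump (N : ℕ) (d : Diagonal) (r : ℝ) (u : Pair) (c : Circles L) (t : ℝ) : ℝ :=
  ∑ K ∈ interfaceElems L N d r, {s | circlePoint r c s ∈ tri d K}.indicator
    (fun s => cutLength d r K / meshSize N * jumpSq r u c s) t

/-- The energies of the elements along a circle. -/
def energyAlong (N : ℕ) (d : Diagonal) (r kpar : ℝ) (u : Pair) (c : Circles L) (t : ℝ) : ℝ :=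
  ∑ K ∈ interfaceElems L N d r, {s | circlePoint r c s ∈ tri d K}.indicator
    (fun _ => elemEnergy d r kpar u K) t

/-- The energy of component `i` on the part of a ray in the collar of width `σ`. -/
def collarEnergy (N : ℕ) (d : Diagonal) (r kpar σ : ℝ) (u : Pair) (i : Fin 2) (c : Circles L)
    (t : ℝ) : ℝ :=
  rayEnergy L N d r kpar u i (circleCenter c) (if i = 0 then r - σ else r)
    (if i = 0 then r else r + σ) t

lemma jumpSq_nonneg (c : Circles L) (t : ℝ) : 0 ≤ jumpSq r u c t := by unfold jumpSq; positivity

lemma measurableSet_circle_tri (r : ℝ) (c : Circles L) (K : Elem L N) :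
    MeasurableSet {s | circlePoint r c s ∈ tri d K} :=
  (continuous_circlePoint r c).measurable (measurableSet_tri d K)

lemma jumpSq_periodic (c : Circles L) : Function.Periodic (jumpSq r u c) (2 * Real.pi) := by
  intro t
  rw [jumpSq, jumpSq, circlePoint_periodic r c t]

lemma weightedJump_periodic (c : Circles L) :
    Function.Periodic (weightedJump N d r u c) (2 * Real.pi) := by
  classical
  intro t
  simp only [weightedJump, Set.indicator_apply, Set.mem_ofPred_eq, circlePoint_periodic r c t,
    jumpSq_periodic c t]

lemma collarEnergy_periodic (σ : ℝ) (i : Fin 2) (c : Circles L) :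
    Function.Periodic (collarEnergy N d r kpar σ u i c) (2 * Real.pi) :=
  rayEnergy_periodic _ _ _ _

lemma weightedJump_nonneg (hr : 0 ≤ r) (hN : 0 < N) (c : Circles L) (t : ℝ) :
    0 ≤ weightedJump N d r u c t := by
  refine Finset.sum_nonneg fun K _ => Set.indicator_nonneg (fun s _ => ?_) t
  have := cutLength_nonneg hr d K
  have := meshSize_pos hN
  have := jumpSq_nonneg (r := r) (u := u) c s
  positivity

lemma energyAlong_nonneg (c : Circles L) (t : ℝ) : 0 ≤ energyAlong N d r kpar u c t :=
  Finset.sum_nonneg fun _ _ => Set.indicator_nonneg (fun _ _ => elemEnergy_nonneg _) t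

lemma collarEnergy_nonneg {σ : ℝ} (hσ : 0 ≤ σ) (i : Fin 2) (c : Circles L) (t : ℝ) :
    0 ≤ collarEnergy N d r kpar σ u i c t :=
  rayEnergy_nonneg i _ (by split_ifs <;> linarith) t

lemma isTame_collarEnergy (hr : r < Real.sqrt 3 / 6) (hu : u ∈ Vh L N d r) {σ : ℝ} (hσ : 0 ≤ σ)
    (i : Fin 2) (c : Circles L) : IsTame (collarEnergy N d r kpar σ u i c) :=
  isTame_rayEnergy hr kpar hu i _ (by split_ifs <;> linarith)

lemma isTame_of_periodic {f : ℝ → ℝ} (hf : Continuous f) {T : ℝ} (hT : 0 < T)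
    (h : Function.Periodic f T) : IsTame f := by
  obtain ⟨B, hB⟩ := isCompact_Icc.exists_bound_of_continuousOn (hf.continuousOn (s := Set.Icc 0 T))
  refine ⟨hf.measurable, B, fun t => ?_⟩
  obtain ⟨s, hs, e⟩ := h.exists_mem_Ico₀ hT t
  rw [e]
  exact hB s ⟨hs.1, hs.2.le⟩

lemma isTame_jumpSq (hL : 0 < L) (hN : 0 < N) (hr0 : 0 < r) (hr : r < Real.sqrt 3 / 6)
    (hu : u ∈ Vh L N d r) (c : Circles L) : IsTame (jumpSq r u c) :=
  isTame_of_periodic ((continuous_jump hL hN hr0 hr hu c).norm.pow 2)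
    (by positivity : (0 : ℝ) < 2 * Real.pi) (jumpSq_periodic c)

lemma isTame_weightedJump (hL : 0 < L) (hN : 0 < N) (hr0 : 0 < r) (hr : r < Real.sqrt 3 / 6)
    (hu : u ∈ Vh L N d r) (c : Circles L) : IsTame (weightedJump N d r u c) :=
  IsTame.sum _ fun K _ => ((isTame_jumpSq hL hN hr0 hr hu c).const_mul _).indicator
    (measurableSet_circle_tri r c K)

lemma isTame_energyAlong (c : Circles L) : IsTame (energyAlong N d r kpar u c) :=
  IsTame.sum _ fun K _ => (IsTame.const _).indicator (measurableSet_circle_tri r c K)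

lemma le_weightedJump (hr0 : 0 ≤ r) (hr : r < Real.sqrt 3 / 6) (hN : 0 < N) (c : Circles L) {t : ℝ}
    {K : Elem L N} (hK : circlePoint r c t ∈ tri d K) :
    cutLength d r K / meshSize N * jumpSq r u c t ≤ weightedJump N d r u c t := by
  have hKi := mem_interfaceElems (circlePoint_mem_interface hr0 hr c t) hK
  have h := Finset.single_le_sum (f := fun K => {s | circlePoint r c s ∈ tri d K}.indicator
    (fun s => cutLength d r K / meshSize N * jumpSq r u c s) t) (fun K _ => ?_) hKi
  · refine le_trans (le_of_eq ?_) h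
    exact (Set.indicator_of_mem (M := ℝ) (s := {s | circlePoint r c s ∈ tri d K}) hK
      (fun s => cutLength d r K / meshSize N * jumpSq r u c s)).symm
  · refine Set.indicator_nonneg (fun s _ => ?_) t
    have := cutLength_nonneg hr0 d K
    have := meshSize_pos hN
    have := jumpSq_nonneg (r := r) (u := u) c s
    positivity

lemma le_energyAlong (hr0 : 0 ≤ r) (hr : r < Real.sqrt 3 / 6) (c : Circles L) {t : ℝ}
    {K : Elem L N} (hK : circlePoint r c t ∈ tri d K) :
    elemEnergy d r kpar u K ≤ energyAlong N d r kpar u c t := by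
  have hKi := mem_interfaceElems (circlePoint_mem_interface hr0 hr c t) hK
  have h := Finset.single_le_sum (f := fun K => {s | circlePoint r c s ∈ tri d K}.indicator
    (fun _ => elemEnergy d r kpar u K) t)
    (fun K _ => Set.indicator_nonneg (fun _ _ => elemEnergy_nonneg _) t) hKi
  refine le_trans (le_of_eq ?_) h
  exact (Set.indicator_of_mem (M := ℝ) (s := {s | circlePoint r c s ∈ tri d K}) hK
    (fun _ => elemEnergy d r kpar u K)).symm

/-- Some element contains a definite portion of a short arc. -/
lemma exists_good_elem (hL : 0 < L) (hN : 0 < N) (hr0 : 0 < r) (hr : r < Real.sqrt 3 / 6)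
    (d : Diagonal) (c : Circles L) (t : ℝ) {τ : ℝ} (hτ : 0 < τ) (hτh : τ ≤ meshSize N) :
    ∃ K : Elem L N, τ / 72 ≤
      (volume {s | s ∈ Set.Ioc t (t + τ) ∧ circlePoint r c s ∈ tri d K}).toReal := by
  classical
  have hr1 : r ≤ 1 := by linarith [sqrt_three_lt]
  set S : Elem L N → Set ℝ := fun K => {s | s ∈ Set.Ioc t (t + τ) ∧ circlePoint r c s ∈ tri d K}
    with hS
  have hfin : ∀ K, volume (S K) ≠ ⊤ := fun K =>
    ((measure_mono fun s hs => hs.1).trans_lt (measure_Ioc_lt_top (a := t) (b := t + τ))).ne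
  set F : Finset (Elem L N) := Finset.univ.filter fun K => (S K).Nonempty with hF
  -- All points of the arc are within distance `h` of its initial point, so at most 72 elements
  -- share the arc, and one of them contains at least `1 / 72` of it.
  have hcard : F.card ≤ 72 := by
    refine card_elems_near_le hN d (circlePoint r c t) F fun K hK => ?_
    obtain ⟨s, hs⟩ := (Finset.mem_filter.1 hK).2
    refine ⟨circlePoint r c s, hs.2, ?_⟩
    rw [norm_circlePoint_sub hr0.le, norm_unitNormal_sub]
    have h1 : |Real.sin ((s - t) / 2)| ≤ |(s - t) / 2| := Real.abs_sin_le_abs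
    have h2 : |(s - t) / 2| ≤ τ / 2 := by
      rw [abs_of_nonneg (by linarith [hs.1.1])]
      linarith [hs.1.2]
    nlinarith [abs_nonneg (Real.sin ((s - t) / 2))]
  have hcover : Set.Ioc t (t + τ) ⊆ ⋃ K ∈ F, S K := by
    intro s hs
    obtain ⟨K, hK⟩ := exists_mem_tri hL hN d
      (subdomain_subset_cylinder r 0 (circlePoint_mem_subdomain hr0.le hr c s 0))
    have : s ∈ S K := ⟨hs, hK⟩
    exact Set.mem_biUnion (Finset.mem_filter.2 ⟨Finset.mem_univ K, s, this⟩) this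
  by_contra! hlt
  have h1 : τ ≤ ∑ K ∈ F, (volume (S K)).toReal := by
    have h2 := (measure_mono hcover).trans (measure_biUnion_finset_le (μ := volume) F S)
    rw [Real.volume_Ioc, add_sub_cancel_left] at h2
    have h3 := ENNReal.toReal_mono (ENNReal.sum_ne_top.2 fun K _ => hfin K) h2
    rwa [ENNReal.toReal_ofReal hτ.le, ENNReal.toReal_sum fun K _ => hfin K] at h3
  have hne : F.Nonempty := by
    rw [Finset.nonempty_iff_ne_empty]
    intro h0
    rw [h0, Finset.sum_empty] at h1
    linarith
  have h2 : ∑ K ∈ F, (volume (S K)).toReal < ∑ K ∈ F, τ / 72 :=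
    Finset.sum_lt_sum_of_nonempty hne fun K _ => hlt K
  rw [Finset.sum_const, nsmul_eq_mul] at h2
  have h3 : (F.card : ℝ) * (τ / 72) ≤ 72 * (τ / 72) := by
    gcongr
    exact_mod_cast hcard
  linarith

/-- Both components carry the same phase, so the modulus of the jump is unchanged while each
component can be followed on its own side. -/
lemma norm_jump_eq (kpar : ℝ) (u : Pair) (x : Plane) :
    ‖jump u x‖ = ‖phase kpar x * u 0 x - phase kpar x * u 1 x‖ := by
  rw [← mul_sub, norm_mul, norm_phase, one_mul, jump]

/-- Comparison of the jumps at two points of an arc with a collar. -/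
lemma jumpSq_le_of_collar (hL : 0 < L) (hN : 0 < N) (hr : r < Real.sqrt 3 / 6)
    (hu : u ∈ Vh L N d r) (c : Circles L) {t τ σ : ℝ} (hσ : 0 < σ) (hσr : σ < r)
    (hσ1 : r + σ ≤ 1) (ht : t ∉ edgeDirections L N d)
    (hmem : ∀ ρ ∈ Set.Icc r (r + σ), ∀ s ∈ Set.Icc t (t + τ),
      circleCenter c + ρ • unitNormal s ∈ subdomain L r 1)
    {s : ℝ} (hs : s ∈ Set.Ioc t (t + τ)) (hs' : s ∉ edgeDirections L N d) :
    jumpSq r u c t ≤ 3 * jumpSq r u c s + ∑ i : Fin 2,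
      (9 * σ * (collarEnergy N d r kpar σ u i c t + collarEnergy N d r kpar σ u i c s) +
        9 * (τ / σ) * ∫ y in t..(t + τ), collarEnergy N d r kpar σ u i c y) := by
  set V : Fin 2 → ℝ → ℂ := fun i t => phase kpar (circlePoint r c t) * u i (circlePoint r c t)
    with hV
  have hτ : 0 ≤ τ := by linarith [hs.1, hs.2]
  have hD : ∀ i : Fin 2, ‖V i s - V i t‖ ^ 2 ≤
      3 * σ * (collarEnergy N d r kpar σ u i c t + collarEnergy N d r kpar σ u i c s) +
        3 * (τ / σ) * ∫ y in t..(t + τ), collarEnergy N d r kpar σ u i c y := by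
    intro i
    have hlen : (if i = 0 then r else r + σ) - (if i = 0 then r - σ else r) = σ := by
      split_ifs <;> ring
    have h := collar_variation_le (kpar := kpar) hL hN hr hu i (circleCenter c)
      (α := if i = 0 then r - σ else r) (β := if i = 0 then r else r + σ) (a := t) (b := s)
      (by split_ifs <;> linarith) (by split_ifs <;> linarith) (by split_ifs <;> linarith)
      hs.1.le ht hs' ?_ (ρ₀ := r) ⟨by split_ifs <;> linarith, by split_ifs <;> linarith⟩
    · rw [hlen] at h
      refine h.trans ?_
      have htame := isTame_collarEnergy (kpar := kpar) hr hu hσ.le i c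
      have hmono : ∫ y in t..s, collarEnergy N d r kpar σ u i c y ≤
          ∫ y in t..(t + τ), collarEnergy N d r kpar σ u i c y :=
        intervalIntegral.integral_mono_interval le_rfl hs.1.le hs.2
          (Eventually.of_forall fun y => collarEnergy_nonneg hσ.le i c y)
          (htame.intervalIntegrable _ _)
      have hnn : 0 ≤ ∫ y in t..s, collarEnergy N d r kpar σ u i c y :=
        intervalIntegral.integral_nonneg hs.1.le fun y _ => collarEnergy_nonneg hσ.le i c y
      change 3 * σ * (collarEnergy N d r kpar σ u i c t + collarEnergy N d r kpar σ u i c s) +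
        3 * ((s - t) / σ) * ∫ y in t..s, collarEnergy N d r kpar σ u i c y ≤ _
      have : s - t ≤ τ := by linarith [hs.2]
      gcongr
    · intro ρ hρ y hy
      have hy' : y ∈ Set.Icc t (t + τ) := ⟨hy.1, hy.2.trans hs.2⟩
      by_cases hi : i = 0
      · subst hi
        simp only [if_true] at hρ
        have hball : circleCenter c + ρ • unitNormal y ∈ Metric.closedBall (circleCenter c) r := by
          rw [Metric.mem_closedBall, dist_eq_norm, add_sub_cancel_left, norm_smul, norm_unitNormal,
            mul_one, Real.norm_eq_abs, abs_le]
          exact ⟨by linarith [hρ.1], hρ.2⟩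
        exact (mem_subdomain_zero hr).2 ⟨c, hball⟩
      · have hi1 : i = 1 := by omega
        subst hi1
        simp only [one_ne_zero, if_false] at hρ
        exact hmem ρ hρ y hy'
  have htri : ‖jump u (circlePoint r c t)‖ ≤ ‖jump u (circlePoint r c s)‖ + ‖V 0 s - V 0 t‖ +
      ‖V 1 s - V 1 t‖ := by
    rw [norm_jump_eq kpar, norm_jump_eq kpar]
    change ‖V 0 t - V 1 t‖ ≤ ‖V 0 s - V 1 s‖ + _ + _
    have e : V 0 t - V 1 t = (V 0 s - V 1 s) + -(V 0 s - V 0 t) + (V 1 s - V 1 t) := by ring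
    rw [e]
    refine norm_add₃_le.trans_eq ?_
    rw [norm_neg]
  rw [Fin.sum_univ_two]
  have h0 := hD 0
  have h1 := hD 1
  calc jumpSq r u c t ≤ (‖jump u (circlePoint r c s)‖ + ‖V 0 s - V 0 t‖ + ‖V 1 s - V 1 t‖) ^ 2 := by
        unfold jumpSq; gcongr
    _ ≤ 3 * (‖jump u (circlePoint r c s)‖ ^ 2 + ‖V 0 s - V 0 t‖ ^ 2 + ‖V 1 s - V 1 t‖ ^ 2) :=
        add_three_sq_le _ _ _
    _ ≤ _ := by unfold jumpSq; linarith

end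

end

/-! ### Averaging the jump over an element with a long cut -/

section

variable {L N : ℕ}

section

variable {d : Diagonal} {r kpar : ℝ} {u : Pair}

lemma setIntegral_window_le {f : ℝ → ℝ} (hf : IsTame f) (hf0 : ∀ s, 0 ≤ f s) {t τ : ℝ} (hτ : 0 ≤ τ)
    {S : Set ℝ} (hS : S ⊆ Set.Ioc t (t + τ)) : ∫ s in S, f s ≤ ∫ s in t..(t + τ), f s := by
  rw [intervalIntegral.integral_of_le (by linarith)]
  exact setIntegral_mono_set (hf.integrableOn measure_Ioc_lt_top.ne)
    (Eventually.of_forall hf0) (LE.le.eventuallyLE hS)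

lemma intervalIntegral_nonneg_of {f : ℝ → ℝ} (hf0 : ∀ s, 0 ≤ f s) {t τ : ℝ} (hτ : 0 ≤ τ) :
    0 ≤ ∫ s in t..(t + τ), f s :=
  intervalIntegral.integral_nonneg (by linarith) fun s _ => hf0 s

lemma volume_window_le_cutLength (hr0 : 0 < r) (c : Circles L) (K : Elem L N) (t : ℝ) {τ : ℝ}
    (hτ0 : 0 ≤ τ) (hτ : τ ≤ 2 * Real.pi) :
    r * (volume {s | s ∈ Set.Ioc t (t + τ) ∧ circlePoint r c s ∈ tri d K}).toReal ≤
      cutLength d r K := by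
  rw [cutLength_eq]
  have h := volume_window_le (r := r) c (measurableSet_tri d K) t hτ0 hτ
  calc _ ≤ r * (volume (arcSet r c (tri d K))).toReal := by gcongr
    _ ≤ _ := Finset.single_le_sum (f := fun c : Circles L =>
        r * (volume (arcSet r c (tri d K))).toReal) (fun c _ => by positivity) (Finset.mem_univ c)

/-- The jump at a point of a circle that has a collar. -/
lemma jumpSq_le_of_collar' (hL : 0 < L) (hN : 0 < N) (hr0 : 0 < r) (hr : r < Real.sqrt 3 / 6)
    (hu : u ∈ Vh L N d r) (c : Circles L) {t τ σ : ℝ} (hτ : 0 < τ) (hτh : τ ≤ meshSize N)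
    (hσ : 0 < σ) (hσr : σ < r)
    (hσ1 : r + σ ≤ 1) (ht : t ∉ edgeDirections L N d)
    (hmem : ∀ ρ ∈ Set.Icc r (r + σ), ∀ s ∈ Set.Icc t (t + τ),
      circleCenter c + ρ • unitNormal s ∈ subdomain L r 1) :
    jumpSq r u c t ≤ 3 * (72 / τ) * (72 * meshSize N / (r * τ)) *
        (∫ s in t..(t + τ), weightedJump N d r u c s) + ∑ i : Fin 2,
      (9 * σ * collarEnergy N d r kpar σ u i c t +
        (9 * σ * (72 / τ) + 9 * (τ / σ)) *
          ∫ y in t..(t + τ), collarEnergy N d r kpar σ u i c y) := by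
  have hh := meshSize_pos hN
  have hτpi : τ ≤ 2 * Real.pi := by
    linarith [meshSize_le_one hN, Real.pi_gt_three]
  obtain ⟨K, hK⟩ := exists_good_elem hL hN hr0 hr d c t hτ hτh
  set S : Set ℝ := {s | s ∈ Set.Ioc t (t + τ) ∧ circlePoint r c s ∈ tri d K} with hS
  have hSm : MeasurableSet S := measurableSet_Ioc.inter (measurableSet_circle_tri r c K)
  have hSsub : S ⊆ Set.Ioc t (t + τ) := fun s hs => hs.1
  have hSfin : volume S ≠ ⊤ := ((measure_mono hSsub).trans_lt measure_Ioc_lt_top).ne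
  set m := (volume S).toReal with hm
  have hm0 : 0 < m := lt_of_lt_of_le (by positivity) hK
  have hg : r * τ / 72 ≤ cutLength d r K := by
    have := volume_window_le_cutLength (d := d) hr0 c K t hτ.le hτpi
    calc r * τ / 72 = r * (τ / 72) := by ring
      _ ≤ r * m := by gcongr
      _ ≤ _ := this
  have hg0 : 0 < cutLength d r K := lt_of_lt_of_le (by positivity) hg
  have hJ := isTame_jumpSq hL hN hr0 hr hu c
  have hG := isTame_weightedJump hL hN hr0 hr hu c
  have hQ := fun i => isTame_collarEnergy (kpar := kpar) hr hu hσ.le i c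
  set P := ∑ i : Fin 2, (9 * σ * collarEnergy N d r kpar σ u i c t +
        9 * (τ / σ) * ∫ y in t..(t + τ), collarEnergy N d r kpar σ u i c y) with hP
  -- The comparison is averaged over the parameters `S` of the arc inside the good element `K`.
  -- Since `|Γ_K| ≥ r τ / 72`, the jump on `S` is bounded by the weighted jump.
  have hpt : ∀ᵐ s : ℝ, s ∈ S → jumpSq r u c t ≤ (3 * jumpSq r u c s + P) +
      ∑ i : Fin 2, 9 * σ * collarEnergy N d r kpar σ u i c s := by
    filter_upwards [(countable_edgeDirections (L := L) hN d).ae_notMem volume] with s hs hsS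
    have := jumpSq_le_of_collar (kpar := kpar) hL hN hr hu c hσ hσr hσ1 ht hmem hsS.1 hs
    refine this.trans_eq ?_
    rw [hP, Fin.sum_univ_two, Fin.sum_univ_two, Fin.sum_univ_two]
    ring
  have htame1 : IsTame fun s => 3 * jumpSq r u c s + P := (hJ.const_mul 3).add (IsTame.const P)
  have htame2 : IsTame fun s => ∑ i : Fin 2, 9 * σ * collarEnergy N d r kpar σ u i c s :=
    IsTame.sum _ fun i _ => (hQ i).const_mul _
  have hint : m * jumpSq r u c t ≤ 3 * (∫ s in S, jumpSq r u c s) + m * P +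
      ∑ i : Fin 2, 9 * σ * ∫ s in S, collarEnergy N d r kpar σ u i c s := by
    have h1 := setIntegral_mono_on_ae ((IsTame.const (jumpSq r u c t)).integrableOn hSfin)
      ((htame1.add htame2).integrableOn hSfin) hSm hpt
    rw [integral_add (htame1.integrableOn hSfin) (htame2.integrableOn hSfin),
      integral_add ((hJ.const_mul 3).integrableOn hSfin) ((IsTame.const P).integrableOn hSfin),
      integral_const_mul, setIntegral_const, setIntegral_const, integral_finsetSum _
        fun i _ => ((hQ i).const_mul _).integrableOn hSfin] at h1
    simp only [integral_const_mul] at h1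
    exact h1
  have hJG : ∫ s in S, jumpSq r u c s ≤
      72 * meshSize N / (r * τ) * ∫ s in t..(t + τ), weightedJump N d r u c s := by
    have h1 : ∀ s ∈ S, jumpSq r u c s ≤
        72 * meshSize N / (r * τ) * weightedJump N d r u c s := by
      intro s hs
      have h2 := le_weightedJump (u := u) hr0.le hr hN c hs.2
      have h3 := jumpSq_nonneg (r := r) (u := u) c s
      have h4 : 1 ≤ 72 * meshSize N / (r * τ) * (cutLength d r K / meshSize N) := by
        calc 1 = 72 * meshSize N / (r * τ) * (r * τ / 72 / meshSize N) := by field_simp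
          _ ≤ _ := by gcongr
      calc jumpSq r u c s ≤ 72 * meshSize N / (r * τ) * (cutLength d r K / meshSize N) *
            jumpSq r u c s := by nlinarith
        _ = 72 * meshSize N / (r * τ) * (cutLength d r K / meshSize N * jumpSq r u c s) := by ring
        _ ≤ _ := by gcongr
    refine (setIntegral_mono_on (hJ.integrableOn hSfin) ((hG.const_mul _).integrableOn hSfin)
      hSm h1).trans ?_
    rw [integral_const_mul]
    have := setIntegral_window_le hG (weightedJump_nonneg hr0.le hN c) hτ.le hSsub
    gcongr
  have hQS : ∀ i, ∫ s in S, collarEnergy N d r kpar σ u i c s ≤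
      ∫ s in t..(t + τ), collarEnergy N d r kpar σ u i c s := fun i =>
    setIntegral_window_le (hQ i) (collarEnergy_nonneg hσ.le i c) hτ.le hSsub
  have hG0 : 0 ≤ ∫ s in t..(t + τ), weightedJump N d r u c s :=
    intervalIntegral_nonneg_of (weightedJump_nonneg hr0.le hN c) hτ.le
  have hQ0 : ∀ i, 0 ≤ ∫ s in t..(t + τ), collarEnergy N d r kpar σ u i c s := fun i =>
    intervalIntegral_nonneg_of (collarEnergy_nonneg hσ.le i c) hτ.le
  have hminv : m⁻¹ ≤ 72 / τ := by
    rw [inv_le_comm₀ hm0 (by positivity), inv_div]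
    exact hK
  have hfin : jumpSq r u c t ≤ m⁻¹ * (3 * (∫ s in S, jumpSq r u c s) +
      ∑ i : Fin 2, 9 * σ * ∫ s in S, collarEnergy N d r kpar σ u i c s) + P := by
    refine le_of_mul_le_mul_left (hint.trans_eq ?_) hm0
    field_simp
    ring
  have hmm : 0 < m⁻¹ := inv_pos.2 hm0
  have h72 : 0 < 72 / τ := by positivity
  calc jumpSq r u c t ≤ m⁻¹ * (3 * (∫ s in S, jumpSq r u c s) +
      ∑ i : Fin 2, 9 * σ * ∫ s in S, collarEnergy N d r kpar σ u i c s) + P := hfin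
    _ ≤ (72 / τ) * (3 * (72 * meshSize N / (r * τ) * ∫ s in t..(t + τ), weightedJump N d r u c s) +
      ∑ i : Fin 2, 9 * σ * ∫ s in t..(t + τ), collarEnergy N d r kpar σ u i c s) + P := by
        have hnn : 0 ≤ 3 * (72 * meshSize N / (r * τ) *
            ∫ s in t..(t + τ), weightedJump N d r u c s) +
          ∑ i : Fin 2, 9 * σ * ∫ s in t..(t + τ), collarEnergy N d r kpar σ u i c s :=
          add_nonneg (by positivity) (Finset.sum_nonneg fun i _ => by have := hQ0 i; positivity)
        refine add_le_add (mul_le_mul hminv ?_ ?_ h72.le) le_rfl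
        · exact add_le_add (by linarith) (Finset.sum_le_sum fun i _ =>
            mul_le_mul_of_nonneg_left (hQS i) (by positivity))
        · refine add_nonneg (mul_nonneg (by norm_num) (integral_nonneg fun s => jumpSq_nonneg c s))
            (Finset.sum_nonneg fun i _ => mul_nonneg (by positivity)
              (integral_nonneg fun s => collarEnergy_nonneg hσ.le i c s))
    _ = _ := by
        rw [hP, Fin.sum_univ_two, Fin.sum_univ_two, Fin.sum_univ_two]
        ring

end

end

section

variable {L N : ℕ}

/-! ## Circles close to a side of their half-cell -/

/-- Coordinates adapted to a side of the half-cell around a circle. -/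
lemma exists_side_frame (c : Circles L) (a : Fin 3) : ∃ α : ℝ, ∀ x : Plane,
    cellBary c a x = 1 / 3 - 2 / Real.sqrt 3 *
      (Real.cos α * (x - circleCenter c) 0 + Real.sin α * (x - circleCenter c) 1) ∧
    cellBary c (a + 2) x - cellBary c (a + 1) x =
      2 * (-Real.sin α * (x - circleCenter c) 0 + Real.cos α * (x - circleCenter c) 1) := by
  have h3 := sqrt_three_sq
  have h3p := sqrt_three_pos
  -- `(C, S)` is the unit vector from the centre towards the side, and `α` is its angle.
  have key : ∀ C S : ℝ, C ^ 2 + S ^ 2 = 1 → (∀ x : Plane,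
      cellBary c a x = 1 / 3 - 2 / Real.sqrt 3 *
        (C * (x - circleCenter c) 0 + S * (x - circleCenter c) 1) ∧
      cellBary c (a + 2) x - cellBary c (a + 1) x =
        2 * (-S * (x - circleCenter c) 0 + C * (x - circleCenter c) 1)) → ∃ α : ℝ, ∀ x : Plane,
    cellBary c a x = 1 / 3 - 2 / Real.sqrt 3 *
      (Real.cos α * (x - circleCenter c) 0 + Real.sin α * (x - circleCenter c) 1) ∧
    cellBary c (a + 2) x - cellBary c (a + 1) x =
      2 * (-Real.sin α * (x - circleCenter c) 0 + Real.cos α * (x - circleCenter c) 1) := by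
    intro C S hCS h
    set z : ℂ := ⟨C, S⟩ with hz
    have hn : ‖z‖ = 1 := by
      rw [← sq_eq_sq₀ (norm_nonneg _) zero_le_one, Complex.sq_norm, Complex.normSq_apply]
      simp [hz]; linarith
    have hC := Complex.norm_mul_cos_arg z
    have hS := Complex.norm_mul_sin_arg z
    rw [hn, one_mul] at hC hS
    exact ⟨z.arg, by rw [hC, hS]; exact h⟩
  have hs := cellSign_sq c
  fin_cases a
  · refine key (cellSign c) 0 (by linarith) fun x => ⟨?_, ?_⟩
    · simp [cellBary, tau₁, tau₂]; field_simp; ring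
    · simp [cellBary, tau₁, tau₂]; ring
  · refine key (-(cellSign c) / 2) (cellSign c * Real.sqrt 3 / 2) (by nlinarith) fun x => ⟨?_, ?_⟩
    · simp [cellBary, tau₁, tau₂]; field_simp; ring
    · simp [cellBary, tau₁, tau₂]; field_simp; linear_combination
        (cellSign c * (x 0 - circleCenter c 0)) * h3
  · refine key (-(cellSign c) / 2) (-(cellSign c) * Real.sqrt 3 / 2) (by nlinarith)
      fun x => ⟨?_, ?_⟩
    · simp [cellBary, tau₁, tau₂]; field_simp; ring
    · simp [cellBary, tau₁, tau₂]; field_simp; linear_combination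
        (-(cellSign c) * (x 0 - circleCenter c 0)) * h3

/-- The elements inside a half-cell: those with the same orientation. -/
lemma exists_up_elem (hN : 0 < N) (c : Circles L) (m : Fin 3 → ℕ) (hm : ∑ a, m a + 1 = N) :
    ∃ K : Elem L N, ∀ x, x ∈ tri .short K ↔ ∀ a, (m a : ℝ) ≤ N * cellBary c a x := by
  rw [Fin.sum_univ_three] at hm
  have hmR : (m 0 : ℝ) + m 1 + m 2 + 1 = N := by exact_mod_cast hm
  obtain ⟨s, k⟩ := c
  have hk : N * (k : ℕ) + N ≤ 2 * L * N := by
    have := k.2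
    calc N * (k : ℕ) + N = ((k : ℕ) + 1) * N := by ring
      _ ≤ 2 * L * N := Nat.mul_le_mul_right _ (by omega)
  fin_cases s
  · refine ⟨(⟨m 2, by omega⟩, ⟨N * k + m 1, by omega⟩, false), fun x => ?_⟩
    rw [mem_tri hN]
    simp [Fin.forall_fin_succ, bary, refBary, cellBary, cellSign, tau₁_center, tau₂_center]
    constructor
    · rintro ⟨h0, h1, h2⟩
      refine ⟨?_, ?_, ?_⟩ <;> linarith
    · rintro ⟨h0, h1, h2⟩
      refine ⟨?_, ?_, ?_⟩ <;> linarith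
  -- The half-cell of `B` has the reversed orientation, so rows and columns are counted from the
  -- opposite end.
  · have e1 : ((N - 1 - m 2 : ℕ) : ℝ) = N - 1 - m 2 := by
      rw [Nat.cast_sub (by omega), Nat.cast_sub (by omega)]; simp
    have e2 : ((N * k + (N - 1 - m 1) : ℕ) : ℝ) = N * (k : ℕ) + (N - 1 - m 1) := by
      rw [Nat.cast_add, Nat.cast_sub (by omega), Nat.cast_sub (by omega)]; simp
    refine ⟨(⟨N - 1 - m 2, by omega⟩, ⟨N * k + (N - 1 - m 1), by omega⟩, true), fun x => ?_⟩
    rw [mem_tri hN]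
    simp only [Fin.forall_fin_succ, bary, e1, e2]
    simp [refBary, cellBary, cellSign, tau₁_center, tau₂_center]
    constructor
    · rintro ⟨h0, h1, h2⟩
      refine ⟨?_, ?_, ?_⟩ <;> linarith
    · rintro ⟨h0, h1, h2⟩
      refine ⟨?_, ?_, ?_⟩ <;> linarith

/-- The elements inside a half-cell: those with the opposite orientation. -/
lemma exists_down_elem (hN : 0 < N) (c : Circles L) (m : Fin 3 → ℕ) (hm : ∑ a, m a + 2 = N) :
    ∃ K : Elem L N, ∀ x, x ∈ tri .short K ↔ ∀ a, N * cellBary c a x ≤ m a + 1 := by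
  rw [Fin.sum_univ_three] at hm
  have hmR : (m 0 : ℝ) + m 1 + m 2 + 2 = N := by exact_mod_cast hm
  obtain ⟨s, k⟩ := c
  have hk : N * (k : ℕ) + N ≤ 2 * L * N := by
    have := k.2
    calc N * (k : ℕ) + N = ((k : ℕ) + 1) * N := by ring
      _ ≤ 2 * L * N := Nat.mul_le_mul_right _ (by omega)
  fin_cases s
  · refine ⟨(⟨m 2, by omega⟩, ⟨N * k + m 1, by omega⟩, true), fun x => ?_⟩
    rw [mem_tri hN]
    simp [Fin.forall_fin_succ, bary, refBary, cellBary, cellSign, tau₁_center, tau₂_center]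
    constructor
    · rintro ⟨h0, h1, h2⟩
      refine ⟨?_, ?_, ?_⟩ <;> linarith
    · rintro ⟨h0, h1, h2⟩
      refine ⟨?_, ?_, ?_⟩ <;> linarith
  · have e1 : ((N - 1 - m 2 : ℕ) : ℝ) = N - 1 - m 2 := by
      rw [Nat.cast_sub (by omega), Nat.cast_sub (by omega)]; simp
    have e2 : ((N * k + (N - 1 - m 1) : ℕ) : ℝ) = N * (k : ℕ) + (N - 1 - m 1) := by
      rw [Nat.cast_add, Nat.cast_sub (by omega), Nat.cast_sub (by omega)]; simp
    refine ⟨(⟨N - 1 - m 2, by omega⟩, ⟨N * k + (N - 1 - m 1), by omega⟩, false), fun x => ?_⟩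
    rw [mem_tri hN]
    simp only [Fin.forall_fin_succ, bary, e1, e2]
    simp [refBary, cellBary, cellSign, tau₁_center, tau₂_center]
    constructor
    · rintro ⟨h0, h1, h2⟩
      refine ⟨?_, ?_, ?_⟩ <;> linarith
    · rintro ⟨h0, h1, h2⟩
      refine ⟨?_, ?_, ?_⟩ <;> linarith

/-! ### The coordinates along the circle -/

/-- The scaled distance to the side. -/
def sideDist (n R θ : ℝ) : ℝ := n / 3 - 2 / Real.sqrt 3 * R * Real.cos θ

lemma two_div_sqrt_three_bounds : 1.1546 ≤ 2 / Real.sqrt 3 ∧ 2 / Real.sqrt 3 ≤ 1.1548 := by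
  have h := sqrt_three_pos
  constructor
  · rw [le_div_iff₀ h]; linarith [sqrt_three_lt]
  · rw [div_le_iff₀ h]
    have : 1.73195 < Real.sqrt 3 := Real.lt_sqrt_of_sq_lt (by norm_num)
    linarith

/-- In units of the mesh size: `n = N` and `R = N r`. Since the circle stays inside the half-cell,
`2 / √3 * R < n / 3`, and a point within `1 / 400` of the side satisfies `cos θ ≥ 1 - 3 / 400`. So
it is close to the foot of the centre on the side. -/
lemma side_bounds {n R θ : ℝ} (hn : 1 ≤ n) (hR : 2 / Real.sqrt 3 * R < n / 3)
    (hR0 : 0 < R) (hθ : sideDist n R θ ≤ 1 / 400) :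
    0.99 ≤ Real.cos θ ∧ |Real.sin θ| ≤ 0.13 ∧ 0.28 * n ≤ R ∧ R ≤ 0.29 * n := by
  obtain ⟨hl, hu⟩ := two_div_sqrt_three_bounds
  set w := 2 / Real.sqrt 3 with hw
  unfold sideDist at hθ
  have hc1 := Real.cos_le_one θ
  have hRc : n / 3 - 1 / 400 ≤ w * R * Real.cos θ := by linarith
  have hcpos : 0 < Real.cos θ := by
    by_contra h
    push Not at h
    have : w * R * Real.cos θ ≤ 0 := mul_nonpos_of_nonneg_of_nonpos (by positivity) h
    linarith
  have hcos : 0.9925 ≤ Real.cos θ := by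
    have : w * R * Real.cos θ ≤ n / 3 * Real.cos θ := by gcongr
    nlinarith
  refine ⟨by linarith, ?_, ?_, ?_⟩
  · apply abs_le_of_sq_le_sq _ (by norm_num)
    nlinarith [Real.sin_sq_add_cos_sq θ]
  · have : w * R * Real.cos θ ≤ w * R * 1 := by gcongr
    nlinarith
  · nlinarith

/-- Here `k` is arc length in units of the mesh size. As `cos θ` is close to one, `sin θ` is small
and `k / R ≤ 0.45`, the coordinate along the side advances by almost `k`, while the distance to the
side changes by less than half of it. -/
lemma side_increments {n R θ k : ℝ} (hn : 1 ≤ n) (hR : 2 / Real.sqrt 3 * R < n / 3)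
    (hR0 : 0 < R) (hθ : sideDist n R θ ≤ 1 / 400) (hk0 : 0 ≤ k) (hk : k ≤ 1 / 8) :
    |sideDist n R (θ + k / R) - sideDist n R θ| ≤ 0.42 * k ∧
    0.9 * k ≤ R * Real.sin (θ + k / R) - R * Real.sin θ ∧
    R * Real.sin (θ + k / R) - R * Real.sin θ ≤ 1.03 * k := by
  obtain ⟨hc, hs, hRl, -⟩ := side_bounds hn hR hR0 hθ
  obtain ⟨hl, hu⟩ := two_div_sqrt_three_bounds
  obtain ⟨hs1, hs2⟩ := abs_le.1 hs
  have hc1 := Real.cos_le_one θ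
  rcases hk0.eq_or_lt with rfl | hkp
  · simp
  set δ := k / R with hδ
  have hδ0 : 0 < δ := by positivity
  have hRδ : R * δ = k := by rw [hδ]; field_simp
  have hδ1 : δ ≤ 0.45 := by
    rw [hδ, div_le_iff₀ hR0]; nlinarith
  have h1 : Real.sin δ ≤ δ := (Real.sin_lt hδ0).le
  have h2 : δ - δ ^ 3 / 6 ≤ Real.sin δ := (Real.sin_gt_sub_cube hδ0).le
  have h2' : 0.949 * δ ≤ Real.sin δ := by
    have : δ ^ 2 ≤ 0.45 ^ 2 := by gcongr
    nlinarith
  have h3 : 1 - δ ^ 2 / 2 ≤ Real.cos δ := Real.one_sub_sq_div_two_le_cos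
  have h3' : 1 - Real.cos δ ≤ 0.225 * δ := by nlinarith
  have h4 : 0 ≤ 1 - Real.cos δ := by linarith [Real.cos_le_one δ]
  have hsin0 : 0 ≤ Real.sin δ := by linarith
  have e1 : sideDist n R (θ + δ) - sideDist n R θ =
      2 / Real.sqrt 3 * (R * (Real.cos θ * (1 - Real.cos δ) + Real.sin θ * Real.sin δ)) := by
    rw [sideDist, sideDist, Real.cos_add]; ring
  have e2 : R * Real.sin (θ + δ) - R * Real.sin θ =
      R * (Real.cos θ * Real.sin δ - Real.sin θ * (1 - Real.cos δ)) := by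
    rw [Real.sin_add]; ring
  have b1 : Real.cos θ * (1 - Real.cos δ) + Real.sin θ * Real.sin δ ≤ 0.36 * δ := by nlinarith
  have b2 : -(0.13 * δ) ≤ Real.cos θ * (1 - Real.cos δ) + Real.sin θ * Real.sin δ := by
    nlinarith [mul_nonneg (by linarith : 0 ≤ Real.cos θ) h4]
  have b3 : 0.9 * δ ≤ Real.cos θ * Real.sin δ - Real.sin θ * (1 - Real.cos δ) := by nlinarith
  have b4 : Real.cos θ * Real.sin δ - Real.sin θ * (1 - Real.cos δ) ≤ 1.03 * δ := by nlinarith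
  have c1 := mul_le_mul_of_nonneg_left b1 hR0.le
  have c2 := mul_le_mul_of_nonneg_left b2 hR0.le
  have c3 := mul_le_mul_of_nonneg_left b3 hR0.le
  have c4 := mul_le_mul_of_nonneg_left b4 hR0.le
  have d1 : R * (0.36 * δ) = 0.36 * k := by rw [← hRδ]; ring
  have d2 : R * -(0.13 * δ) = -(0.13 * k) := by rw [← hRδ]; ring
  have d3 : R * (0.9 * δ) = 0.9 * k := by rw [← hRδ]; ring
  have d4 : R * (1.03 * δ) = 1.03 * k := by rw [← hRδ]; ring
  rw [d1] at c1
  rw [d2] at c2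
  rw [d3] at c3
  rw [d4] at c4
  refine ⟨?_, by rw [e2]; exact c3, by rw [e2]; exact c4⟩
  rw [e1, abs_mul, abs_of_pos (by positivity)]
  have hP : |R * (Real.cos θ * (1 - Real.cos δ) + Real.sin θ * Real.sin δ)| ≤ 0.36 * k :=
    abs_le.2 ⟨by linarith, c1⟩
  calc _ ≤ 1.1548 * (0.36 * k) := by gcongr
    _ ≤ 0.42 * k := by linarith

end

section

variable {L N : ℕ}

/-! ### Elements touching the side of a half-cell -/

lemma abs_cellBary_sub_cellBary_le (c : Circles L) (a : Fin 3) (x y : Plane) :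
    |cellBary c a x - cellBary c a y| ≤ 2 / Real.sqrt 3 * ‖x - y‖ := by
  have e : cellBary c a x - cellBary c a y = cellSign c *
      (![-(tau₁ (x - y) + tau₂ (x - y)), tau₂ (x - y), tau₁ (x - y)] a) := by
    fin_cases a <;> simp [cellBary] <;> ring
  rw [e, abs_mul, cellSign_abs, one_mul]
  fin_cases a
  · change |-(tau₁ (x - y) + tau₂ (x - y))| ≤ _
    rw [abs_neg]
    exact abs_tau_add_le (x - y)
  · simpa using abs_tau₂_le (x - y)
  · simpa using abs_tau₁_le (x - y)

lemma forall_fin_three_shift {P : Fin 3 → Prop} (a : Fin 3) :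
    (∀ b, P b) ↔ P a ∧ P (a + 1) ∧ P (a + 2) := by
  refine ⟨fun h => ⟨h _, h _, h _⟩, fun ⟨h0, h1, h2⟩ b => ?_⟩
  fin_cases a <;> fin_cases b <;> first | exact h0 | exact h1 | exact h2

lemma cellBary_sum_shift (c : Circles L) (a : Fin 3) (x : Plane) :
    cellBary c a x + cellBary c (a + 1) x + cellBary c (a + 2) x = 1 := by
  have h := cellBary_sum c x
  fin_cases a
  · exact h
  · change cellBary c 1 x + cellBary c 2 x + cellBary c 0 x = 1
    linarith
  · change cellBary c 2 x + cellBary c 0 x + cellBary c 1 x = 1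
    linarith

lemma exists_index (a : Fin 3) (p q : ℕ) : ∃ m : Fin 3 → ℕ, m a = 0 ∧ m (a + 1) = q ∧
    m (a + 2) = p ∧ ∑ b, m b = p + q := by
  fin_cases a
  · exact ⟨![0, q, p], rfl, rfl, rfl, by simp [Fin.sum_univ_three]; ring⟩
  · exact ⟨![p, 0, q], rfl, rfl, rfl, by simp [Fin.sum_univ_three]⟩
  · exact ⟨![q, p, 0], rfl, rfl, rfl, by simp [Fin.sum_univ_three]; ring⟩

lemma exists_side_up_elem (hN : 0 < N) (c : Circles L) (a : Fin 3) {p q : ℕ} (h : p + q + 1 = N) :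
    ∃ K : Elem L N, ∀ x, x ∈ tri .short K ↔ 0 ≤ N * cellBary c a x ∧
      (q : ℝ) ≤ N * cellBary c (a + 1) x ∧ (p : ℝ) ≤ N * cellBary c (a + 2) x := by
  obtain ⟨m, h0, h1, h2, hs⟩ := exists_index a p q
  obtain ⟨K, hK⟩ := exists_up_elem (L := L) hN c m (by omega)
  refine ⟨K, fun x => ?_⟩
  rw [hK, forall_fin_three_shift a, h0, h1, h2, Nat.cast_zero]

lemma exists_side_down_elem (hN : 0 < N) (c : Circles L) (a : Fin 3) {p q : ℕ} (h : p + q + 2 = N) :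
    ∃ K : Elem L N, ∀ x, x ∈ tri .short K ↔ N * cellBary c a x ≤ 1 ∧
      N * cellBary c (a + 1) x ≤ q + 1 ∧ N * cellBary c (a + 2) x ≤ p + 1 := by
  obtain ⟨m, h0, h1, h2, hs⟩ := exists_index a p q
  obtain ⟨K, hK⟩ := exists_down_elem (L := L) hN c m (by omega)
  refine ⟨K, fun x => ?_⟩
  rw [hK, forall_fin_three_shift a, h0, h1, h2, Nat.cast_zero, zero_add]

/-- A frame at a side of a half-cell. -/
structure SideFrame (c : Circles L) (a : Fin 3) (α : ℝ) (X Y : Plane → ℝ) : Prop where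
  side : ∀ x, cellBary c a x = 1 / 3 - 2 / Real.sqrt 3 * X x
  diff : ∀ x, cellBary c (a + 2) x - cellBary c (a + 1) x = 2 * Y x
  norm_sq : ∀ x, ‖x - circleCenter c‖ ^ 2 = X x ^ 2 + Y x ^ 2
  circle : ∀ r t, X (circlePoint r c t) = r * Real.cos (t - α) ∧
    Y (circlePoint r c t) = r * Real.sin (t - α)
  surj : ∀ ξ η : ℝ, ∃ x, X x = ξ ∧ Y x = η

lemma exists_sideFrame (c : Circles L) (a : Fin 3) : ∃ α X Y, SideFrame c a α X Y := by
  obtain ⟨α, h⟩ := exists_side_frame c a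
  have hsc := Real.sin_sq_add_cos_sq α
  refine ⟨α, fun x => Real.cos α * (x - circleCenter c) 0 + Real.sin α * (x - circleCenter c) 1,
    fun x => -Real.sin α * (x - circleCenter c) 0 + Real.cos α * (x - circleCenter c) 1,
    fun x => (h x).1, fun x => (h x).2, fun x => ?_, fun r t => ?_, fun ξ η => ?_⟩
  · rw [norm_sq_plane]
    linear_combination (-((x - circleCenter c) 0 ^ 2) - (x - circleCenter c) 1 ^ 2) * hsc
  · simp only [circlePoint, add_sub_cancel_left, Real.cos_sub, Real.sin_sub]
    simp [unitNormal]
    constructor <;> ring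
  · refine ⟨circleCenter c +
      !₂[Real.cos α * ξ - Real.sin α * η, Real.sin α * ξ + Real.cos α * η], ?_, ?_⟩
    · simp
      linear_combination ξ * hsc
    · simp
      linear_combination η * hsc

section

variable {r : ℝ} {c : Circles L} {a : Fin 3} {α : ℝ} {X Y : Plane → ℝ}

lemma SideFrame.sideDist_eq (hF : SideFrame c a α X Y) (n r t : ℝ) :
    n * cellBary c a (circlePoint r c t) = sideDist n (n * r) (t - α) := by
  rw [hF.side, (hF.circle r t).1, sideDist]
  ring

lemma SideFrame.two_eq (hF : SideFrame c a α X Y) (n : ℝ) (x : Plane) :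
    n * cellBary c (a + 2) x = (n - n * cellBary c a x) / 2 + n * Y x := by
  have h1 := cellBary_sum_shift c a x
  have h2 := hF.diff x
  linear_combination (n / 2) * h1 + (n / 2) * h2

lemma SideFrame.one_eq (hF : SideFrame c a α X Y) (n : ℝ) (x : Plane) :
    n * cellBary c (a + 1) x = (n - n * cellBary c a x) / 2 - n * Y x := by
  have h1 := cellBary_sum_shift c a x
  have h2 := hF.diff x
  linear_combination (n / 2) * h1 - (n / 2) * h2

/-- Increments of the coordinates when moving forward along the circle. -/
lemma SideFrame.forward (hF : SideFrame c a α X Y) (hr0 : 0 < r) (hr : r < Real.sqrt 3 / 6)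
    (hN : 0 < N) {t k : ℝ} (ht : N * cellBary c a (circlePoint r c t) ≤ 1 / 400) (hk0 : 0 ≤ k)
    (hk : k ≤ 1 / 8) :
    |N * cellBary c a (circlePoint r c (t + k / (N * r))) - N * cellBary c a (circlePoint r c t)| ≤
      0.42 * k ∧
    0.69 * k ≤ N * cellBary c (a + 2) (circlePoint r c (t + k / (N * r))) -
      N * cellBary c (a + 2) (circlePoint r c t) ∧
    N * cellBary c (a + 2) (circlePoint r c (t + k / (N * r))) -
      N * cellBary c (a + 2) (circlePoint r c t) ≤ 1.24 * k ∧
    0.69 * k ≤ N * cellBary c (a + 1) (circlePoint r c t) -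
      N * cellBary c (a + 1) (circlePoint r c (t + k / (N * r))) ∧
    N * cellBary c (a + 1) (circlePoint r c t) -
      N * cellBary c (a + 1) (circlePoint r c (t + k / (N * r))) ≤ 1.24 * k := by
  have hN1 : (1 : ℝ) ≤ N := by exact_mod_cast hN
  have hNr : 2 / Real.sqrt 3 * (N * r) < N / 3 := by
    have h3 := sqrt_three_pos
    have : 2 / Real.sqrt 3 * r < 1 / 3 := by
      rw [div_mul_eq_mul_div, div_lt_iff₀ h3]
      nlinarith [sqrt_three_sq]
    nlinarith
  rw [hF.sideDist_eq] at ht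
  obtain ⟨h1, h2, h3⟩ := side_increments hN1 hNr (by positivity) ht hk0 hk
  have e : t + k / (N * r) - α = t - α + k / (N * r) := by ring
  simp only [hF.two_eq, hF.one_eq, hF.sideDist_eq, (hF.circle r _).2, e]
  obtain ⟨h1a, h1b⟩ := abs_le.1 h1
  refine ⟨h1, ?_, ?_, ?_, ?_⟩ <;> linarith

/-- Increments of the coordinates when moving backward along the circle. -/
lemma SideFrame.backward (hF : SideFrame c a α X Y) (hr0 : 0 < r) (hr : r < Real.sqrt 3 / 6)
    (hN : 0 < N) {t k : ℝ} (ht : N * cellBary c a (circlePoint r c t) ≤ 1 / 400) (hk0 : 0 ≤ k)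
    (hk : k ≤ 1 / 8) :
    N * cellBary c (a + 1) (circlePoint r c t) ≤
      N * cellBary c (a + 1) (circlePoint r c (t - k / (N * r))) ∧
    N * cellBary c (a + 2) (circlePoint r c t) - 1.24 * k ≤
      N * cellBary c (a + 2) (circlePoint r c (t - k / (N * r))) := by
  have hN1 : (1 : ℝ) ≤ N := by exact_mod_cast hN
  have hNr : 2 / Real.sqrt 3 * (N * r) < N / 3 := by
    have h3 := sqrt_three_pos
    have : 2 / Real.sqrt 3 * r < 1 / 3 := by
      rw [div_mul_eq_mul_div, div_lt_iff₀ h3]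
      nlinarith [sqrt_three_sq]
    nlinarith
  have hneg : ∀ θ, sideDist N (N * r) (-θ) = sideDist N (N * r) θ := fun θ => by
    rw [sideDist, sideDist, Real.cos_neg]
  rw [hF.sideDist_eq, ← hneg] at ht
  obtain ⟨h1, h2, h3⟩ := side_increments hN1 hNr (by positivity) ht hk0 hk
  have e : t - k / (N * r) - α = -(-(t - α) + k / (N * r)) := by ring
  simp only [hF.two_eq, hF.one_eq, hF.sideDist_eq, (hF.circle r _).2, e]
  rw [hneg] at h1 ⊢
  rw [Real.sin_neg] at h2 h3 ⊢
  obtain ⟨h1a, h1b⟩ := abs_le.1 h1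
  constructor <;> linarith

/-- In the parametrisation `t + k / (N r)` the number `k` is arc length in units of `h`, so the arc
has length `h / 8`. -/
lemma le_cutLength_of_arc (hr0 : 0 < r) (hN : 0 < N) (d : Diagonal) (K : Elem L N) (c : Circles L)
    {t : ℝ} (hNr : 1 / 8 / (N * r) ≤ 2 * Real.pi)
    (h : ∀ k, 0 ≤ k → k ≤ 1 / 8 → circlePoint r c (t + k / (N * r)) ∈ tri d K) :
    meshSize N / 8 ≤ cutLength d r K := by
  have hN' : (0 : ℝ) < N := by positivity
  set τ := 1 / 8 / (N * r) with hτ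
  have hτ0 : 0 < τ := by positivity
  have h1 := volume_window_le_cutLength (d := d) hr0 c K t hτ0.le hNr
  have e : {s | s ∈ Set.Ioc t (t + τ) ∧ circlePoint r c s ∈ tri d K} = Set.Ioc t (t + τ) := by
    ext s
    refine ⟨fun h => h.1, fun hs => ⟨hs, ?_⟩⟩
    have hs1 : (s - t) * (N * r) ≤ 1 / 8 := by
      rw [← le_div_iff₀ (by positivity)]
      linarith [hs.2]
    have := h ((s - t) * (N * r)) (mul_nonneg (by linarith [hs.1]) (by positivity)) hs1
    rwa [mul_div_cancel_right₀ _ (by positivity), add_sub_cancel] at this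
  rw [e, Real.volume_Ioc, add_sub_cancel_left, ENNReal.toReal_ofReal hτ0.le] at h1
  refine le_trans (le_of_eq ?_) h1
  rw [meshSize_eq, hτ]
  field_simp

lemma SideFrame.radius_bounds (hF : SideFrame c a α X Y) (hr0 : 0 < r) (hr : r < Real.sqrt 3 / 6)
    (hN : 0 < N) {t : ℝ} (ht : N * cellBary c a (circlePoint r c t) ≤ 1 / 400) :
    0.99 ≤ Real.cos (t - α) ∧ |Real.sin (t - α)| ≤ 0.13 ∧ 0.28 ≤ r ∧ r ≤ 0.29 := by
  have hN1 : (1 : ℝ) ≤ N := by exact_mod_cast hN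
  have hNr : 2 / Real.sqrt 3 * (N * r) < N / 3 := by
    have h3 := sqrt_three_pos
    have : 2 / Real.sqrt 3 * r < 1 / 3 := by
      rw [div_mul_eq_mul_div, div_lt_iff₀ h3]
      nlinarith [sqrt_three_sq]
    nlinarith
  rw [hF.sideDist_eq] at ht
  obtain ⟨h1, h2, h3, h4⟩ := side_bounds hN1 hNr (by positivity) ht
  have hN0 : (0 : ℝ) < N := by linarith
  exact ⟨h1, h2, by nlinarith, by nlinarith⟩

lemma SideFrame.window_le (hF : SideFrame c a α X Y) (hr0 : 0 < r) (hr : r < Real.sqrt 3 / 6)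
    (hN : 0 < N) {t : ℝ} (ht : N * cellBary c a (circlePoint r c t) ≤ 1 / 400) :
    1 / (N * r) ≤ 4 * meshSize N := by
  have hN' : (0 : ℝ) < N := by positivity
  obtain ⟨-, -, h, -⟩ := hF.radius_bounds hr0 hr hN ht
  rw [meshSize_eq, div_le_iff₀ (by positivity)]
  field_simp
  linarith

/-- Near a side, an element with its base on the side has a long cut. -/
lemma SideFrame.exists_base_elem (hF : SideFrame c a α X Y) (hr0 : 0 < r) (hr : r < Real.sqrt 3 / 6)
    (hN : 0 < N) {t : ℝ} (ht : N * cellBary c a (circlePoint r c t) ≤ 1 / 400) {p q : ℕ}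
    (hpq : p + q + 1 = N) (hq : (q : ℝ) ≤ N * cellBary c (a + 1) (circlePoint r c t))
    (hp : (p : ℝ) ≤ N * cellBary c (a + 2) (circlePoint r c t)) :
    ∃ K : Elem L N, circlePoint r c t ∈ tri .short K ∧ meshSize N / 8 ≤ cutLength .short r K := by
  have hN' : (0 : ℝ) < N := by positivity
  have hnn : ∀ s, 0 ≤ N * cellBary c a (circlePoint r c s) := fun s =>
    mul_nonneg hN'.le (cellBary_pos hr
      (Metric.sphere_subset_closedBall (circlePoint_mem_sphere hr0.le c s)) a).le
  have hwin : 1 / 8 / (N * r) ≤ 2 * Real.pi := by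
    have := hF.window_le hr0 hr hN ht
    have e : 1 / 8 / (N * r) = 1 / 8 * (1 / (N * r)) := by ring
    rw [e]
    linarith [meshSize_le_one hN, Real.pi_gt_three]
  obtain ⟨K, hK⟩ := exists_side_up_elem (L := L) hN c a hpq
  refine ⟨K, (hK _).2 ⟨hnn t, hq, hp⟩, ?_⟩
  have hsum := cellBary_sum_shift c a (circlePoint r c t)
  have hsum' : N * cellBary c a (circlePoint r c t) + N * cellBary c (a + 1) (circlePoint r c t) +
      N * cellBary c (a + 2) (circlePoint r c t) = N := by linear_combination (N : ℝ) * hsum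
  have hpqR : (p : ℝ) + q + 1 = N := by exact_mod_cast hpq
  -- An arc of length `h / 8` moves the coordinates along the side by at most `1.24 / 8 = 0.155`. If
  -- the distance to the edge ahead is at least `0.2`, the arc is taken forward. Otherwise the edge
  -- behind is at a distance of more than `0.79`, and the arc is taken backward.
  by_cases hcase : (q : ℝ) + 0.2 ≤ N * cellBary c (a + 1) (circlePoint r c t)
  · refine le_cutLength_of_arc hr0 hN .short K c (t := t) hwin fun k hk0 hk => (hK _).2 ?_
    obtain ⟨-, h2, -, -, h5⟩ := hF.forward hr0 hr hN ht hk0 hk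
    exact ⟨hnn _, by linarith, by linarith⟩
  · refine le_cutLength_of_arc hr0 hN .short K c (t := t - 1 / 8 / (N * r)) hwin
      fun k hk0 hk => (hK _).2 ?_
    have e : t - 1 / 8 / (N * r) + k / (N * r) = t - (1 / 8 - k) / (N * r) := by ring
    rw [e]
    obtain ⟨h1, h2⟩ := hF.backward (k := 1 / 8 - k) hr0 hr hN ht (by linarith) (by linarith)
    exact ⟨hnn _, by linarith, by linarith⟩

lemma le_cutArea_of_ball {d : Diagonal} {K : Elem L N} {i : Fin 2} {z : Plane} {ρ : ℝ} (hρ : 0 ≤ ρ)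
    (h : Metric.closedBall z ρ ⊆ cutPart d r K i) : Real.pi * ρ ^ 2 ≤ cutArea d r K i := by
  rw [← volume_closedBall_toReal z hρ]
  exact ENNReal.toReal_mono ((measure_mono Set.inter_subset_left).trans_lt
    (isCompact_tri d K).measure_lt_top).ne (measure_mono h)

/-- Moving away from the side decreases the squared distance to the centre by `3 / 4 * (β - β₀) * (2
n / 3 - β₀ - β)`. For `n ≥ 2` this outweighs the effect of the tangential shift `ξ`. -/
lemma apex_inside_arith {n β β₀ η x x₀ ξ : ℝ} (hn : 2 ≤ n)
    (hx : x = Real.sqrt 3 / 2 * (n / 3 - β)) (hx₀ : x₀ = Real.sqrt 3 / 2 * (n / 3 - β₀))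
    (hη : |η| ≤ 0.0377 * n) (hξ : |ξ| ≤ 0.1165) (h1 : 0.38 ≤ β - β₀) (h2 : β₀ + β ≤ 0.62) :
    x ^ 2 + (η + ξ) ^ 2 ≤ x₀ ^ 2 + η ^ 2 := by
  have f1 : x ^ 2 - x₀ ^ 2 = -(3 / 4 * ((β - β₀) * (2 * n / 3 - β₀ - β))) := by
    rw [hx, hx₀]
    linear_combination ((n / 3 - β) ^ 2 - (n / 3 - β₀) ^ 2) / 4 * sqrt_three_sq
  have f2 : 0.38 * (2 * n / 3 - 0.62) ≤ (β - β₀) * (2 * n / 3 - β₀ - β) :=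
    mul_le_mul h1 (by linarith) (by linarith) (by linarith)
  have f5 : ξ * (2 * η + ξ) ≤ 0.1165 * (2 * (0.0377 * n) + 0.1165) := by
    refine (le_abs_self _).trans ?_
    rw [abs_mul]
    have : |2 * η + ξ| ≤ 2 * (0.0377 * n) + 0.1165 := by
      refine (abs_add_le _ _).trans ?_
      rw [abs_mul, abs_two]
      linarith
    gcongr
  have f6 : (η + ξ) ^ 2 - η ^ 2 = ξ * (2 * η + ξ) := by ring
  linarith

/-- `(C, S)` is the outward normal of the circle at the reference point. A nonnegative component in
this direction places a point beyond the tangent, hence outside the open disc. -/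
lemma apex_outside_arith {n β β₀ e e' C S x x₀ ξ : ℝ}
    (hx : x = Real.sqrt 3 / 2 * (n / 3 - β)) (hx₀ : x₀ = Real.sqrt 3 / 2 * (n / 3 - β₀))
    (hC : 0.99 ≤ C) (hS : |S| ≤ 0.13) (he : 0 ≤ e) (he' : 0 ≤ e')
    (h : e' + 0.355 * e ≤ β₀ - β) (hξ : |ξ| ≤ (e' + 1.29 * e) / 2) :
    0 ≤ C * (x - x₀) + S * ξ := by
  have d1 : 0.866 * (e' + 0.355 * e) ≤ x - x₀ := by
    have h3 : 0.866 ≤ Real.sqrt 3 / 2 := by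
      have : 1.732 < Real.sqrt 3 := Real.lt_sqrt_of_sq_lt (by norm_num)
      linarith
    have h5 := mul_le_mul h3 h (by positivity) (by positivity)
    rw [hx, hx₀]
    linarith
  have h1 : 0.99 * (0.866 * (e' + 0.355 * e)) ≤ C * (x - x₀) := by
    refine mul_le_mul hC d1 (by positivity) (by linarith)
  have h2 : |S * ξ| ≤ 0.13 * ((e' + 1.29 * e) / 2) := by
    rw [abs_mul]; gcongr
  linarith [(abs_le.1 h2).1]

set_option maxHeartbeats 400000 in
/-- Near a side, at the apex of an element pointing to the side: the circle soon enters an element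
with its base on the side, and both parts of the element are not too small. -/
lemma SideFrame.exists_apex_elem (hF : SideFrame c a α X Y) (hr0 : 0 < r) (hr : r < Real.sqrt 3 / 6)
    (hN : 0 < N) {t : ℝ} (ht : N * cellBary c a (circlePoint r c t) ≤ 1 / 800) {p q : ℕ}
    (hpq : p + q + 2 = N) (hq : N * cellBary c (a + 1) (circlePoint r c t) ≤ q + 1)
    (hp : N * cellBary c (a + 2) (circlePoint r c t) ≤ p + 1) :
    ∃ (K K' : Elem L N) (e k : ℝ), 0 ≤ k ∧ k ≤ 2 * e ∧ e ≤ 1 / 800 ∧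
      circlePoint r c t ∈ tri .short K ∧ circlePoint r c (t + k / (N * r)) ∈ tri .short K ∧
      (∀ i, 0.03 * (e * meshSize N) ^ 2 ≤ cutArea .short r K i) ∧
      ∀ k', 0 ≤ k' → k' ≤ 1 / 8 →
        circlePoint r c (t + k / (N * r) + k' / (N * r)) ∈ tri .short K' := by
  have hN' : (0 : ℝ) < N := by positivity
  have hh := meshSize_pos hN
  have hN2 : (2 : ℝ) ≤ N := by exact_mod_cast (by omega : 2 ≤ N)
  have hpqR : (p : ℝ) + q + 2 = N := by exact_mod_cast hpq
  have ht' : N * cellBary c a (circlePoint r c t) ≤ 1 / 400 := by linarith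
  have hnn : ∀ s, 0 ≤ N * cellBary c a (circlePoint r c s) := fun s =>
    mul_nonneg hN'.le (cellBary_pos hr
      (Metric.sphere_subset_closedBall (circlePoint_mem_sphere hr0.le c s)) a).le
  have hsum : ∀ x, N * cellBary c a x + N * cellBary c (a + 1) x + N * cellBary c (a + 2) x = N :=
    fun x => by linear_combination (N : ℝ) * cellBary_sum_shift c a x
  obtain ⟨hcos, hsin, hrl, hru⟩ := hF.radius_bounds hr0 hr hN ht'
  set x := circlePoint r c t with hx
  -- `e` and `e'` measure the distances of the point to the two edges that meet at the apex. They
  -- add up to the scaled coordinate of the side, so both are at most `1 / 800`.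
  set e := p + 1 - N * cellBary c (a + 2) x with he
  set e' := q + 1 - N * cellBary c (a + 1) x with he'
  have he0 : 0 ≤ e := by linarith
  have he0' : 0 ≤ e' := by linarith
  have hee : N * cellBary c a x = e + e' := by linarith [hsum x]
  have he1 : e ≤ 1 / 800 := by linarith
  obtain ⟨K, hK⟩ := exists_side_down_elem (L := L) hN c a hpq
  have hpq' : (p + 1) + q + 1 = N := by omega
  obtain ⟨K', hK'⟩ := exists_side_up_elem (L := L) hN c a hpq'
  -- the exit point
  have hcont : Continuous fun k : ℝ => N * cellBary c (a + 2) (circlePoint r c (t + k / (N * r))) := by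
    have h1 : Continuous fun y => cellBary c (a + 2) y := by
      have h1 := continuous_tau₁
      have h2 := continuous_tau₂
      unfold cellBary
      generalize a + 2 = b
      fin_cases b <;> simp <;> fun_prop
    have h2 : Continuous fun k : ℝ => circlePoint r c (t + k / (N * r)) :=
      (continuous_circlePoint r c).comp (by fun_prop)
    exact continuous_const.mul (h1.comp h2)
  -- The coordinate `a + 2` increases at a rate of at least `0.69`, and `2 * 0.69 > 1`, so the edge
  -- ahead is reached before `k = 2 e`.
  obtain ⟨k, ⟨hk0, hk1⟩, hk⟩ : ∃ k ∈ Set.Icc 0 (2 * e),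
      N * cellBary c (a + 2) (circlePoint r c (t + k / (N * r))) = p + 1 := by
    have hivt := intermediate_value_Icc (by linarith : (0 : ℝ) ≤ 2 * e) hcont.continuousOn
    refine hivt ⟨?_, ?_⟩
    · simpa using hp
    · have := (hF.forward (k := 2 * e) hr0 hr hN ht' (by linarith) (by linarith)).2.1
      linarith
  obtain ⟨g1, g2, g3, g4, g5⟩ := hF.forward hr0 hr hN ht' hk0 (by linarith : k ≤ 1 / 8)
  obtain ⟨g1a, g1b⟩ := abs_le.1 g1
  set y := circlePoint r c (t + k / (N * r)) with hy
  have hy400 : N * cellBary c a y ≤ 1 / 400 := by linarith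
  have hKcell : tri .short K ⊆ halfCell c := by
    intro z hz
    have hz' := (hK z).1 hz
    have hs := hsum z
    refine (forall_fin_three_shift a).2 ⟨?_, ?_, ?_⟩
    · exact nonneg_of_mul_nonneg_right (by linarith) hN'
    · exact nonneg_of_mul_nonneg_right (by linarith [(Nat.cast_nonneg q : (0 : ℝ) ≤ q)]) hN'
    · exact nonneg_of_mul_nonneg_right (by linarith [(Nat.cast_nonneg p : (0 : ℝ) ≤ p)]) hN'
  obtain ⟨hcut0, hcut1⟩ := cutPart_eq_of_subset hr hN hKcell
  have hlip : ∀ (b : Fin 3) (z z' : Plane) (ρ : ℝ), ‖z' - z‖ ≤ ρ →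
      |N * cellBary c b z' - N * cellBary c b z| ≤ 1.1548 * (N * ρ) := by
    intro b z z' ρ hz
    rw [← mul_sub, abs_mul, abs_of_pos hN']
    have h1 := abs_cellBary_sub_cellBary_le c b z' z
    have h2 : 2 / Real.sqrt 3 * ‖z' - z‖ ≤ 1.1548 * ρ := by
      have := two_div_sqrt_three_bounds.2
      gcongr
    refine (mul_le_mul_of_nonneg_left (h1.trans h2) hN'.le).trans_eq ?_
    ring
  have hXs : ∀ z, N * X z = Real.sqrt 3 / 2 * (N / 3 - N * cellBary c a z) := by
    intro z
    rw [hF.side]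
    field_simp
    ring
  have hYs : ∀ z, N * Y z = (N * cellBary c (a + 2) z - N * cellBary c (a + 1) z) / 2 := by
    intro z
    linear_combination (-(N : ℝ) / 2) * hF.diff z
  -- Points on the symmetry axis of the element that starts at the apex.
  have hpoint : ∀ ζ : ℝ, ∃ z, N * cellBary c a z = 2 * ζ ∧ N * cellBary c (a + 1) z = q + 1 - ζ ∧
      N * cellBary c (a + 2) z = p + 1 - ζ := by
    intro ζ
    obtain ⟨z, hz1, hz2⟩ := hF.surj (Real.sqrt 3 / 2 * (1 / 3 - 2 * ζ / N)) ((p - q) / (2 * N))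
    have hz0 : N * cellBary c a z = 2 * ζ := by
      rw [hF.side, hz1]
      field_simp
      ring
    refine ⟨z, hz0, ?_, ?_⟩
    · rw [hF.one_eq, hz0, hz2]
      field_simp
      linarith
    · rw [hF.two_eq, hz0, hz2]
      field_simp
      linarith
  obtain ⟨hsin1, hsin2⟩ := abs_le.1 hsin
  have hXx := (hF.circle r t).1
  have hYx := (hF.circle r t).2
  rw [← hx] at hXx hYx
  refine ⟨K, K', e, k, hk0, hk1, he1, (hK _).2 ⟨by linarith, by linarith, by linarith⟩,
    (hK _).2 ⟨by linarith, by linarith, by linarith⟩, ?_, ?_⟩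
  · have hNh : N * meshSize N = 1 := by rw [meshSize_eq]; field_simp
    refine Fin.forall_fin_two.2 ⟨?_, ?_⟩
    · -- inside
      -- A ball of radius `h / 10` in the middle of the element is closer to the centre of the
      -- circle than `x`.
      obtain ⟨z, hz0, hz1, hz2⟩ := hpoint (1 / 4)
      have hball : Metric.closedBall z (meshSize N / 10) ⊆ cutPart .short r K 0 := by
        intro w hw
        rw [Metric.mem_closedBall, dist_eq_norm] at hw
        have l0 := abs_le.1 (hlip a z w _ hw)
        have l1 := abs_le.1 (hlip (a + 1) z w _ hw)
        have l2 := abs_le.1 (hlip (a + 2) z w _ hw)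
        have hNh' : N * (meshSize N / 10) = 1 / 10 := by rw [← mul_div_assoc, hNh]
        rw [hNh', hz0] at l0
        rw [hNh', hz1] at l1
        rw [hNh', hz2] at l2
        rw [hcut0]
        refine ⟨(hK w).2 ⟨by linarith, by linarith, by linarith⟩, ?_⟩
        rw [Metric.mem_closedBall, dist_eq_norm]
        have hxr : ‖x - circleCenter c‖ = r := by
          rw [← dist_eq_norm]; exact circlePoint_mem_sphere hr0.le c t
        have hX1 := hXs w
        have hX0 := hXs x
        have hY1 := hYs w
        have hY0 := hYs x
        have hYb : |N * Y x| ≤ 0.0377 * N := by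
          rw [hYx, abs_mul, abs_mul, abs_of_pos hN', abs_of_pos hr0]
          have : r * |Real.sin (t - α)| ≤ 0.29 * 0.13 := by gcongr
          exact (mul_le_mul_of_nonneg_left this hN'.le).trans (by linarith)
        obtain ⟨hYb1, hYb2⟩ := abs_le.1 hYb
        rw [← hxr, ← sq_le_sq₀ (norm_nonneg _) (norm_nonneg _), hF.norm_sq, hF.norm_sq]
        have hkey := apex_inside_arith hN2 hX1 hX0 hYb (ξ := N * Y w - N * Y x)
          (by rw [hY1, hY0, abs_le]; constructor <;> linarith) (by linarith) (by linarith)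
        rw [add_sub_cancel] at hkey
        have : (N : ℝ) ^ 2 * (X w ^ 2 + Y w ^ 2) ≤ (N : ℝ) ^ 2 * (X x ^ 2 + Y x ^ 2) := by
          linarith
        exact le_of_mul_le_mul_left this (by positivity)
      refine le_trans ?_ (le_cutArea_of_ball (by positivity) hball)
      have h1 : (e * meshSize N) ^ 2 ≤ meshSize N ^ 2 := by
        rw [mul_pow]
        exact mul_le_of_le_one_left (sq_nonneg _) (pow_le_one₀ he0 (by linarith))
      refine (mul_le_mul_of_nonneg_left h1 (by norm_num)).trans ?_
      rw [div_pow, ← mul_div_assoc, mul_div_right_comm]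
      exact mul_le_mul_of_nonneg_right (by linarith [Real.pi_gt_three]) (sq_nonneg _)
    · -- outside
      -- A ball of radius `e h / 8` near the apex lies beyond the tangent at `x`. The constant
      -- `0.03` is below both `π / 100` and `π / 64`.
      obtain ⟨z, hz0, hz1, hz2⟩ := hpoint (e / 4)
      have hball : Metric.closedBall z (e * meshSize N / 8) ⊆ cutPart .short r K 1 := by
        intro w hw
        rw [Metric.mem_closedBall, dist_eq_norm] at hw
        have l0 := abs_le.1 (hlip a z w _ hw)
        have l1 := abs_le.1 (hlip (a + 1) z w _ hw)
        have l2 := abs_le.1 (hlip (a + 2) z w _ hw)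
        have hNh' : N * (e * meshSize N / 8) = e / 8 := by
          rw [show N * (e * meshSize N / 8) = e / 8 * (N * meshSize N) by ring, hNh, mul_one]
        rw [hNh', hz0] at l0
        rw [hNh', hz1] at l1
        rw [hNh', hz2] at l2
        rw [hcut1]
        refine ⟨(hK w).2 ⟨by linarith, by linarith, by linarith⟩, ?_⟩
        rw [Metric.mem_ball, not_lt, dist_eq_norm]
        have hX1 := hXs w
        have hX0 := hXs x
        have hY1 := hYs w
        have hY0 := hYs x
        have d3 := apex_outside_arith (ξ := N * Y w - N * Y x) hX1 hX0 hcos hsin he0 he0'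
          (by linarith)
          (by rw [hY1, hY0, abs_le]; constructor <;> linarith)
        have d4 : r ≤ Real.cos (t - α) * X w + Real.sin (t - α) * Y w := by
          have hsc := Real.sin_sq_add_cos_sq (t - α)
          have h1 : Real.cos (t - α) * X x + Real.sin (t - α) * Y x = r := by
            rw [hXx, hYx]; linear_combination r * hsc
          have h2 : 0 ≤ (N : ℝ) * (Real.cos (t - α) * X w + Real.sin (t - α) * Y w - r) := by
            linear_combination d3 - (N : ℝ) * h1
          linarith [nonneg_of_mul_nonneg_right h2 hN']
        rw [← sq_le_sq₀ hr0.le (norm_nonneg _), hF.norm_sq]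
        have hsc := Real.sin_sq_add_cos_sq (t - α)
        have h5 : (Real.cos (t - α) * X w + Real.sin (t - α) * Y w) ^ 2 +
            (Real.cos (t - α) * Y w - Real.sin (t - α) * X w) ^ 2 = X w ^ 2 + Y w ^ 2 := by
          linear_combination (X w ^ 2 + Y w ^ 2) * hsc
        rw [← h5]
        exact (pow_le_pow_left₀ hr0.le d4 2).trans (le_add_of_nonneg_right (sq_nonneg _))
      refine le_trans ?_ (le_cutArea_of_ball (by positivity) hball)
      rw [div_pow, ← mul_div_assoc, mul_div_right_comm]
      exact mul_le_mul_of_nonneg_right (by linarith [Real.pi_gt_three]) (sq_nonneg _)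
  · intro k' hk0' hk1'
    obtain ⟨f1, f2, f3, f4, f5⟩ := hF.forward hr0 hr hN hy400 hk0' hk1'
    refine (hK' _).2 ⟨hnn _, ?_, ?_⟩
    · linarith [hsum y]
    · push_cast
      linarith

end

end

section

variable {L N : ℕ}

/-! ### The jump near the side of a half-cell -/

/-- Trigonometric polynomials of degree one satisfy the recurrence with characteristic roots `1` and
`exp (±i s)`, whose polynomial is `z³ - (1 + 2 cos s) z² + (1 + 2 cos s) z - 1`. -/
lemma trig_recurrence (A B C : ℂ) (t s : ℝ) :
    A + B * (Real.cos t : ℂ) + C * (Real.sin t : ℂ) =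
      (1 + 2 * (Real.cos s : ℂ)) *
        (A + B * (Real.cos (t + s) : ℂ) + C * (Real.sin (t + s) : ℂ)) -
      (1 + 2 * (Real.cos s : ℂ)) *
        (A + B * (Real.cos (t + 2 * s) : ℂ) + C * (Real.sin (t + 2 * s) : ℂ)) +
      (A + B * (Real.cos (t + 3 * s) : ℂ) + C * (Real.sin (t + 3 * s) : ℂ)) := by
  have hs : ((Real.sin s : ℝ) : ℂ) ^ 2 + ((Real.cos s : ℝ) : ℂ) ^ 2 = 1 := by
    exact_mod_cast Real.sin_sq_add_cos_sq s
  simp only [Real.cos_add, Real.sin_add, Real.cos_two_mul, Real.sin_two_mul, Real.cos_three_mul,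
    Real.sin_three_mul]
  push_cast at hs ⊢
  linear_combination (4 * Complex.sin s * (Complex.cos t * C - Complex.sin t * B) ) * hs

lemma norm_sq_trig_le {f : ℝ → ℂ} {A B C : ℂ}
    (hf : ∀ t, f t = A + B * (Real.cos t : ℂ) + C * (Real.sin t : ℂ)) (t s : ℝ) :
    ‖f t‖ ^ 2 ≤ 27 * ‖f (t + s)‖ ^ 2 + 27 * ‖f (t + 2 * s)‖ ^ 2 + 3 * ‖f (t + 3 * s)‖ ^ 2 := by
  have h := trig_recurrence A B C t s
  rw [← hf, ← hf, ← hf, ← hf] at h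
  have h3 : ‖(1 + 2 * (Real.cos s : ℂ))‖ ≤ 3 := by
    refine (norm_add_le _ _).trans ?_
    rw [norm_mul, Complex.norm_real, Real.norm_eq_abs, norm_one, Complex.norm_two]
    linarith [Real.abs_cos_le_one s]
  have h4 : ‖f t‖ ≤ 3 * ‖f (t + s)‖ + 3 * ‖f (t + 2 * s)‖ + ‖f (t + 3 * s)‖ := by
    rw [h]
    refine (norm_add_le _ _).trans (add_le_add_left ((norm_sub_le _ _).trans ?_) _)
    rw [norm_mul, norm_mul]
    gcongr
  calc _ ≤ _ := pow_le_pow_left₀ (norm_nonneg _) h4 2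
    _ ≤ _ := add_three_sq_le _ _ _
    _ = _ := by ring

/-- The pointwise estimate is integrated over `s ∈ (0, κ)`, and `27 + 27 / 2 + 3 / 3 ≤ 42`. It
bounds the value at the end of an arc by the mean over the arc, whatever the length of the arc is.
-/
lemma norm_sq_trig_le_integral {f : ℝ → ℂ} {A B C : ℂ}
    (hf : ∀ t, f t = A + B * (Real.cos t : ℂ) + C * (Real.sin t : ℂ)) (t : ℝ) {κ : ℝ}
    (hκ : 0 < κ) : κ * ‖f t‖ ^ 2 ≤ 42 * ∫ s in t..(t + 3 * κ), ‖f s‖ ^ 2 := by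
  have hc : Continuous f := by
    have : f = fun t => A + B * (Real.cos t : ℂ) + C * (Real.sin t : ℂ) := funext hf
    rw [this]
    fun_prop
  have hc2 : Continuous fun s => ‖f s‖ ^ 2 := hc.norm.pow 2
  have hsub : ∀ m : ℝ, 0 < m → m ≤ 3 → ∫ s in (0)..κ, ‖f (t + m * s)‖ ^ 2 ≤
      m⁻¹ * ∫ s in t..(t + 3 * κ), ‖f s‖ ^ 2 := by
    intro m hm hm3
    have := intervalIntegral.integral_comp_add_mul (a := 0) (b := κ) (fun s => ‖f s‖ ^ 2) hm.ne' t
    rw [this, smul_eq_mul, mul_zero, add_zero]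
    refine mul_le_mul_of_nonneg_left ?_ (by positivity)
    refine intervalIntegral.integral_mono_interval le_rfl (by nlinarith) (by nlinarith)
      (Eventually.of_forall fun s => by positivity) (hc2.intervalIntegrable _ _)
  have hi : ∀ m : ℝ, IntervalIntegrable (fun s => ‖f (t + m * s)‖ ^ 2) volume 0 κ := fun m =>
    (hc2.comp (by fun_prop : Continuous fun s : ℝ => t + m * s)).intervalIntegrable _ _
  have h := intervalIntegral.integral_mono_on hκ.le
    (intervalIntegrable_const (c := ‖f t‖ ^ 2))
    ((((hi 1).const_mul 27).add ((hi 2).const_mul 27)).add ((hi 3).const_mul 3))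
    fun s _ => by simpa only [one_mul] using norm_sq_trig_le hf t s
  rw [intervalIntegral.integral_add (((hi 1).const_mul 27).add ((hi 2).const_mul 27))
    ((hi 3).const_mul 3), intervalIntegral.integral_add ((hi 1).const_mul 27) ((hi 2).const_mul 27),
    intervalIntegral.integral_const_mul, intervalIntegral.integral_const_mul,
    intervalIntegral.integral_const_mul, intervalIntegral.integral_const, sub_zero,
    smul_eq_mul] at h
  have h1 := hsub 1 one_pos (by norm_num)
  have h2 := hsub 2 two_pos (by norm_num)
  have h3 := hsub 3 three_pos le_rfl
  have h0 : 0 ≤ ∫ s in t..(t + 3 * κ), ‖f s‖ ^ 2 :=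
    intervalIntegral.integral_nonneg (by linarith) fun s _ => by positivity
  norm_num at h1 h2 h3
  simp only [one_mul] at h
  linarith

lemma affFn_circlePoint (c₀ : ℂ) (b : Fin 2 → ℂ) (r : ℝ) (c : Circles L) (t : ℝ) :
    affFn c₀ b (circlePoint r c t) = affFn c₀ b (circleCenter c) + (r * b 0) * (Real.cos t : ℂ) +
      (r * b 1) * (Real.sin t : ℂ) := by
  simp [affFn, circlePoint, unitNormal, Fin.sum_univ_two]
  ring

lemma abs_waveVec_sum_le {kpar : ℝ} (hk : kpar ∈ Set.Icc 0 (2 * Real.pi)) :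
    ∑ j, |waveVec kpar j| ≤ 16 := by
  have hpi := Real.pi_pos
  have hpi4 := Real.pi_le_four
  have h0 : 0 ≤ kpar / (2 * Real.pi) := div_nonneg hk.1 (by positivity)
  have h1 : kpar / (2 * Real.pi) ≤ 1 := (div_le_one (by positivity)).2 hk.2
  have h3 := sqrt_three_lt
  have h3' := sqrt_three_pos
  have e0 : |k₁ 0| ≤ 8 := by
    rw [k₁]
    simp
    rw [abs_of_pos (by positivity)]
    nlinarith
  have e1 : |k₁ 1| ≤ 8 := by
    rw [k₁]
    simp
    rw [← abs_mul, abs_of_pos (by positivity)]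
    have : Real.pi * Real.sqrt 3 * (Real.sqrt 3) = 3 * Real.pi := by
      linear_combination Real.pi * sqrt_three_sq
    nlinarith
  simp only [Fin.sum_univ_two, waveVec, abs_mul, abs_of_nonneg h0]
  have := abs_nonneg (k₁ 0)
  have := abs_nonneg (k₁ 1)
  nlinarith

section

variable {d : Diagonal} {r kpar : ℝ} {u : Pair}

/-- On an interface element both components are affine, hence so is the jump. The second part
recovers its ordinary gradient from the twisted ones. -/
lemma exists_jump_affFn (hu : u ∈ Vh L N d r) {K : Elem L N} (hK : K ∈ interfaceElems L N d r) :
    ∃ (c₀ : ℂ) (b : Fin 2 → ℂ), (∀ x ∈ tri d K, jump u x = affFn c₀ b x) ∧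
      ∀ x ∈ interior (tri d K), ∀ j, b j = twistedGrad kpar (u 0) x j - twistedGrad kpar (u 1) x j -
        Complex.I * (waveVec kpar j : ℂ) * jump u x := by
  obtain ⟨c0, b0, h0⟩ := exists_affFn hu (mem_coverElems_of_interface hK 0)
  obtain ⟨c1, b1, h1⟩ := exists_affFn hu (mem_coverElems_of_interface hK 1)
  refine ⟨c0 - c1, fun j => b0 j - b1 j, fun x hx => ?_, fun x hx j => ?_⟩
  · rw [jump, h0 x hx, h1 x hx]
    simp [affFn, Fin.sum_univ_two]
    ring
  · rw [twistedGrad_eq_affFn kpar h0 hx j, twistedGrad_eq_affFn kpar h1 hx j, jump,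
      h0 x (interior_subset hx), h1 x (interior_subset hx)]
    simp [affFn, Fin.sum_univ_two]
    ring

/-- Comparison of the jump at two points of an element. -/
lemma norm_jump_sq_le (hk : kpar ∈ Set.Icc 0 (2 * Real.pi)) (hu : u ∈ Vh L N d r) {K : Elem L N}
    (hK : K ∈ interfaceElems L N d r) {x y : Plane} (hx : x ∈ interior (tri d K))
    (hy : y ∈ tri d K) (hxy : ‖y - x‖ ≤ 1 / 32) :
    ‖jump u x‖ ^ 2 ≤ 12 * ‖jump u y‖ ^ 2 +
      24 * ∑ i, ‖y - x‖ ^ 2 * gradSq kpar (u i) x := by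
  obtain ⟨c₀, b, h, hb⟩ := exists_jump_affFn (kpar := kpar) hu hK
  set S : Fin 2 → ℝ := fun i => ∑ j, ‖twistedGrad kpar (u i) x j‖ with hS
  have hS2 : ∀ i, S i ^ 2 ≤ 2 * gradSq kpar (u i) x := fun i => by
    simp only [hS, gradSq, Fin.sum_univ_two]
    nlinarith [sq_nonneg (‖twistedGrad kpar (u i) x 0‖ - ‖twistedGrad kpar (u i) x 1‖)]
  have hbj : ∀ j, ‖b j‖ ≤ ‖twistedGrad kpar (u 0) x j‖ + ‖twistedGrad kpar (u 1) x j‖ +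
      |waveVec kpar j| * ‖jump u x‖ := fun j => by
    rw [hb x hx j]
    refine (norm_sub_le _ _).trans (add_le_add (norm_sub_le _ _) (le_of_eq ?_))
    rw [norm_mul, norm_mul, Complex.norm_I, one_mul, Complex.norm_real, Real.norm_eq_abs]
  have hbs : ∑ j, ‖b j‖ ≤ S 0 + S 1 + 16 * ‖jump u x‖ := by
    calc ∑ j, ‖b j‖ ≤ ∑ j, (‖twistedGrad kpar (u 0) x j‖ + ‖twistedGrad kpar (u 1) x j‖ +
        |waveVec kpar j| * ‖jump u x‖) := Finset.sum_le_sum fun j _ => hbj j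
      _ = S 0 + S 1 + (∑ j, |waveVec kpar j|) * ‖jump u x‖ := by
        rw [Finset.sum_add_distrib, Finset.sum_add_distrib, Finset.sum_mul]
      _ ≤ _ := by have := abs_waveVec_sum_le hk; gcongr
  have hdiff : jump u x - jump u y = -∑ j, b j * ((y - x) j : ℂ) := by
    rw [h x (interior_subset hx), h y hy]
    simp [affFn, Fin.sum_univ_two]
    ring
  have hn : ‖jump u x - jump u y‖ ≤ ‖y - x‖ * ∑ j, ‖b j‖ := by
    rw [hdiff, norm_neg, Finset.mul_sum]
    refine (norm_sum_le _ _).trans (Finset.sum_le_sum fun j _ => ?_)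
    rw [norm_mul, Complex.norm_real, mul_comm]
    have := PiLp.norm_apply_le (y - x) j
    gcongr
  have hz := norm_nonneg (y - x)
  -- The term of order zero contributes at most `16 * (1 / 32) = 1 / 2` of the left side, which is
  -- absorbed and doubles the other terms.
  have hmain : ‖jump u x‖ ≤ 2 * ‖jump u y‖ + 2 * (‖y - x‖ * S 0) + 2 * (‖y - x‖ * S 1) := by
    have h1 : ‖jump u x‖ ≤ ‖jump u y‖ + ‖jump u x - jump u y‖ := by
      have := norm_add_le (jump u y) (jump u x - jump u y)
      rwa [add_sub_cancel] at this
    have h2 : ‖y - x‖ * ∑ j, ‖b j‖ ≤ ‖y - x‖ * (S 0 + S 1 + 16 * ‖jump u x‖) := by gcongr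
    have h3 : ‖y - x‖ * ‖jump u x‖ ≤ 1 / 32 * ‖jump u x‖ := by gcongr
    linarith
  rw [Fin.sum_univ_two]
  have h0 := mul_le_mul_of_nonneg_left (hS2 0) (sq_nonneg ‖y - x‖)
  have h1 := mul_le_mul_of_nonneg_left (hS2 1) (sq_nonneg ‖y - x‖)
  calc ‖jump u x‖ ^ 2 ≤ (2 * ‖jump u y‖ + 2 * (‖y - x‖ * S 0) + 2 * (‖y - x‖ * S 1)) ^ 2 := by
        gcongr
    _ ≤ _ := add_three_sq_le _ _ _
    _ ≤ _ := by linarith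

lemma jumpSq_le_of_long_cut (hr0 : 0 < r) (hr : r < Real.sqrt 3 / 6) (hN : 0 < N) (c : Circles L)
    {t : ℝ} {K : Elem L N} (hK : circlePoint r c t ∈ tri d K)
    (hcut : meshSize N / 8 ≤ cutLength d r K) :
    jumpSq r u c t ≤ 8 * weightedJump N d r u c t := by
  have h1 := le_weightedJump (u := u) hr0.le hr hN c hK
  have hh := meshSize_pos hN
  have h2 : 1 / 8 ≤ cutLength d r K / meshSize N := by
    rw [le_div_iff₀ hh]; linarith
  have := mul_le_mul_of_nonneg_right h2 (jumpSq_nonneg (r := r) (u := u) c t)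
  linarith

/-- The jump at a point where the circle is close to the side of the half-cell. -/
lemma jumpSq_le_of_near_side (hL : 0 < L) (hN : 0 < N) (hr0 : 0 < r) (hr : r < Real.sqrt 3 / 6)
    (hk : kpar ∈ Set.Icc 0 (2 * Real.pi)) (hcut : CutAssumption L N .short r)
    (hu : u ∈ Vh L N .short r) (c : Circles L) (a : Fin 3) {t : ℝ}
    (ht : N * cellBary c a (circlePoint r c t) ≤ 1 / 800)
    (hskel : circlePoint r c t ∉ skeleton L N .short) :
    jumpSq r u c t ≤ 8 * weightedJump N .short r u c t +
      30000 * ((meshSize N)⁻¹ * ∫ s in t..(t + meshSize N), weightedJump N .short r u c s) +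
      3300 * affConst * energyAlong N .short r kpar u c t := by
  have hN' : (0 : ℝ) < N := by positivity
  have hh := meshSize_pos hN
  have hw0 := weightedJump_nonneg (d := .short) (u := u) hr0.le hN c
  have hint0 : 0 ≤ ∫ s in t..(t + meshSize N), weightedJump N .short r u c s :=
    intervalIntegral_nonneg_of hw0 hh.le
  have hE0 := energyAlong_nonneg (d := .short) (r := r) (kpar := kpar) (u := u) (N := N) c t
  have hA := affConst_pos
  have hpos : ∀ b, 0 < N * cellBary c b (circlePoint r c t) := fun b => mul_pos hN'
    (cellBary_pos hr (Metric.sphere_subset_closedBall (circlePoint_mem_sphere hr0.le c t)) b)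
  have hsum : N * cellBary c a (circlePoint r c t) + N * cellBary c (a + 1) (circlePoint r c t) +
      N * cellBary c (a + 2) (circlePoint r c t) = N := by
    linear_combination (N : ℝ) * cellBary_sum_shift c a (circlePoint r c t)
  obtain ⟨α, X, Y, hF⟩ := exists_sideFrame c a
  have ht4 : N * cellBary c a (circlePoint r c t) ≤ 1 / 400 := by linarith
  obtain ⟨-, -, -, hru⟩ := hF.radius_bounds hr0 hr hN ht4
  have hwin := hF.window_le hr0 hr hN ht4
  -- The integer parts locate the element in the strip of the mesh along the side: `p + q + 1 = N`
  -- if its base is on the side, and `p + q + 2 = N` if only its apex is.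
  set p := ⌊N * cellBary c (a + 2) (circlePoint r c t)⌋₊ with hp
  set q := ⌊N * cellBary c (a + 1) (circlePoint r c t)⌋₊ with hq
  have hp1 := Nat.floor_le (hpos (a + 2)).le
  have hq1 := Nat.floor_le (hpos (a + 1)).le
  have hp2 := Nat.lt_floor_add_one (N * cellBary c (a + 2) (circlePoint r c t))
  have hq2 := Nat.lt_floor_add_one (N * cellBary c (a + 1) (circlePoint r c t))
  rw [← hp] at hp1 hp2
  rw [← hq] at hq1 hq2
  have hlt : p + q < N := by
    have : (p : ℝ) + q < N := by linarith [hpos a]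
    exact_mod_cast this
  have hge : N < p + q + 3 := by
    have : (N : ℝ) < p + q + 3 := by linarith [hpos a]
    exact_mod_cast this
  rcases (by omega : p + q + 1 = N ∨ p + q + 2 = N) with hpq | hpq
  · obtain ⟨K, hK, hlen⟩ := hF.exists_base_elem hr0 hr hN ht4 hpq hq1 hp1
    have := jumpSq_le_of_long_cut (u := u) hr0 hr hN c hK hlen
    have h2 : 0 ≤ (meshSize N)⁻¹ * ∫ s in t..(t + meshSize N), weightedJump N .short r u c s := by
      positivity
    have h3 : 0 ≤ affConst * energyAlong N .short r kpar u c t := by positivity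
    linarith
  · obtain ⟨K, K', e, k, hk0, hke, he, hK, hKy, harea, harc⟩ :=
      hF.exists_apex_elem hr0 hr hN ht hpq hq2.le hp2.le
    set t' := t + k / (N * r) with ht'
    have hΓ := circlePoint_mem_interface hr0.le hr c t
    have hKi := mem_interfaceElems hΓ hK
    have hxi : circlePoint r c t ∈ interior (tri .short K) := by
      by_contra hx
      exact hskel ⟨K, hK, hx⟩
    have hNr : 0 < N * r := by positivity
    have hNh : (N : ℝ)⁻¹ = meshSize N := by rw [meshSize_eq, one_div]
    have hz : ‖circlePoint r c t' - circlePoint r c t‖ ≤ 2 * e * meshSize N := by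
      rw [norm_circlePoint_sub hr0.le, norm_unitNormal_sub]
      have h1 : |Real.sin ((t' - t) / 2)| ≤ |(t' - t) / 2| := Real.abs_sin_le_abs
      have h2 : |(t' - t) / 2| = k / (N * r) / 2 := by
        rw [ht', add_sub_cancel_left, abs_of_nonneg (by positivity)]
      rw [h2] at h1
      have h3 : r * (k / (N * r)) = k * meshSize N := by
        rw [← hNh]; field_simp
      nlinarith
    have hz' : ‖circlePoint r c t' - circlePoint r c t‖ ≤ 1 / 32 := by
      nlinarith [meshSize_le_one hN]
    have hcomp := norm_jump_sq_le hk hu hKi hxi hKy hz'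
    -- the energy part
    have hen : ∑ i, ‖circlePoint r c t' - circlePoint r c t‖ ^ 2 *
        gradSq kpar (u i) (circlePoint r c t) ≤ 137 * affConst * energyAlong N .short r kpar u c t := by
      refine le_trans ?_ (mul_le_mul_of_nonneg_left
        (le_energyAlong (u := u) (kpar := kpar) hr0.le hr c hK) (by positivity))
      rw [elemEnergy, Finset.mul_sum]
      refine Finset.sum_le_sum fun i _ => ?_
      have h1 := cutArea_mul_gradSq_le hr0.le hr hN hcut kpar hu hxi hΓ i
      have h2 : ‖circlePoint r c t' - circlePoint r c t‖ ^ 2 ≤ 137 * cutArea .short r K i := by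
        calc _ ≤ (2 * e * meshSize N) ^ 2 := by gcongr
          _ = 4 * (e * meshSize N) ^ 2 := by ring
          _ ≤ _ := by linarith [harea i, sq_nonneg (e * meshSize N)]
      calc _ ≤ 137 * cutArea .short r K i * gradSq kpar (u i) (circlePoint r c t) :=
            mul_le_mul_of_nonneg_right h2 (gradSq_nonneg _ _ _)
        _ ≤ _ := by linarith
    -- the jump at the exit point
    have hlen : meshSize N / 8 ≤ cutLength .short r K' := by
      refine le_cutLength_of_arc hr0 hN .short K' c (t := t') ?_ harc
      have e1 : 1 / 8 / (N * r) = 1 / 8 * (1 / (N * r)) := by ring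
      rw [e1]
      linarith [meshSize_le_one hN, Real.pi_gt_three]
    -- `3 κ` is the parameter length of an arc of length `h / 8` in `K'`, on which the jump is a
    -- trigonometric polynomial of degree one.
    set κ := 1 / 24 / (N * r) with hκ
    have hκ0 : 0 < κ := by positivity
    have h3κ : 3 * κ = 1 / 8 / (N * r) := by rw [hκ]; ring
    have hK'i : K' ∈ interfaceElems L N .short r := by
      refine mem_interfaceElems (circlePoint_mem_interface hr0.le hr c (t' + 0 / (N * r)))
        (harc 0 le_rfl (by norm_num))
    obtain ⟨c₀, b, hJ, -⟩ := exists_jump_affFn (kpar := kpar) hu hK'i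
    have harc' : ∀ s ∈ Set.Icc t' (t' + 3 * κ), circlePoint r c s ∈ tri .short K' := by
      intro s hs
      have h1 : (s - t') * (N * r) ≤ 1 / 8 := by
        rw [← le_div_iff₀ hNr]; linarith [hs.2]
      have := harc ((s - t') * (N * r)) (mul_nonneg (by linarith [hs.1]) hNr.le) h1
      rwa [mul_div_cancel_right₀ _ hNr.ne', add_sub_cancel] at this
    have htrig := norm_sq_trig_le_integral (f := fun s => affFn c₀ b (circlePoint r c s))
      (fun s => affFn_circlePoint c₀ b r c s) t' hκ0
    have hmono : ∫ s in t'..(t' + 3 * κ), ‖affFn c₀ b (circlePoint r c s)‖ ^ 2 ≤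
        8 * ∫ s in t..(t + meshSize N), weightedJump N .short r u c s := by
      have hG := isTame_weightedJump hL hN hr0 hr hu c
      have hJt := isTame_jumpSq hL hN hr0 hr hu c
      have e1 : ∫ s in t'..(t' + 3 * κ), ‖affFn c₀ b (circlePoint r c s)‖ ^ 2 =
          ∫ s in t'..(t' + 3 * κ), jumpSq r u c s := by
        refine intervalIntegral.integral_congr fun s hs => ?_
        rw [Set.uIcc_of_le (by linarith)] at hs
        simp only [jumpSq, hJ _ (harc' s hs)]
      have h2 : ∫ s in t'..(t' + 3 * κ), jumpSq r u c s ≤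
          ∫ s in t'..(t' + 3 * κ), 8 * weightedJump N .short r u c s :=
        intervalIntegral.integral_mono_on (by linarith) (hJt.intervalIntegrable _ _)
          ((hG.const_mul 8).intervalIntegrable _ _)
          fun s hs => jumpSq_le_of_long_cut hr0 hr hN c (harc' s hs) hlen
      rw [e1]
      refine h2.trans ?_
      rw [intervalIntegral.integral_const_mul]
      refine mul_le_mul_of_nonneg_left ?_ (by norm_num)
      have hkk : k / (N * r) = k * (1 / (N * r)) := by ring
      have hk1 : k / (N * r) ≤ 1 / 400 * (1 / (N * r)) := by
        rw [hkk]
        exact mul_le_mul_of_nonneg_right (by linarith) (by positivity)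
      have h8 : 1 / 8 / (N * r) = 1 / 8 * (1 / (N * r)) := by ring
      refine intervalIntegral.integral_mono_interval ?_ (by linarith) ?_
        (Eventually.of_forall hw0) (hG.intervalIntegrable _ _)
      · have : 0 ≤ k / (N * r) := by positivity
        linarith
      · rw [h3κ, ht', h8]
        linarith
    -- `κ⁻¹ = 24 N r ≤ 7 / h` because `r ≤ 0.29`, and `7 * 42 * 8 = 2352`.
    have hJt' : jumpSq r u c t' ≤
        2400 * ((meshSize N)⁻¹ * ∫ s in t..(t + meshSize N), weightedJump N .short r u c s) := by
      have h1 : jumpSq r u c t' = ‖affFn c₀ b (circlePoint r c t')‖ ^ 2 := by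
        rw [jumpSq, hJ _ (harc' t' ⟨le_rfl, by linarith⟩)]
      have h2 : κ⁻¹ ≤ 7 * (meshSize N)⁻¹ := by
        rw [hκ, ← hNh, inv_inv]
        rw [show (1 / 24 / (N * r))⁻¹ = 24 * r * N by field_simp]
        nlinarith
      have h3 : jumpSq r u c t' = κ⁻¹ * (κ * ‖affFn c₀ b (circlePoint r c t')‖ ^ 2) := by
        rw [h1]; field_simp
      rw [h3]
      set I := ∫ s in t..(t + meshSize N), weightedJump N .short r u c s
      calc _ ≤ κ⁻¹ * (42 * (8 * I)) := by
            refine mul_le_mul_of_nonneg_left (htrig.trans ?_) (by positivity)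
            linarith
        _ ≤ 7 * (meshSize N)⁻¹ * (42 * (8 * I)) := by gcongr
        _ ≤ _ := by
            have : 0 ≤ (meshSize N)⁻¹ * I := by positivity
            linarith
    change jumpSq r u c t ≤ 12 * jumpSq r u c t' + _ at hcomp
    have h3 : 0 ≤ affConst * energyAlong N .short r kpar u c t := by positivity
    have h4 : 0 ≤ (meshSize N)⁻¹ * ∫ s in t..(t + meshSize N), weightedJump N .short r u c s := by
      positivity
    linarith [hw0 t]

end

end

section

variable {L N : ℕ}

/-! ## Control of the jump by the stabilisation and the energy -/

section

variable {d : Diagonal} {r kpar : ℝ} {u : Pair}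

/-- Away from the sides of the half-cell, the circle has a collar in the background. -/
lemma collar_subset (hr0 : 0 < r) (hr : r < Real.sqrt 3 / 6) (hN : 0 < N) (c : Circles L) {t η : ℝ}
    (hη : 0 < η) (ht : ∀ a, η ≤ N * cellBary c a (circlePoint r c t)) :
    ∀ ρ ∈ Set.Icc r (r + η * meshSize N / 3), ∀ s ∈ Set.Icc t (t + η * meshSize N / 3),
      circleCenter c + ρ • unitNormal s ∈ subdomain L r 1 := by
  intro ρ hρ s hs
  have hN' : (0 : ℝ) < N := by positivity
  have hh := meshSize_pos hN
  set σ := η * meshSize N / 3 with hσ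
  have hσ0 : 0 < σ := by positivity
  set x := circleCenter c + ρ • unitNormal s with hx
  have hr1 : r ≤ 0.3 := by linarith [sqrt_three_lt]
  -- The radial displacement is at most `σ` and the angular one at most `0.3 σ`. The coordinates
  -- start from at least `η h = 3 σ` and have slope below `1.1548`, so they stay positive.
  have hdist : ‖x - circlePoint r c t‖ ≤ 1.3 * σ := by
    have e : x - circlePoint r c t = (ρ - r) • unitNormal s + r • (unitNormal s - unitNormal t) := by
      rw [hx, circlePoint]
      module
    have h1 : |Real.sin ((s - t) / 2)| ≤ |(s - t) / 2| := Real.abs_sin_le_abs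
    rw [abs_of_nonneg (by linarith [hs.1] : 0 ≤ (s - t) / 2)] at h1
    rw [e]
    refine (norm_add_le _ _).trans ?_
    rw [norm_smul, norm_smul, norm_unitNormal, norm_unitNormal_sub, Real.norm_of_nonneg hr0.le,
      Real.norm_of_nonneg (by linarith [hρ.1])]
    have h2 : 2 * |Real.sin ((s - t) / 2)| ≤ σ := by linarith [hs.2]
    have h3 : r * (2 * |Real.sin ((s - t) / 2)|) ≤ 0.3 * σ := by gcongr
    linarith [hρ.2]
  have hpos : ∀ a, 0 < cellBary c a x := by
    intro a
    have h1 := (abs_le.1 (abs_cellBary_sub_cellBary_le c a x (circlePoint r c t))).1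
    have h2 : 2 / Real.sqrt 3 * ‖x - circlePoint r c t‖ ≤ 1.1548 * (1.3 * σ) := by
      have := two_div_sqrt_three_bounds.2
      gcongr
    have h3 : η * meshSize N ≤ cellBary c a (circlePoint r c t) := by
      have e : η * meshSize N = η / N := by rw [meshSize_eq]; ring
      rw [e, div_le_iff₀ hN', mul_comm]
      exact ht a
    have h4 : η * meshSize N = 3 * σ := by rw [hσ]; ring
    linarith
  rw [mem_subdomain_one hr]
  refine ⟨halfCell_subset_cylinder c fun a => (hpos a).le, fun c' hc' => ?_⟩
  have hcc : c' = c := eq_of_mem_halfCell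
    (closedBall_subset_halfCell hr (Metric.ball_subset_closedBall hc')) hpos
  subst hcc
  rw [Metric.mem_ball, dist_eq_norm, hx, add_sub_cancel_left, norm_smul, norm_unitNormal, mul_one,
    Real.norm_of_nonneg (by linarith [hρ.1])] at hc'
  linarith [hρ.1]

/-- For the long diagonal, the circles stay away from the sides of the half-cells. -/
lemma le_cellBary_of_long (hL : 0 < L) (hr0 : 0 < r) (hr : r < Real.sqrt 3 / 6) (hN : 0 < N)
    (hcut : CutAssumption L N .long r) (c : Circles L) (a : Fin 3) (t : ℝ) :
    1 / 800 ≤ N * cellBary c a (circlePoint r c t) := by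
  have hN' : (0 : ℝ) < N := by positivity
  have h1 := gap_of_long hr hL hN hcut
  have h2 := (abs_le.1 (abs_cellBary_sub_le c a (circlePoint r c t))).1
  have h3 : ‖circlePoint r c t - circleCenter c‖ = r := by
    rw [← dist_eq_norm]; exact circlePoint_mem_sphere hr0.le c t
  have h4 := two_div_sqrt_three_bounds.1
  have h0 := sqrt_three_pos
  have hh := meshSize_pos hN
  have hNh : N * meshSize N = 1 := by rw [meshSize_eq]; field_simp
  rw [h3] at h2
  have h5 : 2 / Real.sqrt 3 * r ≤ 2 / Real.sqrt 3 * (Real.sqrt 3 / 6 - meshSize N / 20) := by gcongr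
  have h6 : 2 / Real.sqrt 3 * (Real.sqrt 3 / 6 - meshSize N / 20) =
      1 / 3 - 2 / Real.sqrt 3 * (meshSize N / 20) := by
    field_simp
    ring
  have h7 : 1 * (meshSize N / 20) ≤ 2 / Real.sqrt 3 * (meshSize N / 20) := by gcongr; linarith
  have h8 : meshSize N / 20 ≤ cellBary c a (circlePoint r c t) := by linarith
  nlinarith

/-- The majorant of the squared jump. -/
def jumpMajorant (N : ℕ) (d : Diagonal) (r kpar σ : ℝ) (u : Pair) (c : Circles L) (t : ℝ) : ℝ :=
  weightedJump N d r u c t +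
    (meshSize N)⁻¹ * (∫ s in t..(t + meshSize N), weightedJump N d r u c s) +
    ∑ i : Fin 2, (meshSize N * collarEnergy N d r kpar σ u i c t +
      ∫ s in t..(t + meshSize N), collarEnergy N d r kpar σ u i c s) +
    energyAlong N d r kpar u c t

/-- The first summand serves the points with a collar in the background, where the jump is averaged
over a good element. The other two come from the points near a side. -/
def jumpConst (r₀ η : ℝ) : ℝ := 140000 / (r₀ * η ^ 2) + 30000 + 3300 * affConst

lemma jumpConst_pos {r₀ η : ℝ} (hr₀ : 0 < r₀) : 0 < jumpConst r₀ η := by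
  have := affConst_pos
  have : 0 ≤ 140000 / (r₀ * η ^ 2) := by positivity
  unfold jumpConst
  linarith

/-- The pointwise bound of the jump. -/
lemma jumpSq_le_majorant (hL : 0 < L) (hN : 0 < N) {r₀ η : ℝ} (hr₀ : 0 < r₀) (hrr : r₀ ≤ r)
    (hr : r < Real.sqrt 3 / 6) (hη : 0 < η) (hη1 : η ≤ 1 / 800) (hηr : η ≤ r₀)
    (hk : kpar ∈ Set.Icc 0 (2 * Real.pi)) (hcut : CutAssumption L N d r) (hu : u ∈ Vh L N d r)
    (c : Circles L) {t : ℝ} (ht : t ∉ edgeDirections L N d)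
    (hskel : circlePoint r c t ∉ skeleton L N d) :
    jumpSq r u c t ≤
      jumpConst r₀ η * jumpMajorant N d r kpar (η * meshSize N / 3) u c t := by
  have hr0 : 0 < r := hr₀.trans_le hrr
  have hh := meshSize_pos hN
  have hh1 := meshSize_le_one hN
  have hA := affConst_pos
  set σ := η * meshSize N / 3 with hσ
  have hσ0 : 0 < σ := by positivity
  have hG0 := weightedJump_nonneg (d := d) (u := u) hr0.le hN c
  have hQ0 := fun i => collarEnergy_nonneg (N := N) (d := d) (r := r) (kpar := kpar) (u := u)
    hσ0.le i c
  have hE0 := energyAlong_nonneg (d := d) (r := r) (kpar := kpar) (u := u) (N := N) c t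
  have hGi0 : 0 ≤ ∫ s in t..(t + meshSize N), weightedJump N d r u c s :=
    intervalIntegral_nonneg_of hG0 hh.le
  have hQi0 : ∀ i, 0 ≤ ∫ s in t..(t + meshSize N), collarEnergy N d r kpar σ u i c s := fun i =>
    intervalIntegral_nonneg_of (hQ0 i) hh.le
  have hGh : 0 ≤ (meshSize N)⁻¹ * ∫ s in t..(t + meshSize N), weightedJump N d r u c s := by
    positivity
  have hS0 : 0 ≤ ∑ i : Fin 2, (meshSize N * collarEnergy N d r kpar σ u i c t +
      ∫ s in t..(t + meshSize N), collarEnergy N d r kpar σ u i c s) :=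
    Finset.sum_nonneg fun i _ => add_nonneg (mul_nonneg hh.le (hQ0 i t)) (hQi0 i)
  have hC0 : 0 ≤ 140000 / (r₀ * η ^ 2) := by positivity
  have hGt := hG0 t
  -- Either there is room for a collar of width `η h / 3` in the background, or the circle is close
  -- to a side of its half-cell. By the gap, the second case occurs only for the short diagonal.
  by_cases hfar : ∀ a, η ≤ N * cellBary c a (circlePoint r c t)
  · have hσh : σ ≤ meshSize N := by rw [hσ]; nlinarith
    have hσr : σ < r := by rw [hσ]; nlinarith
    have hσ1 : r + σ ≤ 1 := by
      have : σ ≤ 1 / 2400 := by rw [hσ]; nlinarith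
      linarith [sqrt_three_lt]
    have h := jumpSq_le_of_collar' (kpar := kpar) hL hN hr0 hr hu c hσ0 hσh hσ0 hσr hσ1 ht
      (collar_subset hr0 hr hN c hη hfar)
    have hGt' := isTame_weightedJump hL hN hr0 hr hu c
    have hQt := fun i => isTame_collarEnergy (kpar := kpar) hr hu hσ0.le i c
    have hGm : ∫ s in t..(t + σ), weightedJump N d r u c s ≤
        ∫ s in t..(t + meshSize N), weightedJump N d r u c s :=
      intervalIntegral.integral_mono_interval le_rfl (by linarith) (by linarith)
        (Eventually.of_forall hG0) (hGt'.intervalIntegrable _ _)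
    have hQm : ∀ i, ∫ s in t..(t + σ), collarEnergy N d r kpar σ u i c s ≤
        ∫ s in t..(t + meshSize N), collarEnergy N d r kpar σ u i c s := fun i =>
      intervalIntegral.integral_mono_interval le_rfl (by linarith) (by linarith)
        (Eventually.of_forall (hQ0 i)) ((hQt i).intervalIntegrable _ _)
    have hc1 : 3 * (72 / σ) * (72 * meshSize N / (r * σ)) ≤
        140000 / (r₀ * η ^ 2) * (meshSize N)⁻¹ := by
      have e : 3 * (72 / σ) * (72 * meshSize N / (r * σ)) =
          139968 / (r * η ^ 2) * (meshSize N)⁻¹ := by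
        rw [hσ]; field_simp; norm_num
      rw [e]
      gcongr
      norm_num
    have hc2 : 9 * σ * (72 / σ) + 9 * (σ / σ) = 657 := by
      field_simp; norm_num
    have h1 : 3 * (72 / σ) * (72 * meshSize N / (r * σ)) *
        (∫ s in t..(t + σ), weightedJump N d r u c s) ≤ 140000 / (r₀ * η ^ 2) *
          ((meshSize N)⁻¹ * ∫ s in t..(t + meshSize N), weightedJump N d r u c s) := by
      rw [← mul_assoc]
      exact mul_le_mul hc1 hGm (intervalIntegral_nonneg_of hG0 hσ0.le) (by positivity)
    have h2 : ∑ i : Fin 2, (9 * σ * collarEnergy N d r kpar σ u i c t +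
        (9 * σ * (72 / σ) + 9 * (σ / σ)) *
          ∫ y in t..(t + σ), collarEnergy N d r kpar σ u i c y) ≤
        657 * ∑ i : Fin 2, (meshSize N * collarEnergy N d r kpar σ u i c t +
          ∫ s in t..(t + meshSize N), collarEnergy N d r kpar σ u i c s) := by
      rw [Finset.mul_sum]
      refine Finset.sum_le_sum fun i _ => ?_
      rw [hc2, mul_add]
      refine add_le_add ?_ (mul_le_mul_of_nonneg_left (hQm i) (by norm_num))
      have := mul_le_mul_of_nonneg_right hσh (hQ0 i t)
      have := mul_nonneg hh.le (hQ0 i t)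
      nlinarith
    unfold jumpConst jumpMajorant
    have h3 := mul_nonneg hC0 hGt
    have h4 := mul_nonneg hC0 hS0
    have h5 := mul_nonneg hC0 hE0
    have h6 := mul_nonneg hA.le hGt
    have h7 := mul_nonneg hA.le hGh
    have h8 := mul_nonneg hA.le hS0
    have h9 := mul_nonneg hA.le hE0
    have h10 := mul_nonneg hC0 hGh
    linarith
  · push Not at hfar
    obtain ⟨a, ha⟩ := hfar
    rcases d with _ | _
    · have h := jumpSq_le_of_near_side hL hN hr0 hr hk hcut hu c a (by linarith) hskel
      unfold jumpConst jumpMajorant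
      have h3 := mul_nonneg hC0 hGt
      have h4 := mul_nonneg hC0 hS0
      have h5 := mul_nonneg hC0 hE0
      have h6 := mul_nonneg hA.le hGt
      have h7 := mul_nonneg hA.le hGh
      have h8 := mul_nonneg hA.le hS0
      have h9 := mul_nonneg hA.le hE0
      have h10 := mul_nonneg hC0 hGh
      linarith
    · have := le_cellBary_of_long hL hr0 hr hN hcut c a t
      linarith

/-- By Fubini this is an integral of translates over `(0, h)`, and by periodicity all translates
have the same integral over a period. -/
lemma integral_window {f : ℝ → ℝ} (hf : IsTame f) {T : ℝ} (hT : Function.Periodic f T)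
    {h : ℝ} (hh : 0 ≤ h) :
    ∫ t in (0)..T, ∫ s in t..(t + h), f s = h * ∫ t in (0)..T, f t := by
  have e1 : ∀ t, ∫ s in t..(t + h), f s = ∫ s in (0)..h, f (t + s) := fun t => by
    rw [intervalIntegral.integral_comp_add_left, add_zero]
  have e2 : ∀ s, ∫ t in (0)..T, f (t + s) = ∫ t in (0)..T, f t := fun s => by
    rw [intervalIntegral.integral_comp_add_right, zero_add, add_comm T s]
    simpa using hT.intervalIntegral_add_eq s 0
  simp_rw [e1]
  obtain ⟨hm, B, hB⟩ := hf
  have hi : Integrable (Function.uncurry fun t s => f (t + s))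
      ((volume.restrict (Set.uIoc 0 T)).prod (volume.restrict (Set.Ioc 0 h))) := by
    rw [Set.uIoc]
    refine Integrable.of_bound (C := B) (hm.comp measurable_add).aestronglyMeasurable ?_
    filter_upwards with p
    exact hB _
  simp_rw [intervalIntegral.integral_of_le hh]
  rw [intervalIntegral_integral_swap hi]
  simp_rw [e2]
  rw [← intervalIntegral.integral_of_le hh, intervalIntegral.integral_const, sub_zero, smul_eq_mul]

lemma isTame_window {f : ℝ → ℝ} (hf : IsTame f) (h : ℝ) : IsTame fun t => ∫ s in t..(t + h), f s := by
  obtain ⟨hm, B, hB⟩ := hf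
  have hi : ∀ a b, IntervalIntegrable f volume a b := IsTame.intervalIntegrable ⟨hm, B, hB⟩
  refine ⟨?_, B * |h|, fun t => ?_⟩
  · have hc : Continuous fun t => ∫ s in (0)..t, f s := intervalIntegral.continuous_primitive hi 0
    have e : (fun t => ∫ s in t..(t + h), f s) =
        fun t => (∫ s in (0)..(t + h), f s) - ∫ s in (0)..t, f s := by
      ext t
      rw [intervalIntegral.integral_interval_sub_left (hi _ _) (hi _ _)]
    rw [e]
    exact ((hc.comp (by fun_prop : Continuous fun t : ℝ => t + h)).sub hc).measurable
  · have := intervalIntegral.norm_integral_le_of_norm_le_const (a := t) (b := t + h) (C := B)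
      (f := f) fun s _ => hB s
    rwa [add_sub_cancel_left] at this

lemma isTame_jumpMajorant (hL : 0 < L) (hN : 0 < N) (hr0 : 0 < r) (hr : r < Real.sqrt 3 / 6)
    (hu : u ∈ Vh L N d r) {σ : ℝ} (hσ : 0 ≤ σ) (c : Circles L) :
    IsTame (jumpMajorant N d r kpar σ u c) := by
  have hG := isTame_weightedJump hL hN hr0 hr hu c
  have hQ := fun i => isTame_collarEnergy (kpar := kpar) hr hu hσ i c
  have hE := isTame_energyAlong (d := d) (r := r) (kpar := kpar) (u := u) (N := N) c
  exact ((hG.add ((isTame_window hG _).const_mul _)).add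
    (IsTame.sum _ fun i _ => ((hQ i).const_mul _).add (isTame_window (hQ i) _))).add hE

lemma integral_jumpMajorant (hL : 0 < L) (hN : 0 < N) (hr0 : 0 < r) (hr : r < Real.sqrt 3 / 6)
    (hu : u ∈ Vh L N d r) {σ : ℝ} (hσ : 0 ≤ σ) (c : Circles L) :
    ∫ t in (0)..(2 * Real.pi), jumpMajorant N d r kpar σ u c t =
      2 * (∫ t in (0)..(2 * Real.pi), weightedJump N d r u c t) +
      2 * meshSize N *
        ∑ i : Fin 2, (∫ t in (0)..(2 * Real.pi), collarEnergy N d r kpar σ u i c t) +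
      ∫ t in (0)..(2 * Real.pi), energyAlong N d r kpar u c t := by
  have hh := meshSize_pos hN
  have hG := isTame_weightedJump hL hN hr0 hr hu c
  have hQ := fun i => isTame_collarEnergy (kpar := kpar) hr hu hσ i c
  have hE := isTame_energyAlong (d := d) (r := r) (kpar := kpar) (u := u) (N := N) c
  have hGw := (isTame_window hG (meshSize N)).const_mul (meshSize N)⁻¹
  have hQw := fun i => ((hQ i).const_mul (meshSize N)).add (isTame_window (hQ i) (meshSize N))
  have hQs := IsTame.sum Finset.univ fun i _ => hQw i
  unfold jumpMajorant
  rw [intervalIntegral.integral_add (((hG.add hGw).add hQs).intervalIntegrable _ _)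
      (hE.intervalIntegrable _ _),
    intervalIntegral.integral_add ((hG.add hGw).intervalIntegrable _ _)
      (hQs.intervalIntegrable _ _),
    intervalIntegral.integral_add (hG.intervalIntegrable _ _) (hGw.intervalIntegrable _ _),
    intervalIntegral.integral_const_mul, integral_window hG (weightedJump_periodic c) hh.le,
    intervalIntegral.integral_finsetSum fun i _ => (hQw i).intervalIntegrable _ _]
  have e : ∀ i : Fin 2, ∫ t in (0)..(2 * Real.pi), (meshSize N * collarEnergy N d r kpar σ u i c t +
      ∫ s in t..(t + meshSize N), collarEnergy N d r kpar σ u i c s) =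
      2 * meshSize N * ∫ t in (0)..(2 * Real.pi), collarEnergy N d r kpar σ u i c t := fun i => by
    rw [intervalIntegral.integral_add (((hQ i).const_mul _).intervalIntegrable _ _)
      ((isTame_window (hQ i) _).intervalIntegrable _ _), intervalIntegral.integral_const_mul,
      integral_window (hQ i) (collarEnergy_periodic σ i c) hh.le]
    ring
  simp_rw [e]
  rw [← Finset.mul_sum, inv_mul_cancel_left₀ hh.ne']
  ring

/-- The pointwise majorant is integrated over the circle. The collars have inner radius at least `r₀
/ 2`, so polar coordinates bound their energies by the bulk energy, with the factor `h` from the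
width of the window. -/
lemma integral_jumpSq_le (hL : 0 < L) (hN : 0 < N) {r₀ η : ℝ} (hr₀ : 0 < r₀) (hrr : r₀ ≤ r)
    (hr : r < Real.sqrt 3 / 6) (hη : 0 < η) (hη1 : η ≤ 1 / 800) (hηr : η ≤ r₀)
    (hk : kpar ∈ Set.Icc 0 (2 * Real.pi)) (hcut : CutAssumption L N d r) (hu : u ∈ Vh L N d r)
    (c : Circles L) :
    ∫ t in (0)..(2 * Real.pi), jumpSq r u c t ≤ jumpConst r₀ η *
      (2 * (∫ t in (0)..(2 * Real.pi), weightedJump N d r u c t) +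
      4 / r₀ * meshSize N * (∑ i : Fin 2, ∫ x in subdomain L r i, gradSq kpar (u i) x) +
      ∫ t in (0)..(2 * Real.pi), energyAlong N d r kpar u c t) := by
  have hr0 : 0 < r := hr₀.trans_le hrr
  have hh := meshSize_pos hN
  have hh1 := meshSize_le_one hN
  have hσ0 : 0 < η * meshSize N / 3 := by positivity
  have hσ2 : η * meshSize N / 3 ≤ r₀ / 2 := by nlinarith
  have hM := isTame_jumpMajorant (kpar := kpar) hL hN hr0 hr hu hσ0.le c
  have hJ := isTame_jumpSq hL hN hr0 hr hu c
  have h1 := intervalIntegral.integral_mono_ae (a := 0) (b := 2 * Real.pi) (μ := volume)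
    (by positivity) (hJ.intervalIntegrable _ _)
    ((hM.const_mul (jumpConst r₀ η)).intervalIntegrable _ _)
    (by
      filter_upwards [(countable_edgeDirections (L := L) hN d).ae_notMem volume,
        (countable_circle_skeleton (L := L) hN d (circleCenter c) hr0.ne').ae_notMem volume]
        with t ht ht'
      exact jumpSq_le_majorant (kpar := kpar) hL hN hr₀ hrr hr hη hη1 hηr hk hcut hu c ht ht')
  rw [intervalIntegral.integral_const_mul, integral_jumpMajorant hL hN hr0 hr hu hσ0.le c] at h1
  refine h1.trans (mul_le_mul_of_nonneg_left ?_ (jumpConst_pos hr₀).le)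
  have hQ : ∀ i : Fin 2, ∫ t in (0)..(2 * Real.pi),
      collarEnergy N d r kpar (η * meshSize N / 3) u i c t ≤
        2 / r₀ * ∫ x in subdomain L r i, gradSq kpar (u i) x := by
    intro i
    have hα : r₀ / 2 ≤ if i = 0 then r - η * meshSize N / 3 else r := by split_ifs <;> linarith
    have h2 := integral_rayEnergy_le (kpar := kpar) hL hN hr hu i (circleCenter c)
      (α := if i = 0 then r - η * meshSize N / 3 else r)
      (β := if i = 0 then r else r + η * meshSize N / 3)
      (lt_of_lt_of_le (by positivity) hα) (by split_ifs <;> linarith)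
    refine h2.trans (mul_le_mul_of_nonneg_right ?_ (integral_nonneg fun x => gradSq_nonneg _ _ _))
    rw [show 2 / r₀ = (r₀ / 2)⁻¹ from (inv_div _ _).symm]
    exact inv_anti₀ (by positivity) hα
  have hQs : 2 * meshSize N * ∑ i : Fin 2, (∫ t in (0)..(2 * Real.pi),
      collarEnergy N d r kpar (η * meshSize N / 3) u i c t) ≤
      4 / r₀ * meshSize N * ∑ i : Fin 2, ∫ x in subdomain L r i, gradSq kpar (u i) x := by
    calc _ ≤ 2 * meshSize N * ∑ i : Fin 2, 2 / r₀ * ∫ x in subdomain L r i, gradSq kpar (u i) x := by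
          gcongr with i
          exact hQ i
      _ = _ := by rw [← Finset.mul_sum]; ring
  linarith

lemma integral_arcSet_eq {f : ℝ → ℝ} (c : Circles L) (K : Elem L N) :
    ∫ t in arcSet r c (tri d K), f t =
      ∫ t in (0)..(2 * Real.pi), {s | circlePoint r c s ∈ tri d K}.indicator f t := by
  rw [intervalIntegral.integral_of_le (by positivity),
    setIntegral_indicator (measurableSet_circle_tri r c K)]
  rfl

lemma lineIntegral_jump_eq (K : Elem L N) : (lineIntegral L r (tri d K) fun x _ => ‖jump u x‖ ^ 2) =
    ∑ c : Circles L, r * ∫ t in (0)..(2 * Real.pi),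
      {s | circlePoint r c s ∈ tri d K}.indicator (jumpSq r u c) t := by
  rw [lineIntegral_eq]
  refine Finset.sum_congr rfl fun c _ => ?_
  rw [← integral_arcSet_eq, ← integral_const_mul]
  rfl

lemma sum_lineIntegral_jump_le (hL : 0 < L) (hN : 0 < N) (hr0 : 0 < r) (hr : r < Real.sqrt 3 / 6)
    (hu : u ∈ Vh L N d r) (s : Finset (Elem L N)) :
    ∑ K ∈ s, (lineIntegral L r (tri d K) fun x _ => ‖jump u x‖ ^ 2) ≤
      72 * ∑ c : Circles L, r * ∫ t in (0)..(2 * Real.pi), jumpSq r u c t := by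
  simp_rw [lineIntegral_jump_eq]
  rw [Finset.sum_comm, Finset.mul_sum]
  refine Finset.sum_le_sum fun c _ => ?_
  have hJ := isTame_jumpSq hL hN hr0 hr hu c
  have hI : ∀ K : Elem L N, IsTame ({s | circlePoint r c s ∈ tri d K}.indicator (jumpSq r u c)) :=
    fun K => hJ.indicator (measurableSet_circle_tri r c K)
  rw [← Finset.mul_sum, ← intervalIntegral.integral_finsetSum
    fun K _ => (hI K).intervalIntegrable _ _, mul_left_comm (72 : ℝ) r]
  refine mul_le_mul_of_nonneg_left ?_ hr0.le
  rw [← intervalIntegral.integral_const_mul]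
  refine intervalIntegral.integral_mono_on (by positivity)
    ((IsTame.sum _ fun K _ => hI K).intervalIntegrable _ _)
    ((hJ.const_mul 72).intervalIntegrable _ _) fun t _ => ?_
  have h := sum_indicator_tri_le (d := d) hN s (circlePoint r c t)
  have e : ∀ K : Elem L N, {s | circlePoint r c s ∈ tri d K}.indicator (jumpSq r u c) t =
      (tri d K).indicator (fun _ => (1 : ℝ)) (circlePoint r c t) * jumpSq r u c t := by
    classical
    intro K
    simp only [Set.indicator_apply, Set.mem_ofPred_eq]
    split_ifs <;> simp
  simp_rw [e]
  rw [← Finset.sum_mul]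
  exact mul_le_mul_of_nonneg_right h (jumpSq_nonneg c t)

lemma sum_integral_weightedJump (hL : 0 < L) (hN : 0 < N) (hr0 : 0 < r) (hr : r < Real.sqrt 3 / 6)
    (hu : u ∈ Vh L N d r) :
    ∑ c : Circles L, r * ∫ t in (0)..(2 * Real.pi), weightedJump N d r u c t =
      ∑ K ∈ interfaceElems L N d r, cutLength d r K / meshSize N *
        lineIntegral L r (tri d K) fun x _ => ‖jump u x‖ ^ 2 := by
  simp_rw [lineIntegral_jump_eq, Finset.mul_sum]
  rw [Finset.sum_comm]
  refine Finset.sum_congr rfl fun c _ => ?_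
  have hJ := isTame_jumpSq hL hN hr0 hr hu c
  unfold weightedJump
  rw [intervalIntegral.integral_finsetSum fun K _ => ((hJ.const_mul _).indicator
    (measurableSet_circle_tri r c K)).intervalIntegrable _ _, Finset.mul_sum]
  refine Finset.sum_congr rfl fun K _ => ?_
  rw [mul_left_comm (cutLength d r K / meshSize N) r,
    ← intervalIntegral.integral_const_mul (cutLength d r K / meshSize N)]
  congr 1
  refine intervalIntegral.integral_congr fun t _ => ?_
  exact Set.indicator_const_mul _ _ _ _

/-- The element `K` is counted with weight `|Γ_K| ≤ 96 L h`, and the overlap is at most 72-fold: `96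
* 72 = 6912`. -/
lemma sum_integral_energyAlong (hL : 0 < L) (hN : 0 < N) (hr0 : 0 < r) (hr : r < Real.sqrt 3 / 6)
    (hu : u ∈ Vh L N d r) :
    ∑ c : Circles L, r * ∫ t in (0)..(2 * Real.pi), energyAlong N d r kpar u c t ≤
      6912 * L * meshSize N * ∑ i : Fin 2, ∫ x in subdomain L r i, gradSq kpar (u i) x := by
  have e : ∑ c : Circles L, r * ∫ t in (0)..(2 * Real.pi), energyAlong N d r kpar u c t =
      ∑ K ∈ interfaceElems L N d r, cutLength d r K * elemEnergy d r kpar u K := by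
    simp_rw [cutLength_eq, Finset.sum_mul]
    rw [Finset.sum_comm]
    refine Finset.sum_congr rfl fun c _ => ?_
    unfold energyAlong
    rw [intervalIntegral.integral_finsetSum fun K _ => ((IsTame.const _).indicator
      (measurableSet_circle_tri r c K)).intervalIntegrable _ _, Finset.mul_sum]
    refine Finset.sum_congr rfl fun K _ => ?_
    rw [← integral_arcSet_eq, setIntegral_const, smul_eq_mul, mul_assoc]
    rfl
  rw [e]
  have hh := meshSize_pos hN
  calc _ ≤ ∑ K ∈ interfaceElems L N d r, 96 * L * meshSize N * elemEnergy d r kpar u K :=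
        Finset.sum_le_sum fun K _ =>
          mul_le_mul_of_nonneg_right (cutLength_le hr0 hN d K) (elemEnergy_nonneg K)
    _ = 96 * L * meshSize N * ∑ i : Fin 2, ∑ K ∈ interfaceElems L N d r, cutEnergy d r kpar u K i := by
        rw [← Finset.mul_sum, Finset.sum_comm]
        rfl
    _ ≤ 96 * L * meshSize N * ∑ i : Fin 2, 72 * ∫ x in subdomain L r i, gradSq kpar (u i) x := by
        gcongr with i
        exact sum_cutEnergy_le hL hN hr kpar hu _ i
    _ = _ := by rw [← Finset.mul_sum]; ring

/-- The jump is controlled by its part on the elements with a long cut and by the energy. -/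
lemma sum_jump_le (hL : 0 < L) (hN : 0 < N) {r₀ η : ℝ} (hr₀ : 0 < r₀) (hrr : r₀ ≤ r)
    (hr : r < Real.sqrt 3 / 6) (hη : 0 < η) (hη1 : η ≤ 1 / 800) (hηr : η ≤ r₀)
    (hk : kpar ∈ Set.Icc 0 (2 * Real.pi)) (hcut : CutAssumption L N d r) (hu : u ∈ Vh L N d r) :
    ∑ K ∈ interfaceElems L N d r, (meshSize N)⁻¹ *
        (lineIntegral L r (tri d K) fun x _ => ‖jump u x‖ ^ 2) ≤
      72 * jumpConst r₀ η * (2 + 16 * L / r₀ + 6912 * L) *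
        ((∑ K ∈ interfaceElems L N d r, (meshSize N)⁻¹ * (cutLength d r K / meshSize N) *
          lineIntegral L r (tri d K) fun x _ => ‖jump u x‖ ^ 2) +
        ∑ i : Fin 2, ∫ x in subdomain L r i, gradSq kpar (u i) x) := by
  have hr0 : 0 < r := hr₀.trans_le hrr
  have hh := meshSize_pos hN
  have hC := jumpConst_pos (η := η) hr₀
  have hr1 : r ≤ 1 := by linarith [sqrt_three_lt]
  set E := ∑ i : Fin 2, ∫ x in subdomain L r i, gradSq kpar (u i) x with hE
  have hE0 : 0 ≤ E := Finset.sum_nonneg fun i _ => integral_nonneg fun x => gradSq_nonneg _ _ _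
  set X := ∑ K ∈ interfaceElems L N d r, cutLength d r K / meshSize N *
        lineIntegral L r (tri d K) fun x _ => ‖jump u x‖ ^ 2 with hX
  have hX0 : 0 ≤ X := Finset.sum_nonneg fun K _ => mul_nonneg
    (div_nonneg (cutLength_nonneg hr0.le d K) hh.le)
    (lineIntegral_nonneg hr0.le _ fun _ _ => by positivity)
  have e : (∑ K ∈ interfaceElems L N d r, (meshSize N)⁻¹ * (cutLength d r K / meshSize N) *
      lineIntegral L r (tri d K) fun x _ => ‖jump u x‖ ^ 2) = (meshSize N)⁻¹ * X := by
    rw [hX, Finset.mul_sum]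
    simp_rw [mul_assoc]
  rw [e, ← Finset.mul_sum]
  have h1 := sum_lineIntegral_jump_le hL hN hr0 hr hu (interfaceElems L N d r)
  have h2 : ∑ c : Circles L, r * ∫ t in (0)..(2 * Real.pi), jumpSq r u c t ≤
      jumpConst r₀ η * (2 * X + 16 * L / r₀ * meshSize N * E + 6912 * L * meshSize N * E) := by
    calc _ ≤ ∑ c : Circles L, r * (jumpConst r₀ η *
          (2 * (∫ t in (0)..(2 * Real.pi), weightedJump N d r u c t) + 4 / r₀ * meshSize N * E +
            ∫ t in (0)..(2 * Real.pi), energyAlong N d r kpar u c t)) :=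
          Finset.sum_le_sum fun c _ => mul_le_mul_of_nonneg_left
            (integral_jumpSq_le hL hN hr₀ hrr hr hη hη1 hηr hk hcut hu c) hr0.le
      _ = jumpConst r₀ η *
          (2 * (∑ c : Circles L, r * ∫ t in (0)..(2 * Real.pi), weightedJump N d r u c t) +
          r * (16 * L / r₀ * meshSize N * E) +
          ∑ c : Circles L, r * ∫ t in (0)..(2 * Real.pi), energyAlong N d r kpar u c t) := by
          clear_value E
          have e4 : r * (16 * L / r₀ * meshSize N * E) =
              ∑ c : Circles L, r * (4 / r₀ * meshSize N * E) := by
            simp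
            ring
          rw [e4, Finset.mul_sum, ← Finset.sum_add_distrib, ← Finset.sum_add_distrib,
            Finset.mul_sum]
          exact Finset.sum_congr rfl fun c _ => by ring
      _ ≤ _ := by
          rw [sum_integral_weightedJump hL hN hr0 hr hu]
          have h3 := sum_integral_energyAlong (kpar := kpar) hL hN hr0 hr hu
          have h4 : 0 ≤ 16 * L / r₀ * meshSize N * E := by positivity
          have h5 : r * (16 * L / r₀ * meshSize N * E) ≤ 16 * L / r₀ * meshSize N * E :=
            mul_le_of_le_one_left h4 hr1
          gcongr
  calc _ ≤ (meshSize N)⁻¹ * (72 * (jumpConst r₀ η *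
        (2 * X + 16 * L / r₀ * meshSize N * E + 6912 * L * meshSize N * E))) := by
        gcongr
        exact h1.trans (by gcongr)
    _ = 72 * jumpConst r₀ η * (2 * ((meshSize N)⁻¹ * X) + (16 * L / r₀ + 6912 * L) * E) := by
        field_simp
        ring
    _ ≤ 72 * jumpConst r₀ η * ((2 + 16 * L / r₀ + 6912 * L) * ((meshSize N)⁻¹ * X + E)) := by
        have h6 : 0 ≤ (meshSize N)⁻¹ * X := by positivity
        have h7 : 0 ≤ (16 * L / r₀ + 6912 * L) * ((meshSize N)⁻¹ * X) := by positivity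
        refine mul_le_mul_of_nonneg_left ?_ (by positivity)
        linarith
    _ = _ := by ring

end

end

section

variable {L N : ℕ}

/-! ## The Nitsche form -/

section

variable {d : Diagonal} {r kpar wmin wmax : ℝ} {u v : Pair} {M : Medium}

/-- The integrand of the form in the subdomains. -/
def weightForm (M : Medium) (r kpar : ℝ) (i : Fin 2) (u v : Plane → ℂ) (x : Plane) : ℂ :=
  ∑ j, (M.W r i x).mulVec (twistedGrad kpar u x) j * star (twistedGrad kpar v x j)

lemma integrableOn_gradSq (hL : 0 < L) (hN : 0 < N) (hr : r < Real.sqrt 3 / 6)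
    (hu : u ∈ Vh L N d r) (i : Fin 2) : IntegrableOn (gradSq kpar (u i)) (subdomain L r i) := by
  refine ((integrable_density hr kpar hu i).integrableOn (s := subdomain L r i)).congr ?_
  rw [Filter.EventuallyEq, ae_restrict_iff' (isClosed_subdomain hr i).measurableSet]
  filter_upwards [gradSq_ae_eq_density (d := d) (r := r) (u := u) hL hN kpar i] with x hx hxi
  exact (hx hxi).symm

lemma aestronglyMeasurable_twistedGrad (hL : 0 < L) (hN : 0 < N)
    (hu : u ∈ Vh L N d r) (i j : Fin 2) :
    AEStronglyMeasurable (fun x => twistedGrad kpar (u i) x j)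
      (volume.restrict (subdomain L r i)) := by
  have h1 : AEStronglyMeasurable (fun x => twistedGrad kpar (u i) x j)
      (volume.restrict (liveSet L N d r i)) :=
    (continuousOn_twistedGrad kpar hu i j).aestronglyMeasurable (isOpen_liveSet d r i).measurableSet
  have h2 : subdomain L r i ≤ᵐ[volume] liveSet L N d r i := ae_mem_liveSet hL hN d r i
  exact h1.mono_measure (Measure.restrict_mono_ae h2)

/-- Young's inequality with a free parameter. The same parameter is kept in all parts of the form
and optimised once, in `le_sqrt_mul_sqrt`. -/
lemma norm_weightForm_le (hw : WeightBounds M L r wmin wmax) (hmin : 0 < wmin) {i : Fin 2}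
    {x : Plane} (hx : x ∈ subdomain L r i) (u v : Plane → ℂ) {s : ℝ} (hs : 0 < s) :
    ‖weightForm M r kpar i u v x‖ ≤
      wmax / 2 * (s * gradSq kpar u x + s⁻¹ * gradSq kpar v x) := by
  have w0 := supW_pos hw hmin i
  have h := hw.mulVec_le i x hx (twistedGrad kpar u x)
  set w := M.supW L r i with hwd
  set z := (M.W r i x).mulVec (twistedGrad kpar u x) with hz
  have h1 : ∀ a b : ℝ, a * b ≤ 1 / 2 * (s / w * a ^ 2 + w * s⁻¹ * b ^ 2) := by
    intro a b
    have : 0 ≤ 1 / 2 * (s / w) * (a - w / s * b) ^ 2 := by positivity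
    have e : 1 / 2 * (s / w * a ^ 2 + w * s⁻¹ * b ^ 2) - a * b =
        1 / 2 * (s / w) * (a - w / s * b) ^ 2 := by
      field_simp; ring
    linarith
  have h2 : ‖weightForm M r kpar i u v x‖ ≤
      1 / 2 * (s / w * ∑ j, ‖z j‖ ^ 2 + w * s⁻¹ * gradSq kpar v x) := by
    rw [gradSq, Finset.mul_sum, Finset.mul_sum, ← Finset.sum_add_distrib, Finset.mul_sum]
    refine (norm_sum_le _ _).trans (Finset.sum_le_sum fun j _ => ?_)
    rw [norm_mul, norm_star]
    exact h1 _ _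
  have hgu := gradSq_nonneg kpar u x
  have hgv := gradSq_nonneg kpar v x
  calc _ ≤ _ := h2
    _ ≤ 1 / 2 * (s / w * (w ^ 2 * gradSq kpar u x) + w * s⁻¹ * gradSq kpar v x) := by
        gcongr
        exact h
    _ = w * (1 / 2 * (s * gradSq kpar u x + s⁻¹ * gradSq kpar v x)) := by field_simp
    _ ≤ wmax * (1 / 2 * (s * gradSq kpar u x + s⁻¹ * gradSq kpar v x)) :=
        mul_le_mul_of_nonneg_right (hw.supW_le i) (by positivity)
    _ = _ := by ring

lemma norm_integral_weightForm_le (hL : 0 < L) (hN : 0 < N) (hr : r < Real.sqrt 3 / 6)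
    (hw : WeightBounds M L r wmin wmax) (hmin : 0 < wmin) (hu : u ∈ Vh L N d r)
    (hv : v ∈ Vh L N d r) (i : Fin 2) {s : ℝ} (hs : 0 < s) :
    ‖∫ x in subdomain L r i, weightForm M r kpar i (u i) (v i) x‖ ≤
      wmax / 2 * (s * (∫ x in subdomain L r i, gradSq kpar (u i) x) +
        s⁻¹ * ∫ x in subdomain L r i, gradSq kpar (v i) x) := by
  have h1 := (integrableOn_gradSq (kpar := kpar) hL hN hr hu i).const_mul s
  have h2 := (integrableOn_gradSq (kpar := kpar) hL hN hr hv i).const_mul s⁻¹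
  refine (norm_integral_le_of_norm_le ((h1.add h2).const_mul (wmax / 2)) ?_).trans_eq ?_
  · rw [ae_restrict_iff' (isClosed_subdomain hr i).measurableSet]
    exact Eventually.of_forall fun x hx => norm_weightForm_le hw hmin hx _ _ hs
  · rw [integral_const_mul]
    simp only [Pi.add_apply]
    rw [integral_add h1 h2, integral_const_mul, integral_const_mul]

lemma integral_weightForm_self (hL : 0 < L) (hN : 0 < N) (hr : r < Real.sqrt 3 / 6)
    (hw : WeightBounds M L r wmin wmax) (hmin : 0 < wmin) (hu : u ∈ Vh L N d r) (i : Fin 2) :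
    ∃ b : ℝ, ∫ x in subdomain L r i, weightForm M r kpar i (u i) (u i) x = b ∧
      wmin * ∫ x in subdomain L r i, gradSq kpar (u i) x ≤ b := by
  have hS := (isClosed_subdomain (L := L) hr i).measurableSet
  have hg := integrableOn_gradSq (kpar := kpar) hL hN hr hu i
  have hm : AEStronglyMeasurable (weightForm M r kpar i (u i) (u i))
      (volume.restrict (subdomain L r i)) := by
    have ht := fun j => aestronglyMeasurable_twistedGrad (kpar := kpar) hL hN hu i j
    have hW := fun a b => (measurable_W M r i a b).aestronglyMeasurable
      (μ := volume.restrict (subdomain L r i))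
    unfold weightForm
    simp only [Matrix.mulVec, dotProduct]
    exact Finset.aestronglyMeasurable_fun_sum _ fun j _ =>
      (Finset.aestronglyMeasurable_fun_sum _ fun l _ => (hW j l).mul (ht l)).mul (ht j).star
  have hint : IntegrableOn (weightForm M r kpar i (u i) (u i)) (subdomain L r i) := by
    refine Integrable.mono' (((hg.const_mul 1).add (hg.const_mul 1⁻¹)).const_mul (wmax / 2)) hm ?_
    rw [ae_restrict_iff' hS]
    exact Eventually.of_forall fun x hx => norm_weightForm_le hw hmin hx _ _ one_pos
  refine ⟨∫ x in subdomain L r i, (weightForm M r kpar i (u i) (u i) x).re, ?_, ?_⟩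
  · rw [← integral_complex_ofReal]
    refine setIntegral_congr_fun hS fun x hx => ?_
    exact Complex.ext rfl (hw.form_im i x hx _)
  · rw [← integral_const_mul]
    exact setIntegral_mono_on (hg.const_mul wmin) hint.re hS fun x hx => hw.form_re i x hx _

lemma lineIntegral_star (S : Set Plane) (f : Plane → Plane → ℂ) :
    (lineIntegral L r S fun x n => star (f x n)) = star (lineIntegral L r S f) := by
  rw [lineIntegral_eq, lineIntegral_eq, star_sum]
  refine Finset.sum_congr rfl fun c _ => ?_
  refine Eq.trans ?_ integral_conj
  refine congrArg _ (funext fun t => ?_)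
  simp

lemma lineIntegral_ofReal (S : Set Plane) (f : Plane → Plane → ℝ) :
    (lineIntegral L r S fun x n => (f x n : ℂ)) = (lineIntegral L r S f : ℝ) := by
  rw [lineIntegral_eq, lineIntegral_eq, Complex.ofReal_sum]
  refine Finset.sum_congr rfl fun c _ => ?_
  rw [← integral_complex_ofReal]
  refine congrArg _ (funext fun t => ?_)
  simp

lemma lineIntegral_const_mul (S : Set Plane) (a : ℝ) (f : Plane → Plane → ℝ) :
    (lineIntegral L r S fun x n => a * f x n) = a * lineIntegral L r S f := by
  rw [lineIntegral_eq, lineIntegral_eq, Finset.mul_sum]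
  refine Finset.sum_congr rfl fun c _ => ?_
  rw [← integral_const_mul]
  refine congrArg _ (funext fun t => ?_)
  simp only [smul_eq_mul]
  ring

/-- The energy in the subdomains. -/
def bulkEnergy (L : ℕ) (r kpar : ℝ) (u : Pair) : ℝ :=
  ∑ i : Fin 2, ∫ x in subdomain L r i, gradSq kpar (u i) x

lemma bulkEnergy_nonneg (L : ℕ) (r kpar : ℝ) (u : Pair) : 0 ≤ bulkEnergy L r kpar u :=
  Finset.sum_nonneg fun _ _ => integral_nonneg fun _ => gradSq_nonneg _ _ _

/-- The jump part of the energy. -/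
def jumpEnergy (L N : ℕ) (d : Diagonal) (r : ℝ) (u : Pair) : ℝ :=
  ∑ K ∈ interfaceElems L N d r, (meshSize N)⁻¹ *
    lineIntegral L r (tri d K) fun x _ => ‖jump u x‖ ^ 2

lemma energySq_eq (L N : ℕ) (d : Diagonal) (r kpar : ℝ) (u : Pair) :
    energySq L N d r kpar u = bulkEnergy L r kpar u + jumpEnergy L N d r u := rfl

/-- The stabilisation. -/
def stabEnergy (M : Medium) (L N : ℕ) (d : Diagonal) (r : ℝ) (u : Pair) : ℝ :=
  ∑ K ∈ interfaceElems L N d r, elemJump M d r u K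

/-- The flux part of the form. -/
def fluxForm (M : Medium) (L N : ℕ) (d : Diagonal) (r kpar : ℝ) (u v : Pair) : ℂ :=
  ∑ K ∈ interfaceElems L N d r, lineIntegral L r (tri d K) fun x n =>
    avgFlux M r kpar d K u x n * star (jump v x)

/-- The stabilisation part of the form. -/
def stabForm (M : Medium) (L N : ℕ) (d : Diagonal) (r : ℝ) (u v : Pair) : ℂ :=
  ((meshSize N : ℂ))⁻¹ * ∑ K ∈ interfaceElems L N d r, lineIntegral L r (tri d K) fun x _ =>
    ((lamK M d r K : ℝ) : ℂ) * (jump u x * star (jump v x))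

lemma elemJump_nonneg (hr0 : 0 < r) (hN : 0 < N) (hw : WeightBounds M L r wmin wmax)
    (hmin : 0 < wmin) (K : Elem L N) : 0 ≤ elemJump M d r u K :=
  mul_nonneg (mul_nonneg (inv_nonneg.2 (meshSize_pos hN).le) (lamK_nonneg hr0.le hw hmin hN K))
    (lineIntegral_nonneg hr0.le _ fun _ _ => by positivity)

lemma stabEnergy_nonneg (hr0 : 0 < r) (hN : 0 < N) (hw : WeightBounds M L r wmin wmax)
    (hmin : 0 < wmin) : 0 ≤ stabEnergy M L N d r u :=
  Finset.sum_nonneg fun K _ => elemJump_nonneg hr0 hN hw hmin K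

lemma jumpEnergy_nonneg (hr0 : 0 < r) (hN : 0 < N) : 0 ≤ jumpEnergy L N d r u :=
  Finset.sum_nonneg fun _ _ => mul_nonneg (inv_nonneg.2 (meshSize_pos hN).le)
    (lineIntegral_nonneg hr0.le _ fun _ _ => by positivity)

lemma stabEnergy_le (hr0 : 0 < r) (hN : 0 < N) (hw : WeightBounds M L r wmin wmax)
    (hmin : 0 < wmin) (hmax : 0 < wmax) :
    stabEnergy M L N d r u ≤ 3456 * L * wmax ^ 2 / wmin * jumpEnergy L N d r u := by
  rw [stabEnergy, jumpEnergy, Finset.mul_sum]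
  refine Finset.sum_le_sum fun K _ => ?_
  have h1 := lamK_le (d := d) hr0 hw hmin hmax hN K
  have h2 : 0 ≤ (meshSize N)⁻¹ * lineIntegral L r (tri d K) fun x _ => ‖jump u x‖ ^ 2 :=
    mul_nonneg (inv_nonneg.2 (meshSize_pos hN).le)
      (lineIntegral_nonneg hr0.le _ fun _ _ => by positivity)
  rw [elemJump, mul_comm (meshSize N)⁻¹, mul_assoc]
  exact mul_le_mul_of_nonneg_right h1 h2

/-- The second consistency term is the conjugate of the first with exchanged arguments, so on the
diagonal the two add up to a real number. -/
lemma nitscheForm_eq (M : Medium) (L N : ℕ) (d : Diagonal) (r kpar lam : ℝ) (u v : Pair) :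
    nitscheForm M L N d r kpar lam u v =
      (∑ i : Fin 2, ∫ x in subdomain L r i, weightForm M r kpar i (u i) (v i) x) -
      fluxForm M L N d r kpar u v - star (fluxForm M L N d r kpar v u) +
      lam * stabForm M L N d r u v := by
  have h1 : (∑ K ∈ interfaceElems L N d r, lineIntegral L r (tri d K) fun x n =>
      star (avgFlux M r kpar d K v x n) * jump u x) = star (fluxForm M L N d r kpar v u) := by
    rw [fluxForm, star_sum]
    refine Finset.sum_congr rfl fun K _ => ?_
    rw [← lineIntegral_star]
    simp only [star_mul', star_star]
  have h2 : ((meshSize N : ℂ))⁻¹ * (∑ K ∈ interfaceElems L N d r,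
      lineIntegral L r (tri d K) fun x _ =>
        ((lam * lamK M d r K : ℝ) : ℂ) * (jump u x * star (jump v x))) =
      lam * stabForm M L N d r u v := by
    rw [stabForm, mul_left_comm (lam : ℂ)]
    congr 1
    rw [Finset.mul_sum]
    refine Finset.sum_congr rfl fun K _ => ?_
    rw [lineIntegral_eq, lineIntegral_eq, Finset.mul_sum]
    refine Finset.sum_congr rfl fun c _ => ?_
    rw [← integral_const_mul]
    refine congrArg _ (funext fun t => ?_)
    simp only [Complex.real_smul, Complex.ofReal_mul]
    ring
  rw [nitscheForm, h1, h2]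
  rfl

lemma stabForm_self (M : Medium) (u : Pair) :
    stabForm M L N d r u u = (stabEnergy M L N d r u : ℝ) := by
  rw [stabForm, stabEnergy, Complex.ofReal_sum, Finset.mul_sum]
  refine Finset.sum_congr rfl fun K _ => ?_
  have e : (fun x (_ : Plane) => ((lamK M d r K : ℝ) : ℂ) * (jump u x * star (jump u x))) =
      fun x _ => ((lamK M d r K * ‖jump u x‖ ^ 2 : ℝ) : ℂ) := by
    funext x _
    rw [Complex.star_def, Complex.mul_conj, Complex.normSq_eq_norm_sq]
    push_cast
    rfl
  rw [e, lineIntegral_ofReal _ fun x n => lamK M d r K * ‖jump u x‖ ^ 2, lineIntegral_const_mul,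
    elemJump]
  push_cast
  ring

lemma norm_stabForm_le (hL : 0 < L) (hr0 : 0 < r) (hr : r < Real.sqrt 3 / 6) (hN : 0 < N)
    (hw : WeightBounds M L r wmin wmax) (hmin : 0 < wmin) (hu : u ∈ Vh L N d r)
    (hv : v ∈ Vh L N d r) {s : ℝ} (hs : 0 < s) :
    ‖stabForm M L N d r u v‖ ≤
      1 / 2 * (s * stabEnergy M L N d r u + s⁻¹ * stabEnergy M L N d r v) := by
  have hh := meshSize_pos hN
  have hcont : ∀ {w : Pair}, w ∈ Vh L N d r → ∀ c : Circles L,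
      Continuous fun t => ‖jump w (circlePoint r c t)‖ ^ 2 := fun hw' c =>
    (continuous_jump hL hN hr0 hr hw' c).norm.pow 2
  rw [stabForm, Finset.mul_sum, stabEnergy, stabEnergy, Finset.mul_sum, Finset.mul_sum,
    ← Finset.sum_add_distrib, Finset.mul_sum]
  refine (norm_sum_le _ _).trans (Finset.sum_le_sum fun K _ => ?_)
  have hl := lamK_nonneg (d := d) hr0.le hw hmin hN K
  have h1 := norm_lineIntegral_le hr0.le d K
    (f := fun x _ => ((lamK M d r K : ℝ) : ℂ) * (jump u x * star (jump v x)))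
    (g := fun x => lamK M d r K * (1 / 2 * (s * ‖jump u x‖ ^ 2 + s⁻¹ * ‖jump v x‖ ^ 2)))
    (fun c => ((((hcont hu c).const_mul s).add ((hcont hv c).const_mul s⁻¹)).const_mul
      (1 / 2)).const_mul _)
    (fun c => Eventually.of_forall fun t _ => by
      rw [norm_mul, norm_mul, norm_star, Complex.norm_real, Real.norm_of_nonneg hl]
      refine mul_le_mul_of_nonneg_left ?_ hl
      generalize ‖jump u (circlePoint r c t)‖ = a
      generalize ‖jump v (circlePoint r c t)‖ = b
      have : 0 ≤ 1 / 2 * s * (a - s⁻¹ * b) ^ 2 := by positivity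
      have e : 1 / 2 * (s * a ^ 2 + s⁻¹ * b ^ 2) - a * b = 1 / 2 * s * (a - s⁻¹ * b) ^ 2 := by
        field_simp; ring
      linarith)
  rw [lineIntegral_const_mul, lineIntegral_const_mul] at h1
  have h2 : (lineIntegral L r (tri d K) fun x _ => s * ‖jump u x‖ ^ 2 + s⁻¹ * ‖jump v x‖ ^ 2) =
      s * (lineIntegral L r (tri d K) fun x _ => ‖jump u x‖ ^ 2) +
        s⁻¹ * lineIntegral L r (tri d K) fun x _ => ‖jump v x‖ ^ 2 := by
    rw [← lineIntegral_const_mul, ← lineIntegral_const_mul]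
    simp only [lineIntegral_eq, ← Finset.sum_add_distrib]
    refine Finset.sum_congr rfl fun c _ => ?_
    simp only [smul_add]
    exact integral_add
      (integrableOn_arcSet (((hcont hu c).const_mul s).const_smul r) r c _)
      (integrableOn_arcSet (((hcont hv c).const_mul s⁻¹).const_smul r) r c _)
  rw [h2] at h1
  rw [norm_mul, norm_inv, Complex.norm_real, Real.norm_of_nonneg hh.le, elemJump, elemJump]
  refine (mul_le_mul_of_nonneg_left h1 (inv_nonneg.2 hh.le)).trans_eq ?_
  ring

/-- The constant of the flux form. -/
def fluxConst (wmin wmax : ℝ) : ℝ := 432 * wmax * Real.sqrt (affConst / wmin)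

lemma fluxConst_nonneg (hmax : 0 < wmax) : 0 ≤ fluxConst wmin wmax := by
  unfold fluxConst
  positivity

lemma norm_fluxForm_le (hL : 0 < L) (hr0 : 0 < r) (hr : r < Real.sqrt 3 / 6) (hN : 0 < N)
    (hw : WeightBounds M L r wmin wmax) (hmin : 0 < wmin) (hmax : 0 < wmax)
    (hcut : CutAssumption L N d r) (hu : u ∈ Vh L N d r) (hv : v ∈ Vh L N d r) {s : ℝ}
    (hs : 0 < s) :
    ‖fluxForm M L N d r kpar u v‖ ≤ fluxConst wmin wmax / 2 *
      (s * bulkEnergy L r kpar u + s⁻¹ * stabEnergy M L N d r v) := by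
  have hE : ∑ K ∈ interfaceElems L N d r, elemEnergy d r kpar u K ≤
      72 * bulkEnergy L r kpar u := by
    unfold elemEnergy bulkEnergy
    rw [Finset.sum_comm, Finset.mul_sum]
    exact Finset.sum_le_sum fun i _ => sum_cutEnergy_le hL hN hr kpar hu _ i
  have hB : 0 ≤ 48 * wmax * Real.sqrt (affConst / wmin) := by positivity
  -- The factors `s / 9` and `9 / s` balance the overlap constant: with 72 rounded up to 81, both
  -- sums carry the factor 9.
  have h1 : ∀ K : Elem L N, Real.sqrt (elemEnergy d r kpar u K) * Real.sqrt (elemJump M d r v K) ≤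
      1 / 2 * (s / 9 * elemEnergy d r kpar u K + 9 * s⁻¹ * elemJump M d r v K) := by
    intro K
    have hEn : 0 ≤ elemEnergy d r kpar u K := elemEnergy_nonneg K
    have hJn : 0 ≤ elemJump M d r v K := elemJump_nonneg hr0 hN hw hmin K
    nth_rewrite 2 [← Real.sq_sqrt hEn]
    nth_rewrite 2 [← Real.sq_sqrt hJn]
    generalize Real.sqrt (elemEnergy d r kpar u K) = a
    generalize Real.sqrt (elemJump M d r v K) = b
    have : 0 ≤ 1 / 2 * (s / 9) * (a - 9 * s⁻¹ * b) ^ 2 := by positivity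
    have e : 1 / 2 * (s / 9 * a ^ 2 + 9 * s⁻¹ * b ^ 2) - a * b =
        1 / 2 * (s / 9) * (a - 9 * s⁻¹ * b) ^ 2 := by
      field_simp; ring
    linarith
  have hX : 0 ≤ stabEnergy M L N d r v := stabEnergy_nonneg hr0 hN hw hmin
  have hE0 := bulkEnergy_nonneg L r kpar u
  calc ‖fluxForm M L N d r kpar u v‖ ≤ ∑ K ∈ interfaceElems L N d r,
        48 * wmax * Real.sqrt (affConst / wmin) *
          (1 / 2 * (s / 9 * elemEnergy d r kpar u K + 9 * s⁻¹ * elemJump M d r v K)) := by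
        refine (norm_sum_le _ _).trans (Finset.sum_le_sum fun K _ => ?_)
        exact (norm_fluxTerm_le hL hr0 hr hN hw hmin hmax hcut hu hv K).trans
          (mul_le_mul_of_nonneg_left (h1 K) hB)
    _ = 48 * wmax * Real.sqrt (affConst / wmin) * (1 / 2 *
          (s / 9 * (∑ K ∈ interfaceElems L N d r, elemEnergy d r kpar u K) +
            9 * s⁻¹ * stabEnergy M L N d r v)) := by
        rw [stabEnergy, ← Finset.mul_sum, ← Finset.mul_sum, Finset.sum_add_distrib,
          ← Finset.mul_sum, ← Finset.mul_sum]
    _ ≤ 48 * wmax * Real.sqrt (affConst / wmin) * (1 / 2 *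
          (s / 9 * (81 * bulkEnergy L r kpar u) + 9 * s⁻¹ * stabEnergy M L N d r v)) := by
        gcongr
        linarith
    _ = _ := by
        unfold fluxConst
        ring

/-- Coercivity up to the energy norm. -/
lemma nitscheForm_self (hL : 0 < L) (hr0 : 0 < r) (hr : r < Real.sqrt 3 / 6) (hN : 0 < N)
    (hw : WeightBounds M L r wmin wmax) (hmin : 0 < wmin) (hmax : 0 < wmax)
    (hcut : CutAssumption L N d r) (hu : u ∈ Vh L N d r) {lam : ℝ}
    (hlam : 2 * fluxConst wmin wmax * (fluxConst wmin wmax + 1) / wmin + 1 ≤ lam) :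
    (nitscheForm M L N d r kpar lam u u).im = 0 ∧
      wmin / 2 * bulkEnergy L r kpar u + stabEnergy M L N d r u ≤
        (nitscheForm M L N d r kpar lam u u).re := by
  choose b hb hb' using fun i => integral_weightForm_self (kpar := kpar) hL hN hr hw hmin hu i
  have e : nitscheForm M L N d r kpar lam u u =
      ((∑ i, b i - 2 * (fluxForm M L N d r kpar u u).re + lam * stabEnergy M L N d r u : ℝ) : ℂ) := by
    rw [nitscheForm_eq, stabForm_self]
    simp_rw [hb]
    apply Complex.ext <;> simp
    ring
  rw [e]
  refine ⟨Complex.ofReal_im _, ?_⟩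
  rw [Complex.ofReal_re]
  have hX : 0 ≤ stabEnergy M L N d r u := stabEnergy_nonneg hr0 hN hw hmin
  have hE0 := bulkEnergy_nonneg L r kpar u
  have hC := fluxConst_nonneg (wmin := wmin) hmax
  have hbs : wmin * bulkEnergy L r kpar u ≤ ∑ i, b i := by
    rw [bulkEnergy, Finset.mul_sum]
    exact Finset.sum_le_sum fun i _ => hb' i
  have hre := (Complex.abs_re_le_norm (fluxForm M L N d r kpar u u)).trans' (le_abs_self _)
  set C := fluxConst wmin wmax with hCdef
  -- With this parameter the flux terms use up at most half of the bulk coercivity, and `lam - 1`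
  -- copies of the stabilisation absorb the rest. `C + 1` instead of `C` keeps the denominator
  -- positive.
  have hs : 0 < wmin / (2 * (C + 1)) := by positivity
  have hF := norm_fluxForm_le (kpar := kpar) hL hr0 hr hN hw hmin hmax hcut hu hu
    (s := wmin / (2 * (C + 1))) hs
  rw [← hCdef] at hF
  have h1 : C * (wmin / (2 * (C + 1))) ≤ wmin / 2 := by
    rw [mul_div_assoc', div_le_div_iff₀ (by positivity) two_pos]
    nlinarith
  have h2 : C * (wmin / (2 * (C + 1)))⁻¹ ≤ lam - 1 := by
    rw [inv_div, mul_div_assoc', ← mul_assoc, mul_comm C 2]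
    linarith
  have h3 := mul_le_mul_of_nonneg_right h1 hE0
  have h4 := mul_le_mul_of_nonneg_right h2 hX
  nlinarith

/-- The form is bounded up to a balancing factor. -/
lemma norm_nitscheForm_le (hL : 0 < L) (hr0 : 0 < r) (hr : r < Real.sqrt 3 / 6) (hN : 0 < N)
    (hw : WeightBounds M L r wmin wmax) (hmin : 0 < wmin) (hmax : 0 < wmax)
    (hcut : CutAssumption L N d r) (hu : u ∈ Vh L N d r) (hv : v ∈ Vh L N d r) {lam : ℝ}
    (hlam : 0 ≤ lam) {s : ℝ} (hs : 0 < s) :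
    ‖nitscheForm M L N d r kpar lam u v‖ ≤
      (wmax + fluxConst wmin wmax +
        (fluxConst wmin wmax + lam) * (3456 * L * wmax ^ 2 / wmin)) / 2 *
        (s * energySq L N d r kpar u + s⁻¹ * energySq L N d r kpar v) := by
  have hC := fluxConst_nonneg (wmin := wmin) hmax
  have hs' : 0 < s⁻¹ := inv_pos.2 hs
  have hB : ‖∑ i : Fin 2, ∫ x in subdomain L r i, weightForm M r kpar i (u i) (v i) x‖ ≤
      wmax / 2 * (s * bulkEnergy L r kpar u + s⁻¹ * bulkEnergy L r kpar v) := by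
    rw [bulkEnergy, bulkEnergy, Finset.mul_sum, Finset.mul_sum, ← Finset.sum_add_distrib,
      Finset.mul_sum]
    exact (norm_sum_le _ _).trans (Finset.sum_le_sum fun i _ =>
      norm_integral_weightForm_le hL hN hr hw hmin hu hv i hs)
  have hF1 := norm_fluxForm_le (kpar := kpar) hL hr0 hr hN hw hmin hmax hcut hu hv hs
  have hF2 := norm_fluxForm_le (kpar := kpar) hL hr0 hr hN hw hmin hmax hcut hv hu hs'
  rw [inv_inv] at hF2
  have hS := norm_stabForm_le (M := M) hL hr0 hr hN hw hmin hu hv hs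
  have hXu := mul_le_mul_of_nonneg_left
    (stabEnergy_le (d := d) (u := u) hr0 hN hw hmin hmax) hs.le
  have hXv := mul_le_mul_of_nonneg_left
    (stabEnergy_le (d := d) (u := v) hr0 hN hw hmin hmax) hs'.le
  have hEu := mul_nonneg hs.le (bulkEnergy_nonneg L r kpar u)
  have hEv := mul_nonneg hs'.le (bulkEnergy_nonneg L r kpar v)
  have hYu := mul_nonneg hs.le (jumpEnergy_nonneg (L := L) (d := d) (u := u) hr0 hN)
  have hYv := mul_nonneg hs'.le (jumpEnergy_nonneg (L := L) (d := d) (u := v) hr0 hN)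
  have hΛ : 0 ≤ 3456 * L * wmax ^ 2 / wmin := by positivity
  set C := fluxConst wmin wmax
  set Λ := 3456 * L * wmax ^ 2 / wmin
  have hn : ‖nitscheForm M L N d r kpar lam u v‖ ≤
      ‖∑ i : Fin 2, ∫ x in subdomain L r i, weightForm M r kpar i (u i) (v i) x‖ +
      ‖fluxForm M L N d r kpar u v‖ + ‖fluxForm M L N d r kpar v u‖ +
        lam * ‖stabForm M L N d r u v‖ := by
    rw [nitscheForm_eq]
    refine (norm_add_le _ _).trans (add_le_add ((norm_sub_le _ _).trans
      (add_le_add (norm_sub_le _ _) (norm_star _).le)) (le_of_eq ?_))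
    rw [norm_mul, Complex.norm_real, Real.norm_of_nonneg hlam]
  have hS' := mul_le_mul_of_nonneg_left hS hlam
  have hX1 := mul_le_mul_of_nonneg_left (add_le_add hXu hXv) (add_nonneg hC hlam)
  have p1 := mul_nonneg (add_nonneg hmax.le hC) (add_nonneg hYu hYv)
  have p2 := mul_nonneg (mul_nonneg (add_nonneg hC hlam) hΛ) (add_nonneg hEu hEv)
  have p3 := mul_nonneg hC (add_nonneg hEu hEv)
  rw [energySq_eq, energySq_eq]
  linarith

end

/-- The hypothesis says that `a s² - 2 A s + b` is nonnegative for `s > 0`. For `s ≤ 0` this is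
clear from the signs, so the discriminant is not positive. No case distinction for vanishing `a` or
`b` is needed. -/
lemma le_sqrt_mul_sqrt {A a b : ℝ} (hA : 0 ≤ A) (ha : 0 ≤ a) (hb : 0 ≤ b)
    (h : ∀ s : ℝ, 0 < s → A ≤ 1 / 2 * (s * a + s⁻¹ * b)) : A ≤ Real.sqrt a * Real.sqrt b := by
  rw [← Real.sqrt_mul ha]
  refine Real.le_sqrt_of_sq_le ?_
  have hd : ∀ s : ℝ, 0 ≤ a * (s * s) + (-(2 * A)) * s + b := by
    intro s
    rcases le_or_gt s 0 with hs | hs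
    · have := mul_nonneg hA (neg_nonneg.2 hs)
      have := mul_nonneg ha (mul_self_nonneg s)
      linarith
    · have h1 := mul_le_mul_of_nonneg_left (h s hs) hs.le
      have e : s * (1 / 2 * (s * a + s⁻¹ * b)) = 1 / 2 * (a * (s * s) + b) := by
        field_simp
      rw [e] at h1
      linarith
  have := discrim_le_zero hd
  rw [discrim] at this
  linarith

end

end EdgeNitsche

end

/-! ### Coercivity and boundedness of the Nitsche form -/

open EdgeNitsche in
theorem mainTheorem5 (M : Medium) (c₀ : ℝ) (hc₀ : 0 < c₀) (L : ℕ) (hL : 0 < L)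
    (kpar : ℝ) (hk : kpar ∈ Set.Icc 0 (2 * Real.pi)) (d : Diagonal)
    (r₀ : ℝ) (hr₀ : 0 < r₀) :
    ∃ lam₀ : ℝ, 0 < lam₀ ∧ ∀ lam : ℝ, lam₀ ≤ lam →
      ∃ C₇ C₈ : ℝ, 0 < C₇ ∧ 0 < C₈ ∧
        ∀ r : ℝ, r₀ ≤ r → r < dist (site 0) (site 1) / 2 → M.Elliptic r c₀ →
          ∀ N : ℕ, 0 < N → CutAssumption L N d r →
            (∀ q ∈ Vh L N d r,
              (nitscheForm M L N d r kpar lam q q).im = 0 ∧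
              C₇ * energyNorm L N d r kpar q ^ 2 ≤ (nitscheForm M L N d r kpar lam q q).re) ∧
            (∀ q ∈ Vh0 L N d r, ∀ χ ∈ Vh0 L N d r,
              ‖nitscheForm M L N d r kpar lam q χ‖ ≤
                C₈ * energyNorm L N d r kpar q * energyNorm L N d r kpar χ) := by
  obtain ⟨wmin, wmax, hmin, hmax, hW⟩ := exists_weightBounds M hc₀ hL
  have hC := fluxConst_nonneg (wmin := wmin) hmax
  -- `1 / 800` is the range of the estimate near a side, and `η ≤ r₀` leaves room for the inner
  -- collar.
  set η := min (1 / 800) r₀ with hη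
  have hη0 : 0 < η := lt_min (by norm_num) hr₀
  have hJ := jumpConst_pos (η := η) hr₀
  set B := 72 * jumpConst r₀ η * (2 + 16 * L / r₀ + 6912 * L) with hB
  have hB0 : 0 < B := by positivity
  set A := 32 * wmax / wmin ^ 2 with hA
  have hA0 : 0 < A := by positivity
  refine ⟨2 * fluxConst wmin wmax * (fluxConst wmin wmax + 1) / wmin + 1, by positivity,
    fun lam hlam => ?_⟩
  have hlam0 : 0 < lam := lt_of_lt_of_le (by positivity) hlam
  -- The jump part is at most `B (A stab + bulk)`, so the squared norm is at most `(1 + B) bulk + B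
  -- A stab`. Both terms are compared with `wmin / 2 * bulk + stab`, the lower bound of the form.
  refine ⟨((1 + B) * (2 / wmin) + B * A)⁻¹, wmax + fluxConst wmin wmax +
    (fluxConst wmin wmax + lam) * (3456 * L * wmax ^ 2 / wmin), by positivity, by positivity,
    fun r hrr hr hM N hN hcut => ?_⟩
  rw [half_dist_sites] at hr
  have hr0 : 0 < r := hr₀.trans_le hrr
  have hw := hW r hr0.le hr hM
  have hE : ∀ q, 0 ≤ energySq L N d r kpar q := fun q =>
    add_nonneg (bulkEnergy_nonneg L r kpar q) (jumpEnergy_nonneg hr0 hN)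
  refine ⟨fun q hq => ?_, fun q hq χ hχ => ?_⟩
  · obtain ⟨him, hre⟩ := nitscheForm_self (kpar := kpar) hL hr0 hr hN hw hmin hmax hcut hq hlam
    refine ⟨him, le_trans ?_ hre⟩
    have hX : 0 ≤ stabEnergy M L N d r q := stabEnergy_nonneg hr0 hN hw hmin
    have hE0 := bulkEnergy_nonneg L r kpar q
    have hjump := sum_jump_le (kpar := kpar) hL hN hr₀ hrr hr hη0 (min_le_left _ _)
      (min_le_right _ _) hk hcut hq
    have hlong : (∑ K ∈ interfaceElems L N d r, (meshSize N)⁻¹ * (cutLength d r K / meshSize N) *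
        lineIntegral L r (tri d K) fun x _ => ‖jump q x‖ ^ 2) ≤ A * stabEnergy M L N d r q := by
      rw [stabEnergy, Finset.mul_sum]
      refine Finset.sum_le_sum fun K _ => ?_
      have h1 := le_lamK (d := d) hr0 hw hmin hmax hN K
      have h2 : 0 ≤ (meshSize N)⁻¹ * lineIntegral L r (tri d K) fun x _ => ‖jump q x‖ ^ 2 :=
        mul_nonneg (inv_nonneg.2 (meshSize_pos hN).le)
          (lineIntegral_nonneg hr0.le _ fun _ _ => by positivity)
      have h3 : cutLength d r K / meshSize N ≤ A * lamK M d r K := by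
        calc cutLength d r K / meshSize N =
            A * (wmin ^ 2 / (32 * wmax) * (cutLength d r K / meshSize N)) := by
              rw [hA]; field_simp
          _ ≤ _ := by gcongr
      have h4 := mul_le_mul_of_nonneg_right h3 h2
      rw [elemJump]
      linarith
    change jumpEnergy L N d r q ≤ B * (_ + bulkEnergy L r kpar q) at hjump
    have hY : jumpEnergy L N d r q ≤ B * (A * stabEnergy M L N d r q + bulkEnergy L r kpar q) :=
      hjump.trans (mul_le_mul_of_nonneg_left (by linarith) hB0.le)
    rw [energyNorm, Real.sq_sqrt (hE q), inv_mul_le_iff₀ (by positivity), energySq_eq]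
    have e1 : (1 + B) * bulkEnergy L r kpar q =
        (1 + B) * (2 / wmin) * (wmin / 2 * bulkEnergy L r kpar q) := by
      field_simp
    have h5 : 0 ≤ B * A * (wmin / 2 * bulkEnergy L r kpar q) := by positivity
    have h6 : 0 ≤ (1 + B) * (2 / wmin) * stabEnergy M L N d r q := by positivity
    linarith
  · set C := wmax + fluxConst wmin wmax +
      (fluxConst wmin wmax + lam) * (3456 * L * wmax ^ 2 / wmin) with hCd
    have hC0 : 0 < C := by positivity
    have h := le_sqrt_mul_sqrt (A := ‖nitscheForm M L N d r kpar lam q χ‖ / C) (by positivity)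
      (hE q) (hE χ) fun s hs => by
        rw [div_le_iff₀ hC0]
        refine (norm_nitscheForm_le (kpar := kpar) hL hr0 hr hN hw hmin hmax hcut hq.1 hχ.1
          hlam0.le hs).trans_eq ?_
        rw [← hCd]
        ring
    rw [div_le_iff₀ hC0] at h
    unfold energyNorm
    linarith
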